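/- **Definitions.** Let $X$ be a finite set with $n$ elements, $T\colon X\to X$ a cyclic permutation, and for each $x\in X$ let $E(x)$ be a $d$-dimensional Euclidean space. A *cyclic $d$-dimensional cocycle* of period $n$ is a family $A$ of invertible linear maps $A(x)\colon E(x)\to E(Tx)$; write $A^k(x)=A(T^{k-1}x)\cdots A(x)$, and $\mathfrak m(B)=\inf_{\|v\|=1}\|Bv\|$ for a linear map $B$. The cocycle is *bounded by $K$* if $K^{-1}\le \mathfrak m(A(x))\le\|A(x)\|\le K$ for all $x$. Its Lyapunov exponents $\lambda_1\le\dots\le\lambda_d$ are the numbers $\frac1n\log|z|$, where $z$ runs over the eigenvalues of $A^n(x)$ with multiplicity (they do not depend on $x$); its *Lyapunov graph* is $\sigma(A)=(\sigma_0(A),\dots,\sigma_d(A))$ with $\sigma_i(A)=\lambda_1+\dots+\lambda_i$. A *convex graph* is a vector $(\sigma_0,\dots,\sigma_d)\in\mathbb R^{d+1}$ with $\sigma_0=0$ and $\sigma_i-\sigma_{i-1}\le\sigma_{i+1}-\sigma_i$ for $0<i<d$; graphs are ordered coordinatewise. For a power of two $\ell$, an invariant subbundle $F\ne0$ is *$\ell$-dominated*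 by an invariant subbundle $G\neq 0$ if $\|A^\ell|_{F(x)}\|/\mathfrak m(A^\ell|_{G(x)})<\frac12$ for all $x$. A splitting $E=F_1\oplus\dots\oplus F_m$ into nonzero invariant subbundles ($m=1$ allowed) is *$\ell$-dominated* if $F_1\oplus\dots\oplus F_j$ is $\ell$-dominated by $F_{j+1}\oplus\dots\oplus F_m$ for $1\le j\le m-1$; its *indices* are $i_j=\dim(F_1\oplus\dots\oplus F_j)$, $1\le j\le m-1$. The *finest* $\ell$-dominated splitting is the $\ell$-dominated splitting such that every bundle of any $\ell$-dominated splitting is a sum of some of its bundles. **Theorem.** For all $d\ge2$, $K>1$, $\varepsilon>0$ there is a power of two $\ell$ such that the following holds. Let $A$ be a cyclic $d$-dimensional cocycle bounded by $K$ and of period at least $\ell$, and let $i_1<\dots<i_{m-1}$ be the indices of its finest $\ell$-dominated splitting. Let $\sigma$ be a convex graph with $\sigma\ge\sigma(A)$, $\sigma_{i_j}=\sigma_{i_j}(A)$ for $1\le j\le m-1$, and $\sigma_d=\sigma_d(A)$. Then there is a path $A_t$, $t\in[0,1]$, of cocycles over the same $T$ and $E$, with $A_t(x)$ continuous in $t$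 for every $x$, such that $A_0=A$, $\max_x\|A_t(x)-A(x)\|<\varepsilon$ for all $t$, the path of convex graphs $t\mapsto\sigma(A_t)$ is continuous and non-decreasing, and $\sigma(A_1)=\sigma$. -/

import Mathlib

universe u v

/-- A linear cocycle over the permutation `T` of a (finite, discrete) set `X`, on the Euclidean
vector bundle with fibers `E x`: invertible linear maps `A x : E x → E (T x)`. -/
def LinCocycle {X : Type u} (T : Equiv.Perm X) (E : X → Type v)
    [∀ x, NormedAddCommGroup (E x)] [∀ x, InnerProductSpace ℝ (E x)] : Type (max u v) :=
  ∀ x, E x ≃L[ℝ] E (T x)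

/-- The identification of the fibers over two equal base points. -/
def fiberTransport {X : Type u} (E : X → Type v)
    [∀ x, NormedAddCommGroup (E x)] [∀ x, InnerProductSpace ℝ (E x)] :
    ∀ {x y : X}, x = y → (E x →L[ℝ] E y)
  | x, _, rfl => ContinuousLinearMap.id ℝ (E x)

/-- The minimum expansion factor `inf {‖B v‖ : ‖v‖ = 1}` of a linear map. -/
noncomputable def minExpansion {V W : Type v}
    [NormedAddCommGroup V] [InnerProductSpace ℝ V]
    [NormedAddCommGroup W] [InnerProductSpace ℝ W] (B : V →L[ℝ] W) : ℝ :=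
  ⨅ w : Metric.sphere (0 : V) 1, ‖B w‖

/-- For a cyclic permutation of a set with `n` elements, `T ^ n` is the identity. -/
theorem cyclic_iterate_card {X : Type u} [Finite X] {T : Equiv.Perm X}
    (hT : T.IsCycleOn Set.univ) (x : X) : T^[Nat.card X] x = x := by
  classical
  have := Fintype.ofFinite X
  have h : T.IsCycleOn (Finset.univ : Finset X) := by simpa using hT
  have h2 := h.pow_card_apply (Finset.mem_univ x)
  rwa [Finset.card_univ, ← Nat.card_eq_fintype_card, Equiv.Perm.coe_pow] at h2

namespace LinCocycle

section Basic

variable {X : Type u} {T : Equiv.Perm X} {E : X → Type v}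
  [∀ x, NormedAddCommGroup (E x)] [∀ x, InnerProductSpace ℝ (E x)]

/-- The fiber map `A x` as a bounded linear map. -/
def fiberMap (A : LinCocycle T E) (x : X) : E x →L[ℝ] E (T x) :=
  (A x : E x ≃L[ℝ] E (T x)).toContinuousLinearMap

/-- The iterates `A ^ n (x) = A (T ^ (n - 1) x) ⋯ A (T x) A (x)`. -/
def iter (A : LinCocycle T E) : ∀ (n : ℕ) (x : X), E x →L[ℝ] E (T^[n] x)
  | 0, x => ContinuousLinearMap.id ℝ (E x)
  | n + 1, x => (iter A n (T x)).comp (A.fiberMap x)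

/-- The cocycle is bounded by `K`. -/
def BoundedBy (A : LinCocycle T E) (K : ℝ) : Prop :=
  ∀ x, K⁻¹ ≤ minExpansion (A.fiberMap x) ∧ ‖A.fiberMap x‖ ≤ K

/-- `B` is an `ε`-perturbation of `A` (the base being finite, the uniform distance is `< ε` iff
all the fiberwise distances are). -/
def IsPerturbation (ε : ℝ) (A B : LinCocycle T E) : Prop :=
  ∀ x, ‖B.fiberMap x - A.fiberMap x‖ < ε

/-- A path of cocycles parametrized by `[0, 1]`: the fiber maps depend continuously on the
parameter. -/
def IsPath (B : unitInterval → LinCocycle T E) : Prop :=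
  ∀ x, Continuous fun t => (B t).fiberMap x

/-- A path is `ε`-short if all its members are `ε`-perturbations of the initial one. -/
def IsShort (ε : ℝ) (B : unitInterval → LinCocycle T E) : Prop :=
  ∀ t, IsPerturbation ε (B 0) (B t)

/-- `F` is an invariant subbundle (its fibers have constant dimension). -/
def IsInvariantSubbundle (A : LinCocycle T E) (F : ∀ x, Submodule ℝ (E x)) : Prop :=
  (∃ k : ℕ, ∀ x, Module.finrank ℝ (F x) = k) ∧
    ∀ x, (F x).map (A.fiberMap x).toLinearMap = F (T x)

/-- `F` is `ℓ`-dominated by `G`: both are nonzero invariant subbundles, and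
`‖A ^ ℓ | F(x)‖ / m (A ^ ℓ | G(x)) < 1 / 2` at every point. -/
def IsDominatedBy (A : LinCocycle T E) (ℓ : ℕ) (F G : ∀ x, Submodule ℝ (E x)) : Prop :=
  A.IsInvariantSubbundle F ∧ A.IsInvariantSubbundle G ∧
    (∀ x, F x ≠ ⊥) ∧ (∀ x, G x ≠ ⊥) ∧
    ∀ x, ‖(A.iter ℓ x).comp (F x).subtypeL‖ /
      minExpansion ((A.iter ℓ x).comp (G x).subtypeL) < 1 / 2

/-- `E = F 0 ⊕ ⋯ ⊕ F (m - 1)` is an `ℓ`-dominated splitting into nonzero invariant subbundles: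
`F 0 ⊕ ⋯ ⊕ F j` is `ℓ`-dominated by `F (j + 1) ⊕ ⋯ ⊕ F (m - 1)` for each `j < m - 1`.
The trivial splitting (`m = 1`) is allowed. -/
structure IsDominatedSplitting (A : LinCocycle T E) (ℓ : ℕ) {m : ℕ}
    (F : Fin m → ∀ x, Submodule ℝ (E x)) : Prop where
  invariant : ∀ j, A.IsInvariantSubbundle (F j)
  ne_bot : ∀ j x, F j x ≠ ⊥
  isInternal : ∀ x, DirectSum.IsInternal fun j => F j x
  dominated : ∀ j : Fin m, (j : ℕ) + 1 < m →
    A.IsDominatedBy ℓ (fun x => ⨆ i ≤ j, F i x) (fun x => ⨆ i > j, F i x)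

/-- The finest `ℓ`-dominated splitting: the bundles of every `ℓ`-dominated splitting are sums of
some of its bundles. -/
def IsFinestDominatedSplitting (A : LinCocycle T E) (ℓ : ℕ) {m : ℕ}
    (F : Fin m → ∀ x, Submodule ℝ (E x)) : Prop :=
  A.IsDominatedSplitting ℓ F ∧
    ∀ (k : ℕ) (G : Fin k → ∀ x, Submodule ℝ (E x)), A.IsDominatedSplitting ℓ G →
      ∀ j, ∃ S : Set (Fin m), ∀ x, G j x = ⨆ i ∈ S, F i x

/-- The return map `A ^ n (x) : E x → E (T ^ n x) = E x`, `n` being the period of the cyclic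
permutation `T`. -/
noncomputable def returnMap [Finite X] (hT : T.IsCycleOn Set.univ) (A : LinCocycle T E) (x : X) :
    E x →L[ℝ] E x :=
  (fiberTransport E (cyclic_iterate_card hT x)).comp (A.iter (Nat.card X) x)

/-- The Lyapunov exponents of a cyclic cocycle with their multiplicities: the numbers
`log |z| / n`, where `n` is the period and `z` runs over the complex eigenvalues of the return
map, repeated according to (algebraic) multiplicity. -/
noncomputable def lyapunovExponents [Finite X] [∀ x, FiniteDimensional ℝ (E x)]
    (hT : T.IsCycleOn Set.univ) (A : LinCocycle T E) (x : X) : Multiset ℝ :=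
  ((A.returnMap hT x).toLinearMap.charpoly.aroots ℂ).map fun z => Real.log ‖z‖ / Nat.card X

/-- The Lyapunov graph `(σ 0, …, σ d)`: `σ i` is the sum of the `i` smallest Lyapunov exponents.
It does not depend on the point `x`, see `lyapunovGraph_eq`. -/
noncomputable def lyapunovGraph [Finite X] [∀ x, FiniteDimensional ℝ (E x)]
    (hT : T.IsCycleOn Set.univ) (A : LinCocycle T E) (d : ℕ) (x : X) : Fin (d + 1) → ℝ :=
  fun i => (((A.lyapunovExponents hT x).sort (· ≤ ·)).take i).sum

theorem iter_comm (A : LinCocycle T E) (n : ℕ) (x : X) (h : T (T^[n] x) = T^[n] (T x))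
    (w : E x) :
    fiberTransport E h (A.fiberMap _ (A.iter n x w)) = A.iter n (T x) (A.fiberMap x w) := by
  induction n generalizing x with
  | zero => rfl
  | succ n ih => exact ih (T x) h (A.fiberMap x w)

theorem fiberMap_transport (A : LinCocycle T E) {x y : X} (h : x = y) (w : E x) :
    A.fiberMap y (fiberTransport E h w) =
      fiberTransport E (congrArg T h) (A.fiberMap x w) := by
  subst h
  rfl

theorem transport_trans {x y z : X} (h : x = y) (h' : y = z) (w : E x) :
    fiberTransport E h' (fiberTransport E h w) = fiberTransport E (h.trans h') w := by
  subst h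
  subst h'
  rfl

theorem returnMap_apply_map [Finite X] (hT : T.IsCycleOn Set.univ) (A : LinCocycle T E) (x : X)
    (w : E x) :
    A.returnMap hT (T x) (A.fiberMap x w) = A.fiberMap x (A.returnMap hT x w) := by
  simp only [returnMap, ContinuousLinearMap.comp_apply]
  rw [fiberMap_transport, ← iter_comm A _ x (by rw [← Function.iterate_succ_apply,
    Function.iterate_succ_apply']) w, transport_trans]

theorem lyapunovExponents_map [Finite X] [∀ x, FiniteDimensional ℝ (E x)]
    (hT : T.IsCycleOn Set.univ) (A : LinCocycle T E) (x : X) :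
    A.lyapunovExponents hT (T x) = A.lyapunovExponents hT x := by
  have h : (A.returnMap hT (T x)).toLinearMap =
      (A x : E x ≃L[ℝ] E (T x)).toLinearEquiv.conj (A.returnMap hT x).toLinearMap := by
    ext w
    obtain ⟨w, rfl⟩ := (A x : E x ≃L[ℝ] E (T x)).surjective w
    have := returnMap_apply_map hT A x w
    simpa [LinearEquiv.conj_apply, fiberMap] using this
  unfold lyapunovExponents
  rw [h, LinearEquiv.charpoly_conj]

/-- The Lyapunov graph of a cyclic cocycle does not depend on the point. -/
theorem lyapunovGraph_eq [Finite X] [∀ x, FiniteDimensional ℝ (E x)]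
    (hT : T.IsCycleOn Set.univ) (A : LinCocycle T E) (d : ℕ) (x y : X) :
    A.lyapunovGraph hT d x = A.lyapunovGraph hT d y := by
  have key : ∀ n : ℕ, A.lyapunovExponents hT ((T ^ n) x) = A.lyapunovExponents hT x := by
    intro n
    induction n with
    | zero => rfl
    | succ n ih => rw [pow_succ', Equiv.Perm.mul_apply, lyapunovExponents_map, ih]
  obtain ⟨n, rfl⟩ := (hT.2 (Set.mem_univ x) (Set.mem_univ y)).exists_nat_pow_eq
  unfold lyapunovGraph
  rw [key]

end Basic

end LinCocycle

/-- The indices of a splitting `F 0 ⊕ ⋯ ⊕ F (m - 1)`: the dimensions of `F 0 ⊕ ⋯ ⊕ F j` for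
`j < m - 1`. -/
def splittingIndices {X : Type u} {E : X → Type v}
    [∀ x, NormedAddCommGroup (E x)] [∀ x, InnerProductSpace ℝ (E x)] {m : ℕ}
    (F : Fin m → ∀ x, Submodule ℝ (E x)) : Set ℕ :=
  {p | ∃ j : Fin m, (j : ℕ) + 1 < m ∧
    ∀ x, Module.finrank ℝ (⨆ i ≤ j, F i x : Submodule ℝ (E x)) = p}

/-- The convex graphs `(σ 0, …, σ d)` with `σ 0 = 0`. -/
def IsConvexGraph {d : ℕ} (σ : Fin (d + 1) → ℝ) : Prop :=
  σ 0 = 0 ∧ ∀ (i : ℕ) (h : i + 2 < d + 1),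
    σ ⟨i + 1, by omega⟩ - σ ⟨i, by omega⟩ ≤ σ ⟨i + 2, h⟩ - σ ⟨i + 1, by omega⟩

/-- A path of graphs is non-decreasing: it is a continuous path of convex graphs, and later
graphs lie above earlier ones. -/
def IsNondecreasingGraphPath {d : ℕ} (s : unitInterval → Fin (d + 1) → ℝ) : Prop :=
  (∀ t, IsConvexGraph (s t)) ∧ Continuous s ∧ Monotone s

open Polynomial
set_option linter.unusedSectionVars false

/-! The core is a dichotomy (`unifMix`) for cocycles whose return maps have only real eigenvalues.
Let α, β be neighbours in the ordering by modulus, with |α| < |β|. If the period is large, then one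
of two things happens. Either the bundle carrying the eigenvalues up to α is dominated by the
quotient, at a rate C θ^m which depends only on the fiber, the bound K, the position of α and ε. Or
an ε-small deformation that keeps the spectrum, followed by an ε-small one along which only α and β
move, with fixed product, brings these two to the same modulus.

In dimension two (`unifMix_two`) the cocycle is triangular with diagonal entries a, c. If the sums
over a period of the products of |a/c| are bounded at all points, these products decay
exponentially, and this is domination. If one sum is huge, an off-diagonal perturbation with well
chosen signs makes the off-diagonal entry of a return map huge compared with β, and then a tiny
shear at one point moves the trace by a multiple of β and leaves the determinant alone.

Higher dimensions follow by induction (`UnifMix.step`). Consider the quotient by the line of a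
fastest eigenvalue γ and the quotient by the line of a slow eigenvalue. If one of them is not
dominated, it mixes by induction and the mixing lifts. Otherwise compare the growth of the slow
line, seen modulo the γ-line, with the growth of the γ-line. If the resulting sums are bounded, the
domination of the quotients passes to the cocycle (`dom_of_sum_le`). If one is huge, a small
deformation with constant spectrum creates an invariant complement of the γ-line which leans so much
towards that line that inside it the slow line and the β-line are almost parallel
(`exists_undominated_complement`). A dominated bundle makes a definite angle with the invariant
lines outside it (`exists_angle`), so the restriction to this complement is not dominated; it mixes
by induction. If no eigenvalue is left beyond β, pass to the inverse adjoint cocycle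
(`UnifMix.dual`).

To move the graph, rotations in invariant planes first make the spectrum real without changing the
moduli (`exists_real_spectrum`). Then the indices are treated one at a time (`Attain.step`). If the
current cocycle is dominated at an index, so is the nearby original one (`exists_domIdx`), and there
the graph already agrees with the target. Otherwise mixing raises the graph at this index alone,
until it meets the target or becomes affine around the index; in the second case convexity of σ
bounds the remaining gap by the mean of the two neighbouring gaps. As the gaps vanish at both ends,
one sweep over the indices multiplies the largest gap by at most 1 - 2^(-d) (`Attain.contract`). A
number of sweeps that does not depend on the cocycle makes all gaps small, and rescaling the
eigenvalues reaches σ exactly (`exists_reach_target`). The constants are chosen from the last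
perturbation backwards, so that ℓ depends only on d, K and ε. -/

/-- `T` is a cyclic permutation of period `n`. -/
structure IsCyc {X : Type*} (T : Equiv.Perm X) (n : ℕ) : Prop where
  pos : 0 < n
  per : ∀ x, T^[n] x = x
  reach : ∀ x y, ∃ j < n, T^[j] x = y
  inj : ∀ x i j, i < n → j < n → T^[i] x = T^[j] x → i = j

/-! ### Iterates on a trivial bundle and products along orbits -/

section Iterates

variable {X V W : Type*} [NormedAddCommGroup V] [InnerProductSpace ℝ V]
  [NormedAddCommGroup W] [InnerProductSpace ℝ W] (T : Equiv.Perm X)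

/-- Iterates of a cocycle on a trivial bundle. -/
noncomputable def it (A : X → V →L[ℝ] V) : ℕ → X → V →L[ℝ] V
  | 0, _ => ContinuousLinearMap.id ℝ V
  | m + 1, x => (it A m (T x)).comp (A x)

/-- Iterates of a scalar cocycle. -/
noncomputable def sp (a : X → ℝ) (m : ℕ) (x : X) : ℝ := ∏ j ∈ Finset.range m, a (T^[j] x)

variable {T}

@[simp] theorem it_zero (A : X → V →L[ℝ] V) (x : X) : it T A 0 x = ContinuousLinearMap.id ℝ V := rfl

theorem it_succ (A : X → V →L[ℝ] V) (m : ℕ) (x : X) :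
    it T A (m + 1) x = (it T A m (T x)).comp (A x) := rfl

@[simp] theorem it_one (A : X → V →L[ℝ] V) (x : X) : it T A 1 x = A x := by
  ext v; simp [it_succ]

theorem it_add (A : X → V →L[ℝ] V) (m k : ℕ) (x : X) :
    it T A (m + k) x = (it T A k (T^[m] x)).comp (it T A m x) := by
  induction m generalizing x with
  | zero => ext v; simp
  | succ m ih =>
    rw [show m + 1 + k = (m + k) + 1 by ring, it_succ, ih, it_succ, Function.iterate_succ_apply]
    rfl

theorem it_succ' (A : X → V →L[ℝ] V) (m : ℕ) (x : X) :
    it T A (m + 1) x = (A (T^[m] x)).comp (it T A m x) := by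
  rw [it_add]; simp

theorem it_intertwine {A : X → V →L[ℝ] V} {B : X → W →L[ℝ] W} {R : X → V →L[ℝ] W}
    (h : ∀ x, (R (T x)).comp (A x) = (B x).comp (R x)) (m : ℕ) (x : X) :
    (R (T^[m] x)).comp (it T A m x) = (it T B m x).comp (R x) := by
  induction m generalizing x with
  | zero => ext v; simp
  | succ m ih =>
    rw [it_succ, it_succ, Function.iterate_succ_apply, ← ContinuousLinearMap.comp_assoc, ih,
      ContinuousLinearMap.comp_assoc, h, ContinuousLinearMap.comp_assoc]

@[simp] theorem sp_zero (a : X → ℝ) (x : X) : sp T a 0 x = 1 := by simp [sp]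

@[simp] theorem sp_one (a : X → ℝ) (x : X) : sp T a 1 x = a x := by simp [sp]

theorem sp_succ (a : X → ℝ) (m : ℕ) (x : X) : sp T a (m + 1) x = a x * sp T a m (T x) := by
  simp [sp, Finset.prod_range_succ', mul_comm]

theorem sp_succ' (a : X → ℝ) (m : ℕ) (x : X) :
    sp T a (m + 1) x = sp T a m x * a (T^[m] x) := by
  simp [sp, Finset.prod_range_succ]

theorem sp_add (a : X → ℝ) (m k : ℕ) (x : X) :
    sp T a (m + k) x = sp T a m x * sp T a k (T^[m] x) := by
  simp only [sp, Finset.prod_range_add, ← Function.iterate_add_apply]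
  congr 1
  exact Finset.prod_congr rfl fun j _ => by rw [add_comm]

theorem sp_mul (a b : X → ℝ) (m : ℕ) (x : X) :
    sp T (fun y => a y * b y) m x = sp T a m x * sp T b m x := by
  simp [sp, Finset.prod_mul_distrib]

theorem sp_div (a b : X → ℝ) (m : ℕ) (x : X) :
    sp T (fun y => a y / b y) m x = sp T a m x / sp T b m x := by
  simp [sp, Finset.prod_div_distrib]

theorem sp_abs (a : X → ℝ) (m : ℕ) (x : X) :
    sp T (fun y => |a y|) m x = |sp T a m x| := by
  simp [sp, Finset.abs_prod]

theorem sp_const (c : ℝ) (m : ℕ) (x : X) : sp T (fun _ => c) m x = c ^ m := by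
  simp [sp]

theorem sp_ne_zero {a : X → ℝ} (h : ∀ x, a x ≠ 0) (m : ℕ) (x : X) : sp T a m x ≠ 0 :=
  Finset.prod_ne_zero_iff.2 fun _ _ => h _

theorem sp_pos {a : X → ℝ} (h : ∀ x, 0 < a x) (m : ℕ) (x : X) : 0 < sp T a m x :=
  Finset.prod_pos fun _ _ => h _

theorem sp_le_pow {a : X → ℝ} {K : ℝ} (h : ∀ x, 0 ≤ a x ∧ a x ≤ K) (m : ℕ) (x : X) :
    sp T a m x ≤ K ^ m := by
  calc sp T a m x ≤ ∏ _j ∈ Finset.range m, K :=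
        Finset.prod_le_prod (fun _ _ => (h _).1) fun _ _ => (h _).2
    _ = K ^ m := by simp

theorem it_smul_id (a : X → ℝ) (m : ℕ) (x : X) :
    it T (fun y => a y • ContinuousLinearMap.id ℝ V) m x =
      sp T a m x • ContinuousLinearMap.id ℝ V := by
  induction m generalizing x with
  | zero => simp
  | succ m ih => rw [it_succ, ih, sp_succ]; ext v; simp [smul_smul]

/-- Moving the starting point by one step trades the factor at `x` for the factor at `T^[n] x = x`.
-/
theorem sp_per {n : ℕ} (hT : IsCyc T n) {a : X → ℝ} (ha : ∀ x, a x ≠ 0) (x y : X) :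
    sp T a n x = sp T a n y := by
  have key : ∀ j x, sp T a n (T^[j] x) = sp T a n x := by
    intro j
    induction j with
    | zero => intro x; rfl
    | succ j ih =>
      intro x
      rw [Function.iterate_succ_apply, ih]
      have h1 := sp_succ (T := T) a n x
      have h2 := sp_succ' (T := T) a n x
      rw [hT.per] at h2
      rw [h1, mul_comm] at h2
      exact mul_right_cancel₀ (ha x) h2
  obtain ⟨j, -, rfl⟩ := hT.reach x y
  exact (key j x).symm

/-- The cocycle and its inverse are bounded by `K`. -/
def Bdd (A : X → V →L[ℝ] V) (K : ℝ) : Prop := ∀ x, ‖A x‖ ≤ K ∧ ∀ v, ‖v‖ ≤ K * ‖A x v‖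

theorem Bdd.mono {A : X → V →L[ℝ] V} {K K' : ℝ} (h : Bdd A K) (hK : K ≤ K') : Bdd A K' :=
  fun x => ⟨(h x).1.trans hK, fun v => ((h x).2 v).trans (by gcongr)⟩

theorem Bdd.le {A : X → V →L[ℝ] V} {K : ℝ} (h : Bdd A K) (x : X) (v : V) : ‖A x v‖ ≤ K * ‖v‖ :=
  (A x).le_of_opNorm_le (h x).1 v

/-- This is the origin of the threshold `1 / (2 * K)` put on all later perturbations: they stay
invertible, with bound `2 * K`. -/
theorem Bdd.perturb {A B : X → V →L[ℝ] V} {K δ : ℝ} (hK : 0 < K) (h : Bdd A K)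
    (hδ : δ ≤ 1 / (2 * K)) (hK1 : 1 ≤ K) (hAB : ∀ x, ‖B x - A x‖ ≤ δ) : Bdd B (2 * K) := by
  intro x
  have hd : δ ≤ 1 := hδ.trans (by rw [div_le_one (by positivity)]; linarith)
  constructor
  · calc ‖B x‖ = ‖A x + (B x - A x)‖ := by congr 1; abel
      _ ≤ ‖A x‖ + ‖B x - A x‖ := norm_add_le _ _
      _ ≤ K + 1 := add_le_add (h x).1 ((hAB x).trans hd)
      _ ≤ 2 * K := by linarith
  · intro v
    have h1 := (h x).2 v
    have h2 : ‖A x v‖ ≤ ‖B x v‖ + δ * ‖v‖ := by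
      calc ‖A x v‖ = ‖B x v - (B x - A x) v‖ := by congr 1; simp
        _ ≤ ‖B x v‖ + ‖(B x - A x) v‖ := norm_sub_le _ _
        _ ≤ _ := by gcongr; exact (B x - A x).le_of_opNorm_le (hAB x) v
    have h3 : K * (δ * ‖v‖) ≤ ‖v‖ / 2 := by
      calc K * (δ * ‖v‖) ≤ K * (1 / (2 * K) * ‖v‖) := by gcongr
        _ = ‖v‖ / 2 := by field_simp
    nlinarith [mul_le_mul_of_nonneg_left h2 hK.le]

theorem Bdd.injective {A : X → V →L[ℝ] V} {K : ℝ} (h : Bdd A K) (x : X) :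
    Function.Injective (A x) := by
  rw [injective_iff_map_eq_zero]
  intro v hv
  have := (h x).2 v
  rw [hv, norm_zero, mul_zero] at this
  exact norm_le_zero_iff.1 this

theorem Bdd.bijective [FiniteDimensional ℝ V] {A : X → V →L[ℝ] V} {K : ℝ} (h : Bdd A K) (x : X) :
    Function.Bijective (A x) :=
  ⟨h.injective x, (LinearMap.injective_iff_surjective (f := (A x).toLinearMap)).1 (h.injective x)⟩

theorem it_injective {A : X → V →L[ℝ] V} (h : ∀ x, Function.Injective (A x)) (m : ℕ) (x : X) :
    Function.Injective (it T A m x) := by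
  induction m generalizing x with
  | zero => exact fun _ _ h => h
  | succ m ih => exact (ih _).comp (h x)

theorem Bdd.norm_it_le {A : X → V →L[ℝ] V} {K : ℝ} (hK : 0 ≤ K) (h : Bdd A K) (m : ℕ) (x : X)
    (v : V) : ‖it T A m x v‖ ≤ K ^ m * ‖v‖ := by
  induction m generalizing x v with
  | zero => simp
  | succ m ih =>
    calc ‖it T A m (T x) (A x v)‖ ≤ K ^ m * ‖A x v‖ := ih _ _
      _ ≤ K ^ m * (K * ‖v‖) := by gcongr; exact h.le x v
      _ = _ := by ring

theorem Bdd.le_norm_it {A : X → V →L[ℝ] V} {K : ℝ} (hK : 0 ≤ K) (h : Bdd A K) (m : ℕ) (x : X)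
    (v : V) : ‖v‖ ≤ K ^ m * ‖it T A m x v‖ := by
  induction m generalizing x v with
  | zero => simp
  | succ m ih =>
    calc ‖v‖ ≤ K * ‖A x v‖ := (h x).2 v
      _ ≤ K * (K ^ m * ‖it T A m (T x) (A x v)‖) := by gcongr; exact ih _ _
      _ = _ := by rw [it_succ]; simp [pow_succ]; ring

end Iterates

/-! ### Splittings of a fiber in coordinates -/

section Frames

variable {V W₁ W₂ : Type*} [NormedAddCommGroup V] [InnerProductSpace ℝ V]
  [NormedAddCommGroup W₁] [InnerProductSpace ℝ W₁]
  [NormedAddCommGroup W₂] [InnerProductSpace ℝ W₂]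

/-- A splitting of `V` with model fibers `W₁` and `W₂`. -/
structure AlgFrame (V W₁ W₂ : Type*) [NormedAddCommGroup V] [InnerProductSpace ℝ V]
    [NormedAddCommGroup W₁] [InnerProductSpace ℝ W₁]
    [NormedAddCommGroup W₂] [InnerProductSpace ℝ W₂] where
  k : W₁ →L[ℝ] V
  i : W₂ →L[ℝ] V
  k' : V →L[ℝ] W₁
  i' : V →L[ℝ] W₂
  kk : ∀ w, k' (k w) = w
  ii : ∀ w, i' (i w) = w
  ki : ∀ w, k' (i w) = 0
  ik : ∀ w, i' (k w) = 0
  id : ∀ v, k (k' v) + i (i' v) = v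

/-- An orthogonal splitting of `V` with model fibers `W₁` and `W₂`. -/
structure Frame (V W₁ W₂ : Type*) [NormedAddCommGroup V] [InnerProductSpace ℝ V]
    [NormedAddCommGroup W₁] [InnerProductSpace ℝ W₁]
    [NormedAddCommGroup W₂] [InnerProductSpace ℝ W₂] extends AlgFrame V W₁ W₂ where
  pyth : ∀ w₁ w₂, ‖k w₁ + i w₂‖ ^ 2 = ‖w₁‖ ^ 2 + ‖w₂‖ ^ 2

namespace Frame

variable (φ : Frame V W₁ W₂)

/-- The splitting with the two summands exchanged. -/
def swap : Frame V W₂ W₁ where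
  k := φ.i
  i := φ.k
  k' := φ.i'
  i' := φ.k'
  kk := φ.ii
  ii := φ.kk
  ki := φ.ik
  ik := φ.ki
  id v := by rw [add_comm]; exact φ.id v
  pyth w₁ w₂ := by rw [add_comm, φ.pyth, add_comm]

@[simp] theorem norm_k (w : W₁) : ‖φ.k w‖ = ‖w‖ := by
  have := φ.pyth w 0
  simp only [map_zero, add_zero, norm_zero, ne_eq, OfNat.ofNat_ne_zero, not_false_eq_true,
    zero_pow] at this
  exact (pow_left_inj₀ (norm_nonneg _) (norm_nonneg _) two_ne_zero).1 this

@[simp] theorem norm_i (w : W₂) : ‖φ.i w‖ = ‖w‖ := φ.swap.norm_k w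

theorem norm_sq (v : V) : ‖v‖ ^ 2 = ‖φ.k' v‖ ^ 2 + ‖φ.i' v‖ ^ 2 := by
  rw [← φ.pyth, φ.id]

theorem norm_k'_le (v : V) : ‖φ.k' v‖ ≤ ‖v‖ := by
  have := φ.norm_sq v
  exact pow_le_pow_iff_left₀ (norm_nonneg _) (norm_nonneg _) two_ne_zero |>.1
    (by nlinarith [sq_nonneg ‖φ.i' v‖])

theorem norm_i'_le (v : V) : ‖φ.i' v‖ ≤ ‖v‖ := φ.swap.norm_k'_le v

theorem norm_le (v : V) : ‖v‖ ≤ ‖φ.k' v‖ + ‖φ.i' v‖ := by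
  conv_lhs => rw [← φ.id v]
  exact (norm_add_le _ _).trans (by simp)

theorem opNorm_k : ‖φ.k‖ ≤ 1 :=
  ContinuousLinearMap.opNorm_le_bound _ zero_le_one fun w => by simp
theorem opNorm_i : ‖φ.i‖ ≤ 1 := φ.swap.opNorm_k
theorem opNorm_k' : ‖φ.k'‖ ≤ 1 :=
  ContinuousLinearMap.opNorm_le_bound _ zero_le_one fun w => by simpa using φ.norm_k'_le w
theorem opNorm_i' : ‖φ.i'‖ ≤ 1 := φ.swap.opNorm_k'

/-- A perturbation of one diagonal block can thus be inserted into the whole cocycle at no greater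
cost. -/
theorem opNorm_sandwich_le {V₁ V₂ V₃ V₄ : Type*} [NormedAddCommGroup V₁] [InnerProductSpace ℝ V₁]
    [NormedAddCommGroup V₂] [InnerProductSpace ℝ V₂]
    [NormedAddCommGroup V₃] [InnerProductSpace ℝ V₃]
    [NormedAddCommGroup V₄] [InnerProductSpace ℝ V₄] {f : V₃ →L[ℝ] V₄} {g : V₁ →L[ℝ] V₂}
    (hf : ‖f‖ ≤ 1) (hg : ‖g‖ ≤ 1) (D : V₂ →L[ℝ] V₃) : ‖f.comp (D.comp g)‖ ≤ ‖D‖ := by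
  calc ‖f.comp (D.comp g)‖ ≤ ‖f‖ * (‖D‖ * ‖g‖) :=
        (f.opNorm_comp_le _).trans (by gcongr; exact D.opNorm_comp_le g)
    _ ≤ 1 * (‖D‖ * 1) := by gcongr
    _ = ‖D‖ := by ring

end Frame

end Frames

/-! ### Characteristic polynomials of block triangular maps and real spectra -/

section Spectrum

variable {X V W₁ W₂ : Type*} [NormedAddCommGroup V] [InnerProductSpace ℝ V]
  [FiniteDimensional ℝ V]
  [NormedAddCommGroup W₁] [InnerProductSpace ℝ W₁] [FiniteDimensional ℝ W₁]
  [NormedAddCommGroup W₂] [InnerProductSpace ℝ W₂] [FiniteDimensional ℝ W₂]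

theorem charpoly_eq_of_conj {f : V →ₗ[ℝ] V} {g : W₁ →ₗ[ℝ] W₁} (e : V →ₗ[ℝ] W₁)
    (he : Function.Bijective e) (h : e ∘ₗ f = g ∘ₗ e) : f.charpoly = g.charpoly := by
  have : g = (LinearEquiv.ofBijective e he).conj f := by
    ext w
    obtain ⟨v, rfl⟩ := he.2 w
    have h1 := LinearMap.congr_fun h v
    have h2 : (LinearEquiv.ofBijective e he).symm (e v) = v :=
      (LinearEquiv.ofBijective e he).symm_apply_apply v
    simp only [LinearMap.comp_apply] at h1
    simp [LinearEquiv.conj_apply, h2, h1]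
  rw [this, LinearEquiv.charpoly_conj]

theorem charpoly_block_prod (f : W₁ × W₂ →ₗ[ℝ] W₁ × W₂) (p : W₁ →ₗ[ℝ] W₁) (s : W₂ →ₗ[ℝ] W₂)
    (hp : ∀ w, f (w, 0) = (p w, 0)) (hs : ∀ w, (f w).2 = s w.2) :
    f.charpoly = p.charpoly * s.charpoly := by
  classical
  let b₁ := Module.finBasis ℝ W₁
  let b₂ := Module.finBasis ℝ W₂
  rw [← LinearMap.charpoly_toMatrix f (b₁.prod b₂), ← LinearMap.charpoly_toMatrix p b₁,
    ← LinearMap.charpoly_toMatrix s b₂]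
  rw [← Matrix.charpoly_fromBlocks_zero₂₁ (M₁₂ := fun i j => (b₁.repr (f (0, b₂ j)).1) i)]
  congr 1
  ext i j
  rcases i with i | i <;> rcases j with j | j <;>
    simp [LinearMap.toMatrix_apply, hp, hs, Matrix.fromBlocks]

theorem charpoly_block {f : V →ₗ[ℝ] V} {p : W₁ →ₗ[ℝ] W₁} {s : W₂ →ₗ[ℝ] W₂}
    {k : W₁ →ₗ[ℝ] V} {i : W₂ →ₗ[ℝ] V} {k' : V →ₗ[ℝ] W₁} {i' : V →ₗ[ℝ] W₂}
    (hkk : ∀ w, k' (k w) = w) (hii : ∀ w, i' (i w) = w) (hki : ∀ w, k' (i w) = 0)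
    (hik : ∀ w, i' (k w) = 0) (hid : ∀ v, k (k' v) + i (i' v) = v)
    (hp : ∀ w, f (k w) = k (p w)) (hs : ∀ v, i' (f v) = s (i' v)) :
    f.charpoly = p.charpoly * s.charpoly := by
  let e : V ≃ₗ[ℝ] W₁ × W₂ :=
    { (k'.prod i') with
      invFun := fun w => k w.1 + i w.2
      left_inv := fun v => by simpa using hid v
      right_inv := fun w => by ext <;> simp [hkk, hii, hki, hik] }
  have he : ∀ v, e v = (k' v, i' v) := fun v => rfl
  have hes : ∀ w, e.symm w = k w.1 + i w.2 := fun w => rfl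
  rw [← LinearEquiv.charpoly_conj e f]
  refine charpoly_block_prod _ _ _ (fun w => ?_) fun w => ?_
  · simp [LinearEquiv.conj_apply, he, hes, hp, hkk, hik]
  · simp [LinearEquiv.conj_apply, he, hes, hs, hik, hii]

theorem charpoly_smul_id_real (c : ℝ) :
    (c • ContinuousLinearMap.id ℝ ℝ : ℝ →L[ℝ] ℝ).toLinearMap.charpoly = Polynomial.X - C c := by
  rw [← LinearMap.charpoly_toMatrix _ (Module.Basis.singleton Unit ℝ)]
  have : LinearMap.toMatrix (Module.Basis.singleton Unit ℝ) (Module.Basis.singleton Unit ℝ)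
      (c • ContinuousLinearMap.id ℝ ℝ : ℝ →L[ℝ] ℝ).toLinearMap = Matrix.of fun _ _ => c := by
    ext i j
    rw [LinearMap.toMatrix_apply]
    simp
  rw [this]
  simp [Matrix.charpoly, Matrix.charmatrix, Matrix.det_unique]

/-- The eigenvalues of the return maps are the real numbers in `s`, with multiplicities. -/
def HasSpec (T : Equiv.Perm X) (n : ℕ) (A : X → V →L[ℝ] V) (s : Multiset ℝ) : Prop :=
  ∀ x, (it T A n x).toLinearMap.charpoly = (s.map fun r => Polynomial.X - C r).prod

variable {T : Equiv.Perm X} {n : ℕ}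

theorem charpoly_ret_eq (hT : IsCyc T n) {A : X → V →L[ℝ] V}
    (hA : ∀ x, Function.Bijective (A x)) (x y : X) :
    (it T A n x).toLinearMap.charpoly = (it T A n y).toLinearMap.charpoly := by
  have key : ∀ j x, (it T A n x).toLinearMap.charpoly =
      (it T A n (T^[j] x)).toLinearMap.charpoly := by
    intro j
    induction j with
    | zero => intro x; rfl
    | succ j ih =>
      intro x
      rw [Function.iterate_succ_apply, ← ih]
      refine charpoly_eq_of_conj (A x).toLinearMap (hA x) ?_
      have h1 := it_succ (T := T) A n x
      rw [it_succ', hT.per] at h1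
      exact congrArg ContinuousLinearMap.toLinearMap h1
  obtain ⟨j, -, rfl⟩ := hT.reach x y
  exact key j x

theorem it_per_comm (hT : IsCyc T n) (A : X → V →L[ℝ] V) (x : X) :
    (it T A n (T x)).comp (A x) = (A x).comp (it T A n x) := by
  have h1 := it_succ (T := T) A n x
  rw [it_succ', hT.per] at h1
  exact h1.symm

/-- Identifying subspaces isometrically with fixed model fibers keeps sub- and quotient cocycles on
trivial bundles, which is what the inductions on the dimension need. -/
theorem exists_frame (W : Submodule ℝ V) (h₁ : Module.finrank ℝ W = Module.finrank ℝ W₁)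
    (h₂ : Module.finrank ℝ W₁ + Module.finrank ℝ W₂ = Module.finrank ℝ V) :
    ∃ φ : Frame V W₁ W₂, LinearMap.range φ.k.toLinearMap = W := by
  have h₃ : Module.finrank ℝ Wᗮ = Module.finrank ℝ W₂ := by
    have := W.finrank_add_finrank_orthogonal
    omega
  let e₁ : W₁ ≃ₗᵢ[ℝ] W :=
    (stdOrthonormalBasis ℝ W₁).equiv (stdOrthonormalBasis ℝ W) (finCongr h₁.symm)
  let e₂ : W₂ ≃ₗᵢ[ℝ] Wᗮ :=
    (stdOrthonormalBasis ℝ W₂).equiv (stdOrthonormalBasis ℝ Wᗮ) (finCongr h₃.symm)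
  have hW : ∀ w : W, W.orthogonalProjectionOnto (w : V) = w := fun w => by simp
  have hW' : ∀ w : Wᗮ, Wᗮ.orthogonalProjectionOnto (w : V) = w := fun w => by simp
  refine ⟨{
    k := W.subtypeL.comp e₁.toContinuousLinearEquiv.toContinuousLinearMap
    i := Wᗮ.subtypeL.comp e₂.toContinuousLinearEquiv.toContinuousLinearMap
    k' := e₁.symm.toContinuousLinearEquiv.toContinuousLinearMap.comp W.orthogonalProjectionOnto
    i' := e₂.symm.toContinuousLinearEquiv.toContinuousLinearMap.comp Wᗮ.orthogonalProjectionOnto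
    kk := fun w => by simp
    ii := fun w => by simp
    ki := fun w => by
      have : W.orthogonalProjectionOnto (e₂ w : V) = 0 :=
        Submodule.orthogonalProjectionOnto_eq_zero_iff.2 (e₂ w).2
      simp [this]
    ik := fun w => by
      have : Wᗮ.orthogonalProjectionOnto (e₁ w : V) = 0 :=
        Submodule.orthogonalProjectionOnto_eq_zero_iff.2
          ((Submodule.le_orthogonal_orthogonal W) (e₁ w).2)
      simp [this]
    id := fun v => by simp
    pyth := fun w₁ w₂ => ?_ }, ?_⟩
  · have h := norm_add_sq_real (e₁ w₁ : V) (e₂ w₂ : V)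
    have h0 : inner ℝ (e₁ w₁ : V) (e₂ w₂ : V) = 0 :=
      Submodule.inner_right_of_mem_orthogonal (e₁ w₁).2 (e₂ w₂).2
    have n1 : ‖((e₁ w₁ : W) : V)‖ = ‖w₁‖ := e₁.norm_map w₁
    have n2 : ‖((e₂ w₂ : Wᗮ) : V)‖ = ‖w₂‖ := e₂.norm_map w₂
    rw [h0, n1, n2] at h
    simpa using h
  · ext v
    simp only [LinearMap.mem_range]
    constructor
    · rintro ⟨w, rfl⟩
      exact (e₁ w).2
    · intro hv
      exact ⟨e₁.symm ⟨v, hv⟩, by simp⟩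

end Spectrum

/-! ### Block triangular cocycles and invariant lines -/

section BlockCocycles

variable {X V W₁ W₂ : Type*} [NormedAddCommGroup V] [InnerProductSpace ℝ V]
  [FiniteDimensional ℝ V]
  [NormedAddCommGroup W₁] [InnerProductSpace ℝ W₁] [FiniteDimensional ℝ W₁]
  [NormedAddCommGroup W₂] [InnerProductSpace ℝ W₂] [FiniteDimensional ℝ W₂]
  {T : Equiv.Perm X} {n : ℕ}

/-- In the splitting `φ`, the cocycle `A` is block triangular with diagonal blocks `P` and `S`. -/
structure Block (T : Equiv.Perm X) (φ : X → AlgFrame V W₁ W₂) (A : X → V →L[ℝ] V)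
    (P : X → W₁ →L[ℝ] W₁) (S : X → W₂ →L[ℝ] W₂) : Prop where
  sub : ∀ x w, A x ((φ x).k w) = (φ (T x)).k (P x w)
  quot : ∀ x v, (φ (T x)).i' (A x v) = S x ((φ x).i' v)

namespace Block

variable {φ : X → AlgFrame V W₁ W₂} {A : X → V →L[ℝ] V}
  {P : X → W₁ →L[ℝ] W₁} {S : X → W₂ →L[ℝ] W₂}

theorem it_sub (h : Block T φ A P S) (m : ℕ) (x : X) (w : W₁) :
    it T A m x ((φ x).k w) = (φ (T^[m] x)).k (it T P m x w) := by
  have := it_intertwine (T := T) (A := P) (B := A) (R := fun x => (φ x).k)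
    (fun x => by ext w; simp [h.sub]) m x
  exact (DFunLike.congr_fun this w).symm

theorem it_quot (h : Block T φ A P S) (m : ℕ) (x : X) (v : V) :
    (φ (T^[m] x)).i' (it T A m x v) = it T S m x ((φ x).i' v) := by
  have := it_intertwine (T := T) (A := A) (B := S) (R := fun x => (φ x).i')
    (fun x => by ext w; simp [h.quot]) m x
  exact DFunLike.congr_fun this v

theorem charpoly_eq (h : Block T φ A P S) (hT : IsCyc T n) (x : X) :
    (it T A n x).toLinearMap.charpoly =
      (it T P n x).toLinearMap.charpoly * (it T S n x).toLinearMap.charpoly := by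
  have h1 := h.it_sub n x
  have h2 := h.it_quot n x
  rw [hT.per] at h1 h2
  exact charpoly_block (k := (φ x).k.toLinearMap) (i := (φ x).i.toLinearMap)
    (k' := (φ x).k'.toLinearMap) (i' := (φ x).i'.toLinearMap)
    (φ x).kk (φ x).ii (φ x).ki (φ x).ik (φ x).id h1 h2

theorem hasSpec (h : Block T φ A P S) (hT : IsCyc T n) {s t : Multiset ℝ}
    (hP : HasSpec T n P s) (hS : HasSpec T n S t) : HasSpec T n A (s + t) := fun x => by
  rw [h.charpoly_eq hT, hP x, hS x, Multiset.map_add, Multiset.prod_add]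

/-- The change of `S` is inserted through the second summand only, so that the invariant subbundle
and the block on it do not change. `lift_sub` is the mirror operation. -/
theorem lift_quot (h : Block T φ A P S) (S' : X → W₂ →L[ℝ] W₂) :
    Block T φ (fun x => A x + (φ (T x)).i.comp ((S' x - S x).comp (φ x).i')) P S' where
  sub x w := by simp [h.sub, (φ x).ik]
  quot x v := by simp [h.quot, (φ (T x)).ii]

theorem lift_sub (h : Block T φ A P S) (P' : X → W₁ →L[ℝ] W₁) :
    Block T φ (fun x => A x + (φ (T x)).k.comp ((P' x - P x).comp (φ x).k')) P' S where
  sub x w := by simp [h.sub, (φ x).kk]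
  quot x v := by simp [h.quot, (φ (T x)).ik]

end Block

theorem hasSpec_scalar (c : X → ℝ) (hc : ∀ x, c x ≠ 0) (hT : IsCyc T n) (x : X) :
    HasSpec T n (fun y => c y • ContinuousLinearMap.id ℝ ℝ) {sp T c n x} := fun y => by
  rw [it_smul_id, charpoly_smul_id_real, sp_per hT hc y x]
  simp

theorem Block.hasSpec_quot {φ : X → AlgFrame V ℝ W₂} {A : X → V →L[ℝ] V} {c : X → ℝ}
    {S : X → W₂ →L[ℝ] W₂}
    (h : Block T φ A (fun y => c y • ContinuousLinearMap.id ℝ ℝ) S) (hc : ∀ x, c x ≠ 0)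
    (hT : IsCyc T n) {r : ℝ} {s : Multiset ℝ} (hA : HasSpec T n A (r ::ₘ s))
    (hr : ∀ x, sp T c n x = r) : HasSpec T n S s := fun x => by
  have h1 := h.charpoly_eq hT x
  rw [hasSpec_scalar c hc hT x x, hA x, hr x] at h1
  simp only [Multiset.map_cons, Multiset.prod_cons, Multiset.map_singleton,
    Multiset.prod_singleton] at h1
  exact (mul_left_cancel₀ (X_sub_C_ne_zero r) h1).symm

theorem Block.hasSpec_cons {φ : X → AlgFrame V ℝ W₂} {A : X → V →L[ℝ] V} {c : X → ℝ}
    {S : X → W₂ →L[ℝ] W₂}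
    (h : Block T φ A (fun y => c y • ContinuousLinearMap.id ℝ ℝ) S) (hc : ∀ x, c x ≠ 0)
    (hT : IsCyc T n) {r : ℝ} {s : Multiset ℝ} (hS : HasSpec T n S s)
    (hr : ∀ x, sp T c n x = r) : HasSpec T n A (r ::ₘ s) := fun x => by
  have := h.hasSpec hT (hasSpec_scalar c hc hT x) hS x
  rwa [hr x, Multiset.singleton_add] at this

/-- A cocycle which leaves `W₁` invariant is block triangular. -/
theorem block_of_sub (φ : X → AlgFrame V W₁ W₂) (A : X → V →L[ℝ] V) (P : X → W₁ →L[ℝ] W₁)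
    (h : ∀ x w, A x ((φ x).k w) = (φ (T x)).k (P x w)) :
    Block T φ A P (fun x => (φ (T x)).i'.comp ((A x).comp (φ x).i)) where
  sub := h
  quot x v := by
    conv_lhs => rw [← (φ x).id v]
    simp [h, (φ (T x)).ik]

/-- Push `W` forward along the orbit of `x₀` for less than one period; the invariance under the
return map makes the family close up. -/
theorem invariant_family (hT : IsCyc T n) {A : X → V →L[ℝ] V}
    (hA : ∀ x, Function.Bijective (A x)) (x₀ : X) (W : Submodule ℝ V)
    (hW : W.map (it T A n x₀).toLinearMap ≤ W) :
    ∃ F : X → Submodule ℝ V, F x₀ = W ∧ (∀ x, (F x).map (A x).toLinearMap = F (T x)) ∧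
      ∀ x, Module.finrank ℝ (F x) = Module.finrank ℝ W := by
  have hinj := it_injective (T := T) (A := A) fun x => (hA x).1
  choose j hj hjx using hT.reach x₀
  have hfin : ∀ m x, Module.finrank ℝ (W.map (it T A m x).toLinearMap) = Module.finrank ℝ W :=
    fun m x => (LinearEquiv.finrank_eq (Submodule.equivMapOfInjective
      (it T A m x).toLinearMap (hinj m x) W)).symm
  have hWn : W.map (it T A n x₀).toLinearMap = W := Submodule.eq_of_le_of_finrank_eq hW (hfin _ _)
  have hj0 : j x₀ = 0 := hT.inj x₀ _ _ (hj _) hT.pos (by rw [hjx]; rfl)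
  refine ⟨fun x => W.map (it T A (j x) x₀).toLinearMap, ?_, fun x => ?_, fun x => hfin _ _⟩
  · simp only [hj0, it_zero]
    exact Submodule.map_id W
  · have h1 : (W.map (it T A (j x) x₀).toLinearMap).map (A x).toLinearMap =
        W.map (it T A (j x + 1) x₀).toLinearMap := by
      rw [it_succ', hjx, ← Submodule.map_comp]
      rfl
    rw [h1]
    rcases (Nat.succ_le_of_lt (hj x)).lt_or_eq with h | h
    · have : j (T x) = j x + 1 := hT.inj x₀ _ _ (hj _) h (by
        rw [hjx, Function.iterate_succ_apply', hjx])
      simp only [this]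
    · have hx : T x = x₀ := by
        rw [← hT.per x₀, ← h, Nat.succ_eq_add_one, Function.iterate_succ_apply', hjx]
      have : j (T x) = 0 := by rw [hx, hj0]
      simp only [this, show j x + 1 = n from h, hWn, it_zero]
      exact (Submodule.map_id W).symm

theorem exists_eigenline (hT : IsCyc T n) {A : X → V →L[ℝ] V}
    (hA : ∀ x, Function.Bijective (A x)) (x₀ : X) {r : ℝ}
    (hr : (it T A n x₀).toLinearMap.charpoly.IsRoot r) :
    ∃ (e : X → V) (c : X → ℝ), (∀ x, ‖e x‖ = 1) ∧ (∀ x, A x (e x) = c x • e (T x)) ∧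
      (∀ x, c x ≠ 0) ∧ ∀ x, sp T c n x = r := by
  obtain ⟨v, hv⟩ := ((Module.End.hasEigenvalue_iff_isRoot_charpoly _ _).2 hr).exists_hasEigenvector
  have hv0 := hv.2
  have hv1 : it T A n x₀ v = r • v := hv.apply_eq_smul
  obtain ⟨F, hF0, hF, hFr⟩ := invariant_family hT hA x₀ (ℝ ∙ v) (by
    rw [Submodule.map_span_le]
    rintro w hw
    rw [Set.mem_singleton_iff.1 hw]
    change it T A n x₀ v ∈ _
    rw [hv1]
    exact Submodule.smul_mem _ _ (Submodule.mem_span_singleton_self v))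
  have hF1 : ∀ x, Module.finrank ℝ (F x) = 1 := fun x => by rw [hFr, finrank_span_singleton hv0]
  have hex : ∀ x, ∃ e : V, ‖e‖ = 1 ∧ F x = ℝ ∙ e := by
    intro x
    obtain ⟨w, hw0, hw⟩ := finrank_eq_one_iff'.1 (hF1 x)
    have hw0' : (w : V) ≠ 0 := fun h => hw0 (Subtype.ext h)
    have hn : ‖(w : V)‖ ≠ 0 := norm_ne_zero_iff.2 hw0'
    refine ⟨‖(w : V)‖⁻¹ • (w : V), by rw [norm_smul, norm_inv, norm_norm, inv_mul_cancel₀ hn], ?_⟩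
    apply le_antisymm
    · intro u hu
      obtain ⟨t, ht⟩ := hw ⟨u, hu⟩
      rw [Submodule.mem_span_singleton]
      refine ⟨t * ‖(w : V)‖, ?_⟩
      rw [smul_smul, mul_assoc, mul_inv_cancel₀ hn, mul_one]
      exact congrArg Subtype.val ht
    · rw [Submodule.span_singleton_le_iff_mem]
      exact Submodule.smul_mem _ _ w.2
  choose e he1 heF using hex
  have hc : ∀ x, ∃ c : ℝ, A x (e x) = c • e (T x) := by
    intro x
    have : A x (e x) ∈ F (T x) := by
      rw [← hF x]
      exact Submodule.mem_map_of_mem (f := (A x).toLinearMap)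
        (by rw [heF x]; exact Submodule.mem_span_singleton_self _)
    rw [heF, Submodule.mem_span_singleton] at this
    obtain ⟨c, hc⟩ := this
    exact ⟨c, hc.symm⟩
  choose c hc using hc
  have hc0 : ∀ x, c x ≠ 0 := by
    intro x h
    have h1 := hc x
    rw [h, zero_smul, ← map_zero (A x)] at h1
    have := (hA x).1 h1
    have h2 := he1 x
    rw [this, norm_zero] at h2
    exact zero_ne_one h2
  refine ⟨e, c, he1, hc, hc0, fun x => ?_⟩
  rw [sp_per hT hc0 x x₀]
  have hit : ∀ m x, it T A m x (e x) = sp T c m x • e (T^[m] x) := by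
    intro m
    induction m with
    | zero => intro x; simp
    | succ m ih =>
      intro x
      rw [it_succ, ContinuousLinearMap.comp_apply, hc, map_smul, ih, sp_succ, smul_smul]
      rfl
  have h1 := hit n x₀
  rw [hT.per] at h1
  have h2 : it T A n x₀ (e x₀) = r • e x₀ := by
    have : e x₀ ∈ F x₀ := by rw [heF]; exact Submodule.mem_span_singleton_self _
    rw [hF0, Submodule.mem_span_singleton] at this
    obtain ⟨t, ht⟩ := this
    rw [← ht, map_smul, hv1, smul_comm]
  rw [h2] at h1
  have hne : e x₀ ≠ 0 := fun h => by have := he1 x₀; simp [h] at this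
  exact (smul_left_injective ℝ hne h1).symm

theorem it_eigenline {A : X → V →L[ℝ] V} {e : X → V} {c : X → ℝ}
    (hc : ∀ x, A x (e x) = c x • e (T x)) (m : ℕ) (x : X) :
    it T A m x (e x) = sp T c m x • e (T^[m] x) := by
  induction m generalizing x with
  | zero => simp
  | succ m ih =>
    rw [it_succ, ContinuousLinearMap.comp_apply, hc, map_smul, ih, sp_succ, smul_smul]
    rfl

/-- Orthogonal frames whose first component is an invariant line field. -/
theorem exists_line_frame (hT : IsCyc T n) {A : X → V →L[ℝ] V}
    (hA : ∀ x, Function.Bijective (A x)) (x₀ : X) {r : ℝ}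
    (hr : (it T A n x₀).toLinearMap.charpoly.IsRoot r)
    (hd : Module.finrank ℝ W₂ + 1 = Module.finrank ℝ V) :
    ∃ (φ : X → Frame V ℝ W₂) (c : X → ℝ) (S : X → W₂ →L[ℝ] W₂),
      Block T (fun x => (φ x).toAlgFrame) A (fun x => c x • ContinuousLinearMap.id ℝ ℝ) S ∧
      (∀ x, c x ≠ 0) ∧ ∀ x, sp T c n x = r := by
  obtain ⟨e, c, he, hc, hc0, hcr⟩ := exists_eigenline hT hA x₀ hr
  have hex : ∀ x, ∃ φ : Frame V ℝ W₂, ∃ t : ℝ, t ≠ 0 ∧ φ.k 1 = t • e x := by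
    intro x
    have hne : e x ≠ 0 := fun h => by have := he x; simp [h] at this
    obtain ⟨φ, hφ⟩ := exists_frame (W₁ := ℝ) (W₂ := W₂) (ℝ ∙ e x)
      (by rw [finrank_span_singleton hne, Module.finrank_self])
      (by rw [Module.finrank_self]; omega)
    have : φ.k 1 ∈ ℝ ∙ e x := by rw [← hφ]; exact ⟨1, rfl⟩
    obtain ⟨t, ht⟩ := Submodule.mem_span_singleton.1 this
    refine ⟨φ, t, ?_, ht.symm⟩
    rintro rfl
    have h1 := φ.norm_k 1
    rw [← ht] at h1
    simp at h1
  choose φ t ht0 ht using hex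
  let c' : X → ℝ := fun x => t x * c x / t (T x)
  have hk : ∀ x (w : ℝ), (φ x).k w = (w * t x) • e x := by
    intro x w
    have : (φ x).k w = w • (φ x).k 1 := by rw [← map_smul, smul_eq_mul, mul_one]
    rw [this, ht, smul_smul]
  have hsub : ∀ x (w : ℝ), A x ((φ x).k w) =
      (φ (T x)).k ((c' x • ContinuousLinearMap.id ℝ ℝ) w) := by
    intro x w
    rw [hk, hk, map_smul, hc, smul_smul]
    congr 1
    have := ht0 (T x)
    simp only [c', smul_apply, ContinuousLinearMap.id_apply, smul_eq_mul]
    field_simp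
  refine ⟨φ, c', _, block_of_sub (T := T) (fun x => (φ x).toAlgFrame) A
    (fun x => c' x • ContinuousLinearMap.id ℝ ℝ) hsub,
    fun x => div_ne_zero (mul_ne_zero (ht0 _) (hc0 _)) (ht0 _), fun x => ?_⟩
  have : ∀ m x, sp T c' m x = t x * sp T c m x / t (T^[m] x) := by
    intro m
    induction m with
    | zero => intro x; simp [ht0]
    | succ m ih =>
      intro x
      rw [sp_succ', sp_succ', ih, Function.iterate_succ_apply']
      have h1 := ht0 (T^[m] x)
      have h2 := ht0 (T (T^[m] x))
      simp only [c']
      field_simp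
  rw [this, hT.per, hcr, mul_comm, mul_div_assoc, div_self (ht0 x), mul_one]

theorem Block.bdd_sub {φ : X → Frame V W₁ W₂} {A : X → V →L[ℝ] V} {P : X → W₁ →L[ℝ] W₁}
    {S : X → W₂ →L[ℝ] W₂} {K : ℝ} (hK : 0 ≤ K)
    (h : Block T (fun x => (φ x).toAlgFrame) A P S) (hA : Bdd A K) : Bdd P K := by
  have h1 : ∀ x w, ‖A x ((φ x).k w)‖ = ‖P x w‖ := fun x w => by rw [h.sub, Frame.norm_k]
  refine fun x => ⟨ContinuousLinearMap.opNorm_le_bound _ hK fun w => ?_, fun w => ?_⟩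
  · rw [← h1]; simpa using hA.le x ((φ x).k w)
  · rw [← h1]; simpa using (hA x).2 ((φ x).k w)

/-- For the lower bound, `w` is lifted to the vector of `V` whose image has no component in the
invariant bundle; the norm of that image is exactly the norm of `S x w`. -/
theorem Block.bdd_quot {φ : X → Frame V W₁ W₂} {A : X → V →L[ℝ] V} {P : X → W₁ →L[ℝ] W₁}
    {S : X → W₂ →L[ℝ] W₂} {K : ℝ} (hK : 0 ≤ K)
    (h : Block T (fun x => (φ x).toAlgFrame) A P S) (hA : Bdd A K) : Bdd S K := by
  have hP := h.bdd_sub hK hA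
  have hS : ∀ x v, S x ((φ x).i' v) = (φ (T x)).i' (A x v) := fun x v => (h.quot x v).symm
  refine fun x => ⟨ContinuousLinearMap.opNorm_le_bound _ hK fun w => ?_, fun w => ?_⟩
  · have := hS x ((φ x).i w)
    rw [(φ x).ii] at this
    rw [this]
    exact ((φ (T x)).norm_i'_le _).trans (by simpa using hA.le x ((φ x).i w))
  · obtain ⟨r, hr⟩ := (hP.bijective x).2 (-(φ (T x)).k' (A x ((φ x).i w)))
    have e1 : (φ x).i' ((φ x).i w + (φ x).k r) = w := by
      rw [map_add, (φ x).ii, (φ x).ik, add_zero]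
    have e2 : (φ (T x)).k' (A x ((φ x).i w + (φ x).k r)) = 0 := by
      rw [map_add, map_add, h.sub, (φ (T x)).kk, hr, add_neg_cancel]
    have e3 := hS x ((φ x).i w + (φ x).k r)
    rw [e1] at e3
    calc ‖w‖ ≤ ‖(φ x).i w + (φ x).k r‖ := by
          conv_lhs => rw [← e1]
          exact (φ x).norm_i'_le _
      _ ≤ K * ‖A x ((φ x).i w + (φ x).k r)‖ := (hA x).2 _
      _ ≤ K * ‖S x w‖ := by
          gcongr
          refine ((φ (T x)).norm_le _).trans ?_
          rw [e2, norm_zero, zero_add, e3]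

end BlockCocycles

/-! ### Exponential decay of products from bounds on their sums -/

section ScalarDecay

/-- Bernoulli's inequality for `θ = 1 - 1 / (2 * N)`. -/
theorem exists_theta {N : ℕ} (hN : 0 < N) : ∃ θ : ℝ, 1 / 2 ≤ θ ∧ θ < 1 ∧ 1 / 2 ≤ θ ^ N := by
  have hN' : (1 : ℝ) ≤ N := by exact_mod_cast hN
  refine ⟨1 + -(1 / (2 * N)), ?_, ?_, ?_⟩
  · have : 1 / (2 * (N : ℝ)) ≤ 1 / 2 := by gcongr; linarith
    linarith
  · have : (0 : ℝ) < 1 / (2 * N) := by positivity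
    linarith
  · have h := one_add_mul_le_pow (a := -(1 / (2 * (N : ℝ)))) (by
      have : 1 / (2 * (N : ℝ)) ≤ 1 := by rw [div_le_one (by positivity)]; linarith
      linarith) N
    have h2 : (N : ℝ) * -(1 / (2 * N)) = -(1 / 2) := by field_simp
    linarith

variable {X : Type*} {T : Equiv.Perm X} {n : ℕ}

/-- Cut the product into blocks of length `N`, each at most `1 / 2 ≤ θ ^ N`. The incomplete last
block costs `K ^ N`, and the factor `2` makes up for its power of `θ`, which is at least `1 / 2`. -/
theorem sp_decay_of_step {u : X → ℝ} {K θ : ℝ} {N : ℕ} (hN : 0 < N) (hK : 1 ≤ K)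
    (hu : ∀ x, 0 < u x ∧ u x ≤ K) (hθ0 : 0 < θ) (hθ1 : θ ≤ 1) (hθ : 1 / 2 ≤ θ ^ N)
    (h : ∀ x, sp T u N x ≤ 1 / 2) (m : ℕ) (x : X) : sp T u m x ≤ 2 * K ^ N * θ ^ m := by
  have hu0 : ∀ m x, 0 < sp T u m x := fun m x => sp_pos (fun x => (hu x).1) m x
  induction m using Nat.strong_induction_on generalizing x with
  | _ m ih =>
    rcases lt_or_ge m N with hm | hm
    · have h1 : sp T u m x ≤ K ^ m := sp_le_pow (fun x => ⟨(hu x).1.le, (hu x).2⟩) m x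
      have h2 : K ^ m ≤ K ^ N := pow_le_pow_right₀ hK hm.le
      have h3 : θ ^ N ≤ θ ^ m := pow_le_pow_of_le_one hθ0.le hθ1 hm.le
      have h4 : 1 ≤ 2 * θ ^ m := by linarith
      nlinarith [pow_pos (lt_of_lt_of_le one_pos hK) N]
    · obtain ⟨k, rfl⟩ := Nat.exists_eq_add_of_le hm
      rw [sp_add]
      have h1 := ih k (by omega) (T^[N] x)
      calc sp T u N x * sp T u k (T^[N] x) ≤ 1 / 2 * (2 * K ^ N * θ ^ k) := by
            gcongr
            · exact (hu0 _ _).le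
            · exact h x
        _ ≤ θ ^ N * (2 * K ^ N * θ ^ k) := by gcongr
        _ = 2 * K ^ N * θ ^ (N + k) := by rw [pow_add]; ring

/-- Pigeonhole: of the first `N` terms of the sum one is at most `S / N`. The rest of the product up
to time `N` is itself a term of the sum at another point, so at most `S`, and `S ^ 2 / N ≤ 1 / 2`.
-/
theorem sp_step_of_sum {u : X → ℝ} {S : ℝ} {N : ℕ} (hS : 0 ≤ S) (hSN : 2 * S ^ 2 ≤ N) (hN : 0 < N)
    (hNn : N < n) (hu : ∀ x, 0 < u x) (h : ∀ x, ∑ j ∈ Finset.range n, sp T u j x ≤ S) (x : X) :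
    sp T u N x ≤ 1 / 2 := by
  have hu0 : ∀ m x, 0 < sp T u m x := fun m x => sp_pos hu m x
  have hN' : (0 : ℝ) < N := by exact_mod_cast hN
  have hle : ∀ x, ∀ j < n, sp T u j x ≤ S := fun x j hj =>
    (Finset.single_le_sum (f := fun j => sp T u j x) (fun i _ => (hu0 i x).le)
      (Finset.mem_range.2 hj)).trans (h x)
  obtain ⟨j, hj, hjS⟩ : ∃ j < N, sp T u j x ≤ S / N := by
    by_contra hcon
    push Not at hcon
    have h1 : ∑ _j ∈ Finset.range N, S / N < ∑ j ∈ Finset.range N, sp T u j x :=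
      Finset.sum_lt_sum_of_nonempty (by simpa using hN.ne') fun j hj =>
        hcon j (Finset.mem_range.1 hj)
    have h2 : ∑ j ∈ Finset.range N, sp T u j x ≤ ∑ j ∈ Finset.range n, sp T u j x :=
      Finset.sum_le_sum_of_subset_of_nonneg (Finset.range_mono hNn.le) fun i _ _ => (hu0 i x).le
    rw [Finset.sum_const, Finset.card_range, nsmul_eq_mul, mul_div_cancel₀ _ hN'.ne'] at h1
    linarith [h x]
  have e : N = j + (N - j) := by omega
  rw [e, sp_add]
  calc sp T u j x * sp T u (N - j) (T^[j] x) ≤ S / N * S := by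
        gcongr
        · exact (hu0 _ _).le
        · exact hle _ _ (by omega)
    _ ≤ 1 / 2 := by rw [div_mul_eq_mul_div, div_le_iff₀ hN']; linarith

/-- The same pigeonhole backwards in time: the `j`-th term of the sum at `x` is the product over the
`j` points preceding `x`, and by periodicity that stretch starts at `T^[n - j] x`. -/
theorem sp_step_of_sum_backward (hT : IsCyc T n) {u : X → ℝ} {S : ℝ} {N : ℕ} (hS : 0 ≤ S)
    (hSN : 2 * S ^ 2 ≤ N) (hN : 0 < N) (hNn : N < n) (hu : ∀ x, 0 < u x)
    (h : ∀ x, ∑ j ∈ Finset.range n, sp T u j (T^[n - j] x) ≤ S) (x : X) :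
    sp T u N x ≤ 1 / 2 := by
  have hu0 : ∀ m x, 0 < sp T u m x := fun m x => sp_pos hu m x
  have hN' : (0 : ℝ) < N := by exact_mod_cast hN
  have hle : ∀ x, ∀ j < n, sp T u j (T^[n - j] x) ≤ S := fun x j hj =>
    (Finset.single_le_sum (f := fun j => sp T u j (T^[n - j] x)) (fun i _ => (hu0 i _).le)
      (Finset.mem_range.2 hj)).trans (h x)
  obtain ⟨j, hj, hjS⟩ : ∃ j < N, sp T u j (T^[n - j] (T^[N] x)) ≤ S / N := by
    by_contra hcon
    push Not at hcon
    have h1 : ∑ _j ∈ Finset.range N, S / N <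
        ∑ j ∈ Finset.range N, sp T u j (T^[n - j] (T^[N] x)) :=
      Finset.sum_lt_sum_of_nonempty (by simpa using hN.ne') fun j hj =>
        hcon j (Finset.mem_range.1 hj)
    have h2 : ∑ j ∈ Finset.range N, sp T u j (T^[n - j] (T^[N] x)) ≤
        ∑ j ∈ Finset.range n, sp T u j (T^[n - j] (T^[N] x)) :=
      Finset.sum_le_sum_of_subset_of_nonneg (Finset.range_mono hNn.le) fun i _ _ => (hu0 i _).le
    rw [Finset.sum_const, Finset.card_range, nsmul_eq_mul, mul_div_cancel₀ _ hN'.ne'] at h1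
    linarith [h (T^[N] x)]
  have e : N = (N - j) + j := by omega
  have e1 : T^[n - j] (T^[N] x) = T^[N - j] x := by
    rw [← Function.iterate_add_apply, show n - j + N = (N - j) + n by omega,
      Function.iterate_add_apply, hT.per]
  rw [e1] at hjS
  rw [e, sp_add]
  have h3 := hle (T^[N - j] x) (N - j) (by omega)
  rw [← Function.iterate_add_apply, show n - (N - j) + (N - j) = n by omega, hT.per] at h3
  calc sp T u (N - j) x * sp T u j (T^[N - j] x) ≤ S * (S / N) := by
        gcongr
        exact (hu0 _ _).le
    _ ≤ 1 / 2 := by rw [mul_div_assoc', div_le_iff₀ hN']; linarith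

end ScalarDecay

/-! ### Domination by a quotient and mixing of two eigenvalues -/

section Domination

variable {X V W₁ W₂ : Type*} [NormedAddCommGroup V] [InnerProductSpace ℝ V]
  [FiniteDimensional ℝ V]
  [NormedAddCommGroup W₁] [InnerProductSpace ℝ W₁] [FiniteDimensional ℝ W₁]
  [NormedAddCommGroup W₂] [InnerProductSpace ℝ W₂] [FiniteDimensional ℝ W₂]
  {T : Equiv.Perm X} {n : ℕ}

/-- The distance of `w` to the subspace `L`, that is, the norm of `w` in `V ⧸ L`. -/
noncomputable def qd (L : Submodule ℝ V) (w : V) : ℝ := ‖Lᗮ.starProjection w‖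

theorem qd_nonneg (L : Submodule ℝ V) (w : V) : 0 ≤ qd L w := norm_nonneg _

theorem qd_add_le (L : Submodule ℝ V) (v w : V) : qd L (v + w) ≤ qd L v + qd L w := by
  unfold qd; rw [map_add]; exact norm_add_le _ _

theorem qd_smul (L : Submodule ℝ V) (c : ℝ) (w : V) : qd L (c • w) = |c| * qd L w := by
  unfold qd; rw [map_smul, norm_smul, Real.norm_eq_abs]

theorem qd_le_norm (L : Submodule ℝ V) (w : V) : qd L w ≤ ‖w‖ :=
  Lᗮ.norm_starProjection_apply_le w

theorem qd_eq_zero_iff (L : Submodule ℝ V) (w : V) : qd L w = 0 ↔ w ∈ L := by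
  unfold qd
  rw [norm_eq_zero, Submodule.starProjection_apply_eq_zero_iff, Submodule.orthogonal_orthogonal]

theorem qd_sub_of_mem {L : Submodule ℝ V} {l : V} (hl : l ∈ L) (w : V) : qd L (w - l) = qd L w := by
  have : Lᗮ.starProjection l = 0 := by
    rw [Submodule.starProjection_apply_eq_zero_iff, Submodule.orthogonal_orthogonal]; exact hl
  unfold qd; rw [map_sub, this, sub_zero]

theorem qd_le_norm_sub {L : Submodule ℝ V} {l : V} (hl : l ∈ L) (w : V) : qd L w ≤ ‖w - l‖ := by
  rw [← qd_sub_of_mem hl]; exact qd_le_norm _ _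

theorem exists_qd_eq (L : Submodule ℝ V) (w : V) :
    ∃ l ∈ L, ‖w - l‖ = qd L w ∧ ‖w‖ ^ 2 = ‖l‖ ^ 2 + qd L w ^ 2 := by
  refine ⟨L.starProjection w, L.starProjection_apply_mem w, ?_, ?_⟩
  · unfold qd
    rw [Submodule.starProjection_orthogonal_val]
  · exact Submodule.norm_sq_eq_add_norm_sq_starProjection w L

theorem qd_eq_of_forall {L : Submodule ℝ V} {w : V} {t : ℝ} (h₁ : ∃ l ∈ L, ‖w - l‖ ≤ t)
    (h₂ : ∀ l ∈ L, t ≤ ‖w - l‖) : qd L w = t := by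
  obtain ⟨l, hl, h⟩ := h₁
  obtain ⟨l', hl', h', -⟩ := exists_qd_eq L w
  exact le_antisymm ((qd_le_norm_sub hl w).trans h) (h' ▸ h₂ l' hl')

theorem Frame.qd_range (φ : Frame V W₁ W₂) {L : Submodule ℝ V}
    (hL : ∀ v, v ∈ L ↔ φ.i' v = 0) (w : V) : qd L w = ‖φ.i' w‖ := by
  refine qd_eq_of_forall ⟨φ.k (φ.k' w), (hL _).2 (φ.ik _), ?_⟩ fun l hl => ?_
  · have : w - φ.k (φ.k' w) = φ.i (φ.i' w) := by rw [sub_eq_iff_eq_add, add_comm, φ.id]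
    rw [this, φ.norm_i]
  · calc ‖φ.i' w‖ = ‖φ.i' (w - l)‖ := by rw [map_sub, (hL l).1 hl, sub_zero]
      _ ≤ ‖w - l‖ := φ.norm_i'_le _

/-- `L` is dominated by the quotient `V ⧸ L`, with exponential rate. -/
def Dom (T : Equiv.Perm X) (A : X → V →L[ℝ] V) (L : X → Submodule ℝ V) (C θ : ℝ) : Prop :=
  ∀ x m, ∀ l ∈ L x, ∀ w,
    ‖it T A m x l‖ * qd (L x) w ≤ C * θ ^ m * (‖l‖ * qd (L (T^[m] x)) (it T A m x w))

theorem Dom.mono {A : X → V →L[ℝ] V} {L : X → Submodule ℝ V} {C θ C' θ' : ℝ} (h : Dom T A L C θ)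
    (hC : C ≤ C') (hC' : 0 ≤ C') (hθ0 : 0 ≤ θ) (hθ : θ ≤ θ') : Dom T A L C' θ' := fun x m l hl w =>
  (h x m l hl w).trans (by
    have := qd_nonneg (L (T^[m] x)) (it T A m x w)
    gcongr)

/-- The sum of the generalized eigenspaces which do not belong to the eigenvalues in `F`. -/
noncomputable def slow (T : Equiv.Perm X) (n : ℕ) (A : X → V →L[ℝ] V) (F : Multiset ℝ) (x : X) :
    Submodule ℝ V :=
  LinearMap.range (aeval (it T A n x).toLinearMap (F.map fun r => Polynomial.X - C r).prod)

/-- There is a small path of cocycles with the same spectrum `α ::ₘ β ::ₘ s` from `A` to some `A₁`,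
and then a small path along which `α` and `β` are mixed until they have the same modulus. -/
def Mixes (T : Equiv.Perm X) (n : ℕ) (A : X → V →L[ℝ] V) (ε α β : ℝ) (s : Multiset ℝ) : Prop :=
  ∃ A₁, JoinedIn {B | HasSpec T n B (α ::ₘ β ::ₘ s) ∧ ∀ x, ‖B x - A x‖ ≤ ε} A A₁ ∧
    ∃ (f : unitInterval → X → V →L[ℝ] V) (a b : unitInterval → ℝ), Continuous f ∧ f 0 = A₁ ∧
      (∀ t x, ‖f t x - A₁ x‖ ≤ ε) ∧ (∀ t, HasSpec T n (f t) (a t ::ₘ b t ::ₘ s)) ∧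
      Continuous (fun t => |a t|) ∧ Monotone (fun t => |a t|) ∧ (∀ t, |a t| ≤ |b t|) ∧
      |a 1| = |b 1| ∧ a 0 = α ∧ b 0 = β ∧ ∀ t, a t * b t = α * β

theorem Mixes.of_joined {A A' : X → V →L[ℝ] V} {ε δ α β : ℝ} {s : Multiset ℝ}
    (h : Mixes T n A' ε α β s) (hε : 0 ≤ ε) (hδ : 0 ≤ δ)
    (hj : JoinedIn {B | HasSpec T n B (α ::ₘ β ::ₘ s) ∧ ∀ x, ‖B x - A x‖ ≤ δ} A A') :
    Mixes T n A (δ + ε) α β s := by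
  obtain ⟨A₁, h1, f, a, b, h2, h3, h4, h5⟩ := h
  have e1 : JoinedIn {B | HasSpec T n B (α ::ₘ β ::ₘ s) ∧ ∀ x, ‖B x - A x‖ ≤ δ + ε} A A' :=
    hj.mono fun B hB => ⟨hB.1, fun x => (hB.2 x).trans (by linarith)⟩
  refine ⟨A₁, e1.trans (h1.mono fun B hB => ⟨hB.1, fun x => ?_⟩), f, a, b, h2, h3,
    fun t x => (h4 t x).trans (by linarith), h5⟩
  calc ‖B x - A x‖ = ‖(A' x - A x) + (B x - A' x)‖ := by congr 1; abel
    _ ≤ _ := (norm_add_le _ _).trans (add_le_add (hj.target_mem.2 x) (hB.2 x))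

/-- `Λ` stands for the insertion of a block into a larger cocycle. It does not increase distances
and only adds fixed eigenvalues, so both paths in the definition can be lifted. -/
theorem Mixes.lift {A : X → V →L[ℝ] V} {B : X → W₁ →L[ℝ] W₁} {ε α β : ℝ} {s s' : Multiset ℝ}
    (h : Mixes T n B ε α β s) (Λ : (X → W₁ →L[ℝ] W₁) → X → V →L[ℝ] V) (hΛ : Continuous Λ)
    (hΛB : Λ B = A) (hΛn : ∀ B₁ B₂ x, ‖Λ B₁ x - Λ B₂ x‖ ≤ ‖B₁ x - B₂ x‖)
    (hΛs : ∀ B' a b, HasSpec T n B' (a ::ₘ b ::ₘ s) → HasSpec T n (Λ B') (a ::ₘ b ::ₘ s')) :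
    Mixes T n A ε α β s' := by
  subst hΛB
  obtain ⟨A₁, h1, f, a, b, h2, h3, h4, h5, h6⟩ := h
  refine ⟨Λ A₁, ?_, fun t => Λ (f t), a, b, hΛ.comp h2, by simp only [h3],
    fun t x => (hΛn _ _ x).trans (h4 t x), fun t => hΛs _ _ _ (h5 t), h6⟩
  obtain ⟨p, hp⟩ := h1
  refine ⟨p.map hΛ, fun t => ⟨hΛs _ _ _ (hp t).1, fun x => ?_⟩⟩
  exact (hΛn _ _ x).trans ((hp t).2 x)

theorem continuous_affine_lift (g : X → W₁ →L[ℝ] V) (h : X → V →L[ℝ] W₁) (A : X → V →L[ℝ] V)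
    (B : X → W₁ →L[ℝ] W₁) :
    Continuous fun B' : X → W₁ →L[ℝ] W₁ =>
      fun x => A x + (g (T x)).comp ((B' x - B x).comp (h x)) := by
  refine continuous_pi fun x => ?_
  have hx : Continuous fun B' : X → W₁ →L[ℝ] W₁ => B' x := continuous_apply x
  exact continuous_const.add (continuous_const.clm_comp ((hx.sub continuous_const).clm_comp
    continuous_const))

theorem Mixes.lift_quot {φ : X → Frame V ℝ W₂} {A : X → V →L[ℝ] V} {c : X → ℝ}
    {S : X → W₂ →L[ℝ] W₂} {ε α β γ : ℝ} {s : Multiset ℝ} (hT : IsCyc T n)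
    (hb : Block T (fun x => (φ x).toAlgFrame) A (fun x => c x • ContinuousLinearMap.id ℝ ℝ) S)
    (hc : ∀ x, c x ≠ 0) (hγ : ∀ x, sp T c n x = γ) (h : Mixes T n S ε α β s) :
    Mixes T n A ε α β (γ ::ₘ s) := by
  refine h.lift (fun S' x => A x + (φ (T x)).i.comp ((S' x - S x).comp (φ x).i'))
    (continuous_affine_lift (T := T) (fun x => (φ x).i) (fun x => (φ x).i') A S) (by ext; simp)
    (fun B₁ B₂ x => ?_) fun B' a b hB' => ?_
  · rw [add_sub_add_left_eq_sub, ← ContinuousLinearMap.comp_sub, ← ContinuousLinearMap.sub_comp,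
      sub_sub_sub_cancel_right]
    exact Frame.opNorm_sandwich_le (φ (T x)).opNorm_i (φ x).opNorm_i' _
  · have := (hb.lift_quot B').hasSpec_cons hc hT hB' hγ
    rwa [Multiset.cons_swap b γ, Multiset.cons_swap a γ]

theorem Mixes.lift_sub {φ : X → Frame V W₁ ℝ} {A : X → V →L[ℝ] V} {c : X → ℝ}
    {P : X → W₁ →L[ℝ] W₁} {ε α β γ : ℝ} {s : Multiset ℝ} (hT : IsCyc T n)
    (hb : Block T (fun x => (φ x).toAlgFrame) A P (fun x => c x • ContinuousLinearMap.id ℝ ℝ))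
    (hc : ∀ x, c x ≠ 0) (hγ : ∀ x, sp T c n x = γ) (h : Mixes T n P ε α β s) :
    Mixes T n A ε α β (γ ::ₘ s) := by
  refine h.lift (fun P' x => A x + (φ (T x)).k.comp ((P' x - P x).comp (φ x).k'))
    (continuous_affine_lift (T := T) (fun x => (φ x).k) (fun x => (φ x).k') A P) (by ext; simp)
    (fun B₁ B₂ x => ?_) fun B' a b hB' => ?_
  · rw [add_sub_add_left_eq_sub, ← ContinuousLinearMap.comp_sub, ← ContinuousLinearMap.sub_comp,
      sub_sub_sub_cancel_right]
    exact Frame.opNorm_sandwich_le (φ (T x)).opNorm_k (φ x).opNorm_k' _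
  · intro x
    have := (hb.lift_sub B').hasSpec hT hB' (hasSpec_scalar c hc hT x) x
    rw [hγ x, add_comm, Multiset.singleton_add] at this
    rwa [Multiset.cons_swap b γ, Multiset.cons_swap a γ]

end Domination

/-! ### The dichotomy in dimension two -/

section TwoDim

variable {X V W₁ W₂ : Type*} [NormedAddCommGroup V] [InnerProductSpace ℝ V]
  [FiniteDimensional ℝ V]
  [NormedAddCommGroup W₁] [InnerProductSpace ℝ W₁] [FiniteDimensional ℝ W₁]
  [NormedAddCommGroup W₂] [InnerProductSpace ℝ W₂] [FiniteDimensional ℝ W₂]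
  {T : Equiv.Perm X} {n : ℕ}

theorem Block.injective {φ : X → AlgFrame V W₁ W₂} {A : X → V →L[ℝ] V}
    {P : X → W₁ →L[ℝ] W₁} {S : X → W₂ →L[ℝ] W₂} (h : Block T φ A P S)
    (hP : ∀ x, Function.Injective (P x)) (hS : ∀ x, Function.Injective (S x)) (x : X) :
    Function.Injective (A x) := by
  rw [injective_iff_map_eq_zero]
  intro v hv
  have h1 := h.quot x v
  rw [hv, map_zero] at h1
  have h2 : (φ x).i' v = 0 := (injective_iff_map_eq_zero _).1 (hS x) _ h1.symm
  have h3 : v = (φ x).k ((φ x).k' v) := by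
    conv_lhs => rw [← (φ x).id v]
    rw [h2, map_zero, add_zero]
  have h4 := h.sub x ((φ x).k' v)
  rw [← h3, hv] at h4
  have h5 : P x ((φ x).k' v) = 0 := by rw [← (φ (T x)).kk (P x _), ← h4, map_zero]
  rw [h3, (injective_iff_map_eq_zero _).1 (hP x) _ h5, map_zero]

theorem charpoly_two {V : Type*} [NormedAddCommGroup V] [InnerProductSpace ℝ V]
    [FiniteDimensional ℝ V] (φ : AlgFrame V ℝ ℝ) (f : V →ₗ[ℝ] V) :
    f.charpoly = Polynomial.X ^ 2
      - C (φ.k' (f (φ.k 1)) + φ.i' (f (φ.i 1))) * Polynomial.X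
      + C (φ.k' (f (φ.k 1)) * φ.i' (f (φ.i 1)) - φ.k' (f (φ.i 1)) * φ.i' (f (φ.k 1))) := by
  let e : V ≃ₗ[ℝ] ℝ × ℝ :=
    { (φ.k'.toLinearMap.prod φ.i'.toLinearMap) with
      invFun := fun w => φ.k w.1 + φ.i w.2
      left_inv := fun v => by simpa using φ.id v
      right_inv := fun w => by ext <;> simp [φ.kk, φ.ii, φ.ki, φ.ik] }
  have he : ∀ v, e v = (φ.k' v, φ.i' v) := fun v => rfl
  have hes : ∀ w, e.symm w = φ.k w.1 + φ.i w.2 := fun w => rfl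
  rw [← LinearEquiv.charpoly_conj e f, ← LinearMap.charpoly_toMatrix _ (Module.Basis.finTwoProd ℝ),
    Matrix.charpoly_fin_two, Matrix.trace_fin_two, Matrix.det_fin_two]
  simp [LinearMap.toMatrix_apply, LinearEquiv.conj_apply, he, hes]

theorem it_congr {A B : X → V →L[ℝ] V} (m : ℕ) (x : X)
    (h : ∀ j < m, A (T^[j] x) = B (T^[j] x)) : it T A m x = it T B m x := by
  induction m generalizing x with
  | zero => rfl
  | succ m ih =>
    rw [it_succ, it_succ, ih (T x) fun j hj => h (j + 1) (by omega)]
    congr 1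
    exact h 0 (by omega)

/-- The off-diagonal entry of the iterates of the cocycle `!![a, b; 0, c]`. -/
noncomputable def offdiag (T : Equiv.Perm X) (a b c : X → ℝ) (m : ℕ) (x : X) : ℝ :=
  ∑ j ∈ Finset.range m, sp T a (m - 1 - j) (T^[j + 1] x) * b (T^[j] x) * sp T c j x

theorem offdiag_succ (a b c : X → ℝ) (m : ℕ) (x : X) :
    offdiag T a b c (m + 1) x =
      a (T^[m] x) * offdiag T a b c m x + b (T^[m] x) * sp T c m x := by
  unfold offdiag
  rw [Finset.sum_range_succ, Finset.mul_sum]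
  congr 1
  · refine Finset.sum_congr rfl fun j hj => ?_
    have hj := Finset.mem_range.1 hj
    rw [show m + 1 - 1 - j = (m - 1 - j) + 1 by omega, sp_succ', ← Function.iterate_add_apply,
      show m - 1 - j + (j + 1) = m by omega]
    ring
  · simp

theorem offdiag_add_smul (a b b' c : X → ℝ) (t : ℝ) (m : ℕ) (x : X) :
    offdiag T a (fun y => b y + t * b' y) c m x =
      offdiag T a b c m x + t * offdiag T a b' c m x := by
  unfold offdiag
  rw [Finset.mul_sum, ← Finset.sum_add_distrib]
  exact Finset.sum_congr rfl fun j _ => by ring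

theorem Block.it_offdiag {φ : X → AlgFrame V ℝ ℝ} {A : X → V →L[ℝ] V} {a c : X → ℝ}
    (h : Block T φ A (fun x => a x • ContinuousLinearMap.id ℝ ℝ)
      (fun x => c x • ContinuousLinearMap.id ℝ ℝ)) (m : ℕ) (x : X) :
    (φ (T^[m] x)).k' (it T A m x ((φ x).i 1)) =
      offdiag T a (fun y => (φ (T y)).k' (A y ((φ y).i 1))) c m x := by
  induction m with
  | zero => simp [offdiag, (φ x).ki]
  | succ m ih =>
    rw [it_succ', ContinuousLinearMap.comp_apply, offdiag_succ, ← ih]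
    have h1 := h.it_quot m x ((φ x).i 1)
    rw [it_smul_id, (φ x).ii] at h1
    simp only [smul_apply, ContinuousLinearMap.id_apply, smul_eq_mul, mul_one] at h1
    set v := it T A m x ((φ x).i 1)
    have h2 : v = (φ (T^[m] x)).k ((φ (T^[m] x)).k' v) +
        sp T c m x • (φ (T^[m] x)).i 1 := by
      conv_lhs => rw [← (φ (T^[m] x)).id v]
      rw [h1, ← map_smul, smul_eq_mul, mul_one]
    conv_lhs => rw [h2]
    rw [map_add, h.sub, map_smul, Function.iterate_succ_apply', map_add, map_smul,
      (φ (T (T^[m] x))).kk]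
    simp [mul_comm]

/-- The first `n` points of the orbit are distinct, so a sign can be prescribed at each of them
independently. -/
theorem exists_signs (hT : IsCyc T n) (z : X) {g : ℕ → ℝ} {δ : ℝ} (hδ : 0 ≤ δ) :
    ∃ b : X → ℝ, (∀ x, |b x| ≤ δ) ∧ ∀ j < n, b (T^[j] z) * g j = δ * |g j| := by
  choose j hj hjx using hT.reach z
  refine ⟨fun x => δ * SignType.sign (g (j x)), fun x => ?_, fun i hi => ?_⟩
  · rw [abs_mul, abs_of_nonneg hδ]
    refine mul_le_of_le_one_right hδ ?_
    rcases lt_trichotomy (g (j x)) 0 with h | h | h <;> simp [h]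
  · have : j (T^[i] z) = i := hT.inj z _ _ (hj _) hi (hjx _)
    simp only [this]
    rw [mul_assoc, sign_mul_self]

/-- With the signs of `exists_signs` all terms of the off-diagonal entry of the return map add up.
The term with `j` factors of `a`, divided by the product of `c` over the period, is a backward
product of `|a / c|` up to one factor `|c| ≤ K`. -/
theorem abs_offdiag_ge (hT : IsCyc T n) {a c : X → ℝ} (hc : ∀ x, c x ≠ 0) {K : ℝ}
    (hK : 0 < K) (hcK : ∀ x, |c x| ≤ K) (z : X) {δ : ℝ} (hδ : 0 ≤ δ) :
    ∃ b : X → ℝ, (∀ x, |b x| ≤ δ) ∧ δ * |sp T c n z| / K *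
      ∑ j ∈ Finset.range n, sp T (fun y => |a y / c y|) j (T^[n - j] z) ≤
        offdiag T a b c n z := by
  obtain ⟨b, hb, hbj⟩ := exists_signs hT z
    (g := fun j => sp T a (n - 1 - j) (T^[j + 1] z) * sp T c j z) hδ
  refine ⟨b, hb, ?_⟩
  have h1 : offdiag T a b c n z =
      ∑ j ∈ Finset.range n, δ * |sp T a (n - 1 - j) (T^[j + 1] z) * sp T c j z| := by
    unfold offdiag
    refine Finset.sum_congr rfl fun j hj => ?_
    rw [← hbj j (Finset.mem_range.1 hj)]
    ring
  rw [h1, ← Finset.sum_range_reflect, Finset.mul_sum]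
  refine Finset.sum_le_sum fun j hj => ?_
  have hj := Finset.mem_range.1 hj
  rw [show n - (n - 1 - j) = j + 1 by omega, sp_abs, sp_div, abs_div, abs_mul]
  have e : sp T c n z = sp T c j z * (c (T^[j] z) * sp T c (n - 1 - j) (T^[j + 1] z)) := by
    conv_lhs => rw [show n = j + (n - 1 - j + 1) by omega]
    rw [sp_add, sp_succ, ← Function.iterate_succ_apply' T j z]
  rw [e, abs_mul, abs_mul]
  have hc' : |sp T c (n - 1 - j) (T^[j + 1] z)| ≠ 0 := abs_ne_zero.2 (sp_ne_zero hc _ _)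
  calc δ * (|sp T c j z| * (|c (T^[j] z)| * |sp T c (n - 1 - j) (T^[j + 1] z)|)) / K *
        (|sp T a (n - 1 - j) (T^[j + 1] z)| / |sp T c (n - 1 - j) (T^[j + 1] z)|)
      = δ * (|sp T a (n - 1 - j) (T^[j + 1] z)| * |sp T c j z|) * (|c (T^[j] z)| / K) := by
        field_simp
    _ ≤ δ * (|sp T a (n - 1 - j) (T^[j + 1] z)| * |sp T c j z|) * 1 := by
        gcongr
        rw [div_le_one hK]
        exact hcK _
    _ = _ := by ring

/-- The discriminant of the quadratic polynomial with leading coefficient 1. -/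
theorem mix_roots {κ β : ℝ} (hβ : β ≠ 0) (hκ0 : κ ≠ 0) (hκ : |κ| < 1) :
    ∃ (q a b : unitInterval → ℝ) (g : ℝ), 0 ≤ g ∧ (∀ t, q t = 1 + κ - t * (1 + κ - g)) ∧
      0 ≤ 1 + κ - g ∧ 1 + κ - g ≤ 2 ∧
      (∀ t, a t + b t = β * q t) ∧ (∀ t, a t * b t = β * β * κ) ∧ Continuous (fun t => |a t|) ∧
      Monotone (fun t => |a t|) ∧ (∀ t, |a t| ≤ |b t|) ∧ |a 1| = |b 1| ∧ a 0 = β * κ ∧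
      b 0 = β := by
  obtain ⟨hκ1, hκ2⟩ := abs_lt.1 hκ
  -- `g` is the final trace, in units of `β`. The normalised roots have product `κ`, so equal moduli
  -- mean opposite roots, with trace `0`, if `κ ≤ 0`, and a double root, with trace `2 * √κ`, if `κ
  -- > 0`.
  obtain ⟨g, hg0, hgκ, hg1, hgm⟩ : ∃ g : ℝ, 0 ≤ g ∧ 4 * κ ≤ g ^ 2 ∧ g ≤ 1 + κ ∧
      (g = 0 ∨ g ^ 2 = 4 * κ) := by
    rcases le_or_gt κ 0 with h | h
    · exact ⟨0, le_rfl, by linarith [sq_nonneg (0 : ℝ)], by linarith, Or.inl rfl⟩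
    · have hs := Real.sq_sqrt h.le
      refine ⟨2 * √κ, by positivity, by rw [mul_pow, hs]; linarith, ?_,
        Or.inr (by rw [mul_pow, hs]; norm_num)⟩
      nlinarith [sq_nonneg (1 - √κ)]
  let q : unitInterval → ℝ := fun t => 1 + κ - t * (1 + κ - g)
  have hqg : ∀ t, g ≤ q t := fun t => by
    have := t.2.2
    have h1 : 0 ≤ (1 - (t : ℝ)) * (1 + κ - g) := mul_nonneg (by linarith) (by linarith)
    simp only [q]; linarith
  have hqc : Continuous q := by fun_prop
  have hqa : Antitone q := fun s t hst => by
    have : (s : ℝ) * (1 + κ - g) ≤ t * (1 + κ - g) :=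
      mul_le_mul_of_nonneg_right hst (by linarith)
    simp only [q]; linarith
  have hdisc : ∀ t, 0 ≤ q t ^ 2 - 4 * κ := fun t => by
    have := pow_le_pow_left₀ hg0 (hqg t) 2
    linarith
  let w : unitInterval → ℝ := fun t => √(q t ^ 2 - 4 * κ)
  have hw : ∀ t, w t ^ 2 = q t ^ 2 - 4 * κ := fun t => Real.sq_sqrt (hdisc t)
  have hw0 : ∀ t, 0 ≤ w t := fun t => Real.sqrt_nonneg _
  have hwc : Continuous w := by fun_prop
  have hwa : Antitone w := fun s t hst =>
    Real.sqrt_le_sqrt (by have := pow_le_pow_left₀ (hg0.trans (hqg t)) (hqa hst) 2; linarith)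
  have hab : ∀ t, β * (q t - w t) / 2 * (β * (q t + w t) / 2) = β * β * κ := fun t => by
    linear_combination (-β * β / 4) * hw t
  have hbpos : ∀ t, 0 < q t + w t := fun t => by
    rcases (add_nonneg (hg0.trans (hqg t)) (hw0 t)).lt_or_eq with h | h
    · exact h
    · exfalso
      have := hab t
      rw [← h, mul_zero, zero_div, mul_zero] at this
      exact hκ0 (by
        have h2 : β * β ≠ 0 := mul_ne_zero hβ hβ
        exact (mul_eq_zero.1 this.symm).resolve_left h2)
  have hb : ∀ t, |β * (q t + w t) / 2| = |β| * (q t + w t) / 2 := fun t => by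
    rw [abs_div, abs_mul, abs_of_pos (hbpos t), abs_two]
  -- As the product of the roots is fixed, `|a|` increases because `|b|` decreases; the difference
  -- `q - w` needs no study.
  have ha : ∀ t, |β * (q t - w t) / 2| = |β * β * κ| / (|β| * (q t + w t) / 2) := fun t => by
    rw [eq_div_iff (by have := hbpos t; positivity), ← hb, ← abs_mul, hab]
  have hw1 : w 0 = 1 - κ := by
    have : q 0 = 1 + κ := by simp [q]
    simp only [w, this]
    rw [show (1 + κ) ^ 2 - 4 * κ = (1 - κ) ^ 2 by ring, Real.sqrt_sq (by linarith)]
  refine ⟨q, fun t => β * (q t - w t) / 2, fun t => β * (q t + w t) / 2, g, hg0, fun t => rfl,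
    by linarith, by linarith, fun t => by ring, hab, by fun_prop, ?_, fun t => ?_, ?_, ?_, ?_⟩
  · intro s t hst
    simp only [ha]
    have h1 := hqa hst
    have h2 := hwa hst
    have h3 := hbpos t
    have : 0 < |β| := abs_pos.2 hβ
    gcongr
  · rw [hb, abs_div, abs_mul, abs_two]
    have h1 : |q t - w t| ≤ q t + w t := by
      rw [abs_le]; constructor <;> linarith [hw0 t, hg0.trans (hqg t)]
    gcongr
  · have h1 : q 1 = g := by simp [q]
    beta_reduce
    rcases hgm with h | h
    · rw [h1, h, show β * (0 - w 1) / 2 = -(β * (0 + w 1) / 2) by ring, abs_neg]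
    · have : w 1 = 0 := by simp only [w, h1, h]; simp
      rw [this, sub_zero, add_zero]
  · have : q 0 = 1 + κ := by simp [q]
    simp only [this, hw1]; ring
  · have : q 0 = 1 + κ := by simp [q]
    simp only [this, hw1]; ring

theorem line_quot_scalar {φ : X → AlgFrame V W₁ ℝ} {A : X → V →L[ℝ] V} {P : X → W₁ →L[ℝ] W₁}
    {S : X → ℝ →L[ℝ] ℝ} (h : Block T φ A P S) :
    Block T φ A P (fun x => S x 1 • ContinuousLinearMap.id ℝ ℝ) := by
  have : (fun x => S x 1 • ContinuousLinearMap.id ℝ ℝ) = S := by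
    funext x
    ext
    simp
  rwa [this]

theorem exists_two_frame (hT : IsCyc T n) (x₀ : X) {A : X → V →L[ℝ] V} {K : ℝ} (hK : 0 ≤ K)
    (hA : Bdd A K) (hV : Module.finrank ℝ V = 2) {α β : ℝ} (hs : HasSpec T n A {α, β}) :
    ∃ (φ : X → Frame V ℝ ℝ) (a c : X → ℝ),
      Block T (fun x => (φ x).toAlgFrame) A (fun x => a x • ContinuousLinearMap.id ℝ ℝ)
        (fun x => c x • ContinuousLinearMap.id ℝ ℝ) ∧ (∀ x, a x ≠ 0) ∧ (∀ x, c x ≠ 0) ∧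
      (∀ x, |a x| ≤ K) ∧ (∀ x, |c x| ≤ K) ∧ (∀ x, 1 ≤ K * |c x|) ∧
      (∀ x, sp T a n x = α) ∧ ∀ x, sp T c n x = β := by
  obtain ⟨φ, a, S, hb, ha, har⟩ := exists_line_frame (W₂ := ℝ) hT hA.bijective x₀ (r := α)
    (by rw [hs x₀]; simp) (by rw [hV, Module.finrank_self])
  replace hb := line_quot_scalar hb
  have h1 := hb.bdd_sub hK hA
  have h2 := hb.bdd_quot hK hA
  have hc1 : ∀ x, 1 ≤ K * |S x 1| := fun x => by simpa using (h2 x).2 1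
  have hc : ∀ x, S x 1 ≠ 0 := fun x h => by have := hc1 x; norm_num [h] at this
  refine ⟨φ, a, fun x => S x 1, hb, ha, hc, fun x => ?_, fun x => ?_, hc1, har, fun x => ?_⟩
  · simpa using h1.le x 1
  · simpa using h2.le x 1
  · have h3 := hb.hasSpec_quot ha hT hs har x
    rw [hasSpec_scalar _ hc hT x x] at h3
    simpa using h3

theorem Block.mem_slow_iff {φ : X → AlgFrame V ℝ ℝ} {A : X → V →L[ℝ] V} {a c : X → ℝ}
    (h : Block T φ A (fun x => a x • ContinuousLinearMap.id ℝ ℝ)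
      (fun x => c x • ContinuousLinearMap.id ℝ ℝ)) (hT : IsCyc T n) {α β : ℝ} (hαβ : α ≠ β)
    (ha : ∀ x, sp T a n x = α) (hc : ∀ x, sp T c n x = β) (x : X) (v : V) :
    v ∈ slow T n A {β} x ↔ (φ x).i' v = 0 := by
  have h1 : ∀ w, aeval (it T A n x).toLinearMap
      (({β} : Multiset ℝ).map fun r => Polynomial.X - C r).prod w = it T A n x w - β • w :=
    fun w => by simp
  have h2 := h.it_sub n x
  have h3 := h.it_quot n x
  simp only [hT.per, it_smul_id, ha, hc] at h2 h3
  constructor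
  · rintro ⟨w, rfl⟩
    rw [h1, map_sub, h3, map_smul]
    simp
  · intro hv
    refine ⟨(φ x).k ((α - β)⁻¹ * (φ x).k' v), ?_⟩
    rw [h1, h2, ← map_smul, ← map_sub]
    conv_rhs => rw [← (φ x).id v, hv, map_zero, add_zero]
    congr 1
    have : α - β ≠ 0 := sub_ne_zero.2 hαβ
    simp only [smul_apply, ContinuousLinearMap.id_apply, smul_eq_mul]
    field_simp

theorem Block.dom_slow {φ : X → Frame V ℝ ℝ} {A : X → V →L[ℝ] V} {a c : X → ℝ}
    (h : Block T (fun x => (φ x).toAlgFrame) A (fun x => a x • ContinuousLinearMap.id ℝ ℝ)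
      (fun x => c x • ContinuousLinearMap.id ℝ ℝ)) (hT : IsCyc T n) {α β : ℝ} (hαβ : α ≠ β)
    (ha : ∀ x, sp T a n x = α) (hc : ∀ x, sp T c n x = β) (hc0 : ∀ x, c x ≠ 0) {C θ : ℝ}
    (hu : ∀ m x, sp T (fun y => |a y / c y|) m x ≤ C * θ ^ m) : Dom T A (slow T n A {β}) C θ := by
  intro x m l hl w
  have hq : ∀ x w, qd (slow T n A {β} x) w = ‖(φ x).i' w‖ := fun x w =>
    (φ x).qd_range (h.mem_slow_iff hT hαβ ha hc x) w
  rw [h.mem_slow_iff hT hαβ ha hc] at hl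
  obtain ⟨s, rfl⟩ : ∃ s, l = (φ x).k s := ⟨(φ x).k' l, by
    conv_lhs => rw [← (φ x).id l, hl, map_zero, add_zero]⟩
  rw [hq, hq, h.it_sub, h.it_quot, it_smul_id, it_smul_id]
  simp only [smul_apply, ContinuousLinearMap.id_apply, Frame.norm_k, norm_smul, Real.norm_eq_abs]
  have h1 := hu m x
  have h2 : |sp T a m x| = sp T (fun y => |a y / c y|) m x * |sp T c m x| := by
    rw [sp_abs, sp_div, abs_div, div_mul_cancel₀ _ (abs_ne_zero.2 (sp_ne_zero hc0 m x))]
  rw [h2]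
  calc sp T (fun y => |a y / c y|) m x * |sp T c m x| * |s| * |(φ x).i' w|
      ≤ (C * θ ^ m) * |sp T c m x| * |s| * |(φ x).i' w| := by gcongr
    _ = _ := by ring

/-- The return map at `z` is upper triangular with diagonal `α`, `β` and a large corner entry `B`.
Composing it with `1 + t D`, where `D` has only a lower left entry, keeps the determinant and
changes the trace by `t * B` times this entry, so that a tiny entry moves the trace by a multiple of
`β`. -/
theorem Block.mixes_of_offdiag {φ : X → Frame V ℝ ℝ} {A : X → V →L[ℝ] V} {a c : X → ℝ}
    (h : Block T (fun x => (φ x).toAlgFrame) A (fun x => a x • ContinuousLinearMap.id ℝ ℝ)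
      (fun x => c x • ContinuousLinearMap.id ℝ ℝ)) (hT : IsCyc T n) {α β : ℝ}
    (hαβ : |α| < |β|) (ha0 : ∀ x, a x ≠ 0) (ha : ∀ x, sp T a n x = α)
    (hc0 : ∀ x, c x ≠ 0) (hc : ∀ x, sp T c n x = β) (z : X) {K δ : ℝ}
    (hK : ‖A z‖ ≤ K) (hδ : 0 < δ)
    (hz : 2 * |β| ≤ δ * |offdiag T a (fun y => (φ (T y)).k' (A y ((φ y).i 1))) c n z|) :
    ∃ (f : unitInterval → X → V →L[ℝ] V) (p q : unitInterval → ℝ), Continuous f ∧ f 0 = A ∧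
      (∀ t x, ‖f t x - A x‖ ≤ K * δ) ∧ (∀ t, HasSpec T n (f t) {p t, q t}) ∧
      Continuous (fun t => |p t|) ∧ Monotone (fun t => |p t|) ∧ (∀ t, |p t| ≤ |q t|) ∧
      |p 1| = |q 1| ∧ p 0 = α ∧ q 0 = β ∧ ∀ t, p t * q t = α * β := by
  classical
  set B := offdiag T a (fun y => (φ (T y)).k' (A y ((φ y).i 1))) c n z with hB
  have hβ : β ≠ 0 := by rw [← hc z]; exact sp_ne_zero hc0 n z
  have hα : α ≠ 0 := by rw [← ha z]; exact sp_ne_zero ha0 n z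
  have hβ' : 0 < |β| := abs_pos.2 hβ
  have hB0 : B ≠ 0 := by
    rintro h0
    rw [h0, abs_zero, mul_zero] at hz
    linarith
  obtain ⟨Q, p, q, g, hg, hQ, hs1, hs2, hadd, hmul, hpc, hpm, hpq, hpq1, hp0, hq0⟩ :=
    mix_roots (κ := α / β) hβ (div_ne_zero hα hβ) (by rwa [abs_div, div_lt_one hβ'])
  set s := 1 + α / β - g
  -- This entry makes the trace `α + β - t * s * β = β * Q t`, as `mix_roots` requires. It is at
  -- most `δ` because `s ≤ 2`.
  let D : V →L[ℝ] V := (-(s * β / B)) • (φ z).i.comp (φ z).k'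
  have hsB : |s * β / B| ≤ δ := by
    rw [abs_div, abs_mul, abs_of_nonneg hs1, div_le_iff₀ (abs_pos.2 hB0)]
    calc s * |β| ≤ 2 * |β| := by gcongr
      _ ≤ _ := hz
  have hDn : ‖D‖ ≤ δ := by
    refine ContinuousLinearMap.opNorm_le_bound _ hδ.le fun v => ?_
    simp only [D, smul_apply, ContinuousLinearMap.comp_apply]
    rw [norm_smul, Frame.norm_i, norm_neg, Real.norm_eq_abs]
    exact mul_le_mul hsB ((φ z).norm_k'_le v) (norm_nonneg _) hδ.le
  have hDk : ∀ w, D ((φ z).k w) = (-(s * β / B) * w) • (φ z).i 1 := fun w => by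
    rw [← map_smul]
    simp only [D, smul_apply, ContinuousLinearMap.comp_apply, (φ z).kk]
    rw [← map_smul, smul_eq_mul, smul_eq_mul, mul_one]
  have hDi : ∀ w, D ((φ z).i w) = 0 := fun w => by simp [D, (φ z).ki]
  -- `D` has square zero, so that all the maps `1 + t D` are injective.
  have hDD : ∀ v, D (D v) = 0 := fun v => by simp [D, (φ z).ki]
  let f : unitInterval → X → V →L[ℝ] V := fun t x =>
    A x + if x = z then (t : ℝ) • (A z).comp D else 0
  have hfx : ∀ t x, x ≠ z → f t x = A x := fun t x hx => by simp [f, hx]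
  have hfz : ∀ t v, f t z v = A z (v + (t : ℝ) • D v) := fun t v => by simp [f]
  have hAinj : ∀ x, Function.Injective (A x) := fun x => h.injective
    (fun x => by
      rw [injective_iff_map_eq_zero]
      intro w hw
      simpa [ha0] using hw)
    (fun x => by
      rw [injective_iff_map_eq_zero]
      intro w hw
      simpa [hc0] using hw) x
  have hfinj : ∀ t x, Function.Injective (f t x) := by
    intro t x
    by_cases hx : x = z
    · subst hx
      rw [injective_iff_map_eq_zero]
      intro v hv
      rw [hfz] at hv
      have h1 := (injective_iff_map_eq_zero _).1 (hAinj x) _ hv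
      have h2 : D v = 0 := by
        have := congrArg D h1
        rwa [map_add, map_smul, hDD, smul_zero, add_zero, map_zero] at this
      rwa [h2, smul_zero, add_zero] at h1
    · rw [hfx t x hx]; exact hAinj x
  refine ⟨f, p, q, ?_, ?_, ?_, ?_, hpc, hpm, hpq, hpq1, by rw [hp0]; field_simp, hq0, fun t => by
    rw [hmul]; field_simp⟩
  · refine continuous_pi fun x => ?_
    by_cases hx : x = z
    · simp only [f, hx, if_true]
      fun_prop
    · simp only [f, hx, if_false]
      fun_prop
  · funext x; simp [f]
  · intro t x
    by_cases hx : x = z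
    · simp only [f, hx, if_true, add_sub_cancel_left]
      have h1 : ‖(t : ℝ)‖ ≤ 1 := by
        rw [Real.norm_eq_abs, abs_of_nonneg t.2.1]; exact t.2.2
      calc ‖(t : ℝ) • (A z).comp D‖ ≤ 1 * (‖A z‖ * ‖D‖) := by
            rw [norm_smul]
            gcongr
            exact (A z).opNorm_comp_le D
        _ ≤ 1 * (K * δ) := by
            have := (norm_nonneg _).trans hK
            gcongr
        _ = K * δ := one_mul _
    · rw [hfx t x hx, sub_self, norm_zero]
      exact mul_nonneg ((norm_nonneg _).trans hK) hδ.le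
  · intro t x
    rw [charpoly_ret_eq hT (fun x => ⟨hfinj t x, LinearMap.injective_iff_surjective
      (f := (f t x).toLinearMap) |>.1 (hfinj t x)⟩) x z]
    have hit : ∀ v, it T (f t) n z v = it T A n z (v + (t : ℝ) • D v) := by
      intro v
      obtain ⟨m, rfl⟩ := Nat.exists_eq_succ_of_ne_zero hT.pos.ne'
      rw [it_succ, it_succ, ContinuousLinearMap.comp_apply, ContinuousLinearMap.comp_apply, hfz]
      rw [it_congr (B := A) m (T z) fun j hj => hfx t _ fun hjz => ?_]
      have := hT.inj z (j + 1) 0 (by omega) (by omega) hjz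
      omega
    have hMk := h.it_sub n z
    have hMi := h.it_quot n z ((φ z).i 1)
    have hMo := h.it_offdiag n z
    simp only [hT.per, it_smul_id, ha, hc] at hMk hMi hMo
    rw [← hB] at hMo
    rw [(φ z).ii] at hMi
    rw [charpoly_two (φ z).toAlgFrame]
    have e1 : it T (f t) n z ((φ z).i 1) = it T A n z ((φ z).i 1) := by
      rw [hit, hDi, smul_zero, add_zero]
    have e2 : it T (f t) n z ((φ z).k 1) = (φ z).k α +
        (t * -(s * β / B)) • it T A n z ((φ z).i 1) := by
      rw [hit, hDk, smul_smul, map_add, map_smul, hMk]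
      simp
    have e3 : (φ z).k' (it T (f t) n z ((φ z).k 1)) = α - t * s * β := by
      rw [e2, map_add, map_smul, (φ z).kk, hMo, smul_eq_mul]
      field_simp
      ring
    have e4 : (φ z).i' (it T (f t) n z ((φ z).k 1)) = -(t * s * β * β / B) := by
      rw [e2, map_add, map_smul, (φ z).ik, hMi]
      simp
      ring
    have e5 : (φ z).k' (it T (f t) n z ((φ z).i 1)) = B := by rw [e1, hMo]
    have e6 : (φ z).i' (it T (f t) n z ((φ z).i 1)) = β := by rw [e1, hMi]; simp
    change Polynomial.X ^ 2 - C ((φ z).k' (it T (f t) n z ((φ z).k 1)) +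
      (φ z).i' (it T (f t) n z ((φ z).i 1))) * Polynomial.X +
      C ((φ z).k' (it T (f t) n z ((φ z).k 1)) * (φ z).i' (it T (f t) n z ((φ z).i 1)) -
        (φ z).k' (it T (f t) n z ((φ z).i 1)) * (φ z).i' (it T (f t) n z ((φ z).k 1))) = _
    rw [e3, e4, e5, e6]
    have t1 : α - t * s * β + β = p t + q t := by
      rw [hadd, hQ]; field_simp
      ring
    have t2 : (α - t * s * β) * β - B * -(t * s * β * β / B) = p t * q t := by
      rw [hmul]; field_simp
      ring
    rw [t1, t2]
    simp only [Multiset.insert_eq_cons, Multiset.map_cons, Multiset.map_singleton,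
      Multiset.prod_cons, Multiset.prod_singleton, map_add, map_mul]
    ring

/-- Cocycles which are not uniformly dominated between `α` and `β` mix these eigenvalues. -/
def UnifMix.{w} (V : Type) [NormedAddCommGroup V] [InnerProductSpace ℝ V] [FiniteDimensional ℝ V]
    (s t : ℕ) : Prop :=
  ∀ K ε : ℝ, 1 ≤ K → 0 < ε → ∃ (C θ : ℝ) (N : ℕ), 0 ≤ C ∧ 0 < θ ∧ θ < 1 ∧
    ∀ (X : Type w) (T : Equiv.Perm X) (n : ℕ), IsCyc T n → N ≤ n →
      ∀ (A : X → V →L[ℝ] V) (α β : ℝ) (S F : Multiset ℝ), S.card = s → F.card = t →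
        Bdd A K → HasSpec T n A (α ::ₘ β ::ₘ (S + F)) → |α| < |β| →
        (∀ r ∈ S, |r| ≤ |α|) → (∀ r ∈ F, |β| ≤ |r|) →
        ¬ Dom T A (slow T n A (β ::ₘ F)) C θ → Mixes T n A ε α β (S + F)

theorem unifMix_two (V : Type) [NormedAddCommGroup V] [InnerProductSpace ℝ V]
    [FiniteDimensional ℝ V] (hV : Module.finrank ℝ V = 2) : UnifMix V 0 0 := by
  intro K ε hK hε
  have hK0 : 0 < K := by linarith
  set ε₁ := min ε 1
  have hε₁ : 0 < ε₁ := lt_min hε one_pos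
  -- With this `S`, the lower bound `ε₁ * |β| / K * S` for the off-diagonal entry, multiplied by the
  -- size `ε / (2 * K)` of the shear, is exactly the `2 * |β|` demanded by `Block.mixes_of_offdiag`.
  set S := 4 * K ^ 2 / (ε₁ * ε) with hS
  have hS0 : 0 < S := by positivity
  obtain ⟨N, hN⟩ := exists_nat_gt (2 * S ^ 2)
  have hN0 : 0 < N := by
    have : (0 : ℝ) < N := lt_trans (by positivity) hN
    exact_mod_cast this
  obtain ⟨θ, hθ0, hθ1, hθ⟩ := exists_theta hN0
  refine ⟨2 * (K * K) ^ N, θ, N + 1, by positivity, by linarith, hθ1, ?_⟩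
  intro X T n hT hn A α β S' F hS' hF hA hs hαβ _ _ hdom
  obtain rfl := Multiset.card_eq_zero.1 hS'
  obtain rfl := Multiset.card_eq_zero.1 hF
  rw [add_zero] at hs ⊢
  have hX : Nonempty X := by
    by_contra hX
    exact hdom fun x => (hX ⟨x⟩).elim
  obtain ⟨x₀⟩ := hX
  obtain ⟨φ, a, c, hb, ha0, hc0, haK, hcK, hcK', ha, hc⟩ :=
    exists_two_frame hT x₀ hK0.le hA hV hs
  have hαβ' : α ≠ β := fun h => by simp [h] at hαβ
  -- If all backward sums were at most `S`, the products of `|a / c|` would decay exponentially and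
  -- the slow line would be dominated.
  have hbig : ∃ z, S < ∑ j ∈ Finset.range n, sp T (fun y => |a y / c y|) j (T^[n - j] z) := by
    by_contra hcon
    push Not at hcon
    have hu : ∀ x, 0 < |a x / c x| ∧ |a x / c x| ≤ K * K := fun x => by
      refine ⟨abs_pos.2 (div_ne_zero (ha0 x) (hc0 x)), ?_⟩
      have h1 : 0 < |c x| := abs_pos.2 (hc0 x)
      rw [abs_div, div_le_iff₀ h1]
      nlinarith [haK x, hcK' x]
    refine hdom (hb.dom_slow hT hαβ' ha hc hc0 fun m x => ?_)
    exact sp_decay_of_step hN0 (by nlinarith) hu (by linarith) hθ1.le hθ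
      (sp_step_of_sum_backward hT hS0.le hN.le hN0 (by omega) (fun x => (hu x).1) hcon) m x
  obtain ⟨z, hz⟩ := hbig
  have hβ0 : 0 < |β| := lt_of_le_of_lt (abs_nonneg _) hαβ
  obtain ⟨b, hbδ, hbz⟩ := abs_offdiag_ge hT (a := a) hc0 hK0 hcK z hε₁.le
  rw [hc] at hbz
  set b₀ : X → ℝ := fun y => (φ (T y)).k' (A y ((φ y).i 1))
  -- The sign `η` prevents the added corner entry from cancelling the one that `A` already has.
  obtain ⟨η, hη1, hη⟩ : ∃ η : ℝ, |η| = 1 ∧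
      |offdiag T a b c n z| ≤ |offdiag T a b₀ c n z + η * offdiag T a b c n z| := by
    rcases le_total 0 (offdiag T a b₀ c n z * offdiag T a b c n z) with h | h
    · refine ⟨1, by simp, ?_⟩
      rw [← sq_le_sq]; nlinarith [sq_nonneg (offdiag T a b₀ c n z)]
    · refine ⟨-1, by simp, ?_⟩
      rw [← sq_le_sq]; nlinarith [sq_nonneg (offdiag T a b₀ c n z)]
  let D : X → V →L[ℝ] V := fun x => (η * b x) • (φ (T x)).k.comp (φ x).i'
  have hDn : ∀ x, ‖D x‖ ≤ ε₁ := fun x => by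
    refine ContinuousLinearMap.opNorm_le_bound _ hε₁.le fun v => ?_
    simp only [D, smul_apply, ContinuousLinearMap.comp_apply]
    rw [norm_smul, Frame.norm_k, Real.norm_eq_abs, abs_mul, hη1, one_mul]
    exact mul_le_mul (hbδ x) ((φ x).norm_i'_le v) (norm_nonneg _) hε₁.le
  have hbt : ∀ t : ℝ, Block T (fun x => (φ x).toAlgFrame) (fun x => A x + t • D x)
      (fun x => a x • ContinuousLinearMap.id ℝ ℝ) (fun x => c x • ContinuousLinearMap.id ℝ ℝ) :=
    fun t => ⟨fun x w => by simp [D, (φ x).ik, hb.sub],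
      fun x v => by simp [D, (φ (T x)).ik, hb.quot]⟩
  have hst : ∀ t : ℝ, HasSpec T n (fun x => A x + t • D x) (α ::ₘ β ::ₘ 0) := fun t => by
    have := (hbt t).hasSpec hT (hasSpec_scalar a ha0 hT z) (hasSpec_scalar c hc0 hT z)
    rwa [ha, hc] at this
  have hnt : ∀ t : unitInterval, ∀ x, ‖A x + (t : ℝ) • D x - A x‖ ≤ ε₁ := fun t x => by
    rw [add_sub_cancel_left, norm_smul, Real.norm_eq_abs, abs_of_nonneg t.2.1]
    exact (mul_le_of_le_one_left (norm_nonneg _) t.2.2).trans (hDn x)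
  have hnA : ‖A z + (1 : ℝ) • D z‖ ≤ 2 * K := by
    have h1 := (hA z).1
    have h2 := hDn z
    have h3 : ε₁ ≤ 1 := min_le_right _ _
    rw [one_smul]
    exact (norm_add_le _ _).trans (by linarith)
  have hoff : (fun y => (φ (T y)).k' ((A y + (1 : ℝ) • D y) ((φ y).i 1))) =
      fun y => b₀ y + η * b y := by
    funext y
    simp [D, (φ (T y)).kk, (φ y).ii, b₀]
  refine ⟨fun x => A x + (1 : ℝ) • D x, ?_, ?_⟩
  · refine ⟨⟨⟨fun t x => A x + (t : ℝ) • D x, ?_⟩, ?_, ?_⟩, fun t => ⟨hst t, fun x => ?_⟩⟩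
    · exact continuous_pi fun x => by fun_prop
    · funext x; simp
    · funext x; simp
    · exact (hnt t x).trans (min_le_left _ _)
  · obtain ⟨f, p, q, h1, h2, h3, h4, h5⟩ := (hbt 1).mixes_of_offdiag hT hαβ ha0 ha hc0 hc z
      (δ := ε / (2 * K)) hnA (by positivity) (by
        rw [hoff, offdiag_add_smul]
        calc 2 * |β| = ε / (2 * K) * (ε₁ * |β| / K * S) := by rw [hS]; field_simp; ring
          _ ≤ ε / (2 * K) * (ε₁ * |β| / K *
              ∑ j ∈ Finset.range n, sp T (fun y => |a y / c y|) j (T^[n - j] z)) := by gcongr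
          _ ≤ ε / (2 * K) * offdiag T a b c n z := by gcongr
          _ ≤ ε / (2 * K) * |offdiag T a b c n z| := by gcongr; exact le_abs_self _
          _ ≤ _ := by gcongr)
    refine ⟨f, p, q, h1, h2, fun t x => (h3 t x).trans_eq ?_, h4, h5⟩
    field_simp

end TwoDim

/-! ### Angles, and domination in extensions -/

section DominationTools

variable {X V W₁ W₂ : Type*} [NormedAddCommGroup V] [InnerProductSpace ℝ V]
  [FiniteDimensional ℝ V]
  [NormedAddCommGroup W₁] [InnerProductSpace ℝ W₁] [FiniteDimensional ℝ W₁]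
  [NormedAddCommGroup W₂] [InnerProductSpace ℝ W₂] [FiniteDimensional ℝ W₂]
  {T : Equiv.Perm X} {n : ℕ}

theorem IsCyc.finite (hT : IsCyc T n) (x₀ : X) : Finite X :=
  Finite.of_surjective (fun j : Fin n => T^[j] x₀) fun x => by
    obtain ⟨j, hj, h⟩ := hT.reach x₀ x
    exact ⟨⟨j, hj⟩, h⟩

/-- Extensions of dominated cocycles produce sums of `m` terms of size `θ ^ m`. The resulting factor
`1 + m` is absorbed by moving the rate to `(1 + θ) / 2`. -/
theorem exists_absorb {θ : ℝ} (hθ0 : 0 < θ) (hθ1 : θ < 1) :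
    ∃ C θ' : ℝ, 1 ≤ C ∧ θ ≤ θ' ∧ θ' < 1 ∧ ∀ m : ℕ, (1 + m) * θ ^ m ≤ C * θ' ^ m := by
  set θ' := (1 + θ) / 2
  have h0 : 0 < θ' := by positivity
  have h1 : θ / θ' < 1 := by rw [div_lt_one h0]; simp only [θ']; linarith
  have h2 := tendsto_self_mul_const_pow_of_lt_one (div_nonneg hθ0.le h0.le) h1
  obtain ⟨M, hM⟩ := h2.bddAbove_range
  refine ⟨1 + |M|, θ', by linarith [abs_nonneg M], by simp only [θ']; linarith,
    by simp only [θ']; linarith, fun m => ?_⟩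
  have h3 : (m : ℝ) * (θ / θ') ^ m ≤ M := hM ⟨m, rfl⟩
  have h4 : (θ / θ') ^ m ≤ 1 := pow_le_one₀ (by positivity) h1.le
  have h5 : θ ^ m = (θ / θ') ^ m * θ' ^ m := by rw [← mul_pow, div_mul_cancel₀ _ h0.ne']
  rw [h5, ← mul_assoc]
  gcongr
  linarith [le_abs_self M]

theorem it_mem {A : X → V →L[ℝ] V} {L : X → Submodule ℝ V}
    (hL : ∀ x, (L x).map (A x).toLinearMap = L (T x)) (m : ℕ) (x : X) {l : V} (hl : l ∈ L x) :
    it T A m x l ∈ L (T^[m] x) := by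
  induction m generalizing x l with
  | zero => exact hl
  | succ m ih => exact ih (T x) (by rw [← hL]; exact Submodule.mem_map_of_mem hl)

theorem qd_map_le {A : X → V →L[ℝ] V} {L : X → Submodule ℝ V} {K : ℝ} (hA : Bdd A K)
    (hL : ∀ x, (L x).map (A x).toLinearMap = L (T x)) (x : X) (w : V) :
    qd (L (T x)) (A x w) ≤ K * qd (L x) w := by
  obtain ⟨l, hl, h, -⟩ := exists_qd_eq (L x) w
  have h1 : A x l ∈ L (T x) := by rw [← hL]; exact Submodule.mem_map_of_mem hl
  calc _ ≤ ‖A x w - A x l‖ := qd_le_norm_sub h1 _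
    _ = ‖A x (w - l)‖ := by rw [map_sub]
    _ ≤ K * qd (L x) w := by rw [← h]; exact hA.le x _

theorem qd_le_map {A : X → V →L[ℝ] V} {L : X → Submodule ℝ V} {K : ℝ} (hA : Bdd A K)
    (hL : ∀ x, (L x).map (A x).toLinearMap = L (T x)) (x : X) (w : V) :
    qd (L x) w ≤ K * qd (L (T x)) (A x w) := by
  obtain ⟨l', hl', h, -⟩ := exists_qd_eq (L (T x)) (A x w)
  rw [← hL] at hl'
  obtain ⟨l, hl, rfl⟩ := hl'
  calc _ ≤ ‖w - l‖ := qd_le_norm_sub hl _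
    _ ≤ K * ‖A x (w - l)‖ := (hA x).2 _
    _ = _ := by rw [map_sub, ← h]; rfl

theorem qd_le_it {A : X → V →L[ℝ] V} {L : X → Submodule ℝ V} {K : ℝ} (hA : Bdd A K)
    (hK : 0 ≤ K)
    (hL : ∀ x, (L x).map (A x).toLinearMap = L (T x)) (m : ℕ) (x : X) (w : V) :
    qd (L x) w ≤ K ^ m * qd (L (T^[m] x)) (it T A m x w) := by
  induction m generalizing x w with
  | zero => simp
  | succ m ih =>
    calc qd (L x) w ≤ K * qd (L (T x)) (A x w) := qd_le_map hA hL x w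
      _ ≤ K * (K ^ m * qd (L (T^[m] (T x))) (it T A m (T x) (A x w))) := by gcongr; exact ih _ _
      _ = _ := by rw [pow_succ]; simp only [Function.iterate_succ_apply, it_succ]; simp; ring

/-- An invariant line outside of a dominated bundle makes a definite angle with it. -/
theorem exists_angle {C θ K : ℝ} (hθ0 : 0 < θ) (hθ1 : θ < 1) (hK : 1 ≤ K) :
    ∃ δ : ℝ, 0 < δ ∧ δ ≤ 1 ∧ ∀ {X V : Type*} [NormedAddCommGroup V] [InnerProductSpace ℝ V]
      [FiniteDimensional ℝ V] {T : Equiv.Perm X} {n : ℕ} (_ : IsCyc T n) {A : X → V →L[ℝ] V}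
      {L : X → Submodule ℝ V} (_ : Bdd A K) (_ : ∀ x, (L x).map (A x).toLinearMap = L (T x))
      (_ : Dom T A L C θ) {f : X → V} {c : X → ℝ} (_ : ∀ x, A x (f x) = c x • f (T x))
      (_ : ∀ x, f x ∉ L x), ∀ x, δ * ‖f x‖ ≤ qd (L x) (f x) := by
  obtain ⟨m, hm⟩ : ∃ m : ℕ, C * θ ^ m ≤ 1 / 2 := by
    have h := (tendsto_pow_atTop_nhds_zero_of_lt_one hθ0.le hθ1).const_mul C
    rw [mul_zero] at h
    exact (h.eventually (ge_mem_nhds (by norm_num : (0 : ℝ) < 1 / 2))).exists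
  have hK2 : 1 ≤ K ^ (2 * m) := one_le_pow₀ hK
  refine ⟨1 / (2 * K ^ (2 * m)), by positivity, by rw [div_le_one (by positivity)]; linarith, ?_⟩
  intro X V _ _ _ T n hT A L hA hL hdom f c hc hf x
  have hq : ∀ x, 0 < qd (L x) (f x) := fun x =>
    lt_of_le_of_ne (qd_nonneg _ _) fun h => hf x ((qd_eq_zero_iff _ _).1 h.symm)
  have := hT.finite x
  have : Nonempty X := ⟨x⟩
  -- Let `ρ` be the largest ratio of the norm of `f` to its distance from `L`. Over `m` steps the
  -- component in `L` loses a factor `2` against the component outside, so that `ρ ≤ ρ / 2 + K ^ (2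
  -- * m)`, which bounds `ρ`.
  obtain ⟨z, hz⟩ := Finite.exists_max (α := X) (β := ℝ) (fun x => ‖f x‖ / qd (L x) (f x))
  set ρ := ‖f z‖ / qd (L z) (f z)
  have key : ∀ y, ‖f (T^[m] y)‖ / qd (L (T^[m] y)) (f (T^[m] y)) ≤ ρ / 2 + K ^ (2 * m) := by
    intro y
    obtain ⟨l, hl, hl1, hl2⟩ := exists_qd_eq (L y) (f y)
    have hlf : ‖l‖ ≤ ‖f y‖ := by
      refine (pow_le_pow_iff_left₀ (norm_nonneg _) (norm_nonneg _) two_ne_zero).1 ?_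
      nlinarith [sq_nonneg (qd (L y) (f y))]
    have he := it_eigenline hc m y
    have hd := hdom y m l hl (f y)
    have hq1 := qd_le_it hA (by linarith) hL m y (f y)
    rw [he, qd_smul] at hd hq1
    have hc0 : 0 < |sp T c m y| := by
      refine abs_pos.2 fun h0 => ?_
      rw [h0, abs_zero, zero_mul, mul_zero] at hq1
      exact absurd (hq y) (not_lt.2 hq1)
    set q := qd (L y) (f y)
    set q' := qd (L (T^[m] y)) (f (T^[m] y))
    have hqp : 0 < q := hq y
    have hqp' : 0 < q' := hq _
    have h1 : |sp T c m y| * ‖f (T^[m] y)‖ ≤ ‖it T A m y l‖ + K ^ m * q := by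
      calc |sp T c m y| * ‖f (T^[m] y)‖ = ‖it T A m y (f y)‖ := by rw [he, norm_smul]; rfl
        _ = ‖it T A m y l + it T A m y (f y - l)‖ := by rw [← map_add]; congr 2; abel
        _ ≤ ‖it T A m y l‖ + ‖it T A m y (f y - l)‖ := norm_add_le _ _
        _ ≤ _ := by rw [← hl1]; gcongr; exact hA.norm_it_le (by linarith) m y _
    have hρ : ‖f y‖ ≤ ρ * q := by rw [← div_le_iff₀ hqp]; exact hz y
    have h2 : ‖it T A m y l‖ ≤ ρ / 2 * (|sp T c m y| * q') := by
      refine le_of_mul_le_mul_right ?_ hqp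
      calc ‖it T A m y l‖ * q ≤ C * θ ^ m * (‖l‖ * (|sp T c m y| * q')) := hd
        _ ≤ 1 / 2 * (ρ * q * (|sp T c m y| * q')) := by
            gcongr
            exact hlf.trans hρ
        _ = _ := by ring
    have h3 : K ^ m * q ≤ K ^ (2 * m) * (|sp T c m y| * q') := by
      calc K ^ m * q ≤ K ^ m * (K ^ m * (|sp T c m y| * q')) := by gcongr
        _ = _ := by rw [two_mul, pow_add]; ring
    rw [div_le_iff₀ hqp']
    refine le_of_mul_le_mul_left ?_ hc0
    nlinarith
  have hz2 : ρ ≤ ρ / 2 + K ^ (2 * m) := by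
    obtain ⟨y, hy⟩ : ∃ y, T^[m] y = z := (T.bijective.iterate m).2 z
    have := key y
    rwa [hy] at this
  have h4 := hz x
  have h5 := hq x
  rw [div_le_iff₀ h5] at h4
  rw [div_mul_eq_mul_div, one_mul, div_le_iff₀ (by positivity)]
  nlinarith

theorem Bdd.rate {A : X → V →L[ℝ] V} {K : ℝ} (hA : Bdd A K) {φ : X → Frame V ℝ W₂} {c : X → ℝ}
    {Q : X → W₂ →L[ℝ] W₂} (hK : 0 ≤ K)
    (hb : Block T (fun x => (φ x).toAlgFrame) A (fun x => c x • ContinuousLinearMap.id ℝ ℝ) Q)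
    (x : X) : |c x| ≤ K ∧ 1 ≤ K * |c x| ∧ c x ≠ 0 := by
  have h := hb.bdd_sub hK hA
  have h1 : 1 ≤ K * |c x| := by simpa using (h x).2 1
  refine ⟨by simpa using h.le x 1, h1, fun h0 => ?_⟩
  norm_num [h0] at h1

/-- Domination of an invariant line by the quotient `V ⧸ L`, from domination by the line with
rate `c` and by the quotient by that line. -/
theorem dom_line_of_quot {A : X → V →L[ℝ] V} {K C θ δ : ℝ} (hK : 1 ≤ K) (hA : Bdd A K)
    (hC : 0 ≤ C) (hθ : 0 < θ) (hδ : 0 < δ)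
    {φ : X → Frame V ℝ W₂} {c : X → ℝ} {Q : X → W₂ →L[ℝ] W₂}
    (hb : Block T (fun x => (φ x).toAlgFrame) A (fun x => c x • ContinuousLinearMap.id ℝ ℝ) Q)
    {L : X → Submodule ℝ V} {M : X → Submodule ℝ W₂}
    (hL : ∀ x, (L x).map (A x).toLinearMap = L (T x))
    (hM : ∀ x, (M x).map (Q x).toLinearMap = M (T x))
    (hLM : ∀ x, (L x).map (φ x).i'.toLinearMap = M x)
    (hang : ∀ x, δ ≤ qd (L x) ((φ x).k 1)) {a : X → ℝ} (ha : ∀ x, 0 < a x)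
    (haQ : ∀ x m w, sp T a m x * qd (M x) w ≤ C * θ ^ m * qd (M (T^[m] x)) (it T Q m x w))
    (hac : ∀ x m, sp T a m x ≤ C * θ ^ m * |sp T c m x|) (x : X) (m : ℕ) (w : V) :
    sp T a m x * qd (L x) w ≤ (C + 2 * C / δ + 2 * K / δ * K * C ^ 2) * ((1 + m) * θ ^ m) *
      qd (L (T^[m] x)) (it T A m x w) := by
  have hK0 : 0 < K := by linarith
  have hQ := hb.bdd_quot hK0.le hA
  have hc0 : ∀ x, c x ≠ 0 := fun x => (hA.rate hK0.le hb x).2.2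
  have hsa : ∀ m x, 0 < sp T a m x := fun m x => sp_pos ha m x
  have hsc : ∀ m x, 0 < |sp T c m x| := fun m x => abs_pos.2 (sp_ne_zero hc0 m x)
  -- `V ⧸ L` is an extension of `W₂ ⧸ M` by the line. Here `μ` is the coordinate of `w` along the
  -- line, modulo `L`, up to an error measured in `W₂ ⧸ M`.
  have hμ : ∀ x w, ∃ μ : ℝ, qd (L x) (w - (φ x).k μ) ≤ qd (M x) ((φ x).i' w) := by
    intro x w
    obtain ⟨l', hl', h, -⟩ := exists_qd_eq (M x) ((φ x).i' w)
    rw [← hLM] at hl'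
    obtain ⟨l, hl, rfl⟩ := hl'
    refine ⟨(φ x).k' (w - l), ?_⟩
    rw [← h]
    refine (qd_le_norm_sub hl _).trans_eq ?_
    have e1 : w - (φ x).k ((φ x).k' (w - l)) - l = (φ x).i ((φ x).i' (w - l)) := by
      rw [sub_right_comm, sub_eq_iff_eq_add, add_comm, (φ x).id]
    rw [e1, Frame.norm_i, map_sub]
    rfl
  choose μ hμ using hμ
  have hGD : ∀ x w, qd (M x) ((φ x).i' w) ≤ qd (L x) w := by
    intro x w
    obtain ⟨l, hl, h, -⟩ := exists_qd_eq (L x) w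
    have h1 : (φ x).i' l ∈ M x := by rw [← hLM]; exact Submodule.mem_map_of_mem hl
    calc _ ≤ ‖(φ x).i' w - (φ x).i' l‖ := qd_le_norm_sub h1 _
      _ = ‖(φ x).i' (w - l)‖ := by rw [map_sub]
      _ ≤ _ := by rw [← h]; exact (φ x).norm_i'_le _
  have hk : ∀ x (s : ℝ), |s| * δ ≤ qd (L x) ((φ x).k s) := fun x s => by
    have : (φ x).k s = s • (φ x).k 1 := by rw [← map_smul, smul_eq_mul, mul_one]
    rw [this, qd_smul]
    gcongr
    exact hang x
  have hk' : ∀ x (s : ℝ), qd (L x) ((φ x).k s) ≤ |s| := fun x s => by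
    simpa using qd_le_norm (L x) ((φ x).k s)
  set G : ℕ → ℝ := fun j => qd (M (T^[j] x)) ((φ (T^[j] x)).i' (it T A j x w)) with hG
  set ν : ℕ → ℝ := fun j => μ (T^[j] x) (it T A j x w) with hν
  have hG0 : ∀ j, 0 ≤ G j := fun j => qd_nonneg _ _
  have hGQ : ∀ j, G j = qd (M (T^[j] x)) (it T Q j x ((φ x).i' w)) := fun j => by
    simp only [hG]; rw [hb.it_quot]
  have hG1 : ∀ j, G (j + 1) ≤ K * G j := fun j => by
    rw [hGQ, hGQ, it_succ', Function.iterate_succ_apply']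
    exact qd_map_le hQ hM _ _
  have hG2 : ∀ j, G j ≤ K * G (j + 1) := fun j => by
    rw [hGQ, hGQ, it_succ', Function.iterate_succ_apply']
    exact qd_le_map hQ hM _ _
  -- The coordinate is multiplied by `c` up to an error of order `G j`. Solving this recursion from
  -- time `m` back to time `0` gives `hsum`.
  have hstep : ∀ j, |c (T^[j] x)| * |ν j| ≤ |ν (j + 1)| + 2 * K / δ * G j := by
    intro j
    have h1 := qd_map_le hA hL (T^[j] x) (it T A j x w - (φ (T^[j] x)).k (ν j))
    have h2 := hμ (T^[j + 1] x) (it T A (j + 1) x w)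
    have h3 := hk (T^[j + 1] x) (ν (j + 1) - c (T^[j] x) * ν j)
    rw [it_succ', Function.iterate_succ_apply'] at h2
    simp only [Function.iterate_succ_apply'] at h3
    have h4 := (qd_add_le (L (T (T^[j] x))) (A (T^[j] x) (it T A j x w - (φ (T^[j] x)).k (ν j)))
      (-((A (T^[j] x)).comp (it T A j x) w - (φ (T (T^[j] x))).k (ν (j + 1)))))
    have h5 : A (T^[j] x) (it T A j x w - (φ (T^[j] x)).k (ν j)) +
        -((A (T^[j] x)).comp (it T A j x) w - (φ (T (T^[j] x))).k (ν (j + 1))) =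
        (φ (T (T^[j] x))).k (ν (j + 1) - c (T^[j] x) * ν j) := by
      rw [map_sub, hb.sub, map_sub]
      simp
    have h6 : ∀ v, qd (L (T (T^[j] x))) (-v) = qd (L (T (T^[j] x))) v := fun v => by
      have := qd_smul (L (T (T^[j] x))) (-1) v
      simpa using this
    rw [h5, h6] at h4
    have e7 : ν (j + 1) = μ (T (T^[j] x)) ((A (T^[j] x)).comp (it T A j x) w) := by
      simp only [hν]; rw [it_succ', Function.iterate_succ_apply']
    rw [← e7] at h2
    have e8 : qd (M (T (T^[j] x))) ((φ (T (T^[j] x))).i' ((A (T^[j] x)).comp (it T A j x) w)) =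
        G (j + 1) := by
      simp only [hG]; rw [it_succ', Function.iterate_succ_apply']
    rw [e8] at h2
    have h9 := hμ (T^[j] x) (it T A j x w)
    have h10 : |ν (j + 1) - c (T^[j] x) * ν j| * δ ≤ 2 * K * G j := by
      have h11 : K * qd (L (T^[j] x)) (it T A j x w - (φ (T^[j] x)).k (ν j)) ≤ K * G j := by
        gcongr
      linarith [hG1 j]
    have h12 : |ν (j + 1) - c (T^[j] x) * ν j| ≤ 2 * K / δ * G j := by
      rw [div_mul_eq_mul_div, le_div_iff₀ hδ]; exact h10
    have h13 : |c (T^[j] x) * ν j| ≤ |ν (j + 1)| + |ν (j + 1) - c (T^[j] x) * ν j| := by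
      have := abs_sub_abs_le_abs_sub (c (T^[j] x) * ν j) (ν (j + 1))
      rw [abs_sub_comm] at this
      linarith
    rw [abs_mul] at h13
    linarith
  have hsum : ∀ m, |ν 0| ≤ |ν m| / |sp T c m x| +
      ∑ j ∈ Finset.range m, 2 * K / δ * G j / |sp T c (j + 1) x| := by
    intro m
    induction m with
    | zero => simp
    | succ m ih =>
      refine ih.trans ?_
      rw [Finset.sum_range_succ, add_comm (Finset.sum _ _), ← add_assoc]
      refine add_le_add ?_ le_rfl
      have h1 := hsc m x
      have h2 := abs_pos.2 (hc0 (T^[m] x))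
      rw [sp_succ', abs_mul, ← add_div, div_le_div_iff₀ h1 (mul_pos h1 h2)]
      nlinarith [hstep m]
  have hD := hGD (T^[m] x) (it T A m x w)
  set D := qd (L (T^[m] x)) (it T A m x w) with hDdef
  have hD0 : 0 ≤ D := qd_nonneg _ _
  change G m ≤ D at hD
  have hνm : |ν m| ≤ 2 * D / δ := by
    rw [le_div_iff₀ hδ]
    have h1 := hk (T^[m] x) (ν m)
    have h2 := hμ (T^[m] x) (it T A m x w)
    have h3 := qd_add_le (L (T^[m] x)) (it T A m x w)
      (-(it T A m x w - (φ (T^[m] x)).k (ν m)))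
    have h6 : ∀ v, qd (L (T^[m] x)) (-v) = qd (L (T^[m] x)) v := fun v => by
      have := qd_smul (L (T^[m] x)) (-1) v
      simpa using this
    rw [h6] at h3
    have e : it T A m x w + -(it T A m x w - (φ (T^[m] x)).k (ν m)) = (φ (T^[m] x)).k (ν m) := by
      abel
    rw [e] at h3
    change qd (L (T^[m] x)) (it T A m x w - (φ (T^[m] x)).k (ν m)) ≤ G m at h2
    linarith
  have hw0 : qd (L x) w ≤ G 0 + |ν 0| := by
    have h1 := qd_add_le (L x) (w - (φ x).k (ν 0)) ((φ x).k (ν 0))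
    rw [sub_add_cancel] at h1
    exact h1.trans (add_le_add (hμ x w) (hk' x _))
  have t1 : sp T a m x * G 0 ≤ C * θ ^ m * D := by
    have := haQ x m ((φ x).i' w)
    rw [← hGQ] at this
    exact this.trans (by gcongr)
  have t2 : sp T a m x * (|ν m| / |sp T c m x|) ≤ 2 * C / δ * θ ^ m * D := by
    calc sp T a m x * (|ν m| / |sp T c m x|)
        ≤ C * θ ^ m * |sp T c m x| * (2 * D / δ / |sp T c m x|) := by
          gcongr
          exact hac x m
      _ = _ := by have := (hsc m x).ne'; field_simp
  -- Use domination by the line up to time `j + 1`, and domination by `W₂ ⧸ M` from then on. Each of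
  -- the `m` terms is of order `θ ^ m`.
  have t3 : ∀ j ∈ Finset.range m, sp T a m x * (2 * K / δ * G j / |sp T c (j + 1) x|) ≤
      2 * K / δ * K * C ^ 2 * θ ^ m * D := by
    intro j hj
    obtain ⟨i, rfl⟩ : ∃ i, m = (j + 1) + i := ⟨m - (j + 1), by
      have := Finset.mem_range.1 hj; omega⟩
    have h1 := hac x (j + 1)
    have h2 := haQ (T^[j + 1] x) i (it T Q (j + 1) x ((φ x).i' w))
    rw [← hGQ] at h2
    have e : G (j + 1 + i) = qd (M (T^[i] (T^[j + 1] x)))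
        (it T Q i (T^[j + 1] x) (it T Q (j + 1) x ((φ x).i' w))) := by
      rw [hGQ, it_add, add_comm (j + 1) i, Function.iterate_add_apply]; rfl
    rw [← e] at h2
    rw [sp_add]
    have h3 := hsa i (T^[j + 1] x)
    have h4 := hsc (j + 1) x
    have h5 := hG0 j
    have h6 := hG0 (j + 1)
    calc sp T a (j + 1) x * sp T a i (T^[j + 1] x) * (2 * K / δ * G j / |sp T c (j + 1) x|)
        ≤ C * θ ^ (j + 1) * |sp T c (j + 1) x| * sp T a i (T^[j + 1] x) *
          (2 * K / δ * (K * G (j + 1)) / |sp T c (j + 1) x|) := by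
          gcongr
          exact hG2 j
      _ = C * θ ^ (j + 1) * (2 * K / δ * K) * (sp T a i (T^[j + 1] x) * G (j + 1)) := by
          field_simp
      _ ≤ C * θ ^ (j + 1) * (2 * K / δ * K) * (C * θ ^ i * D) := by
          refine mul_le_mul_of_nonneg_left (h2.trans ?_) (by positivity)
          gcongr
      _ = _ := by rw [pow_add]; ring
  have t4 := Finset.sum_le_sum t3
  rw [← Finset.mul_sum, Finset.sum_const, Finset.card_range, nsmul_eq_mul] at t4
  calc sp T a m x * qd (L x) w ≤ sp T a m x * (G 0 + (|ν m| / |sp T c m x| +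
        ∑ j ∈ Finset.range m, 2 * K / δ * G j / |sp T c (j + 1) x|)) := by
        have := (hsa m x).le
        gcongr
        exact hw0.trans (add_le_add le_rfl (hsum m))
    _ ≤ C * θ ^ m * D + (2 * C / δ * θ ^ m * D + m * (2 * K / δ * K * C ^ 2 * θ ^ m * D)) := by
        rw [mul_add, mul_add]
        exact add_le_add t1 (add_le_add t2 t4)
    _ ≤ _ := by
        have h1 : 0 ≤ θ ^ m * D := by positivity
        have h2 : 0 ≤ C * m := by positivity
        have h3 : 0 ≤ 2 * C / δ * m := by positivity
        have h4 : 0 ≤ 2 * K / δ * K * C ^ 2 := by positivity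
        nlinarith [mul_nonneg h1 h2, mul_nonneg h1 h3, mul_nonneg h1 h4]

/-- Domination of `L` by `V ⧸ L`, from domination of an invariant line in `L` and of the quotient
of `L` by this line. -/
theorem dom_of_line {A : X → V →L[ℝ] V} {K C θ θ' E : ℝ} (hK : 1 ≤ K) (hA : Bdd A K)
    (hC : 0 ≤ C) (hθ : 0 < θ) (habs : ∀ m : ℕ, (1 + m) * θ ^ m ≤ E * θ' ^ m)
    {φ : X → Frame V ℝ W₂} {a : X → ℝ} {B : X → W₂ →L[ℝ] W₂}
    (hb : Block T (fun x => (φ x).toAlgFrame) A (fun x => a x • ContinuousLinearMap.id ℝ ℝ) B)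
    {L : X → Submodule ℝ V} {M : X → Submodule ℝ W₂}
    (hM : ∀ x, (M x).map (B x).toLinearMap = M (T x))
    (hLM : ∀ x v, v ∈ L x ↔ (φ x).i' v ∈ M x) (hdom : Dom T B M C θ)
    (ha : ∀ x m w, |sp T a m x| * qd (L x) w ≤
      C * θ ^ m * qd (L (T^[m] x)) (it T A m x w)) :
    Dom T A L ((2 * C + K ^ 2 * C ^ 2 / θ) * E) θ' := by
  have hK0 : 0 < K := by linarith
  have hB := hb.bdd_quot hK0.le hA
  -- `L` is the full preimage of `M`, so distances to `L` can be read in the quotient by the line.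
  have hq : ∀ x w, qd (L x) w = qd (M x) ((φ x).i' w) := by
    intro x w
    obtain ⟨l', hl', h, -⟩ := exists_qd_eq (M x) ((φ x).i' w)
    refine qd_eq_of_forall ⟨(φ x).k ((φ x).k' w) + (φ x).i l', (hLM _ _).2 ?_, ?_⟩ fun l hl => ?_
    · rwa [map_add, (φ x).ik, (φ x).ii, zero_add]
    · have : w - ((φ x).k ((φ x).k' w) + (φ x).i l') = (φ x).i ((φ x).i' w - l') := by
        conv_lhs => enter [1]; rw [← (φ x).id w]
        rw [map_sub]; abel
      rw [this, Frame.norm_i, h]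
    · calc _ ≤ ‖(φ x).i' w - (φ x).i' l‖ := qd_le_norm_sub ((hLM _ _).1 hl) _
        _ = ‖(φ x).i' (w - l)‖ := by rw [map_sub]
        _ ≤ _ := (φ x).norm_i'_le _
  intro x m l hl w
  set lam : ℕ → W₂ := fun j => it T B j x ((φ x).i' l)
  set ν : ℕ → ℝ := fun j => (φ (T^[j] x)).k' (it T A j x l)
  set D : ℕ → ℝ := fun j => qd (L (T^[j] x)) (it T A j x w)
  have hD0 : ∀ j, 0 ≤ D j := fun j => qd_nonneg _ _
  have hDM : ∀ j, D j = qd (M (T^[j] x)) (it T B j x ((φ x).i' w)) := fun j => by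
    simp only [D]; rw [hq, hb.it_quot]
  have hD1 : ∀ j, D j ≤ K * D (j + 1) := fun j => by
    rw [hDM, hDM, it_succ', Function.iterate_succ_apply']
    exact qd_le_map hB hM _ _
  have hlam : ∀ j, ‖lam j‖ * D 0 ≤ C * θ ^ j * (‖(φ x).i' l‖ * D j) := fun j => by
    rw [hDM j]
    have := hdom x j ((φ x).i' l) ((hLM _ _).1 hl) ((φ x).i' w)
    rwa [← hq] at this
  have hstep : ∀ j, |ν (j + 1)| ≤ |a (T^[j] x)| * |ν j| + K * ‖lam j‖ := by
    intro j
    set y := T^[j] x with hy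
    set v := it T A j x l with hv
    have e1 : (φ y).i' v = lam j := hb.it_quot j x l
    have e2 : ν (j + 1) = (φ (T y)).k' (A y v) := by
      simp only [ν]; rw [it_succ', Function.iterate_succ_apply']; rfl
    have e3 : A y v = (φ (T y)).k (a y * ν j) + A y ((φ y).i (lam j)) := by
      conv_lhs => rw [← (φ y).id v]
      rw [map_add, hb.sub, e1]
      rfl
    rw [e2, e3, map_add, (φ (T y)).kk]
    refine (abs_add_le _ _).trans (add_le_add (abs_mul _ _).le ?_)
    calc _ ≤ ‖A y ((φ y).i (lam j))‖ := (φ (T y)).norm_k'_le _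
      _ ≤ K * ‖(φ y).i (lam j)‖ := hA.le _ _
      _ = _ := by rw [Frame.norm_i]
  -- Variation of constants: the component along the line evolves with rate `a` and is forced by the
  -- image `lam j` in the quotient.
  have hνm : ∀ m, |ν m| ≤ |sp T a m x| * |ν 0| +
      ∑ j ∈ Finset.range m, |sp T a (m - 1 - j) (T^[j + 1] x)| * (K * ‖lam j‖) := by
    intro m
    induction m with
    | zero => simp
    | succ m ih =>
      refine (hstep m).trans ?_
      rw [Finset.sum_range_succ, ← add_assoc]
      refine add_le_add ?_ (by simp)
      calc |a (T^[m] x)| * |ν m| ≤ |a (T^[m] x)| * (|sp T a m x| * |ν 0| +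
            ∑ j ∈ Finset.range m, |sp T a (m - 1 - j) (T^[j + 1] x)| * (K * ‖lam j‖)) := by
            gcongr
        _ = _ := by
          rw [mul_add, Finset.mul_sum]
          congr 1
          · rw [sp_succ', abs_mul]; ring
          · refine Finset.sum_congr rfl fun j hj => ?_
            have hj := Finset.mem_range.1 hj
            rw [show m + 1 - 1 - j = (m - 1 - j) + 1 by omega, sp_succ', abs_mul,
              ← Function.iterate_add_apply, show m - 1 - j + (j + 1) = m by omega]
            ring
  have hl1 : ‖(φ x).i' l‖ ≤ ‖l‖ := (φ x).norm_i'_le l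
  have hl2 : |ν 0| ≤ ‖l‖ := (φ x).norm_k'_le l
  have ha' : ∀ i j, |sp T a i (T^[j] x)| * D j ≤ C * θ ^ i * D (j + i) := by
    intro i j
    have := ha (T^[j] x) i (it T A j x w)
    have e : D (j + i) = qd (L (T^[i] (T^[j] x))) (it T A i (T^[j] x) (it T A j x w)) := by
      simp only [D]
      rw [it_add, add_comm j i, Function.iterate_add_apply]; rfl
    rw [e]; exact this
  have t1 : |sp T a m x| * |ν 0| * D 0 ≤ C * θ ^ m * (‖l‖ * D m) := by
    have := ha' m 0
    rw [zero_add] at this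
    calc |sp T a m x| * |ν 0| * D 0 = |ν 0| * (|sp T a m x| * D 0) := by ring
      _ ≤ ‖l‖ * (C * θ ^ m * D m) :=
          mul_le_mul hl2 this (mul_nonneg (abs_nonneg _) (hD0 0)) (norm_nonneg _)
      _ = _ := by ring
  have t2 : ∀ j ∈ Finset.range m, |sp T a (m - 1 - j) (T^[j + 1] x)| * (K * ‖lam j‖) * D 0 ≤
      K ^ 2 * C ^ 2 / θ * θ ^ m * (‖l‖ * D m) := by
    intro j hj
    have hj := Finset.mem_range.1 hj
    have h1 := ha' (m - 1 - j) (j + 1)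
    rw [show j + 1 + (m - 1 - j) = m by omega] at h1
    have e : θ ^ m = θ * (θ ^ j * θ ^ (m - 1 - j)) := by
      rw [← pow_add, ← pow_succ']; congr 1; omega
    have hDj := hD0 j
    have hDj' := hD0 (j + 1)
    calc |sp T a (m - 1 - j) (T^[j + 1] x)| * (K * ‖lam j‖) * D 0
        = |sp T a (m - 1 - j) (T^[j + 1] x)| * K * (‖lam j‖ * D 0) := by ring
      _ ≤ |sp T a (m - 1 - j) (T^[j + 1] x)| * K * (C * θ ^ j * (‖l‖ * (K * D (j + 1)))) := by
          refine mul_le_mul_of_nonneg_left ?_ (by positivity)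
          refine (hlam j).trans (mul_le_mul_of_nonneg_left ?_ (by positivity))
          exact mul_le_mul hl1 (hD1 j) hDj (norm_nonneg _)
      _ = K ^ 2 * (C * θ ^ j * ‖l‖) * (|sp T a (m - 1 - j) (T^[j + 1] x)| * D (j + 1)) := by ring
      _ ≤ K ^ 2 * (C * θ ^ j * ‖l‖) * (C * θ ^ (m - 1 - j) * D m) := by gcongr
      _ = _ := by rw [e]; field_simp
  have t3 := Finset.sum_le_sum t2
  rw [← Finset.sum_mul, Finset.sum_const, Finset.card_range, nsmul_eq_mul] at t3
  have t4 := hlam m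
  have hnorm : ‖it T A m x l‖ ≤ |ν m| + ‖lam m‖ := by
    have := (φ (T^[m] x)).norm_le (it T A m x l)
    rwa [hb.it_quot] at this
  have hlD : 0 ≤ ‖l‖ * D m := mul_nonneg (norm_nonneg _) (hD0 m)
  have hCC : 0 ≤ 2 * C + K ^ 2 * C ^ 2 / θ := by positivity
  calc ‖it T A m x l‖ * D 0 ≤ (|sp T a m x| * |ν 0| +
        ∑ j ∈ Finset.range m, |sp T a (m - 1 - j) (T^[j + 1] x)| * (K * ‖lam j‖) + ‖lam m‖) *
          D 0 := by
        have := hD0 0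
        gcongr
        exact hnorm.trans (add_le_add (hνm m) le_rfl)
    _ ≤ C * θ ^ m * (‖l‖ * D m) + m * (K ^ 2 * C ^ 2 / θ * θ ^ m * (‖l‖ * D m)) +
        C * θ ^ m * (‖l‖ * D m) := by
        rw [add_mul, add_mul]
        refine add_le_add (add_le_add t1 t3) (t4.trans ?_)
        have := hD0 m
        gcongr
    _ ≤ (2 * C + K ^ 2 * C ^ 2 / θ) * ((1 + m) * θ ^ m) * (‖l‖ * D m) := by
        have h1 : 0 ≤ θ ^ m * (‖l‖ * D m) := by positivity
        have h2 : 0 ≤ C * m := by positivity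
        have h4 : 0 ≤ K ^ 2 * C ^ 2 / θ := by positivity
        nlinarith [mul_nonneg h1 h2, mul_nonneg h1 h4]
    _ ≤ (2 * C + K ^ 2 * C ^ 2 / θ) * (E * θ' ^ m) * (‖l‖ * D m) := by
        exact mul_le_mul_of_nonneg_right (mul_le_mul_of_nonneg_left (habs m) hCC) hlD
    _ = _ := by ring

end DominationTools

/-! ### The bundle of the slow eigenvalues -/

section SlowBundle

variable {X V W₁ W₂ : Type*} [NormedAddCommGroup V] [InnerProductSpace ℝ V]
  [FiniteDimensional ℝ V]
  [NormedAddCommGroup W₁] [InnerProductSpace ℝ W₁] [FiniteDimensional ℝ W₁]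
  [NormedAddCommGroup W₂] [InnerProductSpace ℝ W₂] [FiniteDimensional ℝ W₂]
  {T : Equiv.Perm X} {n : ℕ}

theorem aeval_intertwine {V W : Type*} [AddCommGroup V] [Module ℝ V] [AddCommGroup W] [Module ℝ W]
    {f : V →ₗ[ℝ] V} {g : W →ₗ[ℝ] W} {R : V →ₗ[ℝ] W} (h : ∀ v, R (f v) = g (R v)) (p : ℝ[X])
    (v : V) : R (aeval f p v) = aeval g p (R v) := by
  induction p using Polynomial.induction_on generalizing v with
  | C a => simp
  | add p q hp hq => simp [hp, hq]
  | monomial k a ih =>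
    have : ∀ (k : ℕ) v, R ((f ^ k) v) = (g ^ k) (R v) := by
      intro k
      induction k with
      | zero => intro v; simp
      | succ k ih => intro v; rw [pow_succ, pow_succ, Module.End.mul_apply, ih, h]; rfl
    simp [this]

theorem eval_prod_X_sub_C (r : ℝ) (F : Multiset ℝ) :
    (F.map fun s => Polynomial.X - C s).prod.eval r = (F.map fun s => r - s).prod := by
  rw [eval_multiset_prod, Multiset.map_map]
  simp

theorem eval_prod_ne_zero {r : ℝ} {F : Multiset ℝ} (h : r ∉ F) :
    (F.map fun s => Polynomial.X - C s).prod.eval r ≠ 0 := by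
  rw [eval_prod_X_sub_C]
  refine Multiset.prod_ne_zero fun h0 => ?_
  obtain ⟨s, hs, h1⟩ := Multiset.mem_map.1 h0
  rw [sub_eq_zero] at h1
  exact h (h1 ▸ hs)

theorem aeval_eigen {f : V →ₗ[ℝ] V} {v : V} {r : ℝ} (h : f v = r • v) (p : ℝ[X]) :
    aeval f p v = p.eval r • v := by
  induction p using Polynomial.induction_on with
  | C a => simp [Algebra.algebraMap_eq_smul_one]
  | add p q hp hq => simp [hp, hq, add_smul]
  | monomial k a ih =>
    have : ∀ (k : ℕ), (f ^ k) v = r ^ k • v := by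
      intro k
      induction k with
      | zero => simp
      | succ k ih => rw [pow_succ, Module.End.mul_apply, h, map_smul, ih, smul_smul, pow_succ']
    simp only [map_mul, aeval_C, map_pow, aeval_X, Module.End.mul_apply, this,
      Module.algebraMap_end_apply, eval_mul, eval_C, eval_pow, eval_X, smul_smul]

theorem slow_map (hT : IsCyc T n) {A : X → V →L[ℝ] V} (hA : ∀ x, Function.Bijective (A x))
    (F : Multiset ℝ) (x : X) :
    (slow T n A F x).map (A x).toLinearMap = slow T n A F (T x) := by
  have h : ∀ v, A x (it T A n x v) = it T A n (T x) (A x v) := fun v =>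
    (DFunLike.congr_fun (it_per_comm hT A x) v).symm
  have h2 := aeval_intertwine (R := (A x).toLinearMap) h (F.map fun r => Polynomial.X - C r).prod
  ext v
  constructor
  · rintro ⟨_, ⟨w, rfl⟩, rfl⟩
    exact ⟨A x w, (h2 w).symm⟩
  · rintro ⟨w, rfl⟩
    obtain ⟨u, rfl⟩ := (hA x).2 w
    exact ⟨_, ⟨u, rfl⟩, h2 u⟩

theorem mem_slow_of_eigen {A : X → V →L[ℝ] V} {F : Multiset ℝ} {x : X} {v : V} {r : ℝ}
    (h : it T A n x v = r • v) (hr : r ∉ F) : v ∈ slow T n A F x := by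
  have h1 := aeval_eigen (f := (it T A n x).toLinearMap) h (F.map fun r => Polynomial.X - C r).prod
  refine ⟨((F.map fun r => Polynomial.X - C r).prod.eval r)⁻¹ • v, ?_⟩
  rw [map_smul, h1, smul_smul, inv_mul_cancel₀ (eval_prod_ne_zero hr), one_smul]

/-- Cayley–Hamilton: the product over `S` kills the range of the product over `F`. -/
theorem aeval_eq_zero_of_mem_slow {A : X → V →L[ℝ] V} {S F : Multiset ℝ}
    (hs : HasSpec T n A (S + F)) {x : X} {v : V} (hv : v ∈ slow T n A F x) :
    aeval (it T A n x).toLinearMap (S.map fun r => Polynomial.X - C r).prod v = 0 := by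
  obtain ⟨w, rfl⟩ := hv
  rw [← Module.End.mul_apply, ← map_mul, ← Multiset.prod_add, ← Multiset.map_add, ← hs x,
    LinearMap.aeval_self_charpoly]
  rfl

theorem notMem_slow_of_eigen {A : X → V →L[ℝ] V} {S F : Multiset ℝ}
    (hs : HasSpec T n A (S + F)) {x : X} {v : V} {r : ℝ}
    (h : it T A n x v = r • v) (hr : r ∉ S) (hv0 : v ≠ 0) : v ∉ slow T n A F x := by
  intro hv
  have h1 := aeval_eq_zero_of_mem_slow hs hv
  rw [aeval_eigen (f := (it T A n x).toLinearMap) h] at h1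
  exact (smul_ne_zero (eval_prod_ne_zero hr) hv0) h1

theorem slow_eq_bot {A : X → V →L[ℝ] V} {F : Multiset ℝ}
    (hs : HasSpec T n A F) (x : X) : slow T n A F x = ⊥ := by
  refine (Submodule.eq_bot_iff _).2 fun v hv => ?_
  have := aeval_eq_zero_of_mem_slow (S := 0) (by rwa [zero_add]) hv
  simpa using this

theorem dom_bot {A : X → V →L[ℝ] V} {L : X → Submodule ℝ V} {C θ : ℝ} (h : ∀ x, L x = ⊥) : Dom T A L C θ := by
  intro x m l hl w
  rw [h, Submodule.mem_bot] at hl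
  rw [hl, map_zero, norm_zero, zero_mul, zero_mul, mul_zero]

theorem Block.slow_quot {φ : X → AlgFrame V W₁ W₂} {A : X → V →L[ℝ] V} {P : X → W₁ →L[ℝ] W₁}
    {S : X → W₂ →L[ℝ] W₂} (hT : IsCyc T n) (hb : Block T φ A P S) (F : Multiset ℝ) (x : X) :
    (slow T n A F x).map (φ x).i'.toLinearMap = slow T n S F x := by
  have h := hb.it_quot n x
  rw [hT.per] at h
  have h2 := aeval_intertwine (f := (it T A n x).toLinearMap) (g := (it T S n x).toLinearMap)
    (R := (φ x).i'.toLinearMap) h (F.map fun r => Polynomial.X - C r).prod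
  ext v
  constructor
  · rintro ⟨_, ⟨w, rfl⟩, rfl⟩
    exact ⟨(φ x).i' w, (h2 w).symm⟩
  · rintro ⟨w, rfl⟩
    refine ⟨_, ⟨(φ x).i w, rfl⟩, ?_⟩
    rw [h2]
    exact congrArg _ ((φ x).ii w)

/-- On the invariant subspace `slow F` all eigenvalues belong to `S`, so the return map minus `γ` is
injective there and maps it onto itself. This holds whether or not `γ` occurs in `F`, and so allows
quotients that have lost one copy of `γ`. -/
theorem slow_cons {A : X → V →L[ℝ] V} {S F : Multiset ℝ} {γ : ℝ}
    (hs : HasSpec T n A (S + F)) (hγ : γ ∉ S) (x : X) :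
    slow T n A (γ ::ₘ F) x = slow T n A F x := by
  set M := (it T A n x).toLinearMap with hM
  set p := (F.map fun r => Polynomial.X - C r).prod with hp
  have e : ∀ v, aeval M ((γ ::ₘ F).map fun r => Polynomial.X - C r).prod v =
      M (aeval M p v) - γ • aeval M p v := by
    intro v
    rw [Multiset.map_cons, Multiset.prod_cons, map_mul]
    simp [hp]
  have e' : ∀ v, aeval M ((γ ::ₘ F).map fun r => Polynomial.X - C r).prod v =
      aeval M p (M v - γ • v) := by
    intro v
    rw [Multiset.map_cons, Multiset.prod_cons, mul_comm, map_mul]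
    simp [hp]
  have hle : slow T n A (γ ::ₘ F) x ≤ slow T n A F x := by
    rintro _ ⟨v, rfl⟩
    exact ⟨_, (e' v).symm⟩
  let N : V →ₗ[ℝ] V := M - γ • LinearMap.id
  have hmaps : ∀ v ∈ slow T n A F x, N v ∈ slow T n A F x := by
    rintro _ ⟨v, rfl⟩
    exact hle ⟨v, by rw [← hM, e]; rfl⟩
  have hinj : Function.Injective (N.restrict hmaps) := by
    rw [injective_iff_map_eq_zero]
    rintro ⟨v, hv⟩ h
    have h1 : M v = γ • v := by
      have := congrArg Subtype.val h
      simpa [N, sub_eq_zero] using this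
    by_contra h0
    exact notMem_slow_of_eigen hs h1 hγ (fun h2 => h0 (Subtype.ext h2)) hv
  refine le_antisymm hle ?_
  intro v hv
  obtain ⟨⟨w, hw⟩, h⟩ := LinearMap.injective_iff_surjective.1 hinj ⟨v, hv⟩
  have h1 : M w - γ • w = v := congrArg Subtype.val h
  obtain ⟨u, rfl⟩ := hw
  exact ⟨u, by rw [← h1, ← e]⟩

/-- An invariant line makes a definite angle with the invariant line of rate `c`, if it is
dominated in a summable way. -/
theorem line_angle {A : X → V →L[ℝ] V} {K S : ℝ} (hK : 1 ≤ K) (hA : Bdd A K) (hS : 0 ≤ S)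
    (hT : IsCyc T n) {φ : X → Frame V ℝ W₂} {c : X → ℝ} {Q : X → W₂ →L[ℝ] W₂}
    (hb : Block T (fun x => (φ x).toAlgFrame) A (fun x => c x • ContinuousLinearMap.id ℝ ℝ) Q)
    {e : X → V} {a : X → ℝ} (he : ∀ x, ‖e x‖ = 1) (hae : ∀ x, A x (e x) = a x • e (T x))
    (hea : ∀ x, (φ x).i' (e x) ≠ 0)
    (hsum : ∀ x, ∑ j ∈ Finset.range n, sp T (fun y => |a y| * ‖(φ (T y)).i' (e (T y))‖ /
      ‖(φ y).i' (e y)‖ / |c y|) j x ≤ S)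
    (hn : ∀ x, sp T (fun y => |a y| * ‖(φ (T y)).i' (e (T y))‖ /
      ‖(φ y).i' (e y)‖ / |c y|) n x ≤ 1 / 2) (x : X) :
    1 / (1 + 2 * K ^ 2 * S) ≤ ‖(φ x).i' (e x)‖ := by
  have hK0 : 0 < K := by linarith
  set t : X → ℝ := fun y => ‖(φ y).i' (e y)‖ with ht
  set u : X → ℝ := fun y => |a y| * t (T y) / t y / |c y| with hu
  -- `Y` is the cotangent of the angle between `e` and the line of rate `c`. After one period the
  -- recursion returns to `Y x` with a factor at most `1 / 2`, so `Y` is bounded by the accumulated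
  -- errors.
  set Y : X → ℝ := fun y => ‖(φ y).k' (e y)‖ / t y with hY
  have ht0 : ∀ y, 0 < t y := fun y => norm_pos_iff.2 (hea y)
  have hY0 : ∀ y, 0 ≤ Y y := fun y => div_nonneg (norm_nonneg _) (ht0 y).le
  have hstep : ∀ y, Y y ≤ u y * Y (T y) + K ^ 2 := by
    intro y
    obtain ⟨-, h1, hc0⟩ := hA.rate hK0.le hb y
    have hc := abs_pos.2 hc0
    have e1 : A y (e y) = (φ (T y)).k (c y * (φ y).k' (e y)) + A y ((φ y).i ((φ y).i' (e y))) := by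
      conv_lhs => rw [← (φ y).id (e y)]
      rw [map_add, hb.sub]
      rfl
    have e2 := congrArg (φ (T y)).k' e1
    rw [hae, map_smul, map_add, (φ (T y)).kk, smul_eq_mul] at e2
    have h2 : ‖(φ (T y)).k' (A y ((φ y).i ((φ y).i' (e y))))‖ ≤ K * t y := by
      calc _ ≤ ‖A y ((φ y).i ((φ y).i' (e y)))‖ := (φ (T y)).norm_k'_le _
        _ ≤ K * ‖(φ y).i ((φ y).i' (e y))‖ := hA.le _ _
        _ = _ := by rw [Frame.norm_i]
    have h3 : |c y| * ‖(φ y).k' (e y)‖ ≤ |a y| * ‖(φ (T y)).k' (e (T y))‖ + K * t y := by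
      simp only [Real.norm_eq_abs] at h2 ⊢
      rw [← abs_mul, ← abs_mul]
      have : c y * (φ y).k' (e y) =
        a y * (φ (T y)).k' (e (T y)) - (φ (T y)).k' (A y ((φ y).i ((φ y).i' (e y)))) := by linarith
      rw [this]
      exact (abs_sub _ _).trans (by linarith)
    have h4 := ht0 y
    have h5 := ht0 (T y)
    have e3 : u y * Y (T y) + K ^ 2 =
        (|a y| * ‖(φ (T y)).k' (e (T y))‖ + K * (K * |c y|) * t y) / (|c y| * t y) := by
      simp only [hu, hY]
      field_simp
    rw [e3]
    simp only [hY]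
    rw [div_le_div_iff₀ h4 (by positivity)]
    have h6 : K * t y ≤ K * (K * |c y|) * t y := by
      have : K * 1 ≤ K * (K * |c y|) := by gcongr
      nlinarith
    nlinarith [ht0 y]
  have hu0 : ∀ y, 0 ≤ u y := fun y => by
    have := ht0 y
    have := ht0 (T y)
    simp only [hu]; positivity
  have hiter : ∀ m y, Y y ≤ sp T u m y * Y (T^[m] y) +
      K ^ 2 * ∑ j ∈ Finset.range m, sp T u j y := by
    intro m
    induction m with
    | zero => intro y; simp
    | succ m ih =>
      intro y
      have h1 := hstep (T^[m] y)
      have h2 : 0 ≤ sp T u m y := Finset.prod_nonneg fun _ _ => hu0 _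
      rw [Finset.sum_range_succ, sp_succ', Function.iterate_succ_apply']
      nlinarith [ih y, mul_le_mul_of_nonneg_left h1 h2]
  have h1 := hiter n x
  rw [hT.per] at h1
  have h2 : Y x ≤ 2 * K ^ 2 * S := by
    have h3 := mul_le_mul_of_nonneg_right (hn x) (hY0 x)
    have h4 := mul_le_mul_of_nonneg_left (hsum x) (by positivity : 0 ≤ K ^ 2)
    linarith
  have h3 : ‖(φ x).k' (e x)‖ ≤ 2 * K ^ 2 * S * t x := by
    rw [← div_le_iff₀ (ht0 x)]; exact h2
  have h4 := (φ x).norm_le (e x)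
  rw [he] at h4
  rw [div_le_iff₀ (by positivity)]
  change 1 ≤ t x * _
  change 1 ≤ _ + t x at h4
  linarith

end SlowBundle

/-! ### Domination when the relative growth sums are bounded -/

section SummableDomination

theorem qd_quot_le {V W : Type*} [NormedAddCommGroup V] [InnerProductSpace ℝ V]
    [FiniteDimensional ℝ V] [NormedAddCommGroup W] [InnerProductSpace ℝ W] [FiniteDimensional ℝ W]
    {U : Type*} [NormedAddCommGroup U] [InnerProductSpace ℝ U]
    (φ : Frame V U W) {L : Submodule ℝ V} {M : Submodule ℝ W}
    (h : L.map φ.i'.toLinearMap ≤ M) (w : V) : qd M (φ.i' w) ≤ qd L w := by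
  obtain ⟨l, hl, h1, -⟩ := exists_qd_eq L w
  have h2 : φ.i' l ∈ M := h (Submodule.mem_map_of_mem hl)
  calc _ ≤ ‖φ.i' w - φ.i' l‖ := qd_le_norm_sub h2 _
    _ = ‖φ.i' (w - l)‖ := by rw [map_sub]
    _ ≤ _ := by rw [← h1]; exact φ.norm_i'_le _

variable {X V W : Type*} [NormedAddCommGroup V] [InnerProductSpace ℝ V]
  [FiniteDimensional ℝ V]
  [NormedAddCommGroup W] [InnerProductSpace ℝ W] [FiniteDimensional ℝ W]
  {T : Equiv.Perm X} {n : ℕ}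

theorem Block.it_k_one {φ : X → AlgFrame V ℝ W} {A : X → V →L[ℝ] V} {c : X → ℝ}
    {Q : X → W →L[ℝ] W} (hT : IsCyc T n)
    (hb : Block T φ A (fun x => c x • ContinuousLinearMap.id ℝ ℝ) Q) {γ : ℝ}
    (hγ : ∀ x, sp T c n x = γ) (x : X) : it T A n x ((φ x).k 1) = γ • (φ x).k 1 := by
  rw [hb.it_sub, hT.per, it_smul_id, hγ, ← map_smul]
  rfl

theorem Block.map_k_one {φ : X → AlgFrame V ℝ W} {A : X → V →L[ℝ] V} {c : X → ℝ}
    {Q : X → W →L[ℝ] W}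
    (hb : Block T φ A (fun x => c x • ContinuousLinearMap.id ℝ ℝ) Q) (x : X) :
    A x ((φ x).k 1) = c x • (φ (T x)).k 1 := by
  rw [hb.sub, ← map_smul]
  rfl

/-- The relative growth rate of the image of a line field `e` of rate `a` in the quotient by a
line field of rate `c`. -/
noncomputable def relRate (T : Equiv.Perm X) (φ : X → Frame V ℝ W) (e : X → V) (a c : X → ℝ)
    (y : X) : ℝ :=
  |a y| * ‖(φ (T y)).i' (e (T y))‖ / ‖(φ y).i' (e y)‖ / |c y|

-- Bounded sums make the relative rate decay exponentially, and then the slow line makes a definite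
-- angle with the line of rate `c` (`line_angle`). The domination of `B` gives such an angle modulo
-- the slow line (`exists_angle`). Together they separate the whole of `L` from the line of rate
-- `c`. So `dom_line_of_quot` shows that the slow line is dominated by `V ⧸ L`, and `dom_of_line`
-- extends this to all of `L`.
set_option maxHeartbeats 1000000 in
theorem dom_of_sum_le {K C θ S : ℝ} (hK : 1 ≤ K) (hC : 0 ≤ C) (hθ0 : 0 < θ) (hθ1 : θ < 1)
    (hS : 0 ≤ S) : ∃ (C' θ' : ℝ) (N : ℕ), 0 ≤ C' ∧ 0 < θ' ∧ θ' < 1 ∧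
      ∀ {X V W : Type*} [NormedAddCommGroup V] [InnerProductSpace ℝ V] [FiniteDimensional ℝ V]
        [NormedAddCommGroup W] [InnerProductSpace ℝ W] [FiniteDimensional ℝ W]
        {T : Equiv.Perm X} {n : ℕ} (_ : IsCyc T n) (_ : N ≤ n)
        {A : X → V →L[ℝ] V} (_ : Bdd A K) {φ ψ : X → Frame V ℝ W} {a c : X → ℝ}
        {Q B : X → W →L[ℝ] W}
        (_ : Block T (fun x => (φ x).toAlgFrame) A (fun x => c x • ContinuousLinearMap.id ℝ ℝ) Q)
        (_ : Block T (fun x => (ψ x).toAlgFrame) A (fun x => a x • ContinuousLinearMap.id ℝ ℝ) B)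
        {r γ : ℝ} {S₁ F : Multiset ℝ} (_ : ∀ x, sp T a n x = r) (_ : ∀ x, sp T c n x = γ)
        (_ : HasSpec T n A (γ ::ₘ r ::ₘ (S₁ + F))) (_ : r ∉ γ ::ₘ F) (_ : γ ∉ r ::ₘ S₁)
        (_ : Dom T Q (slow T n Q F) C θ) (_ : Dom T B (slow T n B (γ ::ₘ F)) C θ)
        (_ : ∀ x, ∑ j ∈ Finset.range n, sp T (relRate T φ (fun x => (ψ x).k 1) a c) j x ≤ S),
        Dom T A (slow T n A (γ ::ₘ F)) C' θ' := by
  have hK0 : 0 < K := by linarith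
  obtain ⟨N, hN⟩ := exists_nat_gt (2 * S ^ 2)
  have hN0 : 0 < N := by
    have : (0 : ℝ) < N := lt_of_le_of_lt (by positivity) hN
    exact_mod_cast this
  obtain ⟨θ₁, hθ₁, hθ₁', hθ₁N⟩ := exists_theta hN0
  have hθ₁0 : 0 < θ₁ := by linarith
  set C₁ := 2 * (K * K) ^ N with hC₁
  obtain ⟨N₁, hN₁⟩ : ∃ N₁ : ℕ, C₁ * θ₁ ^ N₁ ≤ 1 / 2 := by
    have h := (tendsto_pow_atTop_nhds_zero_of_lt_one hθ₁0.le hθ₁').const_mul C₁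
    rw [mul_zero] at h
    exact (h.eventually (ge_mem_nhds (by norm_num : (0 : ℝ) < 1 / 2))).exists
  set g := 1 / (1 + 2 * K ^ 2 * S) with hg
  have hg0 : 0 < g := by positivity
  have hg1 : g ≤ 1 := by rw [hg, div_le_one (by positivity)]; nlinarith [mul_nonneg (sq_nonneg K) hS]
  obtain ⟨δ, hδ0, hδ1, hδ⟩ := exists_angle (C := C) hθ0 hθ1 hK
  set C₂ := max C C₁
  have hC₁0 : 0 ≤ C₁ := by positivity
  have hC₂0 : 0 ≤ C₂ := hC.trans (le_max_left _ _)
  set θ₂ := max θ θ₁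
  have hθ₂0 : 0 < θ₂ := lt_max_of_lt_left hθ0
  obtain ⟨E₁, θ₃, hE₁, hθ₃, hθ₃1, habs₁⟩ := exists_absorb hθ₂0 (max_lt hθ1 hθ₁')
  have hθ₃0 : 0 < θ₃ := hθ₂0.trans_le hθ₃
  obtain ⟨E₂, θ₄, hE₂, hθ₄, hθ₄1, habs₂⟩ := exists_absorb hθ₃0 hθ₃1
  -- The fast unit vector keeps norm at least `g / 2` modulo the slow line, and there its angle with
  -- the image of `L` is controlled by `δ`.
  set δ' := δ * (g / 2) with hδ'
  have hδ'0 : 0 < δ' := by positivity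
  set C₃ := C₂ + 2 * C₂ / δ' + 2 * K / δ' * K * C₂ ^ 2
  have hC₃ : 0 ≤ C₃ := by positivity
  set C₄ := max C (C₃ * E₁ / g)
  have hC₄ : 0 ≤ C₄ := hC.trans (le_max_left _ _)
  refine ⟨(2 * C₄ + K ^ 2 * C₄ ^ 2 / θ₃) * E₂, θ₄, max (N + 1) N₁, by positivity,
    hθ₃0.trans_le hθ₄, hθ₄1, ?_⟩
  intro X V W _ _ _ _ _ _ T n hT hn A hA φ ψ a c Q B hφ hψ r γ S₁ F ha hc hs hr hγ hdQ hdB hsum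
  have hnN : N < n := lt_of_lt_of_le (Nat.lt_succ_self _) ((le_max_left _ _).trans hn)
  have hnN₁ : N₁ ≤ n := (le_max_right _ _).trans hn
  set L := slow T n A (γ ::ₘ F) with hL
  have hc0 : ∀ x, c x ≠ 0 := fun x => (hA.rate hK0.le hφ x).2.2
  have ha0 : ∀ x, a x ≠ 0 := fun x => (hA.rate hK0.le hψ x).2.2
  have hQ := hφ.bdd_quot hK0.le hA
  have hB := hψ.bdd_quot hK0.le hA
  have hsQ : HasSpec T n Q (r ::ₘ S₁ + F) := by
    have := hφ.hasSpec_quot hc0 hT hs hc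
    rwa [Multiset.cons_add]
  have hsB : HasSpec T n B (S₁ + γ ::ₘ F) := by
    rw [Multiset.cons_swap] at hs
    have := hψ.hasSpec_quot ha0 hT hs ha
    rwa [Multiset.add_cons]
  have hsA : HasSpec T n A (r ::ₘ S₁ + γ ::ₘ F) := by
    rwa [Multiset.add_cons, Multiset.cons_add]
  have hLinv : ∀ x, (L x).map (A x).toLinearMap = L (T x) := fun x =>
    slow_map hT hA.bijective _ x
  have hLQ : ∀ x, (L x).map (φ x).i'.toLinearMap = slow T n Q F x := fun x => by
    rw [← slow_cons hsQ hγ x]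
    exact hφ.slow_quot hT _ x
  have hLB : ∀ x, (L x).map (ψ x).i'.toLinearMap = slow T n B (γ ::ₘ F) x := fun x =>
    hψ.slow_quot hT _ x
  set e : X → V := fun x => (ψ x).k 1 with he
  have he1 : ∀ x, ‖e x‖ = 1 := fun x => by simp [he]
  have hae : ∀ x, A x (e x) = a x • e (T x) := hψ.map_k_one
  have hen : ∀ x, it T A n x (e x) = r • e x := hψ.it_k_one hT ha
  have heL : ∀ x, e x ∈ L x := fun x => mem_slow_of_eigen (hen x) hr
  have hrγ : r ≠ γ := fun h => hr (by simp [h])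
  set t : X → ℝ := fun y => ‖(φ y).i' (e y)‖ with ht
  have ht0 : ∀ y, 0 < t y := by
    intro y
    refine norm_pos_iff.2 fun h0 => ?_
    have h1 : e y = (φ y).k ((φ y).k' (e y)) := by
      conv_lhs => rw [← (φ y).id (e y), h0, map_zero, add_zero]
    have h2 := hφ.it_sub n y ((φ y).k' (e y))
    rw [hT.per, it_smul_id, hc, ← h1, hen] at h2
    simp only [smul_apply, ContinuousLinearMap.id_apply, map_smul] at h2
    rw [← h1, ← sub_eq_zero, ← sub_smul] at h2
    have h3 : e y ≠ 0 := fun h => by have := he1 y; simp [h] at this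
    exact smul_ne_zero (sub_ne_zero.2 hrγ) h3 h2
  have ht1 : ∀ y, t y ≤ 1 := fun y => by
    have := (φ y).norm_i'_le (e y)
    rwa [he1] at this
  have hLM : ∀ x v, v ∈ L x ↔ (ψ x).i' v ∈ slow T n B (γ ::ₘ F) x := by
    intro x v
    constructor
    · intro h
      rw [← hLB]
      exact Submodule.mem_map_of_mem h
    · intro h
      rw [← hLB] at h
      obtain ⟨w, hw, hwv⟩ := h
      have h1 : v = w + (ψ x).k' (v - w) • e x := by
        have h2 := (ψ x).id (v - w)
        have h3 : (ψ x).i' (v - w) = 0 := by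
          rw [map_sub, sub_eq_zero]; exact hwv.symm
        rw [h3, map_zero, add_zero] at h2
        simp only [he]
        rw [← map_smul, smul_eq_mul, mul_one, h2]
        abel
      rw [h1]
      exact add_mem hw (Submodule.smul_mem _ _ (heL x))
  -- the rate of the line in the quotient
  set f : X → W := fun y => (φ y).i' (e y) with hf
  have hQf : ∀ y, Q y (f y) = a y • f (T y) := fun y => by
    simp only [hf]; rw [← hφ.quot, hae, map_smul]
  have hfM : ∀ y, f y ∈ slow T n Q F y := fun y => by
    rw [← hLQ]; exact Submodule.mem_map_of_mem (heL y)
  set b : X → ℝ := fun y => |a y| * t (T y) / t y with hb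
  have hb0 : ∀ y, 0 < b y := fun y => by
    have := ht0 y; have := ht0 (T y); have := abs_pos.2 (ha0 y)
    simp only [hb]; positivity
  have hbt : ∀ m y, sp T b m y * t y = |sp T a m y| * t (T^[m] y) := by
    intro m
    induction m with
    | zero => intro y; simp
    | succ m ih =>
      intro y
      have h1 := ht0 (T^[m] y)
      rw [sp_succ', mul_right_comm, ih, sp_succ', abs_mul, Function.iterate_succ_apply']
      simp only [hb]
      field_simp
  have hbQ : ∀ m y, sp T b m y * t y = ‖it T Q m y (f y)‖ := fun m y => by
    rw [hbt, it_eigenline hQf, norm_smul, Real.norm_eq_abs]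
  have hbK : ∀ y, b y ≤ K := fun y => by
    have h1 := hbQ 1 y
    rw [sp_one, it_one] at h1
    have h2 := hQ.le y (f y)
    rw [← h1] at h2
    exact le_of_mul_le_mul_right h2 (ht0 y)
  set u := relRate T φ e a c with hu
  have hub : ∀ y, u y = b y / |c y| := fun y => rfl
  have hu1 : ∀ y, 0 < u y ∧ u y ≤ K * K := fun y => by
    have h1 := abs_pos.2 (hc0 y)
    have h2 := (hA.rate hK0.le hφ y).2.1
    refine ⟨by rw [hub]; exact div_pos (hb0 y) h1, ?_⟩
    rw [hub, div_le_iff₀ h1]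
    nlinarith [hbK y]
  have hum : ∀ m y, sp T u m y ≤ C₁ * θ₁ ^ m := fun m y =>
    sp_decay_of_step hN0 (by nlinarith) hu1 hθ₁0 hθ₁'.le hθ₁N
      (sp_step_of_sum hS hN.le hN0 hnN (fun y => (hu1 y).1) hsum) m y
  have hun : ∀ y, sp T u n y ≤ 1 / 2 := fun y =>
    ((hum n y).trans (by
      have := pow_le_pow_of_le_one hθ₁0.le hθ₁'.le hnN₁
      gcongr)).trans hN₁
  have htg : ∀ y, g ≤ t y := line_angle hK hA hS hT hφ he1 hae
    (fun y => norm_pos_iff.1 (ht0 y)) hsum hun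
  -- the angle between `L` and the line of rate `c`
  have hkL : ∀ x, (φ x).k 1 ∉ L x := fun x =>
    notMem_slow_of_eigen hsA (hφ.it_k_one hT hc x) hγ (by
      have := (φ x).norm_k 1
      intro h0
      simp [h0] at this)
  have hang : ∀ x, δ' ≤ qd (L x) ((φ x).k 1) := by
    intro x
    have h1 := hδ hT hB (fun x => slow_map hT hB.bijective (γ ::ₘ F) x) hdB
      (f := fun x => (ψ x).i' ((φ x).k 1)) (c := c)
      (fun x => by rw [← hψ.quot, hφ.map_k_one, map_smul])
      (fun x hx => hkL x ((hLM x _).2 hx)) x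
    have h2 : g / 2 ≤ ‖(ψ x).i' ((φ x).k 1)‖ := by
      set s : ℝ := (ψ x).k' ((φ x).k 1)
      have h3 : (φ x).k 1 - s • e x = (ψ x).i ((ψ x).i' ((φ x).k 1)) := by
        rw [sub_eq_iff_eq_add, add_comm]
        conv_lhs => rw [← (ψ x).id ((φ x).k 1)]
        simp only [he, s]
        rw [← map_smul, smul_eq_mul, mul_one]
      have h4 : ‖(ψ x).i' ((φ x).k 1)‖ = ‖(φ x).k 1 - s • e x‖ := by rw [h3, Frame.norm_i]
      rw [h4]
      -- For large `s` the component of `s • e x` transverse to the fast line has norm at least `g /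
      -- 2`; for small `s` the vector `s • e x` is too short to cancel a unit vector.
      rcases le_total (1 / 2) |s| with h | h
      · have h5 := (φ x).norm_i'_le ((φ x).k 1 - s • e x)
        rw [map_sub, (φ x).ik, map_smul, zero_sub, norm_neg, norm_smul, Real.norm_eq_abs] at h5
        refine le_trans ?_ h5
        have := htg x
        change _ ≤ |s| * t x
        nlinarith
      · have h5 := norm_sub_norm_le ((φ x).k 1) (s • e x)
        rw [norm_smul, he1, Frame.norm_k, norm_one, mul_one, Real.norm_eq_abs] at h5
        linarith
    calc δ' ≤ δ * ‖(ψ x).i' ((φ x).k 1)‖ := by rw [hδ']; gcongr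
      _ ≤ _ := h1
      _ ≤ _ := qd_quot_le (ψ x) (hLB x).le _
  have hline := dom_line_of_quot (C := C₂) (θ := θ₂) (a := b) hK hA hC₂0 hθ₂0 hδ'0 hφ hLinv
    (fun x => slow_map hT hQ.bijective F x) hLQ hang hb0
    (fun x m w => by
      have h1 := hdQ x m (f x) (hfM x) w
      rw [← hbQ] at h1
      refine le_of_mul_le_mul_left ?_ (ht0 x)
      have h2 := qd_nonneg (slow T n Q F (T^[m] x)) (it T Q m x w)
      calc t x * (sp T b m x * qd (slow T n Q F x) w)
          = sp T b m x * t x * qd (slow T n Q F x) w := by ring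
        _ ≤ C * θ ^ m * (t x * qd (slow T n Q F (T^[m] x)) (it T Q m x w)) := h1
        _ ≤ C₂ * θ₂ ^ m * (t x * qd (slow T n Q F (T^[m] x)) (it T Q m x w)) := by
          have := (ht0 x).le
          gcongr
          · exact le_max_left _ _
          · exact le_max_left _ _
        _ = _ := by ring)
    (fun x m => by
      have h1 := abs_pos.2 (sp_ne_zero (T := T) hc0 m x)
      have h2 : sp T u m x = sp T b m x / |sp T c m x| := by
        rw [← sp_abs, ← sp_div]; rfl
      have h3 := hum m x
      rw [h2, div_le_iff₀ h1] at h3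
      refine h3.trans ?_
      gcongr
      · exact le_max_right _ _
      · exact le_max_right _ _)
  refine dom_of_line (C := C₄) (θ := θ₃) hK hA hC₄ hθ₃0 habs₂ hψ
    (fun x => slow_map hT hB.bijective (γ ::ₘ F) x) hLM
    (hdB.mono (le_max_left _ _) hC₄ hθ0.le ((le_max_left _ _).trans hθ₃)) fun x m w => ?_
  have h1 := hline x m w
  have h2 := hbt m x
  have h3 := qd_nonneg (L (T^[m] x)) (it T A m x w)
  have h4 := qd_nonneg (L x) w
  -- The products of `|a|` and of `b` differ by a quotient of values of `t`, all of which lie in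
  -- `[g, 1]`.
  have h5 : |sp T a m x| * g ≤ sp T b m x := by
    calc |sp T a m x| * g ≤ |sp T a m x| * t (T^[m] x) := by gcongr; exact htg _
      _ = sp T b m x * t x := h2.symm
      _ ≤ sp T b m x * 1 := by
          have := (sp_pos (T := T) hb0 m x).le
          gcongr
          exact ht1 x
      _ = _ := mul_one _
  have h6 : |sp T a m x| * g * qd (L x) w ≤
      C₃ * (E₁ * θ₃ ^ m) * qd (L (T^[m] x)) (it T A m x w) := by
    calc _ ≤ sp T b m x * qd (L x) w := by gcongr
      _ ≤ _ := h1
      _ ≤ _ := mul_le_mul_of_nonneg_right (mul_le_mul_of_nonneg_left (habs₁ m) hC₃) h3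
  calc |sp T a m x| * qd (L x) w = |sp T a m x| * g * qd (L x) w / g := by
        rw [eq_div_iff hg0.ne']; ring
    _ ≤ C₃ * (E₁ * θ₃ ^ m) * qd (L (T^[m] x)) (it T A m x w) / g :=
        div_le_div_of_nonneg_right h6 hg0.le
    _ = C₃ * E₁ / g * θ₃ ^ m * qd (L (T^[m] x)) (it T A m x w) := by ring
    _ ≤ _ := mul_le_mul_of_nonneg_right (mul_le_mul_of_nonneg_right (le_max_right _ _)
        (pow_nonneg hθ₃0.le m)) h3

end SummableDomination

/-! ### Invariant complements of a line and the twisted cohomological equation -/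

section Complement

variable {X V W : Type*} [NormedAddCommGroup V] [InnerProductSpace ℝ V]
  [FiniteDimensional ℝ V]
  [NormedAddCommGroup W] [InnerProductSpace ℝ W] [FiniteDimensional ℝ W]
  {T : Equiv.Perm X} {n : ℕ}

/-- The twisted Birkhoff sum of the functionals `b` over a period. -/
noncomputable def twistedSum (T : Equiv.Perm X) (n : ℕ) (c : X → ℝ) (Q : X → W →L[ℝ] W)
    (b : X → W →L[ℝ] ℝ) (x : X) : W →L[ℝ] ℝ :=
  ∑ j ∈ Finset.range n, (sp T c (j + 1) x)⁻¹ • (b (T^[j] x)).comp (it T Q j x)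

/-- The solution of the twisted cohomological equation. -/
noncomputable def twistedSol (T : Equiv.Perm X) (n : ℕ) (c : X → ℝ) (Q : X → W →L[ℝ] W)
    (b : X → W →L[ℝ] ℝ) (x : X) : W →L[ℝ] ℝ :=
  -(twistedSum T n c Q b x).comp (Ring.inverse (1 - (sp T c n x)⁻¹ • it T Q n x))

theorem twistedSum_step (hT : IsCyc T n) {c : X → ℝ} (hc : ∀ x, c x ≠ 0) (Q : X → W →L[ℝ] W)
    (b : X → W →L[ℝ] ℝ) (x : X) (w : W) :
    c x * twistedSum T n c Q b x w = twistedSum T n c Q b (T x) (Q x w) +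
      (b x w - (sp T c n x)⁻¹ * b x (it T Q n x w)) := by
  set g : ℕ → ℝ := fun j => (sp T c j (T x))⁻¹ * b (T^[j] x) (it T Q j x w) with hg
  have h1 : c x * twistedSum T n c Q b x w = ∑ j ∈ Finset.range n, g j := by
    simp only [twistedSum, sum_apply, Finset.mul_sum]
    refine Finset.sum_congr rfl fun j _ => ?_
    simp only [hg, smul_apply, ContinuousLinearMap.comp_apply, smul_eq_mul]
    rw [sp_succ, mul_inv, ← mul_assoc, ← mul_assoc, mul_inv_cancel₀ (hc x), one_mul]
  have h2 : twistedSum T n c Q b (T x) (Q x w) = ∑ j ∈ Finset.range n, g (j + 1) := by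
    simp only [twistedSum, sum_apply]
    refine Finset.sum_congr rfl fun j _ => ?_
    simp only [hg, smul_apply, ContinuousLinearMap.comp_apply, smul_eq_mul, it_succ,
      Function.iterate_succ_apply]
  have h3 : g 0 = b x w := by simp [hg]
  have h4 : g n = (sp T c n x)⁻¹ * b x (it T Q n x w) := by
    simp only [hg, hT.per, sp_per hT hc (T x) x]
  rw [h1, h2, ← h3, ← h4]
  have := Finset.sum_range_sub' g n
  rw [Finset.sum_sub_distrib] at this
  linarith

theorem twistedSol_mul {c : X → ℝ} {Q : X → W →L[ℝ] W} (b : X → W →L[ℝ] ℝ) {x : X}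
    (hu : IsUnit (1 - (sp T c n x)⁻¹ • it T Q n x)) (w : W) :
    twistedSol T n c Q b x (w - (sp T c n x)⁻¹ • it T Q n x w) = -twistedSum T n c Q b x w := by
  have h := Ring.inverse_mul_cancel _ hu
  have h1 := DFunLike.congr_fun h w
  simp only [twistedSol, neg_apply, ContinuousLinearMap.comp_apply]
  congr 2

/-- When `b` is the off-diagonal block, this equation says that the graph of the solution is an
invariant complement of the line of rate `c`. The sum over a period solves it up to a boundary term,
which the inverse of `1 - (sp T c n x)⁻¹ • it T Q n x` removes. -/
theorem twistedSol_eq (hT : IsCyc T n) {c : X → ℝ} (hc : ∀ x, c x ≠ 0) {Q : X → W →L[ℝ] W}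
    (b : X → W →L[ℝ] ℝ) (hu : ∀ x, IsUnit (1 - (sp T c n x)⁻¹ • it T Q n x)) (x : X) (w : W) :
    twistedSol T n c Q b (T x) (Q x w) = c x * twistedSol T n c Q b x w + b x w := by
  obtain ⟨v, rfl⟩ : ∃ v, w = v - (sp T c n x)⁻¹ • it T Q n x v :=
    ⟨Ring.inverse (1 - (sp T c n x)⁻¹ • it T Q n x) w, by
      have := DFunLike.congr_fun (Ring.mul_inverse_cancel _ (hu x)) w
      exact this.symm⟩
  have h1 : Q x (v - (sp T c n x)⁻¹ • it T Q n x v) =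
      Q x v - (sp T c n (T x))⁻¹ • it T Q n (T x) (Q x v) := by
    rw [map_sub, map_smul, sp_per hT hc (T x) x]
    congr 2
    exact (DFunLike.congr_fun (it_per_comm hT Q x) v).symm
  rw [h1, twistedSol_mul b (hu _), twistedSol_mul b (hu _), mul_neg, twistedSum_step hT hc,
    map_sub, map_smul, smul_eq_mul]
  ring

theorem twistedSum_eigen {c p : X → ℝ} {Q : X → W →L[ℝ] W} {f : X → W}
    (hf : ∀ x, Q x (f x) = p x • f (T x)) (b : X → W →L[ℝ] ℝ) (x : X) :
    twistedSum T n c Q b x (f x) =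
      ∑ j ∈ Finset.range n, b (T^[j] x) (f (T^[j] x)) * (sp T p j x / sp T c (j + 1) x) := by
  simp only [twistedSum, sum_apply]
  refine Finset.sum_congr rfl fun j _ => ?_
  simp only [smul_apply, ContinuousLinearMap.comp_apply, smul_eq_mul]
  rw [it_eigenline hf, map_smul, smul_eq_mul]
  ring

/-- On an eigenvector the solution is the sum divided, up to sign, by one minus a ratio of modulus
at most `1`. A large sum therefore forces a solution at least half as large. -/
theorem abs_twistedSum_le {c p : X → ℝ} {Q : X → W →L[ℝ] W} {f : X → W}
    (hf : ∀ x, Q x (f x) = p x • f (T x)) (hfn : ∀ x, it T Q n x (f x) = sp T p n x • f x)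
    (b : X → W →L[ℝ] ℝ) {x : X} (hu : IsUnit (1 - (sp T c n x)⁻¹ • it T Q n x))
    (hp : |sp T p n x| ≤ |sp T c n x|) :
    |∑ j ∈ Finset.range n, b (T^[j] x) (f (T^[j] x)) * (sp T p j x / sp T c (j + 1) x)| ≤
      2 * |twistedSol T n c Q b x (f x)| := by
  have h1 := twistedSol_mul b hu (f x)
  rw [twistedSum_eigen hf, hfn, smul_smul] at h1
  have h2 : f x - ((sp T c n x)⁻¹ * sp T p n x) • f x =
      (1 - (sp T c n x)⁻¹ * sp T p n x) • f x := by rw [sub_smul, one_smul]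
  rw [h2, map_smul, smul_eq_mul] at h1
  rw [← abs_neg, ← h1, abs_mul]
  gcongr
  have h3 : |(sp T c n x)⁻¹ * sp T p n x| ≤ 1 := by
    rw [abs_mul, abs_inv, inv_mul_eq_div]
    exact div_le_one_of_le₀ hp (abs_nonneg _)
  calc _ ≤ |(1 : ℝ)| + |(sp T c n x)⁻¹ * sp T p n x| := abs_sub _ _
    _ ≤ 2 := by rw [abs_one]; linarith

/-- A definite angle between `f` and `h` bounds the functionals dual to them. It is what allows the
same small perturbation to act on the two lines independently. -/
theorem exists_dual_of_qd {f h : W} (hf : ‖f‖ = 1) (hh : ‖h‖ = 1) {δ : ℝ} (hδ0 : 0 < δ)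
    (hδ1 : δ ≤ 1) (hq : ∀ s : ℝ, δ ≤ ‖h - s • f‖) :
    ∃ F H : W →L[ℝ] ℝ, F f = 1 ∧ F h = 0 ∧ H f = 0 ∧ H h = 1 ∧ ‖F‖ ≤ 2 / δ ∧ ‖H‖ ≤ 2 / δ := by
  have key : ∀ (f h : W) (δ : ℝ), 0 < δ → (∀ s : ℝ, δ ≤ ‖h - s • f‖) →
      ∃ H : W →L[ℝ] ℝ, H f = 0 ∧ H h = 1 ∧ ‖H‖ ≤ 1 / δ := by
    intro f h δ hδ hq
    obtain ⟨l, hl, h1, -⟩ := exists_qd_eq (ℝ ∙ f) h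
    obtain ⟨s, rfl⟩ := Submodule.mem_span_singleton.1 hl
    have h2 := hq s
    set g := (ℝ ∙ f)ᗮ.starProjection h with hg
    have hgδ : δ ≤ ‖g‖ := by rw [h1] at h2; exact h2
    have hg0 : 0 < ‖g‖ := hδ.trans_le hgδ
    have hgo : g ∈ (ℝ ∙ f)ᗮ := (ℝ ∙ f)ᗮ.starProjection_apply_mem h
    have hgf : inner ℝ g f = 0 :=
      Submodule.inner_left_of_mem_orthogonal (Submodule.mem_span_singleton_self f) hgo
    have hgh : inner ℝ g h = ‖g‖ ^ 2 := by
      have h3 : h = g + (h - g) := by abel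
      have h4 : inner ℝ g (h - g) = 0 := by
        rw [real_inner_comm]
        exact Submodule.starProjection_inner_eq_zero h g hgo
      conv_lhs => rw [h3]
      rw [inner_add_right, h4, add_zero, real_inner_self_eq_norm_sq]
    refine ⟨(‖g‖ ^ 2)⁻¹ • innerSL ℝ g, by simp [hgf], ?_, ?_⟩
    · simp only [smul_apply, innerSL_apply_apply, smul_eq_mul, hgh]
      exact inv_mul_cancel₀ (by positivity)
    · rw [norm_smul, innerSL_apply_norm, norm_inv, norm_pow, norm_norm]
      rw [show (‖g‖ ^ 2)⁻¹ * ‖g‖ = 1 / ‖g‖ by field_simp]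
      gcongr
  have hq' : ∀ s : ℝ, δ / 2 ≤ ‖f - s • h‖ := by
    intro s
    rcases le_total (1 / 2) |s| with hs | hs
    · have hs0 : s ≠ 0 := fun h0 => by norm_num [h0] at hs
      have h1 : f - s • h = (-s) • (h - s⁻¹ • f) := by
        rw [smul_sub, smul_smul, neg_smul, neg_mul, mul_inv_cancel₀ hs0]
        simp
        abel
      rw [h1, norm_smul, norm_neg, Real.norm_eq_abs]
      nlinarith [hq s⁻¹]
    · have h1 := norm_sub_norm_le f (s • h)
      rw [norm_smul, hf, hh, mul_one, Real.norm_eq_abs] at h1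
      linarith
  obtain ⟨H, h1, h2, h3⟩ := key f h δ hδ0 hq
  obtain ⟨F, h4, h5, h6⟩ := key h f (δ / 2) (by positivity) hq'
  refine ⟨F, H, h5, h4, h1, h2, h6.trans (by rw [one_div_div]), h3.trans ?_⟩
  gcongr
  norm_num

theorem exists_sign_add {a b : ℝ} : ∃ η : ℝ, |η| = 1 ∧ |b| ≤ |a + η * b| := by
  rcases le_total 0 (a * b) with h | h
  · refine ⟨1, by simp, ?_⟩
    rw [← sq_le_sq]; nlinarith [sq_nonneg a]
  · refine ⟨-1, by simp, ?_⟩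
    rw [← sq_le_sq]; nlinarith [sq_nonneg a]

/-- `D` adds prescribed values on `f` and on `h`. The signs along the orbit of `z` make the terms of
each twisted sum add up, and the global signs `η`, `τ` exclude cancellation with the contribution of
`b`. -/
theorem exists_steep_functional (hT : IsCyc T n) {c c' p q : X → ℝ} (hc0 : ∀ x, c x ≠ 0)
    {K δ ε : ℝ} (hK : 0 < K) (hcK : ∀ x, |c x| ≤ K)
    (hcc : ∀ j ≤ n, ∀ x, sp T c' j x ≠ 0 ∧ |sp T c' j x| ≤ 2 * |sp T c j x|)
    {Q : X → W →L[ℝ] W} {f h : X → W}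
    (hf : ∀ x, Q x (f x) = p x • f (T x)) (hh : ∀ x, Q x (h x) = q x • h (T x))
    (hf1 : ∀ x, ‖f x‖ = 1) (hh1 : ∀ x, ‖h x‖ = 1) (hδ0 : 0 < δ) (hδ1 : δ ≤ 1)
    (hq : ∀ x (s : ℝ), δ ≤ ‖h x - s • f x‖) (hε : 0 < ε) (b : X → W →L[ℝ] ℝ) (z : X)
    (hu : IsUnit (1 - (sp T c' n z)⁻¹ • it T Q n z))
    (hpn : |sp T p n z| ≤ |sp T c' n z|) (hqn : |sp T q n z| ≤ |sp T c' n z|) :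
    ∃ D : X → W →L[ℝ] ℝ, (∀ x, ‖D x‖ ≤ ε) ∧
      δ * ε / (16 * K) * ∑ j ∈ Finset.range n, |sp T p j z| / |sp T c j z| ≤
        |twistedSol T n c' Q (fun x => b x + D x) z (f z)| ∧
      δ * ε / (16 * K) * ∑ j ∈ Finset.range n, |sp T q j z| / |sp T c j z| ≤
        |twistedSol T n c' Q (fun x => b x + D x) z (h z)| := by
  choose F H hFf hFh hHf hHh hFn hHn using fun x =>
    exists_dual_of_qd (hf1 x) (hh1 x) hδ0 hδ1 (hq x)
  set ε' := δ * ε / 4 with hε'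
  have hε'0 : 0 < ε' := by positivity
  obtain ⟨s, hs, hsj⟩ := exists_signs hT z (g := fun j => sp T p j z / sp T c' (j + 1) z) hε'0.le
  obtain ⟨t, ht, htj⟩ := exists_signs hT z (g := fun j => sp T q j z / sp T c' (j + 1) z) hε'0.le
  obtain ⟨η, hη1, hη⟩ := exists_sign_add
    (a := ∑ j ∈ Finset.range n, b (T^[j] z) (f (T^[j] z)) * (sp T p j z / sp T c' (j + 1) z))
    (b := ∑ j ∈ Finset.range n, s (T^[j] z) * (sp T p j z / sp T c' (j + 1) z))
  obtain ⟨τ, hτ1, hτ⟩ := exists_sign_add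
    (a := ∑ j ∈ Finset.range n, b (T^[j] z) (h (T^[j] z)) * (sp T q j z / sp T c' (j + 1) z))
    (b := ∑ j ∈ Finset.range n, t (T^[j] z) * (sp T q j z / sp T c' (j + 1) z))
  have hn : ∀ (g : X → W) (r : X → ℝ), (∀ x, Q x (g x) = r x • g (T x)) →
      ∀ x, it T Q n x (g x) = sp T r n x • g x := fun g r hg x => by
    rw [it_eigenline hg, hT.per]
  have hlow : ∀ r : X → ℝ, ∀ σ : X → ℝ,
      (∀ j < n, σ (T^[j] z) * (sp T r j z / sp T c' (j + 1) z) =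
        ε' * |sp T r j z / sp T c' (j + 1) z|) →
      δ * ε / (16 * K) * ∑ j ∈ Finset.range n, |sp T r j z| / |sp T c j z| ≤
        |∑ j ∈ Finset.range n, σ (T^[j] z) * (sp T r j z / sp T c' (j + 1) z)| / 2 := by
    intro r σ hσ
    rw [le_div_iff₀ two_pos]
    refine le_trans ?_ (le_abs_self _)
    rw [Finset.mul_sum, Finset.sum_mul]
    refine Finset.sum_le_sum fun j hj => ?_
    have hj := Finset.mem_range.1 hj
    rw [hσ j hj, abs_div]
    obtain ⟨h1, h2⟩ := hcc (j + 1) hj z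
    have h3 : 0 < |sp T c j z| := abs_pos.2 (sp_ne_zero hc0 j z)
    have h4 : |sp T c' (j + 1) z| ≤ 2 * (|sp T c j z| * K) := by
      refine h2.trans ?_
      rw [sp_succ', abs_mul]
      gcongr
      exact hcK _
    have h5 : 0 < |sp T c' (j + 1) z| := abs_pos.2 h1
    calc δ * ε / (16 * K) * (|sp T r j z| / |sp T c j z|) * 2
        = ε' * (|sp T r j z| / (2 * (|sp T c j z| * K))) := by
          rw [hε']; field_simp; ring
      _ ≤ ε' * (|sp T r j z| / |sp T c' (j + 1) z|) := by gcongr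
  refine ⟨fun x => (η * s x) • F x + (τ * t x) • H x, fun x => ?_, ?_, ?_⟩
  · have e1 : ∀ (κ : ℝ) (a : ℝ) (G : W →L[ℝ] ℝ), |κ| = 1 → |a| ≤ ε' → ‖G‖ ≤ 2 / δ →
        ‖(κ * a) • G‖ ≤ ε / 2 := by
      intro κ a G h1 h2 h3
      rw [norm_smul, Real.norm_eq_abs, abs_mul, h1, one_mul]
      calc |a| * ‖G‖ ≤ ε' * (2 / δ) := by gcongr
        _ = ε / 2 := by rw [hε']; field_simp; ring
    have := norm_add_le ((η * s x) • F x) ((τ * t x) • H x)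
    linarith [e1 η (s x) (F x) hη1 (hs x) (hFn x), e1 τ (t x) (H x) hτ1 (ht x) (hHn x)]
  · have h1 := abs_twistedSum_le hf (hn f p hf) (fun x => b x + ((η * s x) • F x + (τ * t x) • H x))
      hu hpn
    have h2 : ∀ x, (b x + ((η * s x) • F x + (τ * t x) • H x)) (f x) = b x (f x) + η * s x :=
      fun x => by simp [hFf, hHf]
    simp only [h2] at h1
    have h3 : ∑ j ∈ Finset.range n, (b (T^[j] z) (f (T^[j] z)) + η * s (T^[j] z)) *
        (sp T p j z / sp T c' (j + 1) z) =
        ∑ j ∈ Finset.range n, b (T^[j] z) (f (T^[j] z)) * (sp T p j z / sp T c' (j + 1) z) +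
        η * ∑ j ∈ Finset.range n, s (T^[j] z) * (sp T p j z / sp T c' (j + 1) z) := by
      rw [Finset.mul_sum, ← Finset.sum_add_distrib]
      exact Finset.sum_congr rfl fun j _ => by ring
    rw [h3] at h1
    have := hlow p s hsj
    linarith
  · have h1 := abs_twistedSum_le hh (hn h q hh) (fun x => b x + ((η * s x) • F x + (τ * t x) • H x))
      hu hqn
    have h2 : ∀ x, (b x + ((η * s x) • F x + (τ * t x) • H x)) (h x) = b x (h x) + τ * t x :=
      fun x => by simp [hFh, hHh]
    simp only [h2] at h1
    have h3 : ∑ j ∈ Finset.range n, (b (T^[j] z) (h (T^[j] z)) + τ * t (T^[j] z)) *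
        (sp T q j z / sp T c' (j + 1) z) =
        ∑ j ∈ Finset.range n, b (T^[j] z) (h (T^[j] z)) * (sp T q j z / sp T c' (j + 1) z) +
        τ * ∑ j ∈ Finset.range n, t (T^[j] z) * (sp T q j z / sp T c' (j + 1) z) := by
      rw [Finset.mul_sum, ← Finset.sum_add_distrib]
      exact Finset.sum_congr rfl fun j _ => by ring
    rw [h3] at h1
    have := hlow q t htj
    linarith

end Complement

/-! ### A path of cocycles that creates an invariant complement -/

section ComplementPath

variable {X V W : Type*} [NormedAddCommGroup V] [InnerProductSpace ℝ V]
  [FiniteDimensional ℝ V]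
  [NormedAddCommGroup W] [InnerProductSpace ℝ W] [FiniteDimensional ℝ W]
  {T : Equiv.Perm X} {n : ℕ}

theorem isUnit_one_sub {M : W →L[ℝ] W} {s : Multiset ℝ} {g : ℝ}
    (hM : M.toLinearMap.charpoly = (s.map fun r => Polynomial.X - C r).prod) (hg : g ∉ s)
    (hg0 : g ≠ 0) : IsUnit (1 - g⁻¹ • M) := by
  have hinj : Function.Injective (1 - g⁻¹ • M : W →L[ℝ] W) := by
    rw [injective_iff_map_eq_zero]
    intro w hw
    by_contra hw0
    have h1 : M w = g • w := by
      have h2 : w - g⁻¹ • M w = 0 := hw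
      rw [sub_eq_zero] at h2
      conv_rhs => rw [h2, smul_smul, mul_inv_cancel₀ hg0, one_smul]
    have h2 : Module.End.HasEigenvalue M.toLinearMap g :=
      Module.End.hasEigenvalue_of_hasEigenvector
        (Module.End.hasEigenvector_iff.2 ⟨Module.End.mem_eigenspace_iff.2 h1, hw0⟩)
    rw [Module.End.hasEigenvalue_iff_isRoot_charpoly, hM, Polynomial.IsRoot] at h2
    exact eval_prod_ne_zero hg h2
  have := FiniteDimensional.complete ℝ W
  rw [ContinuousLinearMap.isUnit_iff_bijective]
  exact ⟨hinj, LinearMap.injective_iff_surjective (f := (1 - g⁻¹ • M : W →L[ℝ] W).toLinearMap) |>.1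
    hinj⟩

theorem continuousAt_twistedSol {c : ℝ → X → ℝ} {Q : X → W →L[ℝ] W} {b : ℝ → X → W →L[ℝ] ℝ}
    {u : ℝ} (hc : ∀ x, Continuous fun t => c t x) (hc0 : ∀ t x, c t x ≠ 0)
    (hb : ∀ x, Continuous fun t => b t x) (x : X)
    (hu : IsUnit (1 - (sp T (c u) n x)⁻¹ • it T Q n x)) :
    ContinuousAt (fun t => twistedSol T n (c t) Q (b t) x) u := by
  have := FiniteDimensional.complete ℝ W
  have hsp : ∀ m x, Continuous fun t => (sp T (c t) m x)⁻¹ := fun m x =>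
    (continuous_finsetProd _ fun j _ => hc _).inv₀ fun t => sp_ne_zero (hc0 t) m x
  have h1 : Continuous fun t => twistedSum T n (c t) Q (b t) x :=
    continuous_finsetSum _ fun j _ => (hsp _ _).smul ((hb _).clm_comp continuous_const)
  have h2 : Continuous fun t => (1 - (sp T (c t) n x)⁻¹ • it T Q n x : W →L[ℝ] W) :=
    continuous_const.sub ((hsp _ _).smul continuous_const)
  have h3 : ContinuousAt (fun t => Ring.inverse (1 - (sp T (c t) n x)⁻¹ • it T Q n x)) u := by
    obtain ⟨v, hv⟩ := hu
    have h4 := NormedRing.inverse_continuousAt v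
    rw [hv] at h4
    exact ContinuousAt.comp (f := fun t => (1 - (sp T (c t) n x)⁻¹ • it T Q n x : W →L[ℝ] W))
      h4 h2.continuousAt
  exact (h1.continuousAt.clm_comp h3).neg

/-- The scaling by `1 - τ` transversally to the kernel of `ν`. -/
noncomputable def transScale (ν : V →L[ℝ] ℝ) (τ : ℝ) : V →L[ℝ] V :=
  ContinuousLinearMap.id ℝ V -
    (τ / ‖ν‖ ^ 2) • ν.smulRight ((InnerProductSpace.toDual ℝ V).symm ν)

theorem apply_transScale {ν : V →L[ℝ] ℝ} (hν : ν ≠ 0) (τ : ℝ) (v : V) :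
    ν (transScale ν τ v) = (1 - τ) * ν v := by
  have h1 : ν ((InnerProductSpace.toDual ℝ V).symm ν) = ‖ν‖ ^ 2 := by
    have h := InnerProductSpace.toDual_symm_apply (x := (InnerProductSpace.toDual ℝ V).symm ν)
      (y := ν)
    rw [← h, real_inner_self_eq_norm_sq, LinearIsometryEquiv.norm_map]
  have h2 : ‖ν‖ ≠ 0 := norm_ne_zero_iff.2 hν
  simp only [transScale, sub_apply, ContinuousLinearMap.id_apply, smul_apply,
    ContinuousLinearMap.smulRight_apply, map_sub, map_smul, smul_eq_mul, h1]
  field_simp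

theorem transScale_apply {ν : V →L[ℝ] ℝ} (τ : ℝ) {v : V} (h : ν v = 0) :
    transScale ν τ v = v := by
  simp [transScale, h]

/-- The correction is `τ` times an orthogonal projection, so the bound does not depend on `ν`. This
matters because the functionals used later need not stay bounded near the start of the path. -/
theorem norm_transScale_sub_le (ν : V →L[ℝ] ℝ) {τ : ℝ} (hτ : 0 ≤ τ) :
    ‖transScale ν τ - ContinuousLinearMap.id ℝ V‖ ≤ τ := by
  rw [transScale, sub_sub_cancel_left, norm_neg, norm_smul, ContinuousLinearMap.norm_smulRight_apply,
    LinearIsometryEquiv.norm_map, Real.norm_eq_abs, abs_of_nonneg (by positivity)]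
  rcases eq_or_ne ‖ν‖ 0 with h | h
  · simp [h, hτ]
  · apply le_of_eq; field_simp

theorem continuousAt_transScale {ν : ℝ → V →L[ℝ] ℝ} {τ : ℝ → ℝ} {u : ℝ} (hν : ContinuousAt ν u)
    (hτ : ContinuousAt τ u) (h0 : ν u ≠ 0) : ContinuousAt (fun t => transScale (ν t) (τ t)) u := by
  have h1 : ContinuousAt (fun t => (InnerProductSpace.toDual ℝ V).symm (ν t)) u :=
    (InnerProductSpace.toDual ℝ V).symm.continuous.continuousAt.comp hν
  have h2 : ‖ν u‖ ^ 2 ≠ 0 := pow_ne_zero _ (norm_ne_zero_iff.2 h0)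
  have h3 : ContinuousAt (fun t => (ν t).smulRight ((InnerProductSpace.toDual ℝ V).symm (ν t))) u :=
    ContinuousAt.clm_apply (f := fun t => ContinuousLinearMap.smulRightL ℝ V V (ν t))
      ((ContinuousLinearMap.smulRightL ℝ V V).continuous.continuousAt.comp hν) h1
  exact continuousAt_const.sub ((hτ.div (hν.norm.pow 2) h2).smul h3)

/-- The splitting into the line of the frame `φ` and the graph of `ξ`. -/
noncomputable def AlgFrame.graph (φ : AlgFrame V ℝ W) (ξ : W →L[ℝ] ℝ) : AlgFrame V W ℝ where
  k := φ.i + φ.k.comp ξ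
  i := φ.k
  k' := φ.i'
  i' := φ.k' - ξ.comp φ.i'
  kk w := by simp [φ.ii, φ.ik]
  ii w := by simp [φ.kk, φ.ik]
  ki w := by simp [φ.ik]
  ik w := by simp [φ.ki, φ.kk, φ.ii, φ.ik]
  id v := by
    simp only [_root_.add_apply, ContinuousLinearMap.comp_apply, _root_.sub_apply, map_sub]
    conv_rhs => rw [← φ.id v]
    abel

/-- `γ` may also be an eigenvalue of `Q`, and then the line need not have an invariant complement.
Hence `G t` accelerates the line by `exp (t * s)`, which creates one, and `U t` contracts by the
same factor transversally to it, which restores the spectrum. The complement may behave badly as `t`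
tends to `0`, but `U t` tends to the identity in any case. -/
theorem exists_complement_path (hT : IsCyc T n) {A : X → V →L[ℝ] V} {K ε s : ℝ} (hK : 1 ≤ K)
    (hA : Bdd A K) {φ : X → Frame V ℝ W} {c : X → ℝ} {Q : X → W →L[ℝ] W}
    (hb : Block T (fun x => (φ x).toAlgFrame) A (fun x => c x • ContinuousLinearMap.id ℝ ℝ) Q)
    {γ : ℝ} (hγ : ∀ x, sp T c n x = γ) {S : Multiset ℝ} (hQ : HasSpec T n Q S)
    (hS : ∀ r ∈ S, |r| ≤ |γ|) (hs0 : 0 < s) (hs1 : s ≤ 1) (hε1 : ε ≤ 1)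
    {D : X → W →L[ℝ] ℝ} (hD : ∀ x, ‖D x‖ ≤ ε) {ξ : X → W →L[ℝ] ℝ}
    (hξ : ξ = twistedSol T n (fun x => c x * Real.exp s) Q
      (fun x => ((φ (T x)).k'.comp ((A x).comp (φ x).i)) + D x)) :
    ∃ A₁, JoinedIn {B | HasSpec T n B (γ ::ₘ S) ∧ ∀ x, ‖B x - A x‖ ≤ 6 * K * s + ε} A A₁ ∧
      Block T (fun x => (φ x).toAlgFrame.graph (ξ x)) A₁ Q
        (fun x => c x • ContinuousLinearMap.id ℝ ℝ) := by
  have hK0 : 0 < K := by linarith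
  have hc0 : ∀ x, c x ≠ 0 := fun x => (hA.rate hK0.le hb x).2.2
  have hcK : ∀ x, |c x| ≤ K := fun x => (hA.rate hK0.le hb x).1
  set b : X → W →L[ℝ] ℝ := fun x => (φ (T x)).k'.comp ((A x).comp (φ x).i) with hbdef
  set cu : ℝ → X → ℝ := fun t x => c x * Real.exp (t * s) with hcu
  have hcu0 : ∀ t x, cu t x ≠ 0 := fun t x => mul_ne_zero (hc0 x) (Real.exp_ne_zero _)
  set z : ℝ → X → W →L[ℝ] ℝ := fun t => twistedSol T n (cu t) Q (fun x => b x + t • D x) with hz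
  have hγ0 : ∀ x : X, γ ≠ 0 := fun x => by rw [← hγ x]; exact sp_ne_zero hc0 n x
  -- The eigenvalues of `Q` are at most `|γ|` in modulus, and the accelerated rate has a strictly
  -- larger product over the period.
  have hun : ∀ t, 0 < t → ∀ x, IsUnit (1 - (sp T (cu t) n x)⁻¹ • it T Q n x) := by
    intro t ht x
    refine isUnit_one_sub (hQ x) (fun hmem => ?_) (sp_ne_zero (hcu0 t) n x)
    have h1 := hS _ hmem
    simp only [hcu] at h1
    rw [sp_mul, hγ, sp_const, abs_mul, abs_of_pos (pow_pos (Real.exp_pos _) n)] at h1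
    have h2 : 1 < Real.exp (t * s) ^ n :=
      one_lt_pow₀ (Real.one_lt_exp_iff.2 (mul_pos ht hs0)) hT.pos.ne'
    nlinarith [abs_pos.2 (hγ0 x)]
  have hzeq : ∀ t, 0 < t → ∀ x w, z t (T x) (Q x w) =
      cu t x * z t x w + (b x + t • D x) w := fun t ht x w =>
    twistedSol_eq hT (hcu0 t) _ (hun t ht) x w
  -- The kernel of `ν t x` is the graph of `z t x`. `G t` multiplies this functional by `cu t`, and
  -- `U t` brings the factor back to `c`.
  let ν : ℝ → X → V →L[ℝ] ℝ := fun t x => (φ x).k' - (z t x).comp (φ x).i'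
  have hν0 : ∀ t x, ν t x ≠ 0 := fun t x h => by
    have := DFunLike.congr_fun h ((φ x).k 1)
    simp [ν, (φ x).kk, (φ x).ik] at this
  let G : ℝ → X → V →L[ℝ] V := fun t x =>
    A x + (φ (T x)).k.comp ((c x * (Real.exp (t * s) - 1)) • (φ x).k' + t • (D x).comp (φ x).i')
  let U : ℝ → X → V →L[ℝ] V := fun t x => transScale (ν t x) (1 - Real.exp (-(t * s)))
  let f : ℝ → X → V →L[ℝ] V := fun t x => (U t (T x)).comp (G t x)
  have hGi : ∀ t x v, (φ (T x)).i' (G t x v) = Q x ((φ x).i' v) := fun t x v => by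
    simp only [G, _root_.add_apply, ContinuousLinearMap.comp_apply, map_add, (φ (T x)).ik, add_zero]
    exact hb.quot x v
  have hAk : ∀ x v, (φ (T x)).k' (A x v) = c x * (φ x).k' v + b x ((φ x).i' v) := fun x v => by
    conv_lhs => rw [← (φ x).id v]
    rw [map_add, hb.sub, map_add, (φ (T x)).kk]
    rfl
  have hGk : ∀ t x v, (φ (T x)).k' (G t x v) =
      cu t x * (φ x).k' v + (b x + t • D x) ((φ x).i' v) := fun t x v => by
    simp only [G, _root_.add_apply, ContinuousLinearMap.comp_apply, map_add, (φ (T x)).kk, hAk,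
      smul_apply, smul_eq_mul, hcu]
    ring
  have hνG : ∀ t, 0 < t → ∀ x v, ν t (T x) (G t x v) = cu t x * ν t x v := fun t ht x v => by
    simp only [ν, _root_.sub_apply, ContinuousLinearMap.comp_apply, hGi, hGk, hzeq t ht]
    ring
  have hblock : ∀ t, 0 < t → Block T (fun x => (φ x).toAlgFrame.graph (z t x)) (f t) Q
      (fun x => c x • ContinuousLinearMap.id ℝ ℝ) := by
    intro t ht
    refine ⟨fun x w => ?_, fun x v => ?_⟩
    · have h1 : ν t (T x) (G t x ((φ x).i w + (φ x).k (z t x w))) = 0 := by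
        rw [hνG t ht]
        simp [ν, (φ x).ki, (φ x).kk, (φ x).ii, (φ x).ik]
      change U t (T x) (G t x ((φ x).i w + (φ x).k (z t x w))) =
        (φ (T x)).i (Q x w) + (φ (T x)).k (z t (T x) (Q x w))
      simp only [U]
      rw [transScale_apply _ h1]
      have e1 : (φ x).i' ((φ x).i w + (φ x).k (z t x w)) = w := by simp [(φ x).ii, (φ x).ik]
      have e2 : (φ x).k' ((φ x).i w + (φ x).k (z t x w)) = z t x w := by
        simp [(φ x).ki, (φ x).kk]
      rw [← (φ (T x)).id (G t x _), hGi, hGk, e1, e2, hzeq t ht, add_comm]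
    · change ν t (T x) (U t (T x) (G t x v)) = c x * ν t x v
      simp only [U]
      rw [apply_transScale (hν0 _ _), hνG t ht]
      simp only [hcu, sub_sub_cancel]
      have : Real.exp (-(t * s)) * Real.exp (t * s) = 1 := by rw [← Real.exp_add]; simp
      linear_combination (c x * ν t x v) * this
  have hf0 : f 0 = A := by
    funext x
    ext v
    simp only [f, U, G, ContinuousLinearMap.comp_apply, zero_mul, neg_zero, Real.exp_zero, sub_self]
    simp [transScale]
  have hGn : ∀ t, 0 ≤ t → t ≤ 1 → ∀ x, ‖G t x - A x‖ ≤ t * (2 * K * s + ε) := by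
    intro t ht0 ht1 x
    have h0 : 0 ≤ ε := (norm_nonneg _).trans (hD x)
    have hts : 0 ≤ t * s := mul_nonneg ht0 hs0.le
    refine ContinuousLinearMap.opNorm_le_bound _ (by positivity) fun v => ?_
    have h1 : |Real.exp (t * s) - 1| ≤ 2 * (t * s) := by
      have := Real.abs_exp_sub_one_le (x := t * s) (by
        rw [abs_of_nonneg hts]; nlinarith)
      rwa [abs_of_nonneg hts] at this
    have h2 : (G t x - A x) v = (φ (T x)).k (c x * (Real.exp (t * s) - 1) * (φ x).k' v +
        t * D x ((φ x).i' v)) := by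
      simp only [G, add_sub_cancel_left]
      rfl
    rw [h2, Frame.norm_k, Real.norm_eq_abs]
    have h3 : |(φ x).k' v| ≤ ‖v‖ := (φ x).norm_k'_le v
    have h4 : |D x ((φ x).i' v)| ≤ ε * ‖v‖ :=
      ((D x).le_of_opNorm_le (hD x) _).trans (by gcongr; exact (φ x).norm_i'_le v)
    calc _ ≤ |c x * (Real.exp (t * s) - 1) * (φ x).k' v| + |t * D x ((φ x).i' v)| := abs_add_le _ _
      _ = |c x| * |Real.exp (t * s) - 1| * |(φ x).k' v| + t * |D x ((φ x).i' v)| := by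
          rw [abs_mul, abs_mul, abs_mul, abs_of_nonneg ht0]
      _ ≤ K * (2 * (t * s)) * ‖v‖ + t * (ε * ‖v‖) := by
          gcongr
          exact hcK x
      _ = _ := by ring
  have hfn : ∀ t, 0 ≤ t → t ≤ 1 → ∀ x, ‖f t x - A x‖ ≤ t * (6 * K * s + ε) := by
    intro t ht0 ht1 x
    have h0 : 0 ≤ ε := (norm_nonneg _).trans (hD x)
    have h1 := hGn t ht0 ht1 x
    have hts : 0 ≤ t * s := mul_nonneg ht0 hs0.le
    have h2 : ‖U t (T x) - ContinuousLinearMap.id ℝ V‖ ≤ t * s := by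
      refine (norm_transScale_sub_le _ ?_).trans ?_
      · have := Real.exp_le_one_iff.2 (neg_nonpos.2 hts); linarith
      · have := Real.add_one_le_exp (-(t * s)); linarith
    have h3 : ‖G t x‖ ≤ 4 * K := by
      have h4 : ‖G t x‖ ≤ ‖A x‖ + ‖G t x - A x‖ := by
        have := norm_add_le (A x) (G t x - A x)
        rwa [add_sub_cancel] at this
      have h5 : t * (2 * K * s + ε) ≤ 1 * (2 * K * 1 + 1) := by gcongr
      linarith [(hA x).1]
    have h4 : f t x - A x = (U t (T x) - ContinuousLinearMap.id ℝ V).comp (G t x) +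
        (G t x - A x) := by
      ext v; simp [f]
    rw [h4]
    calc _ ≤ ‖(U t (T x) - ContinuousLinearMap.id ℝ V).comp (G t x)‖ + ‖G t x - A x‖ :=
          norm_add_le _ _
      _ ≤ ‖U t (T x) - ContinuousLinearMap.id ℝ V‖ * ‖G t x‖ + ‖G t x - A x‖ := by
          gcongr; exact ContinuousLinearMap.opNorm_comp_le _ _
      _ ≤ (t * s) * (4 * K) + t * (2 * K * s + ε) := by gcongr
      _ = _ := by ring
  have hfc : ∀ t, 0 < t → ∀ x, ContinuousAt (fun t => f t x) t := by
    intro t ht x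
    have h1 : ∀ x, ContinuousAt (fun t => z t x) t := fun x =>
      continuousAt_twistedSol (c := cu) (b := fun t x => b x + t • D x) (fun x => by fun_prop) hcu0 (fun x => by fun_prop) x (hun t ht x)
    have h2 : ∀ x, ContinuousAt (fun t => ν t x) t := fun x =>
      continuousAt_const.sub ((h1 x).clm_comp continuousAt_const)
    have h3 : ContinuousAt (fun t => U t (T x)) t :=
      continuousAt_transScale (h2 _) (by fun_prop) (hν0 _ _)
    have h4 : Continuous (fun t => G t x) := by
      refine continuous_const.add (continuous_const.clm_comp (Continuous.add ?_ ?_))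
      · have h5 : Continuous fun t => c x * (Real.exp (t * s) - 1) := by fun_prop
        exact h5.smul continuous_const
      · exact continuous_id.smul continuous_const
    exact h3.clm_comp h4.continuousAt
  have hz1 : z 1 = ξ := by rw [hξ]; simp only [hz, hcu, hbdef, one_mul, one_smul]
  refine ⟨f 1, ⟨⟨⟨fun t => f t, ?_⟩, ?_, ?_⟩, fun t => ⟨?_, fun x => ?_⟩⟩, ?_⟩
  · refine continuous_pi fun x => continuous_iff_continuousAt.2 fun t => ?_
    rcases t.2.1.lt_or_eq with h | h
    · exact (hfc t h x).comp continuous_subtype_val.continuousAt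
    · have ht : t = 0 := Subtype.ext h.symm
      subst ht
      -- At `t = 0` the solution `z` is not controlled; continuity comes from the estimate `hfn`,
      -- which is linear in `t`.
      have h1 : Filter.Tendsto (fun t : unitInterval => (t : ℝ) * (6 * K * s + ε))
          (nhds 0) (nhds 0) := by
        have h2 : Continuous fun t : unitInterval => (t : ℝ) * (6 * K * s + ε) := by fun_prop
        simpa using h2.tendsto 0
      have h3 := squeeze_zero_norm (fun t : unitInterval => hfn t t.2.1 t.2.2 x) h1
      rw [tendsto_sub_nhds_zero_iff] at h3
      have h4 : f ((0 : unitInterval) : ℝ) x = A x := by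
        have := congrFun hf0 x
        simpa using this
      change Filter.Tendsto _ _ (nhds (f ((0 : unitInterval) : ℝ) x))
      rw [h4]
      exact h3
  · simpa using hf0
  · simp
  · rcases t.2.1.lt_or_eq with h | h
    · intro x
      have h1 := (hblock t h).hasSpec hT hQ (hasSpec_scalar c hc0 hT x) x
      rw [hγ, add_comm, Multiset.singleton_add] at h1
      exact h1
    · intro x
      have h1 := hb.hasSpec_cons hc0 hT hQ hγ x
      have h2 : f (t : ℝ) = A := by rw [← h]; exact hf0
      change (it T (f (t : ℝ)) n x).toLinearMap.charpoly = _
      rw [h2]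
      exact h1
  · refine (hfn t t.2.1 t.2.2 x).trans (mul_le_of_le_one_left ?_ t.2.2)
    have h0 : 0 ≤ ε := (norm_nonneg _).trans (hD x)
    positivity
  · rw [← hz1]
    exact hblock 1 one_pos

end ComplementPath

/-! ### An invariant complement without domination -/

section Steep

variable {X V W : Type*} [NormedAddCommGroup V] [InnerProductSpace ℝ V]
  [FiniteDimensional ℝ V]
  [NormedAddCommGroup W] [InnerProductSpace ℝ W] [FiniteDimensional ℝ W]
  {T : Equiv.Perm X} {n : ℕ}

/-- Orthogonal frames for the invariant complement of a line. -/
theorem exists_frame_of_graph (hT : IsCyc T n) (hd : Module.finrank ℝ W + 1 = Module.finrank ℝ V)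
    {A : X → V →L[ℝ] V} {K : ℝ} (hK : 0 ≤ K) (hA : Bdd A K) {η : X → AlgFrame V W ℝ}
    {Q : X → W →L[ℝ] W} {c : X → ℝ}
    (hη : Block T η A Q (fun x => c x • ContinuousLinearMap.id ℝ ℝ))
    {S : Multiset ℝ} {γ : ℝ} (hQ : HasSpec T n Q S) (hA' : HasSpec T n A (γ ::ₘ S)) :
    ∃ (χ : X → Frame V W ℝ) (P : X → W →L[ℝ] W) (c' : X → ℝ),
      Block T (fun x => (χ x).toAlgFrame) A P (fun x => c' x • ContinuousLinearMap.id ℝ ℝ) ∧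
      (∀ x, c' x ≠ 0) ∧ (∀ x, sp T c' n x = γ) ∧ HasSpec T n P S ∧
      ∀ x w, (χ x).k ((χ x).k' ((η x).k w)) = (η x).k w := by
  have hinj : ∀ x, Function.Injective (η x).k := fun x =>
    Function.LeftInverse.injective (η x).kk
  choose χ hχ using fun x => exists_frame (W₁ := W) (W₂ := ℝ) (LinearMap.range (η x).k.toLinearMap)
    (LinearMap.finrank_range_of_inj (hinj x)) (by rw [Module.finrank_self]; exact hd)
  have h1 : ∀ x w, (χ x).k ((χ x).k' ((η x).k w)) = (η x).k w := by
    intro x w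
    have : (η x).k w ∈ LinearMap.range (χ x).k.toLinearMap := by rw [hχ]; exact ⟨w, rfl⟩
    obtain ⟨v, hv⟩ := this
    have hv : (χ x).k v = (η x).k w := hv
    rw [← hv, (χ x).kk]
  have h2 : ∀ x w, (η x).k ((η x).k' ((χ x).k w)) = (χ x).k w := by
    intro x w
    have : (χ x).k w ∈ LinearMap.range (η x).k.toLinearMap := by rw [← hχ]; exact ⟨w, rfl⟩
    obtain ⟨v, hv⟩ := this
    have hv : (η x).k v = (χ x).k w := hv
    rw [← hv, (η x).kk]
  set P : X → W →L[ℝ] W := fun x => (χ (T x)).k'.comp ((A x).comp (χ x).k) with hP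
  have h3 : ∀ x w, A x ((χ x).k w) = (χ (T x)).k (P x w) := by
    intro x w
    have : A x ((χ x).k w) = (η (T x)).k (Q x ((η x).k' ((χ x).k w))) := by
      rw [← hη.sub, h2]
    simp only [hP, ContinuousLinearMap.comp_apply]
    rw [this, h1]
  have hb := line_quot_scalar (block_of_sub (fun x => (χ x).toAlgFrame) A P h3)
  set c' : X → ℝ := fun x => ((χ (T x)).i'.comp ((A x).comp (χ x).i)) 1 with hc'
  have hq := hb.bdd_quot hK hA
  have hc0 : ∀ x, c' x ≠ 0 := fun x h => by
    have h1 := (hq x).2 1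
    have h2 : (c' x • ContinuousLinearMap.id ℝ ℝ : ℝ →L[ℝ] ℝ) 1 = 0 := by rw [h]; simp
    change ‖(1 : ℝ)‖ ≤ K * ‖(c' x • ContinuousLinearMap.id ℝ ℝ : ℝ →L[ℝ] ℝ) 1‖ at h1
    rw [h2, norm_zero, mul_zero, norm_one] at h1
    linarith
  have hPs : HasSpec T n P S := by
    intro x
    rw [← hQ x]
    have hR : Function.Injective ((η x).k'.comp (χ x).k) := by
      rw [injective_iff_map_eq_zero]
      intro w hw
      have h4 := h2 x w
      have h5 : (η x).k' ((χ x).k w) = 0 := hw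
      rw [h5, map_zero] at h4
      rw [← (χ x).kk w, ← h4, map_zero]
    refine charpoly_eq_of_conj ((η x).k'.comp (χ x).k).toLinearMap
      ⟨hR, LinearMap.injective_iff_surjective (f := ((η x).k'.comp (χ x).k).toLinearMap) |>.1 hR⟩ ?_
    have h6 := it_intertwine (T := T) (A := P) (B := Q) (R := fun x => (η x).k'.comp (χ x).k)
      (fun x => by
        ext w
        simp only [ContinuousLinearMap.comp_apply]
        rw [← h3, ← h2 x w, hη.sub, (η (T x)).kk, h2]) n x
    rw [hT.per] at h6
    exact congrArg ContinuousLinearMap.toLinearMap h6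
  refine ⟨χ, P, c', hb, hc0, fun x => ?_, hPs, h1⟩
  -- The product of `c'` over a period is obtained by cancelling the common factor of the
  -- characteristic polynomials.
  have h4 := hb.charpoly_eq hT x
  rw [hA' x, hPs x, hasSpec_scalar c' hc0 hT x x, Multiset.map_cons, Multiset.prod_cons,
    mul_comm, Multiset.map_singleton, Multiset.prod_singleton] at h4
  have h5 : (S.map fun r => Polynomial.X - C r).prod ≠ 0 :=
    (monic_multiset_prod_of_monic S (fun r => Polynomial.X - C r) fun r _ => monic_X_sub_C r).ne_zero
  have h6 := mul_left_cancel₀ h5 h4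
  exact (C_injective (sub_right_injective h6)).symm

-- A huge relative growth sum at `z` allows a small `D` to make `ξ` huge on the image `f` of the
-- slow line. The β-line `h` grows at least as fast as `f` up to a constant, by the domination of
-- `Q`, so `ξ` is huge on `h` too. In the graph of `ξ` the lifts of `f` and `h` both lean towards
-- the line of `γ`, hence are almost parallel, whereas domination in the graph would force a
-- definite angle (`exists_angle`).
set_option maxHeartbeats 1000000 in
theorem exists_undominated_complement {K C θ C' θ' ε : ℝ} (hK : 1 ≤ K) (hC : 0 ≤ C) (hθ0 : 0 < θ)
    (hθ1 : θ < 1) (hθ0' : 0 < θ') (hθ1' : θ' < 1) (hε : 0 < ε) : ∃ S : ℝ, 0 ≤ S ∧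
      ∀ {X V W : Type*} [NormedAddCommGroup V] [InnerProductSpace ℝ V] [FiniteDimensional ℝ V]
        [NormedAddCommGroup W] [InnerProductSpace ℝ W] [FiniteDimensional ℝ W]
        {T : Equiv.Perm X} {n : ℕ} (_ : IsCyc T n)
        (_ : Module.finrank ℝ W + 1 = Module.finrank ℝ V)
        {A : X → V →L[ℝ] V} (_ : Bdd A K) {φ : X → Frame V ℝ W} {a c : X → ℝ}
        {Q : X → W →L[ℝ] W}
        (_ : Block T (fun x => (φ x).toAlgFrame) A (fun x => c x • ContinuousLinearMap.id ℝ ℝ) Q)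
        {e : X → V} (_ : ∀ x, A x (e x) = a x • e (T x))
        (_ : ∀ x, (φ x).i' (e x) ≠ 0) {r γ β : ℝ} {S₁ F : Multiset ℝ} (_ : ∀ x, sp T a n x = r)
        (_ : ∀ x, sp T c n x = γ) (_ : HasSpec T n A (γ ::ₘ (r ::ₘ S₁ + F))) (_ : r ∉ F)
        (_ : β ∈ F) (_ : β ∉ r ::ₘ S₁) (_ : ∀ s ∈ r ::ₘ S₁ + F, |s| ≤ |γ|)
        (_ : Dom T Q (slow T n Q F) C θ) (z : X)
        (_ : S < ∑ j ∈ Finset.range n, sp T (relRate T φ e a c) j z),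
        ∃ A₁, JoinedIn {B | HasSpec T n B (γ ::ₘ (r ::ₘ S₁ + F)) ∧ ∀ x, ‖B x - A x‖ ≤ ε} A A₁ ∧
          ∃ (χ : X → Frame V W ℝ) (P : X → W →L[ℝ] W) (c' : X → ℝ),
            Block T (fun x => (χ x).toAlgFrame) A₁ P (fun x => c' x • ContinuousLinearMap.id ℝ ℝ) ∧
            (∀ x, c' x ≠ 0) ∧ (∀ x, sp T c' n x = γ) ∧ HasSpec T n P (r ::ₘ S₁ + F) ∧
            Bdd P (2 * K) ∧ ¬ Dom T P (slow T n P F) C' θ' := by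
  have hK0 : 0 < K := by linarith
  obtain ⟨δ₁, hδ₁0, hδ₁1, hδ₁⟩ := exists_angle (C := C) hθ0 hθ1 hK
  obtain ⟨δ₂, hδ₂0, hδ₂1, hδ₂⟩ := exists_angle (C := C') (K := 2 * K) hθ0' hθ1' (by linarith)
  set ε₁ := min (ε / 2) (1 / (4 * K)) with hε₁
  have hε₁0 : 0 < ε₁ := lt_min (by positivity) (by positivity)
  have hε₁1 : ε₁ ≤ 1 := (min_le_right _ _).trans (by
    rw [div_le_one (by positivity)]; linarith)
  set κ := δ₁ * ε₁ / (16 * K) with hκ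
  have hκ0 : 0 < κ := by positivity
  set ρ := δ₁ / (C + 1) with hρ
  have hρ0 : 0 < ρ := by positivity
  have hρ1 : ρ ≤ 1 := by rw [hρ, div_le_one (by positivity)]; linarith
  -- `κ` is the gain in `exists_steep_functional`, and `ρ` compares the growth of the slow line with
  -- that of the β-line. Above this threshold both slopes of `ξ` at `z` are at least `3 / δ₂`.
  refine ⟨3 / δ₂ / (κ * ρ), by positivity, ?_⟩
  intro X V W _ _ _ _ _ _ T n hT hd A hA φ a c Q hφ e hae hei r γ β S₁ F ha hc hs hrF hβF hβ hmax
    hdQ z hz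
  have hc0 : ∀ x, c x ≠ 0 := fun x => (hA.rate hK0.le hφ x).2.2
  have hcK : ∀ x, |c x| ≤ K := fun x => (hA.rate hK0.le hφ x).1
  have hQ := hφ.bdd_quot hK0.le hA
  have hsQ : HasSpec T n Q (r ::ₘ S₁ + F) := hφ.hasSpec_quot hc0 hT hs hc
  set t : X → ℝ := fun x => ‖(φ x).i' (e x)‖ with ht
  have ht0 : ∀ x, 0 < t x := fun x => norm_pos_iff.2 (hei x)
  set f : X → W := fun x => (t x)⁻¹ • (φ x).i' (e x) with hf
  have hf1 : ∀ x, ‖f x‖ = 1 := fun x => by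
    simp only [hf]
    rw [norm_smul, norm_inv, Real.norm_eq_abs, abs_of_pos (ht0 x)]
    exact inv_mul_cancel₀ (ht0 x).ne'
  have hf0 : ∀ x, f x ≠ 0 := fun x h => by have := hf1 x; simp [h] at this
  set p : X → ℝ := fun x => a x * t (T x) / t x with hp
  have hQf : ∀ x, Q x (f x) = p x • f (T x) := fun x => by
    simp only [hf, hp]
    rw [map_smul, ← hφ.quot, hae, map_smul, smul_smul, smul_smul]
    congr 1
    have := (ht0 (T x)).ne'
    field_simp
  have hfn : ∀ x, it T Q n x (f x) = sp T p n x • f x := fun x => by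
    rw [it_eigenline hQf, hT.per]
  have hpr : ∀ x, sp T p n x = r := by
    have h1 : ∀ m x, sp T p m x = sp T a m x * t (T^[m] x) / t x := by
      intro m
      induction m with
      | zero => intro x; simp [(ht0 x).ne']
      | succ m ih =>
        intro x
        have h1 := (ht0 (T^[m] x)).ne'
        rw [sp_succ', ih, sp_succ', Function.iterate_succ_apply']
        simp only [hp]
        field_simp
    intro x
    rw [h1, hT.per, ha, mul_div_assoc, div_self (ht0 x).ne', mul_one]
  have hrate : ∀ j x, sp T (relRate T φ e a c) j x = |sp T p j x| / |sp T c j x| := fun j x => by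
    have h1 : relRate T φ e a c = fun y => |p y / c y| := by
      funext y
      simp only [relRate, hp]
      rw [abs_div, abs_div, abs_mul, abs_of_pos (ht0 y), abs_of_pos (ht0 (T y))]
    rw [h1, sp_abs, sp_div, abs_div]
  obtain ⟨h, q, hh1, hQh, hq0, hqn⟩ := exists_eigenline hT hQ.bijective z (r := β) (by
    rw [hsQ z, Polynomial.IsRoot, eval_prod_X_sub_C]
    exact Multiset.prod_eq_zero (Multiset.mem_map.2 ⟨β, Multiset.mem_add.2 (Or.inr hβF), sub_self β⟩))
  have hhn : ∀ x, it T Q n x (h x) = β • h x := fun x => by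
    rw [it_eigenline hQh, hT.per, hqn]
  have hh0 : ∀ x, h x ≠ 0 := fun x h0 => by have := hh1 x; simp [h0] at this
  have hfM : ∀ x, f x ∈ slow T n Q F x := fun x =>
    mem_slow_of_eigen (by rw [hfn, hpr]) hrF
  have hang := hδ₁ hT hQ (fun x => slow_map hT hQ.bijective F x) hdQ hQh
    (fun x => notMem_slow_of_eigen hsQ (hhn x) hβ (hh0 x))
  have hang' : ∀ x (s : ℝ), δ₁ ≤ ‖h x - s • f x‖ := fun x s => by
    have h1 := hang x
    rw [hh1, mul_one] at h1
    exact h1.trans (qd_le_norm_sub (Submodule.smul_mem _ s (hfM x)) _)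
  -- This is the domination of `Q` tested on `f`, which lies in the slow bundle, and on `h`, whose
  -- distance to that bundle is between `δ₁` and `1`.
  have hpq : ∀ j x, ρ * |sp T p j x| ≤ |sp T q j x| := by
    intro j x
    have h1 := hdQ x j (f x) (hfM x) (h x)
    rw [it_eigenline hQf, it_eigenline hQh, norm_smul, hf1, hf1, qd_smul, mul_one, one_mul,
      Real.norm_eq_abs] at h1
    have h2 := hang x
    rw [hh1, mul_one] at h2
    have h3 : qd (slow T n Q F (T^[j] x)) (h (T^[j] x)) ≤ 1 := by
      rw [← hh1 (T^[j] x)]; exact qd_le_norm _ _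
    have h4 : θ ^ j ≤ 1 := pow_le_one₀ hθ0.le hθ1.le
    rw [hρ, div_mul_eq_mul_div, div_le_iff₀ (by positivity)]
    calc δ₁ * |sp T p j x| ≤ |sp T p j x| * qd (slow T n Q F x) (h x) := by
          rw [mul_comm]; gcongr
      _ ≤ C * θ ^ j * (|sp T q j x| * qd (slow T n Q F (T^[j] x)) (h (T^[j] x))) := h1
      _ ≤ C * 1 * (|sp T q j x| * 1) := by
          have := qd_nonneg (slow T n Q F (T^[j] x)) (h (T^[j] x))
          gcongr
      _ ≤ _ := by nlinarith [abs_nonneg (sp T q j x)]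
  have hnpos : (0 : ℝ) < n := by exact_mod_cast hT.pos
  -- The second term gives `exp s ^ n ≤ 2`, so that within a period the accelerated products stay
  -- within a factor `2` of the original ones.
  set s := min (ε₁ / (6 * K)) (Real.log 2 / n) with hsdef
  have hlog := Real.log_pos one_lt_two
  have hs0 : 0 < s := lt_min (by positivity) (by positivity)
  have hs6 : 6 * K * s ≤ ε₁ := by
    have : s ≤ ε₁ / (6 * K) := min_le_left _ _
    rw [le_div_iff₀ (by positivity)] at this
    linarith
  have hs1 : s ≤ 1 := by nlinarith
  set c₁ : X → ℝ := fun x => c x * Real.exp s with hc₁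
  have hc₁sp : ∀ j x, sp T c₁ j x = sp T c j x * Real.exp s ^ j := fun j x => by
    simp only [hc₁]; rw [sp_mul, sp_const]
  have hes : 1 < Real.exp s := Real.one_lt_exp_iff.2 hs0
  have hcc : ∀ j ≤ n, ∀ x, sp T c₁ j x ≠ 0 ∧ |sp T c₁ j x| ≤ 2 * |sp T c j x| := by
    intro j hj x
    have h1 : Real.exp s ^ j ≤ 2 := by
      calc Real.exp s ^ j ≤ Real.exp s ^ n := pow_le_pow_right₀ hes.le hj
        _ = Real.exp (n * s) := (Real.exp_nat_mul _ _).symm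
        _ ≤ Real.exp (Real.log 2) := by
            refine Real.exp_le_exp.2 ?_
            have : s ≤ Real.log 2 / n := min_le_right _ _
            rw [le_div_iff₀ hnpos] at this
            linarith
        _ = 2 := Real.exp_log two_pos
    refine ⟨sp_ne_zero (fun x => mul_ne_zero (hc0 x) (Real.exp_ne_zero _)) j x, ?_⟩
    rw [hc₁sp, abs_mul, abs_of_pos (pow_pos (Real.exp_pos s) j), mul_comm]
    gcongr
  have hγ1 : ∀ x, |γ| < |sp T c₁ n x| := fun x => by
    rw [hc₁sp, hc, abs_mul, abs_of_pos (pow_pos (Real.exp_pos s) n)]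
    have h1 : 1 < Real.exp s ^ n := one_lt_pow₀ hes hT.pos.ne'
    have h2 : 0 < |γ| := abs_pos.2 (by rw [← hc x]; exact sp_ne_zero hc0 n x)
    nlinarith
  have hu : IsUnit (1 - (sp T c₁ n z)⁻¹ • it T Q n z) :=
    isUnit_one_sub (hsQ z) (fun hm => absurd (hmax _ hm) (not_le.2 (hγ1 z))) (hcc n le_rfl z).1
  obtain ⟨D, hD, hDf, hDh⟩ := exists_steep_functional hT hc0 hK0 hcK hcc hQf hQh hf1 hh1 hδ₁0 hδ₁1
    hang' hε₁0 (fun x => (φ (T x)).k'.comp ((A x).comp (φ x).i)) z hu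
    (by rw [hpr]; exact (hmax r (by simp)).trans (hγ1 z).le)
    (by rw [hqn]; exact (hmax β (Multiset.mem_add.2 (Or.inr hβF))).trans (hγ1 z).le)
  set ξ : X → W →L[ℝ] ℝ := twistedSol T n c₁ Q
    (fun x => ((φ (T x)).k'.comp ((A x).comp (φ x).i)) + D x) with hξ
  obtain ⟨A₁, hj, hblk⟩ := exists_complement_path hT hK hA hφ hc hsQ hmax hs0 hs1 hε₁1 hD hξ
  have htot : 6 * K * s + ε₁ ≤ ε := by
    have : ε₁ ≤ ε / 2 := min_le_left _ _
    linarith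
  have htot' : 6 * K * s + ε₁ ≤ 1 / (2 * K) := by
    have h1 : ε₁ ≤ 1 / (4 * K) := min_le_right _ _
    have h2 : 1 / (4 * K) + 1 / (4 * K) = 1 / (2 * K) := by field_simp; norm_num
    linarith
  have hA₁ : Bdd A₁ (2 * K) := hA.perturb hK0 htot' hK hj.target_mem.2
  obtain ⟨χ, P, c', hχ, hc'0, hc'γ, hP, hχη⟩ :=
    exists_frame_of_graph hT hd (by positivity) hA₁ hblk hsQ hj.target_mem.1
  have hPB := hχ.bdd_sub (by positivity) hA₁
  refine ⟨A₁, hj.mono fun B hB => ⟨hB.1, fun x => (hB.2 x).trans htot⟩, χ, P, c', hχ, hc'0, hc'γ,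
    hP, hPB, fun hdP => ?_⟩
  set η := fun x => (φ x).toAlgFrame.graph (ξ x) with hη
  have hηk : ∀ x w, (η x).k w = (φ x).i w + (φ x).k (ξ x w) := fun x w => rfl
  have hlift : ∀ {g : X → W} {o : X → ℝ}, (∀ x, Q x (g x) = o x • g (T x)) →
      ∀ x, P x ((χ x).k' ((η x).k (g x))) = o x • (χ (T x)).k' ((η (T x)).k (g (T x))) := by
    intro g o hg x
    have h1 := hχ.sub x ((χ x).k' ((η x).k (g x)))
    rw [hχη] at h1
    have h2 : A₁ x ((η x).k (g x)) = (η (T x)).k (Q x (g x)) := hblk.sub x (g x)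
    rw [h2, hg, map_smul] at h1
    have h3 := congrArg (χ (T x)).k' h1
    rw [(χ (T x)).kk, map_smul] at h3
    exact h3.symm
  have hPf := hlift hQf
  have hPh := hlift hQh
  have hnorm : ∀ x w, ‖(χ x).k' ((η x).k w)‖ = ‖(η x).k w‖ := fun x w => by
    rw [← hχη x w, (χ x).kk, Frame.norm_k]
  have hPfM : (χ z).k' ((η z).k (f z)) ∈ slow T n P F z := by
    refine mem_slow_of_eigen (r := r) ?_ hrF
    have := it_eigenline hPf n z
    rwa [hT.per, hpr] at this
  have hPhM : ∀ x, (χ x).k' ((η x).k (h x)) ∉ slow T n P F x := fun x => by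
    refine notMem_slow_of_eigen hP (r := β) ?_ hβ ?_
    · have := it_eigenline hPh n x
      rwa [hT.per, hqn] at this
    · intro h0
      have h1 := hnorm x (h x)
      rw [h0, norm_zero] at h1
      have h2 := (η x).kk (h x)
      rw [norm_eq_zero.1 h1.symm, map_zero] at h2
      exact hh0 x h2.symm
  have hfin := hδ₂ hT hPB (fun x => slow_map hT hPB.bijective F x) hdP hPh hPhM z
  have hbig : 3 / δ₂ ≤ |ξ z (f z)| ∧ 3 / δ₂ ≤ |ξ z (h z)| := by
    simp only [hrate] at hz
    rw [div_lt_iff₀ (by positivity)] at hz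
    constructor
    · refine le_trans ?_ hDf
      have h1 : 0 ≤ ∑ j ∈ Finset.range n, |sp T p j z| / |sp T c j z| :=
        Finset.sum_nonneg fun j _ => by positivity
      nlinarith [mul_nonneg hκ0.le h1]
    · refine le_trans ?_ hDh
      have h1 : ρ * ∑ j ∈ Finset.range n, |sp T p j z| / |sp T c j z| ≤
          ∑ j ∈ Finset.range n, |sp T q j z| / |sp T c j z| := by
        rw [Finset.mul_sum]
        refine Finset.sum_le_sum fun j _ => ?_
        rw [← mul_div_assoc]
        gcongr
        exact hpq j z
      nlinarith [mul_le_mul_of_nonneg_left h1 hκ0.le]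
  obtain ⟨hb1, hb2⟩ := hbig
  have hδ3 : 0 < 3 / δ₂ := by positivity
  have hξf : 0 < |ξ z (f z)| := hδ3.trans_le hb1
  have hξh : 0 < |ξ z (h z)| := hδ3.trans_le hb2
  -- `h - τ • f` is in the kernel of `ξ`, so its lift has norm at most `1 + |τ|`, while the lift of
  -- `h` has norm at least `|ξ z (h z)|`. For large slopes this contradicts the definite angle.
  set τ := ξ z (h z) / ξ z (f z) with hτ
  have h1 : qd (slow T n P F z) ((χ z).k' ((η z).k (h z))) ≤ 1 + |τ| := by
    refine (qd_le_norm_sub (Submodule.smul_mem _ τ hPfM) _).trans ?_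
    rw [← map_smul, ← map_smul, ← map_sub, ← map_sub, hnorm, hηk]
    have h2 : ξ z (h z - τ • f z) = 0 := by
      rw [map_sub, map_smul, smul_eq_mul, hτ, div_mul_cancel₀ _ (abs_pos.1 hξf), sub_self]
    rw [h2, map_zero, add_zero, Frame.norm_i]
    refine (norm_sub_le _ _).trans ?_
    rw [norm_smul, hh1, hf1, mul_one, Real.norm_eq_abs]
  have h2 : |ξ z (h z)| ≤ ‖(χ z).k' ((η z).k (h z))‖ := by
    rw [hnorm, hηk]
    have := (φ z).norm_k'_le ((φ z).i (h z) + (φ z).k (ξ z (h z)))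
    rwa [map_add, (φ z).ki, (φ z).kk, zero_add] at this
  have h3 : δ₂ * |ξ z (h z)| ≤ 1 + |τ| := by
    refine le_trans ?_ (hfin.trans h1)
    gcongr
  rw [hτ, abs_div] at h3
  have h4 : 3 ≤ δ₂ * |ξ z (f z)| := by rw [div_le_iff₀ hδ₂0] at hb1; linarith
  have h5 : 3 ≤ δ₂ * |ξ z (h z)| := by rw [div_le_iff₀ hδ₂0] at hb2; linarith
  have h6 : |ξ z (h z)| / |ξ z (f z)| ≤ δ₂ * |ξ z (h z)| / 3 := by
    rw [div_le_div_iff₀ hξf three_pos]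
    nlinarith
  linarith

end Steep

/-! ### The induction step of the dichotomy -/

section MixingStep

variable {X V W : Type*} [NormedAddCommGroup V] [InnerProductSpace ℝ V]
  [FiniteDimensional ℝ V]
  [NormedAddCommGroup W] [InnerProductSpace ℝ W] [FiniteDimensional ℝ W]
  {T : Equiv.Perm X} {n : ℕ}

theorem Block.quot_eigen_ne_zero {φ : X → AlgFrame V ℝ W} {A : X → V →L[ℝ] V} {c : X → ℝ}
    {Q : X → W →L[ℝ] W} (hT : IsCyc T n)
    (hφ : Block T φ A (fun x => c x • ContinuousLinearMap.id ℝ ℝ) Q) {γ r : ℝ}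
    (hc : ∀ x, sp T c n x = γ) (hrγ : r ≠ γ) {x : X} {v : V} (hv : it T A n x v = r • v)
    (hv0 : v ≠ 0) : (φ x).i' v ≠ 0 := by
  intro h0
  have h1 : v = (φ x).k ((φ x).k' v) := by
    conv_lhs => rw [← (φ x).id v, h0, map_zero, add_zero]
  have h2 := hφ.it_sub n x ((φ x).k' v)
  rw [hT.per, it_smul_id, hc, ← h1, hv] at h2
  simp only [smul_apply, ContinuousLinearMap.id_apply, map_smul] at h2
  rw [← h1, ← sub_eq_zero, ← sub_smul] at h2
  exact smul_ne_zero (sub_ne_zero.2 hrγ) hv0 h2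

theorem HasSpec.isRoot {A : X → V →L[ℝ] V} {s : Multiset ℝ} (h : HasSpec T n A s) (x : X) {r : ℝ}
    (hr : r ∈ s) : (it T A n x).toLinearMap.charpoly.IsRoot r := by
  rw [h x, Polynomial.IsRoot, eval_prod_X_sub_C]
  exact Multiset.prod_eq_zero (Multiset.mem_map.2 ⟨r, hr, sub_self r⟩)

theorem exists_max_abs {F : Multiset ℝ} (h : F ≠ 0) : ∃ γ ∈ F, ∀ r ∈ F, |r| ≤ |γ| := by
  classical
  obtain ⟨γ, h1, h2⟩ := F.toFinset.exists_max_image (fun r => |r|) (by simpa using h)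
  exact ⟨γ, by simpa using h1, fun r hr => h2 r (by simpa using hr)⟩

/-- Suppose that `A` does not mix. Mixing of a quotient lifts, so by induction the quotients by the
fastest line and by a slow line are dominated. If the relative growth sums are bounded, `A` is
dominated; otherwise a deformation of `A` has an undominated complement of the fastest line, and the
mixing of this complement lifts as well. -/
theorem UnifMix.step.{w} {V W : Type} [NormedAddCommGroup V] [InnerProductSpace ℝ V]
    [FiniteDimensional ℝ V] [NormedAddCommGroup W] [InnerProductSpace ℝ W] [FiniteDimensional ℝ W]
    (hd : Module.finrank ℝ W + 1 = Module.finrank ℝ V) {s t : ℕ} (hQ : UnifMix.{w} W s t)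
    (hB : s = 0 ∨ ∃ s', s = s' + 1 ∧ UnifMix.{w} W s' (t + 1)) : UnifMix.{w} V s (t + 1) := by
  intro K ε hK hε
  have hK0 : 0 < K := by linarith
  obtain ⟨C₁, θ₁, N₁, hC₁, hθ₁, hθ₁', h₁⟩ := hQ K ε hK hε
  -- This second use of the induction hypothesis is for the complement: creating it costs `ε / 2`
  -- and doubles the bound.
  obtain ⟨C₂, θ₂, N₂, hC₂, hθ₂, hθ₂', h₂⟩ := hQ (2 * K) (ε / 2) (by linarith) (by positivity)
  obtain ⟨C₃, θ₃, N₃, hC₃, hθ₃, hθ₃', h₃⟩ : ∃ (C₃ θ₃ : ℝ) (N₃ : ℕ), 0 ≤ C₃ ∧ 0 < θ₃ ∧ θ₃ < 1 ∧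
      ∀ s', s = s' + 1 → ∀ (X : Type w) (T : Equiv.Perm X) (n : ℕ), IsCyc T n → N₃ ≤ n →
      ∀ (A : X → W →L[ℝ] W) (α β : ℝ) (S F : Multiset ℝ), S.card = s' → F.card = t + 1 →
        Bdd A K → HasSpec T n A (α ::ₘ β ::ₘ (S + F)) → |α| < |β| →
        (∀ r ∈ S, |r| ≤ |α|) → (∀ r ∈ F, |β| ≤ |r|) →
        ¬ Dom T A (slow T n A (β ::ₘ F)) C₃ θ₃ → Mixes T n A ε α β (S + F) := by
    rcases hB with h | ⟨s', h, hB⟩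
    · exact ⟨0, 1 / 2, 0, le_rfl, by norm_num, by norm_num, fun s' hs' => by omega⟩
    · obtain ⟨C, θ, N, h1, h2, h3, h4⟩ := hB K ε hK hε
      refine ⟨C, θ, N, h1, h2, h3, fun s'' hs'' => ?_⟩
      obtain rfl : s' = s'' := by omega
      exact h4
  have hC : 0 ≤ max C₁ C₃ := hC₁.trans (le_max_left _ _)
  have hθ : 0 < max θ₁ θ₃ := lt_max_of_lt_left hθ₁
  have hθ' : max θ₁ θ₃ < 1 := max_lt hθ₁' hθ₃'
  obtain ⟨S₀, hS₀, hsteep⟩ := exists_undominated_complement (C' := C₂) (θ' := θ₂) (ε := ε / 2)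
    hK hC hθ hθ' hθ₂ hθ₂' (by positivity)
  obtain ⟨C', θ', N', hC', hθ0', hθ1', hdomA⟩ := dom_of_sum_le hK hC hθ hθ' hS₀
  refine ⟨C', θ', max (max N₁ N₂) (max N₃ N'), hC', hθ0', hθ1', ?_⟩
  intro X T n hT hn A α β S F hS hF hA hs hαβ hSα hFβ hdom
  by_contra hmix
  have hn₁ : N₁ ≤ n := by omega
  have hn₂ : N₂ ≤ n := by omega
  have hn₃ : N₃ ≤ n := by omega
  have hn' : N' ≤ n := by omega
  have hX : Nonempty X := by
    by_contra hX
    exact hdom fun x => (hX ⟨x⟩).elim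
  obtain ⟨x₀⟩ := hX
  obtain ⟨γ, hγF, hγmax⟩ := exists_max_abs (F := F) (by rintro rfl; simp at hF)
  obtain ⟨F', rfl⟩ := Multiset.exists_cons_of_mem hγF
  have hF' : F'.card = t := by simpa using hF
  have hβγ : |β| ≤ |γ| := hFβ γ hγF
  have hmax : ∀ r ∈ α ::ₘ S + β ::ₘ F', |r| ≤ |γ| := by
    intro r hr
    rcases Multiset.mem_add.1 hr with h | h
    · rcases Multiset.mem_cons.1 h with rfl | h
      · exact hαβ.le.trans hβγ
      · exact (hSα r h).trans (hαβ.le.trans hβγ)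
    · rcases Multiset.mem_cons.1 h with rfl | h
      · exact hβγ
      · exact hγmax r (Multiset.mem_cons_of_mem h)
  have hdisj : ∀ r ∈ α ::ₘ S, ∀ r' ∈ γ ::ₘ β ::ₘ F', r ≠ r' := by
    intro r hr r' hr' h
    have h1 : |r| ≤ |α| := by
      rcases Multiset.mem_cons.1 hr with rfl | h
      · exact le_rfl
      · exact hSα r h
    have h2 : |β| ≤ |r'| := by
      rw [Multiset.cons_swap] at hr'
      rcases Multiset.mem_cons.1 hr' with rfl | h
      · exact le_rfl
      · exact hFβ r' h
    rw [h] at h1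
    linarith
  have hs' : HasSpec T n A (γ ::ₘ (α ::ₘ S + β ::ₘ F')) := by
    convert hs using 1
    simp only [← Multiset.singleton_add]; abel
  -- the quotient by the fastest line
  obtain ⟨φ, c, Q, hφ, hc0, hc⟩ := exists_line_frame (W₂ := W) hT hA.bijective x₀ (r := γ)
    (hs'.isRoot x₀ (by simp)) hd
  have hQB := hφ.bdd_quot hK0.le hA
  have hsQ := hφ.hasSpec_quot hc0 hT hs' hc
  have hdQ : Dom T Q (slow T n Q (β ::ₘ F')) C₁ θ₁ := by
    by_contra h
    have h1 := h₁ X T n hT hn₁ Q α β S F' hS hF' hQB (by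
      convert hsQ using 1
      simp only [← Multiset.singleton_add]; abel) hαβ hSα
      (fun r hr => hFβ r (Multiset.mem_cons_of_mem hr)) h
    refine hmix ?_
    have h2 := h1.lift_quot hT hφ hc0 hc
    rwa [← Multiset.add_cons] at h2
  -- the quotient by a slow line
  obtain ⟨r, S₁, hrS, ψ, a, B, hψ, ha0, ha, hdB⟩ : ∃ (r : ℝ) (S₁ : Multiset ℝ)
      (_ : α ::ₘ S = r ::ₘ S₁) (ψ : X → Frame V ℝ W) (a : X → ℝ) (B : X → W →L[ℝ] W),
      Block T (fun x => (ψ x).toAlgFrame) A (fun x => a x • ContinuousLinearMap.id ℝ ℝ) B ∧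
      (∀ x, a x ≠ 0) ∧ (∀ x, sp T a n x = r) ∧
      Dom T B (slow T n B (γ ::ₘ β ::ₘ F')) C₃ θ₃ := by
    -- If `α` is the only slow eigenvalue, the quotient by its line has zero slow bundle and is
    -- dominated for free. Otherwise remove another slow eigenvalue, so that `α` and `β` both
    -- survive in the quotient and the induction applies.
    rcases Nat.eq_zero_or_pos s with h0 | h0
    · obtain rfl := Multiset.card_eq_zero.1 (hS.trans h0)
      obtain ⟨ψ, a, B, hψ, ha0, ha⟩ := exists_line_frame (W₂ := W) hT hA.bijective x₀ (r := α)
        (hs.isRoot x₀ (by simp)) hd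
      refine ⟨α, 0, rfl, ψ, a, B, hψ, ha0, ha, dom_bot fun x => slow_eq_bot ?_ x⟩
      refine hψ.hasSpec_quot ha0 hT (r := α) ?_ ha
      convert hs using 2
      rw [Multiset.cons_swap, zero_add]
    · obtain ⟨r, hr⟩ := Multiset.card_pos_iff_exists_mem.1 (by omega : 0 < S.card)
      obtain ⟨S', rfl⟩ := Multiset.exists_cons_of_mem hr
      obtain ⟨ψ, a, B, hψ, ha0, ha⟩ := exists_line_frame (W₂ := W) hT hA.bijective x₀ (r := r)
        (hs.isRoot x₀ (by simp)) hd
      refine ⟨r, α ::ₘ S', Multiset.cons_swap _ _ _, ψ, a, B, hψ, ha0, ha, ?_⟩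
      by_contra h
      rw [Multiset.cons_swap] at h
      have hBB := hψ.bdd_quot hK0.le hA
      have h1 := h₃ (s - 1) (by omega) X T n hT hn₃ B α β S' (γ ::ₘ F') (by
        simp at hS; omega) (by simpa using hF') hBB
        (hψ.hasSpec_quot ha0 hT (r := r) (by
          convert hs using 1
          simp only [← Multiset.singleton_add]; abel) ha) hαβ
        (fun r hr => hSα r (Multiset.mem_cons_of_mem hr)) hFβ h
      refine hmix ?_
      have h2 := h1.lift_quot hT hψ ha0 ha
      rwa [← Multiset.cons_add] at h2
  have hr : r ∈ α ::ₘ S := by rw [hrS]; simp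
  have hrF : r ∉ γ ::ₘ β ::ₘ F' := fun h => hdisj r hr r h rfl
  have hγS : γ ∉ r ::ₘ S₁ := fun h => hdisj γ (by rwa [hrS]) γ (by simp) rfl
  have hβS : β ∉ r ::ₘ S₁ := fun h => hdisj β (by rwa [hrS]) β (by simp) rfl
  have hs'' : HasSpec T n A (γ ::ₘ (r ::ₘ S₁ + β ::ₘ F')) := by rwa [← hrS]
  have hdQ' := hdQ.mono (le_max_left C₁ C₃) hC hθ₁.le (le_max_left θ₁ θ₃)
  by_cases hsum : ∀ x, ∑ j ∈ Finset.range n,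
      sp T (relRate T φ (fun x => (ψ x).k 1) a c) j x ≤ S₀
  · refine hdom ?_
    rw [Multiset.cons_swap]
    exact hdomA hT hn' hA hφ hψ ha hc (by rwa [← Multiset.cons_add]) hrF hγS hdQ'
      (hdB.mono (le_max_right C₁ C₃) hC hθ₃.le (le_max_right θ₁ θ₃)) hsum
  · push Not at hsum
    obtain ⟨z, hz⟩ := hsum
    obtain ⟨A₁, hj, χ, P, c', hχ, hc'0, hc', hP, hPB, hPdom⟩ := hsteep hT hd hA hφ
      (e := fun x => (ψ x).k 1) hψ.map_k_one (fun x => hφ.quot_eigen_ne_zero hT hc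
        (fun h => hrF (by simp [h])) (hψ.it_k_one hT ha x) (fun h0 => by
          have := (ψ x).norm_k 1
          simp [h0] at this)) ha hc hs''
      (fun h => hrF (Multiset.mem_cons_of_mem h)) (by simp) hβS (by rwa [← hrS]) hdQ' z hz
    rw [← hrS] at hP hj
    have h1 := h₂ X T n hT hn₂ P α β S F' hS hF' hPB (by
      convert hP using 1
      simp only [← Multiset.singleton_add]; abel) hαβ hSα
      (fun r hr => hFβ r (Multiset.mem_cons_of_mem hr)) hPdom
    refine hmix ?_
    have h2 := h1.lift_sub hT hχ hc'0 hc'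
    rw [← Multiset.add_cons] at h2
    have e1 : γ ::ₘ (α ::ₘ S + β ::ₘ F') = α ::ₘ β ::ₘ (S + γ ::ₘ F') := by
      simp only [← Multiset.singleton_add]; abel
    rw [e1] at hj
    have h3 := h2.of_joined (by positivity) (by positivity) hj
    rwa [add_halves] at h3

end MixingStep

/-! ### Duality, and the dichotomy in every dimension -/

section Dual

variable {X V W : Type*} [NormedAddCommGroup V] [InnerProductSpace ℝ V]
  [FiniteDimensional ℝ V] {T : Equiv.Perm X} {n : ℕ}

theorem charpoly_adjoint_real (f : V →L[ℝ] V) :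
    (star f).toLinearMap.charpoly = f.toLinearMap.charpoly := by
  classical
  have := FiniteDimensional.complete ℝ V
  let b := stdOrthonormalBasis ℝ V
  rw [← LinearMap.charpoly_toMatrix f.toLinearMap b.toBasis,
    ← LinearMap.charpoly_toMatrix _ b.toBasis, ← Matrix.charpoly_transpose]
  congr 1
  ext i j
  simp only [Matrix.transpose_apply, LinearMap.toMatrix_apply, OrthonormalBasis.coe_toBasis,
    OrthonormalBasis.coe_toBasis_repr_apply, ContinuousLinearMap.coe_coe, OrthonormalBasis.repr_apply_apply,
    ContinuousLinearMap.star_eq_adjoint, ContinuousLinearMap.adjoint_inner_right]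
  rw [real_inner_comm]

theorem reverse_X_sub_C (r : ℝ) :
    (Polynomial.X - C r : ℝ[X]).reverse = 1 - C r * Polynomial.X := by
  rw [reverse, natDegree_X_sub_C, reflect_sub, reflect_C]
  have : reflect 1 (Polynomial.X : ℝ[X]) = 1 := by
    simp
  rw [this, pow_one]

/-- Reversing a product of factors `X - r` gives factors `1 - r X`, which are proportional to `X -
r⁻¹`; the constant is determined because both sides are monic. -/
theorem charpoly_of_leftInverse {f g : V →ₗ[ℝ] V} (h : g ∘ₗ f = LinearMap.id) {s : Multiset ℝ}
    (hs : ∀ r ∈ s, r ≠ 0) (hf : f.charpoly = (s.map fun r => Polynomial.X - C r).prod) :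
    g.charpoly = ((s.map (·⁻¹)).map fun r => Polynomial.X - C r).prod := by
  classical
  let b := Module.finBasis ℝ V
  set A := LinearMap.toMatrix b b f with hA
  set B := LinearMap.toMatrix b b g with hB
  have hBA : B * A = 1 := by
    rw [hA, hB, ← LinearMap.toMatrix_comp, h, LinearMap.toMatrix_id]
  have hB' : B = A⁻¹ := (Matrix.inv_eq_left_inv hBA).symm
  have hu : IsUnit A := IsUnit.of_mul_eq_one_right B hBA
  have h1 : A.charpoly = (s.map fun r => Polynomial.X - C r).prod := by
    rw [hA, LinearMap.charpoly_toMatrix, hf]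
  have h2 : A.charpolyRev = C (s.map fun r => -r).prod *
      ((s.map (·⁻¹)).map fun r => Polynomial.X - C r).prod := by
    rw [← Matrix.reverse_charpoly, h1]
    clear h1 hf
    induction s using Multiset.induction_on with
    | empty =>
      rw [Multiset.map_zero, Multiset.prod_zero, ← C_1, reverse_C]
      simp
    | cons r s ih =>
      have hr : r ≠ 0 := hs r (Multiset.mem_cons_self _ _)
      simp only [Multiset.map_cons, Multiset.prod_cons]
      rw [reverse_mul_of_domain, ih fun r hr => hs r (Multiset.mem_cons_of_mem hr),
        reverse_X_sub_C]
      have : (1 - C r * Polynomial.X : ℝ[X]) = C (-r) * (Polynomial.X - C r⁻¹) := by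
        rw [mul_sub, ← C_mul, neg_mul, mul_inv_cancel₀ hr]
        simp
        ring
      rw [this, C_mul]
      ring
  have h3 := Matrix.charpoly_inv A hu
  rw [← hB', h2, hB, LinearMap.charpoly_toMatrix] at h3
  set q := ((s.map (·⁻¹)).map fun r => Polynomial.X - C r).prod with hq
  have hqm : q.Monic := monic_multiset_prod_of_monic _ (fun r => Polynomial.X - C r)
    fun r _ => monic_X_sub_C r
  obtain ⟨k, hk⟩ : ∃ k : ℝ, g.charpoly = C k * q := by
    refine ⟨(-1) ^ Fintype.card (Fin (Module.finrank ℝ V)) * Ring.inverse A.det *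
      (s.map fun r => -r).prod, ?_⟩
    rw [h3]
    simp only [C_mul, C_pow, C_neg, C_1]
    ring
  have h4 := congrArg leadingCoeff hk
  rw [(LinearMap.charpoly_monic g).leadingCoeff, leadingCoeff_mul, leadingCoeff_C,
    hqm.leadingCoeff, mul_one] at h4
  rw [hk, ← h4, C_1, one_mul]

theorem HasSpec.ne_zero {A : X → V →L[ℝ] V} {s : Multiset ℝ} (h : HasSpec T n A s)
    (hA : ∀ x, Function.Injective (A x)) (x : X) {r : ℝ} (hr : r ∈ s) : r ≠ 0 := by
  rintro rfl
  have h1 := h.isRoot x hr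
  rw [← Module.End.hasEigenvalue_iff_isRoot_charpoly] at h1
  obtain ⟨v, hv⟩ := h1.exists_hasEigenvector
  have h2 : it T A n x v = (0 : ℝ) • v := hv.apply_eq_smul
  rw [zero_smul] at h2
  exact hv.2 ((injective_iff_map_eq_zero _).1 (it_injective hA n x) v h2)

/-- The contragredient cocycle. -/
noncomputable def dual (A : X → V →L[ℝ] V) (x : X) : V →L[ℝ] V := star (Ring.inverse (A x))

theorem Bdd.isUnit {A : X → V →L[ℝ] V} {K : ℝ} (hA : Bdd A K) (x : X) : IsUnit (A x) := by
  have := FiniteDimensional.complete ℝ V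
  exact ContinuousLinearMap.isUnit_iff_bijective.2 (hA.bijective x)

theorem dual_dual {A : X → V →L[ℝ] V} {K : ℝ} (hA : Bdd A K) : dual (dual A) = A := by
  funext x
  obtain ⟨u, hu⟩ := hA.isUnit x
  unfold dual
  rw [Ring.inverse_star, star_star, ← hu, Ring.inverse_unit, Ring.inverse_unit, inv_inv]

theorem inner_dual {A : X → V →L[ℝ] V} {K : ℝ} (hA : Bdd A K) (x : X) (v w : V) :
    inner ℝ (dual A x v) (A x w) = inner ℝ v w := by
  unfold dual
  rw [ContinuousLinearMap.star_eq_adjoint, ContinuousLinearMap.adjoint_inner_left]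
  congr 1
  exact DFunLike.congr_fun (Ring.inverse_mul_cancel _ (hA.isUnit x)) w

theorem inner_it_dual {A : X → V →L[ℝ] V} {K : ℝ} (hA : Bdd A K) (m : ℕ) (x : X) (v w : V) :
    inner ℝ (it T (dual A) m x v) (it T A m x w) = inner ℝ v w := by
  induction m generalizing x v w with
  | zero => rfl
  | succ m ih =>
    rw [it_succ, it_succ, ContinuousLinearMap.comp_apply, ContinuousLinearMap.comp_apply, ih,
      inner_dual hA]

theorem norm_inverse_le {A : X → V →L[ℝ] V} {K : ℝ} (hK : 0 ≤ K) (hA : Bdd A K) (x : X) :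
    ‖Ring.inverse (A x)‖ ≤ K := by
  refine ContinuousLinearMap.opNorm_le_bound _ hK fun v => ?_
  have h1 : A x (Ring.inverse (A x) v) = v :=
    DFunLike.congr_fun (Ring.mul_inverse_cancel _ (hA.isUnit x)) v
  have h2 := (hA x).2 (Ring.inverse (A x) v)
  rwa [h1] at h2

theorem Bdd.dual {A : X → V →L[ℝ] V} {K : ℝ} (hK : 0 ≤ K) (hA : Bdd A K) : Bdd (dual A) K := by
  refine fun x => ⟨?_, fun v => ?_⟩
  · rw [_root_.dual, ContinuousLinearMap.star_eq_adjoint, LinearIsometryEquiv.norm_map]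
    exact norm_inverse_le hK hA x
  · rcases eq_or_ne v 0 with rfl | hv
    · simp
    · have h0 : 0 < ‖v‖ := norm_pos_iff.2 hv
      refine le_of_mul_le_mul_right ?_ h0
      calc ‖v‖ * ‖v‖ = inner ℝ (_root_.dual A x v) (A x v) := by
            rw [inner_dual hA, real_inner_self_eq_norm_mul_norm]
        _ ≤ ‖_root_.dual A x v‖ * ‖A x v‖ := real_inner_le_norm _ _
        _ ≤ ‖_root_.dual A x v‖ * (K * ‖v‖) := by gcongr; exact hA.le x v
        _ = _ := by ring

theorem norm_dual_sub_le {A B : X → V →L[ℝ] V} {K : ℝ} (hK : 0 ≤ K) (hA : Bdd A K) (hB : Bdd B K)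
    (x : X) : ‖dual A x - dual B x‖ ≤ K * K * ‖A x - B x‖ := by
  have h : Ring.inverse (A x) - Ring.inverse (B x) =
      Ring.inverse (A x) * (B x - A x) * Ring.inverse (B x) := by
    rw [mul_sub, sub_mul, mul_assoc, Ring.mul_inverse_cancel _ (hB.isUnit x),
      Ring.inverse_mul_cancel _ (hA.isUnit x), mul_one, one_mul]
  unfold dual
  rw [← star_sub, ContinuousLinearMap.star_eq_adjoint, LinearIsometryEquiv.norm_map, h]
  calc _ ≤ ‖Ring.inverse (A x)‖ * ‖B x - A x‖ * ‖Ring.inverse (B x)‖ :=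
        (norm_mul_le _ _).trans (by gcongr; exact norm_mul_le _ _)
    _ ≤ K * ‖B x - A x‖ * K := by
        gcongr
        · exact norm_inverse_le hK hA x
        · exact norm_inverse_le hK hB x
    _ = _ := by rw [norm_sub_rev]; ring

theorem HasSpec.dual {A : X → V →L[ℝ] V} {K : ℝ} (hA : Bdd A K) {s : Multiset ℝ}
    (hs : HasSpec T n A s) : HasSpec T n (dual A) (s.map (·⁻¹)) := by
  intro x
  have := FiniteDimensional.complete ℝ V
  rw [← charpoly_adjoint_real]
  refine charpoly_of_leftInverse ?_ (fun r hr => hs.ne_zero hA.injective x hr) (hs x)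
  ext w
  refine ext_inner_left ℝ fun v => ?_
  simp only [LinearMap.comp_apply, ContinuousLinearMap.coe_coe, LinearMap.id_apply]
  rw [ContinuousLinearMap.star_eq_adjoint, ContinuousLinearMap.adjoint_inner_right,
    inner_it_dual hA]

theorem continuous_dual {ι : Type*} [TopologicalSpace ι] {f : ι → X → V →L[ℝ] V} {K : ℝ}
    (hf : Continuous f) (hB : ∀ t, Bdd (f t) K) : Continuous fun t => dual (f t) := by
  have := FiniteDimensional.complete ℝ V
  refine continuous_pi fun x => ?_
  have h1 : Continuous fun t => Ring.inverse (f t x) := by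
    refine continuous_iff_continuousAt.2 fun t => ?_
    obtain ⟨u, hu⟩ := (hB t).isUnit x
    have h2 := NormedRing.inverse_continuousAt u
    rw [hu] at h2
    exact ContinuousAt.comp (f := fun t => f t x) h2
      ((continuous_apply x).comp hf).continuousAt
  exact h1.star

/-- Duality inverts the eigenvalues, so the slower of the pair becomes `β⁻¹` and the roles of `a`
and `b` are exchanged. Since `a * b` is constant, `|b⁻¹|` is a multiple of `|a|` and inherits its
continuity and monotonicity. -/
theorem Mixes.dual {A : X → V →L[ℝ] V} {K ε δ α β : ℝ} {s : Multiset ℝ} (hK : 1 ≤ K) (hA : Bdd A K)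
    (hδ : δ ≤ 1 / (4 * K)) (hδε : 4 * K ^ 2 * δ ≤ ε) (hα : α ≠ 0) (hβ : β ≠ 0)
    (h : Mixes T n (dual A) δ β⁻¹ α⁻¹ (s.map (·⁻¹))) : Mixes T n A ε α β s := by
  have hK0 : 0 < K := by linarith
  have hD := hA.dual hK0.le
  obtain ⟨A₁, ⟨γ, hγ⟩, f, a, b, hf, hf0, hfn, hfs, hac, ham, hab, hab1, ha0, hb0, hprod⟩ := h
  have h2 : 1 / (4 * K) + 1 / (4 * K) = 1 / (2 * K) := by field_simp; norm_num
  have h3 : 0 < 1 / (4 * K) := by positivity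
  have hγB : ∀ t, Bdd (γ t) (2 * K) := fun t => hD.perturb hK0
    (by linarith : δ ≤ 1 / (2 * K)) hK (hγ t).2
  have hA₁n : ∀ x, ‖A₁ x - _root_.dual A x‖ ≤ δ := by
    have := (hγ 1).2
    simpa using this
  have hA₁B : Bdd A₁ (2 * K) := by
    have := hγB 1
    rwa [γ.target] at this
  have hfB : ∀ t, Bdd (f t) (2 * K) := fun t => hD.perturb hK0
    (by linarith : δ + δ ≤ 1 / (2 * K)) hK fun x => by
      have h4 : f t x - _root_.dual A x = (f t x - A₁ x) + (A₁ x - _root_.dual A x) := by abel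
      rw [h4]
      exact (norm_add_le _ _).trans (add_le_add (hfn t x) (hA₁n x))
  have hinv : ∀ s : Multiset ℝ, (s.map (·⁻¹)).map (·⁻¹) = s := fun s => by
    rw [Multiset.map_map]; simp
  have hcons : ∀ p q : ℝ, (p ::ₘ q ::ₘ s.map (·⁻¹)).map (·⁻¹) = q⁻¹ ::ₘ p⁻¹ ::ₘ s := fun p q => by
    rw [Multiset.map_cons, Multiset.map_cons, hinv, Multiset.cons_swap]
  have hlip : ∀ B B' : X → V →L[ℝ] V, Bdd B (2 * K) → Bdd B' (2 * K) → ∀ x, ‖B x - B' x‖ ≤ δ →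
      ‖_root_.dual B x - _root_.dual B' x‖ ≤ ε := fun B B' hB hB' x hx => by
    refine ((norm_dual_sub_le (by positivity) hB hB' x).trans ?_).trans hδε
    calc 2 * K * (2 * K) * ‖B x - B' x‖ ≤ 2 * K * (2 * K) * δ := by gcongr
      _ = _ := by ring
  have hD2 : Bdd (_root_.dual A) (2 * K) := hD.mono (by linarith)
  have hab0 : ∀ t, a t ≠ 0 ∧ b t ≠ 0 := fun t => by
    rw [← mul_ne_zero_iff, hprod]
    exact mul_ne_zero (inv_ne_zero hβ) (inv_ne_zero hα)
  have hbinv : ∀ t, |(b t)⁻¹| = |a t| * |α * β| := fun t => by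
    have h4 := hprod t
    have h5 := (hab0 t).2
    rw [← abs_mul]
    congr 1
    field_simp
    field_simp at h4
    linear_combination (-1 : ℝ) * h4
  refine ⟨_root_.dual A₁, ⟨⟨⟨fun t => _root_.dual (γ t), continuous_dual γ.continuous hγB⟩,
    ?_, ?_⟩, fun t => ⟨?_, fun x => ?_⟩⟩, fun t => _root_.dual (f t), fun t => (b t)⁻¹,
    fun t => (a t)⁻¹, continuous_dual hf hfB, ?_, fun t x => hlip _ _ (hfB t) hA₁B x (hfn t x),
    fun t => ?_, ?_, ?_, fun t => ?_, ?_, ?_, ?_, fun t => ?_⟩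
  · change _root_.dual (γ 0) = A
    rw [γ.source]; exact dual_dual hA
  · change _root_.dual (γ 1) = _
    rw [γ.target]
  · have := (hγ t).1.dual (hγB t)
    rw [hcons, inv_inv, inv_inv] at this
    exact this
  · change ‖_root_.dual (γ t) x - A x‖ ≤ ε
    have := hlip _ _ (hγB t) hD2 x ((hγ t).2 x)
    rwa [dual_dual hA] at this
  · simp only [hf0]
  · have := (hfs t).dual (hfB t)
    rwa [hcons] at this
  · simp only [hbinv]
    exact hac.mul continuous_const
  · intro s t hst
    simp only [hbinv]
    exact mul_le_mul_of_nonneg_right (ham hst) (abs_nonneg _)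
  · rw [abs_inv, abs_inv]
    exact inv_anti₀ (abs_pos.2 (hab0 t).1) (hab t)
  · rw [abs_inv, abs_inv, hab1]
  · change (b 0)⁻¹ = α
    rw [hb0, inv_inv]
  · change (a 0)⁻¹ = β
    rw [ha0, inv_inv]
  · change (b t)⁻¹ * (a t)⁻¹ = α * β
    rw [← mul_inv, mul_comm, hprod, mul_inv, inv_inv, inv_inv, mul_comm]

theorem isCoprime_prod_X_sub_C {S F : Multiset ℝ} (h : ∀ r ∈ S, r ∉ F) :
    IsCoprime (S.map fun r => Polynomial.X - C r).prod (F.map fun r => Polynomial.X - C r).prod := by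
  induction S using Multiset.induction_on with
  | empty => simpa using isCoprime_one_left
  | cons r S ih =>
    rw [Multiset.map_cons, Multiset.prod_cons]
    refine IsCoprime.mul_left ?_ (ih fun r hr => h r (Multiset.mem_cons_of_mem hr))
    have hr := h r (Multiset.mem_cons_self _ _)
    clear ih h
    induction F using Multiset.induction_on with
    | empty => simpa using isCoprime_one_right
    | cons q F ih =>
      rw [Multiset.map_cons, Multiset.prod_cons]
      refine IsCoprime.mul_right (isCoprime_X_sub_C_of_isUnit_sub ?_)
        (ih fun h => hr (Multiset.mem_cons_of_mem h))
      exact (sub_ne_zero.2 fun h => hr (by simp [h])).isUnit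

/-- Bézout for the coprime products over `S` and over `F` turns the range into a kernel. -/
theorem mem_slow_iff {A : X → V →L[ℝ] V} {S F : Multiset ℝ} (hs : HasSpec T n A (S + F))
    (h : ∀ r ∈ S, r ∉ F) (x : X) (v : V) : v ∈ slow T n A F x ↔
      aeval (it T A n x).toLinearMap (S.map fun r => Polynomial.X - C r).prod v = 0 := by
  refine ⟨aeval_eq_zero_of_mem_slow hs, fun hv => ?_⟩
  obtain ⟨a, b, hab⟩ := isCoprime_prod_X_sub_C h
  have h1 := congrArg (fun p => aeval (it T A n x).toLinearMap p v) hab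
  simp only [map_add, map_mul, map_one, LinearMap.add_apply, Module.End.mul_apply, hv, map_zero,
    zero_add, Module.End.one_apply] at h1
  refine ⟨aeval (it T A n x).toLinearMap b v, ?_⟩
  rw [← Module.End.mul_apply, ← map_mul, mul_comm, map_mul]
  exact h1

theorem aeval_inverse_eq_zero_iff {f g : V →ₗ[ℝ] V} (h1 : ∀ v, g (f v) = v) (h2 : ∀ v, f (g v) = v)
    {F : Multiset ℝ} (hF : ∀ r ∈ F, r ≠ 0) (v : V) :
    aeval g (F.map fun r => Polynomial.X - C r).prod v = 0 ↔
      aeval f ((F.map (·⁻¹)).map fun r => Polynomial.X - C r).prod v = 0 := by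
  induction F using Multiset.induction_on generalizing v with
  | empty => simp
  | cons r F ih =>
    have hr : r ≠ 0 := hF r (Multiset.mem_cons_self _ _)
    simp only [Multiset.map_cons, Multiset.prod_cons]
    rw [mul_comm, map_mul, Module.End.mul_apply, ih fun r hr => hF r (Multiset.mem_cons_of_mem hr)]
    set p := ((F.map (·⁻¹)).map fun r => Polynomial.X - C r).prod with hp
    have hcomm : ∀ w, aeval f p (g w) = g (aeval f p w) := fun w => by
      have := aeval_intertwine (f := f) (g := f) (R := g) (fun v => by rw [h1, h2]) p w
      exact this.symm
    have e1 : aeval g (Polynomial.X - C r) v = g v - r • v := by simp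
    have e2 : ∀ w, aeval f (Polynomial.X - C r⁻¹) w = f w - r⁻¹ • w := fun w => by simp
    rw [map_mul, Module.End.mul_apply, e1, e2, map_sub, hcomm, map_smul]
    set w := aeval f p v
    constructor
    · intro h
      have h3 := congrArg f h
      rw [map_sub, h2, map_smul, map_zero, sub_eq_zero] at h3
      have h4 : f w = r⁻¹ • w := by
        conv_rhs => rw [h3]
        rw [smul_smul, inv_mul_cancel₀ hr, one_smul]
      rw [h4, sub_self]
    · intro h
      have h3 := congrArg g h
      rw [map_sub, h1, map_smul, map_zero, sub_eq_zero] at h3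
      have h4 : g w = r • w := by
        conv_rhs => rw [h3]
        rw [smul_smul, mul_inv_cancel₀ hr, one_smul]
      rw [h4, sub_self]

theorem aeval_star (f : V →L[ℝ] V) (p : ℝ[X]) (v w : V) :
    inner ℝ (aeval (star f).toLinearMap p v) w = inner ℝ v (aeval f.toLinearMap p w) := by
  have := FiniteDimensional.complete ℝ V
  induction p using Polynomial.induction_on generalizing v w with
  | C a => simp [real_inner_smul_left, real_inner_smul_right]
  | add p q hp hq => simp [inner_add_left, inner_add_right, hp, hq]
  | monomial k a ih =>
    have e1 : aeval (star f).toLinearMap (C a * Polynomial.X ^ (k + 1)) v =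
        aeval (star f).toLinearMap (C a * Polynomial.X ^ k) (star f v) := by
      rw [pow_succ, ← mul_assoc, map_mul, Module.End.mul_apply, aeval_X]; rfl
    have e2 : aeval f.toLinearMap (C a * Polynomial.X ^ (k + 1)) w =
        f (aeval f.toLinearMap (C a * Polynomial.X ^ k) w) := by
      rw [pow_succ, ← mul_assoc, mul_comm, map_mul, Module.End.mul_apply, aeval_X]; rfl
    rw [e1, e2, ih, ContinuousLinearMap.star_eq_adjoint, ContinuousLinearMap.adjoint_inner_left]

/-- The kernel of a polynomial in the adjoint is the orthogonal complement of the range of that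
polynomial in the map. The adjoint of the return map of `A` is the inverse of the dual return map,
and passing to inverses replaces the roots by their inverses. -/
theorem slow_dual {A : X → V →L[ℝ] V} {K : ℝ} (hA : Bdd A K) {S F : Multiset ℝ}
    (hs : HasSpec T n A (S + F)) (h : ∀ r ∈ S, r ∉ F) (x : X) :
    slow T n (dual A) (S.map (·⁻¹)) x = (slow T n A F x)ᗮ := by
  have := FiniteDimensional.complete ℝ V
  have hs' := hs.dual hA
  rw [Multiset.map_add, add_comm] at hs'
  have h0 : ∀ r ∈ F, r ≠ 0 := fun r hr =>
    hs.ne_zero hA.injective x (Multiset.mem_add.2 (Or.inr hr))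
  set M := it T A n x with hM
  set N := it T (dual A) n x with hN
  have hNM : ∀ w, star N (M w) = w := fun w => by
    refine ext_inner_left ℝ fun v => ?_
    rw [ContinuousLinearMap.star_eq_adjoint, ContinuousLinearMap.adjoint_inner_right, hN, hM,
      inner_it_dual hA]
  have hMN : ∀ w, star M (N w) = w := fun w => by
    refine ext_inner_right ℝ fun v => ?_
    rw [ContinuousLinearMap.star_eq_adjoint, ContinuousLinearMap.adjoint_inner_left, hN, hM,
      inner_it_dual hA]
  have hNM' : ∀ w, N (star M w) = w := fun w => by
    have hinj : Function.Injective (star M).toLinearMap :=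
      LinearMap.injective_iff_surjective.2 fun w => ⟨N w, hMN w⟩
    exact hinj (hMN (star M w))
  ext v
  rw [mem_slow_iff hs' (by
    intro r hr hr'
    obtain ⟨a, ha, rfl⟩ := Multiset.mem_map.1 hr
    obtain ⟨b, hb, hab⟩ := Multiset.mem_map.1 hr'
    exact h a (inv_injective hab ▸ hb) ha), ← aeval_inverse_eq_zero_iff (g := (star M).toLinearMap)
    (f := N.toLinearMap) hMN hNM' h0, Submodule.mem_orthogonal']
  constructor
  · rintro hv _ ⟨w, rfl⟩
    rw [← aeval_star, hv, inner_zero_left]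
  · intro hv
    refine ext_inner_right ℝ fun w => ?_
    rw [aeval_star, inner_zero_left]
    exact hv _ ⟨w, rfl⟩

/-- The pairing of an orbit of the dual cocycle with an orbit of `A` is constant. The norm of `L` is
dual to the distance from `M = Lᗮ` and vice versa, so the domination of `M` is the transpose of that
of `L`. -/
theorem Dom.of_dual {A : X → V →L[ℝ] V} {K C θ : ℝ} (hK : 0 ≤ K) (hA : Bdd A K)
    (hC : 0 ≤ C) (hθ : 0 ≤ θ)
    {L M : X → Submodule ℝ V} (hLM : ∀ x, M x = (L x)ᗮ)
    (hL : ∀ x, (L x).map (A x).toLinearMap = L (T x))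
    (hM : ∀ x, (M x).map (dual A x).toLinearMap = M (T x))
    (h : Dom T (dual A) M C θ) : Dom T A L C θ := by
  intro x m l hl w
  have hqL : ∀ x w, qd (L x) w = ‖(M x).starProjection w‖ := fun x w => by rw [hLM]; rfl
  have hqM : ∀ x, ∀ l ∈ L x, qd (M x) l = ‖l‖ := fun x l hl => by
    unfold qd
    rw [Submodule.starProjection_eq_self_iff.2]
    rw [hLM, Submodule.orthogonal_orthogonal]
    exact hl
  have hinn : ∀ x, ∀ l ∈ L x, ∀ v, inner ℝ l v ≤ ‖l‖ * qd (M x) v := by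
    intro x l hl v
    obtain ⟨p, hp, hp1, -⟩ := exists_qd_eq (M x) v
    have h1 : inner ℝ l p = 0 := by
      rw [hLM] at hp
      exact Submodule.inner_right_of_mem_orthogonal hl hp
    calc inner ℝ l v = inner ℝ l (v - p) := by rw [inner_sub_right, h1, sub_zero]
      _ ≤ ‖l‖ * ‖v - p‖ := real_inner_le_norm _ _
      _ = _ := by rw [hp1]
  have hinn' : ∀ x, ∀ l ∈ M x, ∀ v, inner ℝ l v ≤ ‖l‖ * qd (L x) v := by
    intro x l hl v
    obtain ⟨p, hp, hp1, -⟩ := exists_qd_eq (L x) v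
    have h1 : inner ℝ l p = 0 := by
      rw [hLM] at hl
      exact Submodule.inner_left_of_mem_orthogonal hp hl
    calc inner ℝ l v = inner ℝ l (v - p) := by rw [inner_sub_right, h1, sub_zero]
      _ ≤ ‖l‖ * ‖v - p‖ := real_inner_le_norm _ _
      _ = _ := by rw [hp1]
  set y := T^[m] x
  set k := (M x).starProjection w with hk
  have hkM : k ∈ M x := (M x).starProjection_apply_mem w
  have hkq : ‖k‖ = qd (L x) w := (hqL x w).symm
  have hkw : inner ℝ k w = ‖k‖ * ‖k‖ := by
    have h1 : inner ℝ k (w - k) = 0 := by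
      rw [real_inner_comm]
      exact Submodule.starProjection_inner_eq_zero w k hkM
    have h2 : w = k + (w - k) := by abel
    conv_lhs => rw [h2]
    rw [inner_add_right, h1, add_zero, real_inner_self_eq_norm_mul_norm]
  have e1 : ‖k‖ * ‖k‖ ≤ ‖it T (dual A) m x k‖ * qd (L y) (it T A m x w) := by
    rw [← hkw, ← inner_it_dual hA m x k w]
    exact hinn' y _ (it_mem hM m x hkM) _
  -- The test vectors are `k`, the part of `w` orthogonal to `L`, and this `v`, whose dual orbit
  -- ends exactly at the image of `l`.
  obtain ⟨v, hv⟩ : ∃ v, it T (dual A) m x v = it T A m x l := by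
    have := it_injective (T := T) (hA.dual hK).injective m x
    exact LinearMap.injective_iff_surjective (f := (it T (dual A) m x).toLinearMap) |>.1 this _
  have e2 : ‖it T A m x l‖ * ‖it T A m x l‖ ≤ ‖l‖ * qd (M x) v := by
    rw [← real_inner_self_eq_norm_mul_norm]
    conv_lhs => rw [← hv]
    rw [hv]
    have h1 := inner_it_dual (T := T) hA m x v l
    rw [hv] at h1
    rw [h1, real_inner_comm]
    exact hinn x l hl v
  have e3 := h x m k hkM v
  rw [hv, hqM y _ (it_mem hL m x hl)] at e3
  rw [← hkq]
  rcases (norm_nonneg k).eq_or_lt with h0 | h0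
  · rw [← h0, mul_zero]
    have := qd_nonneg (L y) (it T A m x w)
    positivity
  rcases (norm_nonneg (it T A m x l)).eq_or_lt with h0' | h0'
  · rw [← h0', zero_mul]
    have := qd_nonneg (L y) (it T A m x w)
    positivity
  refine le_of_mul_le_mul_right ?_ (mul_pos h0 h0')
  have hq := qd_nonneg (L y) (it T A m x w)
  have hq' := qd_nonneg (M x) v
  calc ‖it T A m x l‖ * ‖k‖ * (‖k‖ * ‖it T A m x l‖)
      = (‖it T A m x l‖ * ‖it T A m x l‖) * (‖k‖ * ‖k‖) := by ring
    _ ≤ (‖l‖ * qd (M x) v) * (‖it T (dual A) m x k‖ * qd (L y) (it T A m x w)) := by gcongr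
    _ = ‖l‖ * qd (L y) (it T A m x w) * (‖it T (dual A) m x k‖ * qd (M x) v) := by ring
    _ ≤ ‖l‖ * qd (L y) (it T A m x w) * (C * θ ^ m * (‖k‖ * ‖it T A m x l‖)) := by gcongr
    _ = _ := by ring

theorem UnifMix.dual.{w} {V : Type} [NormedAddCommGroup V] [InnerProductSpace ℝ V]
    [FiniteDimensional ℝ V] {s t : ℕ} (h : UnifMix.{w} V t s) : UnifMix.{w} V s t := by
  intro K ε hK hε
  have hK0 : 0 < K := by linarith
  set δ := min (1 / (4 * K)) (ε / (4 * K ^ 2)) with hδ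
  have hδ0 : 0 < δ := lt_min (by positivity) (by positivity)
  obtain ⟨C, θ, N, hC, hθ0, hθ1, h1⟩ := h K δ hK hδ0
  refine ⟨C, θ, N, hC, hθ0, hθ1, fun X T n hT hn A α β S F hS hF hA hs hαβ hSα hFβ hdom => ?_⟩
  have hX : Nonempty X := by
    by_contra hX
    exact hdom fun x => (hX ⟨x⟩).elim
  obtain ⟨x₀⟩ := hX
  have hα : α ≠ 0 := hs.ne_zero hA.injective x₀ (by simp)
  have hβ : β ≠ 0 := hs.ne_zero hA.injective x₀ (by simp)
  refine Mixes.dual (δ := δ) hK hA (min_le_left _ _) ?_ hα hβ ?_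
  · have : δ ≤ ε / (4 * K ^ 2) := min_le_right _ _
    rw [le_div_iff₀ (by positivity)] at this
    linarith
  have hs' : HasSpec T n A (α ::ₘ S + β ::ₘ F) := by
    convert hs using 1
    simp only [← Multiset.singleton_add]; abel
  have hdisj : ∀ r ∈ α ::ₘ S, r ∉ β ::ₘ F := by
    intro r hr hr'
    have h1 : |r| ≤ |α| := by
      rcases Multiset.mem_cons.1 hr with rfl | h
      · exact le_rfl
      · exact hSα r h
    have h2 : |β| ≤ |r| := by
      rcases Multiset.mem_cons.1 hr' with rfl | h
      · exact le_rfl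
      · exact hFβ r h
    linarith
  have hD := hA.dual hK0.le
  have h2 := h1 X T n hT hn (_root_.dual A) β⁻¹ α⁻¹ (F.map (·⁻¹)) (S.map (·⁻¹)) (by simpa using hF)
    (by simpa using hS) hD
    (by
      have := hs.dual hA
      convert this using 1
      simp only [Multiset.map_cons, Multiset.map_add, Multiset.map_singleton, ← Multiset.singleton_add]; abel)
    (by rw [abs_inv, abs_inv]; exact inv_strictAnti₀ (abs_pos.2 hα) hαβ)
    (fun r hr => by
      obtain ⟨q, hq, rfl⟩ := Multiset.mem_map.1 hr
      rw [abs_inv, abs_inv]; exact inv_anti₀ (abs_pos.2 hβ) (hFβ q hq))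
    (fun r hr => by
      obtain ⟨q, hq, rfl⟩ := Multiset.mem_map.1 hr
      rw [abs_inv, abs_inv]
      refine inv_anti₀ (abs_pos.2 (hs.ne_zero hA.injective x₀ ?_)) (hSα q hq)
      simp [hq])
    (fun hd => hdom (Dom.of_dual hK0.le hA hC hθ0.le (slow_dual hA hs' hdisj)
      (fun x => slow_map hT hA.bijective _ x) (fun x => slow_map hT hD.bijective _ x) (by
        rwa [Multiset.map_cons])))
  rwa [← Multiset.map_add, add_comm F S] at h2

/-- The inductive step removes an eigenvalue beyond `β` and therefore needs `t > 0`. If `t = 0`,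
duality exchanges `s` and `t`. -/
theorem unifMix.{w} (N s t : ℕ) (hN : s + t = N) (V : Type) [NormedAddCommGroup V]
    [InnerProductSpace ℝ V] [FiniteDimensional ℝ V] (hV : Module.finrank ℝ V = N + 2) :
    UnifMix.{w} V s t := by
  induction N generalizing s t V with
  | zero =>
    obtain ⟨rfl, rfl⟩ : s = 0 ∧ t = 0 := by omega
    exact unifMix_two V hV
  | succ N ih =>
    have key : ∀ s t, s + t = N → UnifMix.{w} V s (t + 1) := by
      intro s t hst
      have hW : Module.finrank ℝ (EuclideanSpace ℝ (Fin (N + 2))) = N + 2 := by simp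
      refine UnifMix.step (W := EuclideanSpace ℝ (Fin (N + 2))) (by rw [hW, hV])
        (ih s t hst _ hW) ?_
      rcases Nat.eq_zero_or_pos s with h | h
      · exact Or.inl h
      · exact Or.inr ⟨s - 1, by omega, ih (s - 1) (t + 1) (by omega) _ hW⟩
    rcases Nat.eq_zero_or_pos t with rfl | h
    · obtain rfl : s = N + 1 := by omega
      exact (key 0 N (by omega)).dual
    · have := key s (t - 1) (by omega)
      rwa [show t - 1 + 1 = t by omega] at this

end Dual

/-! ### Robustness of domination under perturbation -/

theorem exists_fixed_of_powers {E : Type*} [NormedAddCommGroup E] [NormedSpace ℝ E]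
    [FiniteDimensional ℝ E] (L : E →ₗ[ℝ] E) {C θ r : ℝ} (hθ0 : 0 ≤ θ) (hθ1 : θ < 1)
    (hL : ∀ m v, ‖(L ^ m) v‖ ≤ C * θ ^ m * ‖v‖) {Q : E → E} (hC : 0 ≤ C) (hr : 0 ≤ r)
    (hQ0 : C / (1 - θ) * ‖Q 0‖ ≤ r / 2)
    (hQ : ∀ u v, ‖u‖ ≤ r → ‖v‖ ≤ r → C / (1 - θ) * ‖Q u - Q v‖ ≤ ‖u - v‖ / 2) :
    ∃ u, ‖u‖ ≤ r ∧ u - L u = Q u := by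
  have := FiniteDimensional.complete ℝ E
  have hθ' : 0 < 1 - θ := by linarith
  have hC1 : 0 ≤ C / (1 - θ) := by positivity
  have hgeo : ∀ m, (∑ j ∈ Finset.range m, θ ^ j) ≤ 1 / (1 - θ) := fun m => by
    rw [geom_sum_eq hθ1.ne, ← neg_div_neg_eq, neg_sub, neg_sub]
    gcongr
    linarith [pow_nonneg hθ0 m]
  -- A Neumann series: `L` itself need not be a contraction, but the decay of its powers bounds the
  -- inverse of `1 - L` by `C / (1 - θ)`. The equation `u = (1 - L)⁻¹ (Q u)` is then solved by
  -- contraction on the ball of radius `r`.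
  have hinv : ∀ v, ‖v‖ ≤ C / (1 - θ) * ‖v - L v‖ := by
    intro v
    have h1 : ∀ m, ‖v‖ ≤ C / (1 - θ) * ‖v - L v‖ + C * θ ^ m * ‖v‖ := by
      intro m
      have h2 : v = (∑ j ∈ Finset.range m, (L ^ j) (v - L v)) + (L ^ m) v := by
        induction m with
        | zero => simp
        | succ m ih =>
          rw [Finset.sum_range_succ, map_sub, pow_succ, Module.End.mul_apply]
          conv_lhs => rw [ih]
          abel
      calc ‖v‖ ≤ ‖∑ j ∈ Finset.range m, (L ^ j) (v - L v)‖ + ‖(L ^ m) v‖ := by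
            conv_lhs => rw [h2]
            exact norm_add_le _ _
        _ ≤ (∑ j ∈ Finset.range m, C * θ ^ j * ‖v - L v‖) + C * θ ^ m * ‖v‖ :=
            add_le_add (norm_sum_le_of_le _ fun j _ => hL j _) (hL m v)
        _ = C * ‖v - L v‖ * (∑ j ∈ Finset.range m, θ ^ j) + C * θ ^ m * ‖v‖ := by
            rw [Finset.mul_sum]
            congr 1
            exact Finset.sum_congr rfl fun j _ => by ring
        _ ≤ C * ‖v - L v‖ * (1 / (1 - θ)) + C * θ ^ m * ‖v‖ := by
            gcongr
            exact hgeo m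
        _ = _ := by ring
    have h2 : Filter.Tendsto (fun m : ℕ => C / (1 - θ) * ‖v - L v‖ + C * θ ^ m * ‖v‖)
        Filter.atTop (nhds (C / (1 - θ) * ‖v - L v‖ + C * 0 * ‖v‖)) :=
      (((tendsto_pow_atTop_nhds_zero_of_lt_one hθ0 hθ1).const_mul C).mul_const _).const_add _
    have := ge_of_tendsto' h2 h1
    simpa using this
  have hinj : Function.Injective (LinearMap.id - L : E →ₗ[ℝ] E) := by
    rw [injective_iff_map_eq_zero]
    intro v hv
    have h1 := hinv v
    have h2 : v - L v = 0 := hv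
    rw [h2, norm_zero, mul_zero] at h1
    exact norm_le_zero_iff.1 h1
  have hsurj := LinearMap.injective_iff_surjective.1 hinj
  choose G hG using hsurj
  have hG' : ∀ q, G q - L (G q) = q := hG
  have hGn : ∀ q q', ‖G q - G q'‖ ≤ C / (1 - θ) * ‖q - q'‖ := fun q q' => by
    have := hinv (G q - G q')
    rwa [map_sub, sub_sub_sub_comm, hG', hG'] at this
  have hG0 : G 0 = 0 := hinj (by rw [hG]; simp)
  have hmaps : Set.MapsTo (fun u => G (Q u)) (Metric.closedBall 0 r) (Metric.closedBall 0 r) := by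
    intro u hu
    rw [mem_closedBall_zero_iff] at hu ⊢
    have h1 := hGn (Q u) 0
    rw [hG0, sub_zero, sub_zero] at h1
    have h2 := hQ u 0 hu (by simpa using hr)
    rw [sub_zero] at h2
    calc ‖G (Q u)‖ ≤ C / (1 - θ) * ‖Q u‖ := h1
      _ ≤ C / (1 - θ) * (‖Q u - Q 0‖ + ‖Q 0‖) := by
          gcongr
          exact norm_le_norm_sub_add _ _
      _ ≤ r := by rw [mul_add]; linarith
  obtain ⟨u, hu, hfix, -⟩ := ContractingWith.exists_fixedPoint' (K := 1 / 2)
    (Metric.isClosed_closedBall (x := (0 : E)) (ε := r)).isComplete hmaps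
    ⟨by norm_num, LipschitzWith.of_dist_le_mul fun p q => by
      rw [Subtype.dist_eq, Subtype.dist_eq, dist_eq_norm, dist_eq_norm]
      refine (hGn _ _).trans ((hQ _ _ (mem_closedBall_zero_iff.1 p.2)
        (mem_closedBall_zero_iff.1 q.2)).trans (le_of_eq ?_))
      simp; ring⟩ (x := 0) (by simpa using hr) (edist_ne_top _ _)
  refine ⟨u, mem_closedBall_zero_iff.1 hu, ?_⟩
  have h1 : G (Q u) = u := hfix
  conv_lhs => rw [← h1]
  exact hG' _

section Robust

variable {X V W₁ W₂ : Type*} [NormedAddCommGroup V] [InnerProductSpace ℝ V]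
  [FiniteDimensional ℝ V]
  [NormedAddCommGroup W₁] [InnerProductSpace ℝ W₁] [FiniteDimensional ℝ W₁]
  [NormedAddCommGroup W₂] [InnerProductSpace ℝ W₂] [FiniteDimensional ℝ W₂]
  {T : Equiv.Perm X} {n : ℕ}

/-- The cocycle `P` is dominated by the cocycle `S`, with exponential rate. -/
def PairDom (T : Equiv.Perm X) (P : X → W₁ →L[ℝ] W₁) (S : X → W₂ →L[ℝ] W₂) (C θ : ℝ) : Prop :=
  ∀ x m p s, ‖it T P m x p‖ * ‖s‖ ≤ C * θ ^ m * (‖p‖ * ‖it T S m x s‖)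

theorem norm_it_sub_le {A B : X → V →L[ℝ] V} {K τ : ℝ} (hK : 1 ≤ K) (hA : Bdd A K) (hτ0 : 0 ≤ τ)
    (hτ : τ ≤ 1) (hAB : ∀ x, ‖B x - A x‖ ≤ τ) (m : ℕ) (x : X) (v : V) :
    ‖it T B m x v - it T A m x v‖ ≤ m * (2 * K) ^ m * τ * ‖v‖ := by
  induction m generalizing x v with
  | zero => simp
  | succ m ih =>
    have h1 : ‖B x v - A x v‖ ≤ τ * ‖v‖ := by
      have := (B x - A x).le_of_opNorm_le (hAB x) v
      simpa using this
    have h2 : ‖B x v‖ ≤ 2 * K * ‖v‖ := by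
      have h3 := norm_add_le (A x v) (B x v - A x v)
      rw [add_sub_cancel] at h3
      have h4 := hA.le x v
      have : τ * ‖v‖ ≤ K * ‖v‖ := by gcongr; linarith
      linarith
    have h3 := hA.norm_it_le (T := T) (by linarith) m (T x) (B x v - A x v)
    have e : it T B (m + 1) x v - it T A (m + 1) x v =
        (it T B m (T x) (B x v) - it T A m (T x) (B x v)) + it T A m (T x) (B x v - A x v) := by
      rw [it_succ, it_succ, map_sub]; simp
    rw [e]
    have h5 : K ^ m ≤ (2 * K) ^ (m + 1) := by
      calc K ^ m ≤ (2 * K) ^ m := by gcongr; linarith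
        _ ≤ _ := pow_le_pow_right₀ (by linarith) (by omega)
    calc _ ≤ m * (2 * K) ^ m * τ * (2 * K * ‖v‖) + K ^ m * (τ * ‖v‖) :=
          (norm_add_le _ _).trans (add_le_add ((ih _ _).trans (by gcongr)) (h3.trans (by gcongr)))
      _ ≤ m * (2 * K) ^ m * τ * (2 * K * ‖v‖) + (2 * K) ^ (m + 1) * (τ * ‖v‖) := by gcongr
      _ = _ := by push_cast; ring

/-- After `m₀` steps the domination constant is at most `1 / 8`. A perturbation small in terms of
`m₀` costs a factor `2` for each of the two cocycles, which leaves `1 / 2`, and this can be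
iterated. -/
theorem PairDom.perturb.{w} {K C θ κ : ℝ} (hK : 1 ≤ K) (hθ0 : 0 ≤ θ) (hθ1 : θ < 1) (hκ : 0 < κ) :
    ∃ τ, 0 < τ ∧ τ ≤ 1 / (2 * K) ∧ ∃ ℓ₀ : ℕ, ∀ {X : Type w} {W₁ W₂ : Type} [NormedAddCommGroup W₁]
      [InnerProductSpace ℝ W₁] [FiniteDimensional ℝ W₁] [NormedAddCommGroup W₂]
      [InnerProductSpace ℝ W₂] [FiniteDimensional ℝ W₂]
      {T : Equiv.Perm X} {P P' : X → W₁ →L[ℝ] W₁} {S S' : X → W₂ →L[ℝ] W₂}, Bdd P K → Bdd S K →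
      PairDom T P S C θ → (∀ x, ‖P' x - P x‖ ≤ τ) → (∀ x, ‖S' x - S x‖ ≤ τ) → ∀ ℓ ≥ ℓ₀, ∀ x p s,
        ‖it T P' ℓ x p‖ * ‖s‖ ≤ κ * (‖p‖ * ‖it T S' ℓ x s‖) := by
  have hK0 : 0 < K := by linarith
  obtain ⟨m₀, hm₀, hm₀1⟩ : ∃ m₀ : ℕ, 1 ≤ m₀ ∧ C * θ ^ m₀ ≤ 1 / 8 := by
    have h1 : Filter.Tendsto (fun m : ℕ => C * θ ^ m) Filter.atTop (nhds (C * 0)) :=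
      (tendsto_pow_atTop_nhds_zero_of_lt_one hθ0 hθ1).const_mul C
    rw [mul_zero] at h1
    obtain ⟨m, h2, h3⟩ := ((h1.eventually_le_const (show (0 : ℝ) < 1 / 8 by norm_num)).and
      (Filter.eventually_ge_atTop 1)).exists
    exact ⟨m, h3, h2⟩
  set D := m₀ * (2 * K) ^ m₀ with hD
  have hD0 : 0 < D := by positivity
  -- `q₀` blocks also pay for the incomplete last block, which costs at most `(2 * K) ^ (2 * m₀)`.
  obtain ⟨q₀, hq₀⟩ : ∃ q₀ : ℕ, (1 / 2 : ℝ) ^ q₀ < κ / (2 * K) ^ (2 * m₀) :=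
    exists_pow_lt_of_lt_one (by positivity) (by norm_num)
  refine ⟨min (1 / (2 * K)) (1 / (2 * D * K ^ m₀)), lt_min (by positivity) (by positivity),
    min_le_left _ _, q₀ * m₀, ?_⟩
  intro X W₁ W₂ _ _ _ _ _ _ T P P' S S' hP hS hPS hPP hSS ℓ hℓ x p s
  set τ := min (1 / (2 * K)) (1 / (2 * D * K ^ m₀))
  have hτ0 : 0 ≤ τ := le_min (by positivity) (by positivity)
  have hτ1 : τ ≤ 1 / (2 * K) := min_le_left _ _
  have hτ2 : D * τ * K ^ m₀ ≤ 1 / 2 := by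
    have : τ ≤ 1 / (2 * D * K ^ m₀) := min_le_right _ _
    rw [le_div_iff₀ (by positivity)] at this
    linarith
  have hτ3 : τ ≤ 1 := hτ1.trans (by rw [div_le_one (by positivity)]; linarith)
  have hP' := hP.perturb hK0 hτ1 hK hPP
  have hS' := hS.perturb hK0 hτ1 hK hSS
  have step : ∀ x p s, ‖it T P' m₀ x p‖ * ‖s‖ ≤ 1 / 2 * (‖p‖ * ‖it T S' m₀ x s‖) := by
    intro x p s
    have h1 := norm_it_sub_le (T := T) hK hP hτ0 hτ3 hPP m₀ x p
    have h2 := norm_it_sub_le (T := T) hK hS hτ0 hτ3 hSS m₀ x s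
    rw [← hD] at h1 h2
    have h3 := hP.le_norm_it (T := T) hK0.le m₀ x p
    have h4 := hS.le_norm_it (T := T) hK0.le m₀ x s
    have h5 : D * τ * ‖p‖ ≤ 1 / 2 * ‖it T P m₀ x p‖ := by
      calc D * τ * ‖p‖ ≤ D * τ * (K ^ m₀ * ‖it T P m₀ x p‖) := by gcongr
        _ = D * τ * K ^ m₀ * ‖it T P m₀ x p‖ := by ring
        _ ≤ _ := by gcongr
    have h6 : D * τ * ‖s‖ ≤ 1 / 2 * ‖it T S m₀ x s‖ := by
      calc D * τ * ‖s‖ ≤ D * τ * (K ^ m₀ * ‖it T S m₀ x s‖) := by gcongr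
        _ = D * τ * K ^ m₀ * ‖it T S m₀ x s‖ := by ring
        _ ≤ _ := by gcongr
    have h7 : ‖it T P' m₀ x p‖ ≤ 2 * ‖it T P m₀ x p‖ := by
      have := norm_le_norm_sub_add (it T P' m₀ x p) (it T P m₀ x p)
      have := norm_nonneg (it T P m₀ x p)
      linarith
    have h8 : ‖it T S m₀ x s‖ ≤ 2 * ‖it T S' m₀ x s‖ := by
      have := norm_le_norm_sub_add (it T S m₀ x s) (it T S' m₀ x s)
      rw [norm_sub_rev] at this
      linarith
    calc ‖it T P' m₀ x p‖ * ‖s‖ ≤ 2 * (‖it T P m₀ x p‖ * ‖s‖) := by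
          rw [← mul_assoc]; gcongr
      _ ≤ 2 * (C * θ ^ m₀ * (‖p‖ * ‖it T S m₀ x s‖)) := by
          exact mul_le_mul_of_nonneg_left (hPS x m₀ p s) (by norm_num)
      _ ≤ 2 * (1 / 8 * (‖p‖ * (2 * ‖it T S' m₀ x s‖))) := by gcongr
      _ = _ := by ring
  have steps : ∀ q x p s, ‖it T P' (m₀ * q) x p‖ * ‖s‖ ≤
      (1 / 2) ^ q * (‖p‖ * ‖it T S' (m₀ * q) x s‖) := by
    intro q
    induction q with
    | zero => intro x p s; simp
    | succ q ih =>
      intro x p s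
      rw [mul_add, mul_one, it_add, it_add, ContinuousLinearMap.comp_apply,
        ContinuousLinearMap.comp_apply]
      set y := T^[m₀ * q] x
      set p₁ := it T P' (m₀ * q) x p
      set s₁ := it T S' (m₀ * q) x s
      rcases (norm_nonneg s₁).eq_or_lt with h0 | h0
      · have : s = 0 := (injective_iff_map_eq_zero _).1 (it_injective hS'.injective _ x) s
          (norm_eq_zero.1 h0.symm)
        simp only [this, norm_zero, mul_zero]
        positivity
      refine le_of_mul_le_mul_right ?_ h0
      calc ‖it T P' m₀ y p₁‖ * ‖s‖ * ‖s₁‖ = (‖it T P' m₀ y p₁‖ * ‖s₁‖) * ‖s‖ := by ring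
        _ ≤ (1 / 2 * (‖p₁‖ * ‖it T S' m₀ y s₁‖)) * ‖s‖ := 
            mul_le_mul_of_nonneg_right (step y p₁ s₁) (norm_nonneg _)
        _ = 1 / 2 * ‖it T S' m₀ y s₁‖ * (‖p₁‖ * ‖s‖) := by ring
        _ ≤ 1 / 2 * ‖it T S' m₀ y s₁‖ * ((1 / 2) ^ q * (‖p‖ * ‖s₁‖)) := 
            mul_le_mul_of_nonneg_left (ih x p s) (by positivity)
        _ = _ := by ring
  have hℓd : ℓ = m₀ * (ℓ / m₀) + ℓ % m₀ := (Nat.div_add_mod ℓ m₀).symm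
  have hr : ℓ % m₀ < m₀ := Nat.mod_lt _ hm₀
  have hq : q₀ ≤ ℓ / m₀ := (Nat.le_div_iff_mul_le hm₀).2 hℓ
  set q := ℓ / m₀
  set r := ℓ % m₀
  rw [hℓd, it_add, it_add, ContinuousLinearMap.comp_apply, ContinuousLinearMap.comp_apply]
  set y := T^[m₀ * q] x
  set p₁ := it T P' (m₀ * q) x p
  set s₁ := it T S' (m₀ * q) x s
  have h2K : 1 ≤ 2 * K := by linarith
  have h1 := hP'.norm_it_le (T := T) (by positivity) r y p₁
  have h2 := hS'.le_norm_it (T := T) (by positivity) r y s₁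
  calc ‖it T P' r y p₁‖ * ‖s‖ ≤ (2 * K) ^ r * ‖p₁‖ * ‖s‖ := by gcongr
    _ = (2 * K) ^ r * (‖p₁‖ * ‖s‖) := by ring
    _ ≤ (2 * K) ^ r * ((1 / 2) ^ q * (‖p‖ * ‖s₁‖)) := 
        mul_le_mul_of_nonneg_left (steps q x p s) (by positivity)
    _ ≤ (2 * K) ^ r * ((1 / 2) ^ q * (‖p‖ * ((2 * K) ^ r * ‖it T S' r y s₁‖))) := by gcongr
    _ = ((1 / 2) ^ q * (2 * K) ^ (2 * r)) * (‖p‖ * ‖it T S' r y s₁‖) := by ring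
    _ ≤ ((1 / 2) ^ q₀ * (2 * K) ^ (2 * m₀)) * (‖p‖ * ‖it T S' r y s₁‖) := by
        have e1 : (1 / 2 : ℝ) ^ q ≤ (1 / 2) ^ q₀ :=
          pow_le_pow_of_le_one (by norm_num) (by norm_num) hq
        have e2 : (2 * K) ^ (2 * r) ≤ (2 * K) ^ (2 * m₀) :=
          pow_le_pow_right₀ h2K (by omega)
        gcongr
    _ ≤ κ * (‖p‖ * ‖it T S' r y s₁‖) := by
        rw [lt_div_iff₀ (by positivity)] at hq₀
        gcongr

/-- Written as a fixed point equation with `S` inverted, the invariance of a graph over `W₁` has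
linear part `ξ ↦ S⁻¹ ξ(T x) P`, whose powers decay by domination. The remaining terms are small
because `c`, `a - P`, `e - S` and the slopes are small. -/
theorem exists_slow_graph (hT : IsCyc T n) {P a : X → W₁ →L[ℝ] W₁} {S e : X → W₂ →L[ℝ] W₂}
    {b : X → W₂ →L[ℝ] W₁} {c : X → W₁ →L[ℝ] W₂} {K C θ δ ρ : ℝ} (hK : 1 ≤ K) (hC : 0 ≤ C)
    (hθ0 : 0 ≤ θ) (hθ1 : θ < 1) (hS : Bdd S K) (hPS : PairDom T P S C θ)
    (ha : ∀ x, ‖a x - P x‖ ≤ δ) (he : ∀ x, ‖e x - S x‖ ≤ δ) (hc : ∀ x, ‖c x‖ ≤ δ)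
    (hb : ∀ x, ‖b x‖ ≤ 2 * K) (hρ : 0 ≤ ρ) (h1 : C / (1 - θ) * (K * δ) ≤ ρ / 2)
    (h2 : C / (1 - θ) * (K * (2 * δ + 4 * K * ρ)) ≤ 1 / 2) :
    ∃ ξ : X → W₁ →L[ℝ] W₂, (∀ x, ‖ξ x‖ ≤ ρ) ∧
      ∀ x p, e x (ξ x p) + c x p = ξ (T x) (a x p + b x (ξ x p)) := by
  rcases isEmpty_or_nonempty X with hX | ⟨⟨x₀⟩⟩
  · exact ⟨0, fun x => (IsEmpty.false x).elim, fun x => (IsEmpty.false x).elim⟩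
  have := hT.finite x₀
  have := Fintype.ofFinite X
  have := FiniteDimensional.complete ℝ W₂
  have hδ : 0 ≤ δ := (norm_nonneg _).trans (hc x₀)
  set R : X → W₂ →L[ℝ] W₂ := fun x => Ring.inverse (S x) with hR
  have hRn : ∀ x, ‖R x‖ ≤ K := fun x => norm_inverse_le (by linarith) hS x
  have hSR : ∀ x w, S x (R x w) = w := fun x w =>
    DFunLike.congr_fun (Ring.mul_inverse_cancel _ (hS.isUnit x)) w
  let L : (X → W₁ →L[ℝ] W₂) →ₗ[ℝ] (X → W₁ →L[ℝ] W₂) :=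
    { toFun := fun ξ x => (R x).comp ((ξ (T x)).comp (P x))
      map_add' := fun ξ ζ => by ext; simp
      map_smul' := fun t ξ => by ext; simp }
  have hLm : ∀ m ξ x p, it T S m x ((L ^ m) ξ x p) = ξ (T^[m] x) (it T P m x p) := by
    intro m
    induction m with
    | zero => intro ξ x p; rfl
    | succ m ih =>
      intro ξ x p
      rw [pow_succ', Module.End.mul_apply, it_succ, it_succ]
      change it T S m (T x) (S x (R x ((L ^ m) ξ (T x) (P x p)))) = _
      rw [hSR, ih]
      rfl
  have hLn : ∀ m ξ, ‖(L ^ m) ξ‖ ≤ C * θ ^ m * ‖ξ‖ := by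
    intro m ξ
    refine (pi_norm_le_iff_of_nonneg (by positivity)).2 fun x => ?_
    refine ContinuousLinearMap.opNorm_le_bound _ (by positivity) fun p => ?_
    have h3 := hLm m ξ x p
    set w := (L ^ m) ξ x p
    have h4 := hPS x m p w
    rw [h3] at h4
    have h5 : ‖ξ (T^[m] x) (it T P m x p)‖ ≤ ‖ξ‖ * ‖it T P m x p‖ :=
      (ξ _).le_of_opNorm_le (norm_le_pi_norm ξ _) _
    rcases (norm_nonneg (it T P m x p)).eq_or_lt with h0 | h0
    · have h6 : it T P m x p = 0 := norm_eq_zero.1 h0.symm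
      rw [h6, map_zero] at h3
      have : w = 0 := (injective_iff_map_eq_zero _).1 (it_injective hS.injective _ x) _ h3
      rw [this, norm_zero]; positivity
    · refine le_of_mul_le_mul_left ?_ h0
      calc ‖it T P m x p‖ * ‖w‖ ≤ C * θ ^ m * (‖p‖ * (‖ξ‖ * ‖it T P m x p‖)) :=
            h4.trans (by gcongr)
        _ = _ := by ring
  let Q : (X → W₁ →L[ℝ] W₂) → (X → W₁ →L[ℝ] W₂) := fun ξ x =>
    (R x).comp ((ξ (T x)).comp ((a x - P x) + (b x).comp (ξ x)) - c x - (e x - S x).comp (ξ x))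
  have hC1 : 0 ≤ C / (1 - θ) := div_nonneg hC (by linarith)
  have hQ0 : C / (1 - θ) * ‖Q 0‖ ≤ ρ / 2 := by
    refine (mul_le_mul_of_nonneg_left ?_ hC1).trans h1
    refine (pi_norm_le_iff_of_nonneg (by positivity)).2 fun x => ?_
    have : Q 0 x = (R x).comp (- c x) := by ext; simp [Q]
    rw [this]
    refine (ContinuousLinearMap.opNorm_comp_le _ _).trans ?_
    rw [norm_neg]
    gcongr
    exacts [hRn x, hc x]
  have hQL : ∀ u v, ‖u‖ ≤ ρ → ‖v‖ ≤ ρ → C / (1 - θ) * ‖Q u - Q v‖ ≤ ‖u - v‖ / 2 := by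
    intro ξ ζ hξ hζ
    have h3 : ‖Q ξ - Q ζ‖ ≤ K * (2 * δ + 4 * K * ρ) * ‖ξ - ζ‖ := by
      refine (pi_norm_le_iff_of_nonneg (by positivity)).2 fun x => ?_
      have h4 : (Q ξ - Q ζ) x = (R x).comp ((ξ (T x) - ζ (T x)).comp (a x - P x) +
          (ξ (T x) - ζ (T x)).comp ((b x).comp (ξ x)) + (ζ (T x)).comp ((b x).comp (ξ x - ζ x)) -
          (e x - S x).comp (ξ x - ζ x)) := by
        ext p
        simp [Q]
        abel
      have hd : ∀ y, ‖ξ y - ζ y‖ ≤ ‖ξ - ζ‖ := fun y => norm_le_pi_norm (ξ - ζ) y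
      have hξ' : ∀ y, ‖ξ y‖ ≤ ρ := fun y => (norm_le_pi_norm ξ y).trans hξ
      have hζ' : ∀ y, ‖ζ y‖ ≤ ρ := fun y => (norm_le_pi_norm ζ y).trans hζ
      have e1 : ‖(ξ (T x) - ζ (T x)).comp (a x - P x)‖ ≤ ‖ξ - ζ‖ * δ :=
        (ContinuousLinearMap.opNorm_comp_le _ _).trans (by gcongr; exacts [hd _, ha _])
      have e2 : ‖(ξ (T x) - ζ (T x)).comp ((b x).comp (ξ x))‖ ≤ ‖ξ - ζ‖ * (2 * K * ρ) :=
        (ContinuousLinearMap.opNorm_comp_le _ _).trans (by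
          gcongr
          · exact hd _
          · exact (ContinuousLinearMap.opNorm_comp_le _ _).trans (by gcongr; exacts [hb _, hξ' _]))
      have e3 : ‖(ζ (T x)).comp ((b x).comp (ξ x - ζ x))‖ ≤ ρ * (2 * K * ‖ξ - ζ‖) :=
        (ContinuousLinearMap.opNorm_comp_le _ _).trans (by
          gcongr
          · exact hζ' _
          · exact (ContinuousLinearMap.opNorm_comp_le _ _).trans (by gcongr; exacts [hb _, hd _]))
      have e4 : ‖(e x - S x).comp (ξ x - ζ x)‖ ≤ δ * ‖ξ - ζ‖ :=
        (ContinuousLinearMap.opNorm_comp_le _ _).trans (by gcongr; exacts [he _, hd _])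
      rw [h4]
      calc _ ≤ K * ((‖ξ - ζ‖ * δ + ‖ξ - ζ‖ * (2 * K * ρ) + ρ * (2 * K * ‖ξ - ζ‖)) + δ * ‖ξ - ζ‖) := by
            refine (ContinuousLinearMap.opNorm_comp_le _ _).trans ?_
            gcongr
            · exact hRn x
            · exact (norm_sub_le _ _).trans (add_le_add ((norm_add₃_le).trans (by gcongr)) e4)
        _ = _ := by ring
    calc C / (1 - θ) * ‖Q ξ - Q ζ‖ ≤ C / (1 - θ) * (K * (2 * δ + 4 * K * ρ) * ‖ξ - ζ‖) := by gcongr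
      _ = C / (1 - θ) * (K * (2 * δ + 4 * K * ρ)) * ‖ξ - ζ‖ := by ring
      _ ≤ 1 / 2 * ‖ξ - ζ‖ := by gcongr
      _ = _ := by ring
  obtain ⟨ξ, hξ, hξe⟩ := exists_fixed_of_powers L (Q := Q) hθ0 hθ1 hLn hC hρ hQ0 hQL
  refine ⟨ξ, fun x => (norm_le_pi_norm ξ x).trans hξ, fun x p => ?_⟩
  have h3 := congrArg (S x) (DFunLike.congr_fun (congrFun hξe x) p)
  change S x (ξ x p - R x (ξ (T x) (P x p))) = S x (R x (ξ (T x) ((a x p - P x p) + b x (ξ x p))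
    - c x p - (e x (ξ x p) - S x (ξ x p)))) at h3
  rw [map_sub, hSR, hSR] at h3
  have h4 : a x p + b x (ξ x p) = P x p + ((a x p - P x p) + b x (ξ x p)) := by abel
  rw [h4, map_add (ξ (T x))]
  rw [sub_eq_iff_eq_add] at h3
  rw [← sub_eq_zero] at h3 ⊢
  rw [← h3]
  abel

/-- For graphs over `W₂` the linear part is `η ↦ P η S⁻¹`, transported forward. The block `b` is
bounded but not small, so the slopes are only bounded; the quadratic term is harmless because it
contains the small block `c`. -/
theorem exists_fast_graph (hT : IsCyc T n) {P a : X → W₁ →L[ℝ] W₁} {S e : X → W₂ →L[ℝ] W₂}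
    {b : X → W₂ →L[ℝ] W₁} {c : X → W₁ →L[ℝ] W₂} {K C θ δ ρ : ℝ} (hK : 1 ≤ K) (hC : 0 ≤ C)
    (hθ0 : 0 ≤ θ) (hθ1 : θ < 1) (hS : Bdd S K) (hPS : PairDom T P S C θ)
    (ha : ∀ x, ‖a x - P x‖ ≤ δ) (he : ∀ x, ‖e x - S x‖ ≤ δ) (hc : ∀ x, ‖c x‖ ≤ δ)
    (hb : ∀ x, ‖b x‖ ≤ 2 * K) (hρ : 0 ≤ ρ) (h1 : C / (1 - θ) * (2 * K ^ 2) ≤ ρ / 2)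
    (h2 : C / (1 - θ) * (K * (δ * (2 + 2 * ρ))) ≤ 1 / 2) :
    ∃ η : X → W₂ →L[ℝ] W₁, (∀ x, ‖η x‖ ≤ ρ) ∧
      ∀ x s, a x (η x s) + b x s = η (T x) (c x (η x s) + e x s) := by
  rcases isEmpty_or_nonempty X with hX | ⟨⟨x₀⟩⟩
  · exact ⟨0, fun x => (IsEmpty.false x).elim, fun x => (IsEmpty.false x).elim⟩
  have := hT.finite x₀
  have := Fintype.ofFinite X
  have := FiniteDimensional.complete ℝ W₂
  have hδ : 0 ≤ δ := (norm_nonneg _).trans (hc x₀)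
  set R : X → W₂ →L[ℝ] W₂ := fun x => Ring.inverse (S x) with hR
  have hRn : ∀ x, ‖R x‖ ≤ K := fun x => norm_inverse_le (by linarith) hS x
  have hSR : ∀ x w, S x (R x w) = w := fun x w =>
    DFunLike.congr_fun (Ring.mul_inverse_cancel _ (hS.isUnit x)) w
  have hRS : ∀ x w, R x (S x w) = w := fun x w =>
    DFunLike.congr_fun (Ring.inverse_mul_cancel _ (hS.isUnit x)) w
  let L : (X → W₂ →L[ℝ] W₁) →ₗ[ℝ] (X → W₂ →L[ℝ] W₁) :=
    { toFun := fun η y => (P (T.symm y)).comp ((η (T.symm y)).comp (R (T.symm y)))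
      map_add' := fun ξ ζ => by ext; simp
      map_smul' := fun t ξ => by ext; simp }
  have hL : ∀ η x s, L η (T x) (S x s) = P x (η x s) := fun η x s => by
    change P (T.symm (T x)) (η (T.symm (T x)) (R (T.symm (T x)) (S x s))) = _
    rw [Equiv.symm_apply_apply, hRS]
  have hLm : ∀ m η x s, (L ^ m) η (T^[m] x) (it T S m x s) = it T P m x (η x s) := by
    intro m
    induction m with
    | zero => intro ξ x p; rfl
    | succ m ih =>
      intro η x s
      rw [pow_succ', Module.End.mul_apply, it_succ', it_succ', Function.iterate_succ_apply',
        ContinuousLinearMap.comp_apply, hL, ih]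
      rfl
  have hLn : ∀ m η, ‖(L ^ m) η‖ ≤ C * θ ^ m * ‖η‖ := by
    intro m η
    refine (pi_norm_le_iff_of_nonneg (by positivity)).2 fun y => ?_
    refine ContinuousLinearMap.opNorm_le_bound _ (by positivity) fun s => ?_
    obtain ⟨x, rfl⟩ : ∃ x, T^[m] x = y := (T.surjective.iterate m) y
    obtain ⟨u, rfl⟩ := LinearMap.injective_iff_surjective (f := (it T S m x).toLinearMap) |>.1
      (it_injective hS.injective m x) s
    have h3 := hPS x m (η x u) u
    rw [ContinuousLinearMap.coe_coe, hLm]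
    have h5 : ‖η x u‖ ≤ ‖η‖ * ‖u‖ := (η _).le_of_opNorm_le (norm_le_pi_norm η _) _
    rcases (norm_nonneg u).eq_or_lt with h0 | h0
    · rw [norm_eq_zero.1 h0.symm]; simp
    · refine le_of_mul_le_mul_right ?_ h0
      calc ‖it T P m x (η x u)‖ * ‖u‖ ≤ C * θ ^ m * (‖η‖ * ‖u‖ * ‖it T S m x u‖) :=
            h3.trans (by gcongr)
        _ = _ := by ring
  let Q : (X → W₂ →L[ℝ] W₁) → (X → W₂ →L[ℝ] W₁) := fun η y =>
    ((a (T.symm y) - P (T.symm y)).comp (η (T.symm y)) + b (T.symm y) -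
      (η y).comp ((c (T.symm y)).comp (η (T.symm y)) + (e (T.symm y) - S (T.symm y)))).comp
      (R (T.symm y))
  have hC1 : 0 ≤ C / (1 - θ) := div_nonneg hC (by linarith)
  have hQ0 : C / (1 - θ) * ‖Q 0‖ ≤ ρ / 2 := by
    refine (mul_le_mul_of_nonneg_left ?_ hC1).trans h1
    refine (pi_norm_le_iff_of_nonneg (by positivity)).2 fun y => ?_
    have : Q 0 y = (b (T.symm y)).comp (R (T.symm y)) := by ext; simp [Q]
    rw [this]
    calc _ ≤ 2 * K * K := (ContinuousLinearMap.opNorm_comp_le _ _).trans (by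
          gcongr; exacts [hb _, hRn _])
      _ = _ := by ring
  have hQL : ∀ u v, ‖u‖ ≤ ρ → ‖v‖ ≤ ρ → C / (1 - θ) * ‖Q u - Q v‖ ≤ ‖u - v‖ / 2 := by
    intro ξ ζ hξ hζ
    have h3 : ‖Q ξ - Q ζ‖ ≤ K * (δ * (2 + 2 * ρ)) * ‖ξ - ζ‖ := by
      refine (pi_norm_le_iff_of_nonneg (by positivity)).2 fun y => ?_
      set x := T.symm y
      have h4 : (Q ξ - Q ζ) y = ((a x - P x).comp (ξ x - ζ x) -
          ((ξ y - ζ y).comp ((c x).comp (ξ x)) + (ζ y).comp ((c x).comp (ξ x - ζ x)) +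
          (ξ y - ζ y).comp (e x - S x))).comp (R x) := by
        ext p
        simp [Q, x]
        abel
      have hd : ∀ y, ‖ξ y - ζ y‖ ≤ ‖ξ - ζ‖ := fun y => norm_le_pi_norm (ξ - ζ) y
      have hξ' : ∀ y, ‖ξ y‖ ≤ ρ := fun y => (norm_le_pi_norm ξ y).trans hξ
      have hζ' : ∀ y, ‖ζ y‖ ≤ ρ := fun y => (norm_le_pi_norm ζ y).trans hζ
      have e1 : ‖(a x - P x).comp (ξ x - ζ x)‖ ≤ δ * ‖ξ - ζ‖ :=
        (ContinuousLinearMap.opNorm_comp_le _ _).trans (by gcongr; exacts [ha _, hd _])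
      have e2 : ‖(ξ y - ζ y).comp ((c x).comp (ξ x))‖ ≤ ‖ξ - ζ‖ * (δ * ρ) :=
        (ContinuousLinearMap.opNorm_comp_le _ _).trans (by
          gcongr
          · exact hd _
          · exact (ContinuousLinearMap.opNorm_comp_le _ _).trans (by gcongr; exacts [hc _, hξ' _]))
      have e3 : ‖(ζ y).comp ((c x).comp (ξ x - ζ x))‖ ≤ ρ * (δ * ‖ξ - ζ‖) :=
        (ContinuousLinearMap.opNorm_comp_le _ _).trans (by
          gcongr
          · exact hζ' _
          · exact (ContinuousLinearMap.opNorm_comp_le _ _).trans (by gcongr; exacts [hc _, hd _]))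
      have e4 : ‖(ξ y - ζ y).comp (e x - S x)‖ ≤ ‖ξ - ζ‖ * δ :=
        (ContinuousLinearMap.opNorm_comp_le _ _).trans (by gcongr; exacts [hd _, he _])
      rw [h4]
      calc _ ≤ (δ * ‖ξ - ζ‖ + (‖ξ - ζ‖ * (δ * ρ) + ρ * (δ * ‖ξ - ζ‖) + ‖ξ - ζ‖ * δ)) * K := by
            refine (ContinuousLinearMap.opNorm_comp_le _ _).trans ?_
            gcongr
            · exact (norm_sub_le _ _).trans (add_le_add e1 ((norm_add₃_le).trans (by gcongr)))
            · exact hRn x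
        _ = _ := by ring
    calc C / (1 - θ) * ‖Q ξ - Q ζ‖ ≤ C / (1 - θ) * (K * (δ * (2 + 2 * ρ)) * ‖ξ - ζ‖) := by gcongr
      _ = C / (1 - θ) * (K * (δ * (2 + 2 * ρ))) * ‖ξ - ζ‖ := by ring
      _ ≤ 1 / 2 * ‖ξ - ζ‖ := by gcongr
      _ = _ := by ring
  obtain ⟨η, hη, hηe⟩ := exists_fixed_of_powers L (Q := Q) hθ0 hθ1 hLn hC hρ hQ0 hQL
  refine ⟨η, fun x => (norm_le_pi_norm η x).trans hη, fun x s => ?_⟩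
  have h3 := DFunLike.congr_fun (congrFun hηe (T x)) (S x s)
  have h4 : Q η (T x) (S x s) = (a x (η x s) - P x (η x s)) + b x s -
      η (T x) (c x (η x s) + (e x s - S x s)) := by
    simp [Q, hRS]
  rw [h4, Pi.sub_apply, sub_apply, hL] at h3
  have h5 : c x (η x s) + e x s = (c x (η x s) + (e x s - S x s)) + S x s := by abel
  rw [h5, map_add (η (T x)), sub_eq_iff_eq_add.1 h3]
  abel

end Robust

/-! ### Dominated splittings of nearby cocycles -/

section DominatedIndex

variable {X V : Type*} [NormedAddCommGroup V] [InnerProductSpace ℝ V]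
  [FiniteDimensional ℝ V] {T : Equiv.Perm X} {n : ℕ}

/-- There is an invariant splitting which is dominated at time `ℓ`, with slow bundle of
dimension `i`. -/
def DomIdx (T : Equiv.Perm X) (A : X → V →L[ℝ] V) (ℓ i : ℕ) : Prop :=
  ∃ L H : X → Submodule ℝ V, (∀ x, (L x).map (A x).toLinearMap = L (T x)) ∧
    (∀ x, (H x).map (A x).toLinearMap = H (T x)) ∧ (∀ x, IsCompl (L x) (H x)) ∧
    (∀ x, Module.finrank ℝ (L x) = i) ∧
    ∀ x, ∀ l ∈ L x, ∀ h ∈ H x, ‖it T A ℓ x l‖ * ‖h‖ ≤ 1 / 4 * (‖l‖ * ‖it T A ℓ x h‖)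

theorem isCompl_graphs {W₁ W₂ : Type*} [NormedAddCommGroup W₁] [InnerProductSpace ℝ W₁]
    [FiniteDimensional ℝ W₁] [NormedAddCommGroup W₂] [InnerProductSpace ℝ W₂]
    [FiniteDimensional ℝ W₂] (φ : Frame V W₁ W₂) {ξ : W₁ →L[ℝ] W₂} {η : W₂ →L[ℝ] W₁}
    (h : ‖η‖ * ‖ξ‖ < 1) :
    IsCompl (LinearMap.range (φ.k + φ.i.comp ξ).toLinearMap)
      (LinearMap.range (φ.k.comp η + φ.i).toLinearMap) ∧
    Module.finrank ℝ (LinearMap.range (φ.k + φ.i.comp ξ).toLinearMap) = Module.finrank ℝ W₁ := by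
  have e1 : ∀ p, φ.k' ((φ.k + φ.i.comp ξ) p) = p := fun p => by simp [φ.kk, φ.ki]
  have e2 : ∀ p, φ.i' ((φ.k + φ.i.comp ξ) p) = ξ p := fun p => by simp [φ.ii, φ.ik]
  have e3 : ∀ s, φ.k' ((φ.k.comp η + φ.i) s) = η s := fun p => by simp [φ.kk, φ.ki]
  have e4 : ∀ s, φ.i' ((φ.k.comp η + φ.i) s) = s := fun p => by simp [φ.ii, φ.ik]
  have f1 := LinearMap.finrank_range_of_inj (f := (φ.k + φ.i.comp ξ).toLinearMap)
    (Function.LeftInverse.injective e1)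
  have f2 := LinearMap.finrank_range_of_inj (f := (φ.k.comp η + φ.i).toLinearMap)
    (Function.LeftInverse.injective e4)
  have hdisj : Disjoint (LinearMap.range (φ.k + φ.i.comp ξ).toLinearMap)
      (LinearMap.range (φ.k.comp η + φ.i).toLinearMap) := by
    rw [Submodule.disjoint_def]
    rintro _ ⟨p, rfl⟩ ⟨s, hs⟩
    have h1 := congrArg φ.k' hs
    have h2 := congrArg φ.i' hs
    simp only [ContinuousLinearMap.coe_coe] at h1 h2 ⊢
    rw [e1, e3] at h1
    rw [e2, e4] at h2
    rw [h2] at h1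
    have h3 : ‖p‖ ≤ ‖η‖ * ‖ξ‖ * ‖p‖ := by
      conv_lhs => rw [← h1]
      calc _ ≤ ‖η‖ * (‖ξ‖ * ‖p‖) := (η.le_opNorm _).trans (by gcongr; exact ξ.le_opNorm _)
        _ = _ := by ring
    have h4 : ‖p‖ = 0 := by
      by_contra h0
      have := lt_of_le_of_ne (norm_nonneg p) (Ne.symm h0)
      nlinarith
    rw [norm_eq_zero.1 h4, map_zero]
  refine ⟨⟨hdisj, codisjoint_iff.2 (Submodule.eq_top_of_disjoint _ _ ?_ hdisj)⟩, f1⟩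
  rw [f1, f2]
  let e : (W₁ × W₂) ≃ₗ[ℝ] V :=
    { (φ.k.toLinearMap.coprod φ.i.toLinearMap) with
      invFun := fun v => (φ.k' v, φ.i' v)
      left_inv := fun w => by ext <;> simp [φ.kk, φ.ii, φ.ki, φ.ik]
      right_inv := fun v => by simpa using φ.id v }
  rw [← e.finrank_eq, Module.finrank_prod]

theorem map_graph {W : Type*} [NormedAddCommGroup W] [InnerProductSpace ℝ W]
    {A : X → V →L[ℝ] V} {g : X → W →L[ℝ] V} {P : X → W →L[ℝ] W}
    (hP : ∀ x, Function.Surjective (P x)) (h : ∀ x w, A x (g x w) = g (T x) (P x w)) (x : X) :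
    (LinearMap.range (g x).toLinearMap).map (A x).toLinearMap =
      LinearMap.range (g (T x)).toLinearMap := by
  ext v
  constructor
  · rintro ⟨_, ⟨w, rfl⟩, rfl⟩
    exact ⟨P x w, (h x w).symm⟩
  · rintro ⟨w, rfl⟩
    obtain ⟨w, rfl⟩ := hP x w
    exact ⟨g x w, ⟨w, rfl⟩, h x w⟩

-- The slow graph has small slope and the fast graph has slope at most `R`, so they are
-- complementary. On them `A` is conjugate to perturbations `P'`, `S'` of the diagonal blocks of
-- `B`, to which `PairDom.perturb` applies.
set_option maxHeartbeats 1000000 in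
theorem exists_domIdx_of_frames.{w} {K C θ : ℝ} (hK : 1 ≤ K) (hC : 0 ≤ C) (hθ0 : 0 ≤ θ)
    (hθ1 : θ < 1) (V W₁ W₂ : Type) [NormedAddCommGroup V] [InnerProductSpace ℝ V]
    [FiniteDimensional ℝ V] [NormedAddCommGroup W₁] [InnerProductSpace ℝ W₁]
    [FiniteDimensional ℝ W₁] [NormedAddCommGroup W₂] [InnerProductSpace ℝ W₂]
    [FiniteDimensional ℝ W₂] :
    ∃ ε₁ > 0, ∃ ℓ₀ : ℕ, ∀ (X : Type w) (T : Equiv.Perm X) (n : ℕ), IsCyc T n →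
      ∀ (A B : X → V →L[ℝ] V) (φ : X → Frame V W₁ W₂) (P : X → W₁ →L[ℝ] W₁)
        (S : X → W₂ →L[ℝ] W₂), Bdd B K → Block T (fun x => (φ x).toAlgFrame) B P S →
        PairDom T P S C θ → (∀ x, ‖A x - B x‖ ≤ ε₁) → ∀ ℓ ≥ ℓ₀,
          DomIdx T A ℓ (Module.finrank ℝ W₁) := by
  have hK0 : 0 < K := by linarith
  set C₁ := C / (1 - θ) with hC₁
  have hC₁0 : 0 ≤ C₁ := div_nonneg hC (by linarith)
  set R := 4 * C₁ * K ^ 2 with hR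
  have hR0 : 0 ≤ R := by positivity
  -- The graph maps distort norms by at most `2` and `1 + R`; with this constant the domination of
  -- the graphs comes out as `1 / 4`.
  obtain ⟨τ, hτ0, hτK, ℓ₀, hτ⟩ := PairDom.perturb.{w} (C := C) (κ := 1 / (8 * (1 + R))) hK hθ0 hθ1
    (by positivity)
  -- The three bounds make the graphs complementary, the graph transform a contraction, and `P'` a
  -- perturbation of `P` within `τ`.
  set ρ := min (min (1 / (2 * (1 + R))) (1 / (16 * K ^ 2 * (1 + C₁)))) (τ / (4 * K)) with hρ
  have hρ0 : 0 < ρ := lt_min (lt_min (by positivity) (by positivity)) (by positivity)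
  have hρ1 : ρ * (1 + R) ≤ 1 / 2 := by
    have : ρ ≤ 1 / (2 * (1 + R)) := (min_le_left _ _).trans (min_le_left _ _)
    rw [le_div_iff₀ (by positivity)] at this
    linarith
  have hρ2 : ρ * (16 * K ^ 2 * (1 + C₁)) ≤ 1 := by
    have : ρ ≤ 1 / (16 * K ^ 2 * (1 + C₁)) := (min_le_left _ _).trans (min_le_right _ _)
    rwa [le_div_iff₀ (by positivity)] at this
  have hρ3 : ρ * (4 * K) ≤ τ := by
    have : ρ ≤ τ / (4 * K) := min_le_right _ _
    rwa [le_div_iff₀ (by positivity)] at this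
  set δ := min (min (ρ / (2 * K * (1 + C₁))) (1 / (8 * K * (1 + C₁) * (1 + R))))
    (min (τ / (2 * (1 + R))) 1) with hδ
  have hδ0 : 0 < δ := lt_min (lt_min (by positivity) (by positivity))
    (lt_min (by positivity) one_pos)
  have hδ1 : δ * (2 * K * (1 + C₁)) ≤ ρ := by
    have : δ ≤ ρ / (2 * K * (1 + C₁)) := (min_le_left _ _).trans (min_le_left _ _)
    rwa [le_div_iff₀ (by positivity)] at this
  have hδ2 : δ * (8 * K * (1 + C₁) * (1 + R)) ≤ 1 := by
    have : δ ≤ 1 / (8 * K * (1 + C₁) * (1 + R)) := (min_le_left _ _).trans (min_le_right _ _)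
    rwa [le_div_iff₀ (by positivity)] at this
  have hδ3 : δ * (2 * (1 + R)) ≤ τ := by
    have : δ ≤ τ / (2 * (1 + R)) := (min_le_right _ _).trans (min_le_left _ _)
    rwa [le_div_iff₀ (by positivity)] at this
  have hδ4 : δ ≤ 1 := (min_le_right _ _).trans (min_le_right _ _)
  refine ⟨δ, hδ0, ℓ₀, fun X T n hT A B φ P S hB hb hPS hAB ℓ hℓ => ?_⟩
  have hP := hb.bdd_sub hK0.le hB
  have hS := hb.bdd_quot hK0.le hB
  set a : X → W₁ →L[ℝ] W₁ := fun x => (φ (T x)).k'.comp ((A x).comp (φ x).k) with ha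
  set b : X → W₂ →L[ℝ] W₁ := fun x => (φ (T x)).k'.comp ((A x).comp (φ x).i) with hbd
  set c : X → W₁ →L[ℝ] W₂ := fun x => (φ (T x)).i'.comp ((A x).comp (φ x).k) with hc
  set e : X → W₂ →L[ℝ] W₂ := fun x => (φ (T x)).i'.comp ((A x).comp (φ x).i) with he
  have ha' : ∀ x, ‖a x - P x‖ ≤ δ := fun x => by
    have : a x - P x = (φ (T x)).k'.comp ((A x - B x).comp (φ x).k) := by
      ext p; simp [ha, hb.sub, (φ (T x)).kk]
    rw [this]
    exact (Frame.opNorm_sandwich_le (φ _).opNorm_k' (φ _).opNorm_k _).trans (hAB x)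
  have hc' : ∀ x, ‖c x‖ ≤ δ := fun x => by
    have : c x = (φ (T x)).i'.comp ((A x - B x).comp (φ x).k) := by
      ext p; simp [hc, hb.sub, (φ (T x)).ik]
    rw [this]
    exact (Frame.opNorm_sandwich_le (φ _).opNorm_i' (φ _).opNorm_k _).trans (hAB x)
  have he' : ∀ x, ‖e x - S x‖ ≤ δ := fun x => by
    have : e x - S x = (φ (T x)).i'.comp ((A x - B x).comp (φ x).i) := by
      ext p; simp [he, hb.quot, (φ x).ii]
    rw [this]
    exact (Frame.opNorm_sandwich_le (φ _).opNorm_i' (φ _).opNorm_i _).trans (hAB x)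
  have hb' : ∀ x, ‖b x‖ ≤ 2 * K := fun x => by
    refine (Frame.opNorm_sandwich_le (φ _).opNorm_k' (φ _).opNorm_i _).trans ?_
    have := norm_le_norm_sub_add (A x) (B x)
    have := hAB x
    have := (hB x).1
    linarith
  have hKK : K ≤ K ^ 2 := by nlinarith
  obtain ⟨ξ, hξ, hξe⟩ := exists_slow_graph hT hK hC hθ0 hθ1 hS hPS ha' he' hc' hb' hρ0.le
    (by
      rw [← hC₁]
      have : 0 ≤ δ * K := by positivity
      nlinarith) (by
      rw [← hC₁]
      have e1 : C₁ * K * δ ≤ 1 / 8 := by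
        have : 0 ≤ δ * K := by positivity
        have : 0 ≤ δ * K * C₁ := by positivity
        have : 0 ≤ δ * K * R := by positivity
        have : 0 ≤ δ * K * C₁ * R := by positivity
        nlinarith
      have e2 : C₁ * K ^ 2 * ρ ≤ 1 / 16 := by
        have : 0 ≤ ρ * K ^ 2 := by positivity
        nlinarith
      linarith)
  obtain ⟨η, hη, hηe⟩ := exists_fast_graph hT hK hC hθ0 hθ1 hS hPS ha' he' hc' hb' hR0
    (by rw [← hC₁, hR]; linarith) (by
      rw [← hC₁]
      have : 0 ≤ δ * K := by positivity
      have : 0 ≤ δ * K * R := by positivity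
      nlinarith)
  set P' : X → W₁ →L[ℝ] W₁ := fun x => a x + (b x).comp (ξ x) with hP'
  set S' : X → W₂ →L[ℝ] W₂ := fun x => (c x).comp (η x) + e x with hS'
  have hPP : ∀ x, ‖P' x - P x‖ ≤ τ := fun x => by
    have e1 : P' x - P x = (a x - P x) + (b x).comp (ξ x) := by simp only [hP']; abel
    rw [e1]
    calc _ ≤ δ + 2 * K * ρ := (norm_add_le _ _).trans (add_le_add (ha' x)
          ((ContinuousLinearMap.opNorm_comp_le _ _).trans (by gcongr; exacts [hb' x, hξ x])))
      _ ≤ τ := by nlinarith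
  have hSS : ∀ x, ‖S' x - S x‖ ≤ τ := fun x => by
    have e1 : S' x - S x = (c x).comp (η x) + (e x - S x) := by simp only [hS']; abel
    rw [e1]
    calc _ ≤ δ * R + δ := (norm_add_le _ _).trans (add_le_add
          ((ContinuousLinearMap.opNorm_comp_le _ _).trans (by gcongr; exacts [hc' x, hη x]))
          (he' x))
      _ ≤ τ := by nlinarith
  have hPb := hP.perturb hK0 hτK hK hPP
  have hSb := hS.perturb hK0 hτK hK hSS
  set g : X → W₁ →L[ℝ] V := fun x => (φ x).k + (φ x).i.comp (ξ x) with hg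
  set f : X → W₂ →L[ℝ] V := fun x => (φ x).k.comp (η x) + (φ x).i with hf
  have hAg : ∀ x p, A x (g x p) = g (T x) (P' x p) := fun x p => by
    rw [← (φ (T x)).id (A x (g x p))]
    simp only [hg, hP', add_apply, ContinuousLinearMap.comp_apply]
    rw [← hξe]
    simp [a, b, c, e]
    abel
  have hAf : ∀ x s, A x (f x s) = f (T x) (S' x s) := fun x s => by
    rw [← (φ (T x)).id (A x (f x s))]
    simp only [hf, hS', add_apply, ContinuousLinearMap.comp_apply]
    rw [← hηe]
    simp [a, b, c, e]
  have hdomℓ := hτ hP hS hPS hPP hSS ℓ hℓ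
  have hgi : ∀ x p, it T A ℓ x (g x p) = g (T^[ℓ] x) (it T P' ℓ x p) := fun x p => by
    have := it_intertwine (T := T) (A := P') (B := A) (R := g)
      (fun x => by ext w; simp [hAg]) ℓ x
    exact (DFunLike.congr_fun this p).symm
  have hfi : ∀ x p, it T A ℓ x (f x p) = f (T^[ℓ] x) (it T S' ℓ x p) := fun x p => by
    have := it_intertwine (T := T) (A := S') (B := A) (R := f)
      (fun x => by ext w; simp [hAf]) ℓ x
    exact (DFunLike.congr_fun this p).symm
  have hg1 : ∀ x p, ‖p‖ ≤ ‖g x p‖ := fun x p => by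
    have := (φ x).norm_k'_le (g x p)
    simpa [hg, (φ x).kk, (φ x).ki] using this
  have hf1 : ∀ x s, ‖s‖ ≤ ‖f x s‖ := fun x p => by
    have := (φ x).norm_i'_le (f x p)
    simpa [hf, (φ x).ii, (φ x).ik] using this
  have hg2 : ∀ x p, ‖g x p‖ ≤ 2 * ‖p‖ := fun x p => by
    have h1 : ‖g x p‖ ≤ ‖p‖ + ‖ξ x p‖ := by
      simpa [hg] using norm_add_le ((φ x).k p) ((φ x).i (ξ x p))
    have h2 := (ξ x).le_of_opNorm_le (hξ x) p
    have h3 : ρ * ‖p‖ ≤ 1 * ‖p‖ := by gcongr; nlinarith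
    linarith
  have hf2 : ∀ x s, ‖f x s‖ ≤ (1 + R) * ‖s‖ := fun x p => by
    have h1 : ‖f x p‖ ≤ ‖η x p‖ + ‖p‖ := by
      simpa [hf] using norm_add_le ((φ x).k (η x p)) ((φ x).i p)
    have h2 := (η x).le_of_opNorm_le (hη x) p
    linarith
  have hcompl : ∀ x, ‖η x‖ * ‖ξ x‖ < 1 := fun x => by
    calc ‖η x‖ * ‖ξ x‖ ≤ R * ρ := by gcongr; exacts [hη x, hξ x]
      _ < 1 := by nlinarith
  refine ⟨fun x => LinearMap.range (g x).toLinearMap, fun x => LinearMap.range (f x).toLinearMap,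
    map_graph (fun x => (hPb.bijective x).2) hAg, map_graph (fun x => (hSb.bijective x).2) hAf,
    fun x => (isCompl_graphs (φ x) (hcompl x)).1, fun x => (isCompl_graphs (φ x) (hcompl x)).2,
    fun x => ?_⟩
  rintro _ ⟨p, rfl⟩ _ ⟨s, rfl⟩
  simp only [ContinuousLinearMap.coe_coe]
  rw [hgi, hfi]
  calc ‖g (T^[ℓ] x) (it T P' ℓ x p)‖ * ‖f x s‖
      ≤ (2 * ‖it T P' ℓ x p‖) * ((1 + R) * ‖s‖) := by gcongr; exacts [hg2 _ _, hf2 _ _]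
    _ = 2 * (1 + R) * (‖it T P' ℓ x p‖ * ‖s‖) := by ring
    _ ≤ 2 * (1 + R) * (1 / (8 * (1 + R)) * (‖p‖ * ‖it T S' ℓ x s‖)) :=
        mul_le_mul_of_nonneg_left (hdomℓ x p s) (by positivity)
    _ = 1 / 4 * (‖p‖ * ‖it T S' ℓ x s‖) := by field_simp; ring
    _ ≤ _ := by gcongr; exacts [hg1 _ _, hf1 _ _]

/-- `Dom` provides no invariant complement of `L`. The fast graph over the orthogonal complement
supplies one for `A`, so domination by the quotient is enough to get a splitting. -/
theorem exists_domIdx.{w} {K C θ : ℝ} (hK : 1 ≤ K) (hC : 0 ≤ C) (hθ0 : 0 ≤ θ) (hθ1 : θ < 1)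
    (V : Type) [NormedAddCommGroup V] [InnerProductSpace ℝ V] [FiniteDimensional ℝ V] (i : ℕ)
    (hi : i ≤ Module.finrank ℝ V) :
    ∃ ε₁ > 0, ∃ ℓ₀ : ℕ, ∀ (X : Type w) (T : Equiv.Perm X) (n : ℕ), IsCyc T n →
      ∀ (A B : X → V →L[ℝ] V) (L : X → Submodule ℝ V), Bdd B K →
        (∀ x, (L x).map (B x).toLinearMap = L (T x)) → (∀ x, Module.finrank ℝ (L x) = i) →
        Dom T B L C θ → (∀ x, ‖A x - B x‖ ≤ ε₁) → ∀ ℓ ≥ ℓ₀, DomIdx T A ℓ i := by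
  have hW₁ : Module.finrank ℝ (EuclideanSpace ℝ (Fin i)) = i := by simp
  have hW₂ : Module.finrank ℝ (EuclideanSpace ℝ (Fin (Module.finrank ℝ V - i))) =
    Module.finrank ℝ V - i := by simp
  obtain ⟨ε₁, hε₁, ℓ₀, h⟩ := exists_domIdx_of_frames.{w} hK hC hθ0 hθ1 V
    (EuclideanSpace ℝ (Fin i)) (EuclideanSpace ℝ (Fin (Module.finrank ℝ V - i)))
  refine ⟨ε₁, hε₁, ℓ₀, fun X T n hT A B L hB hL hLi hdom hAB ℓ hℓ => ?_⟩
  choose φ hφ using fun x => exists_frame (W₁ := EuclideanSpace ℝ (Fin i))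
    (W₂ := EuclideanSpace ℝ (Fin (Module.finrank ℝ V - i))) (L x) (by rw [hLi, hW₁])
    (by rw [hW₁, hW₂]; omega)
  have hmem : ∀ x v, v ∈ L x ↔ (φ x).i' v = 0 := fun x v => by
    rw [← hφ]
    constructor
    · rintro ⟨w, rfl⟩; exact (φ x).ik w
    · intro hv
      refine ⟨(φ x).k' v, ?_⟩
      have := (φ x).id v
      rwa [hv, map_zero, add_zero] at this
  have hk : ∀ x w, (φ x).k w ∈ L x := fun x w => (hmem _ _).2 ((φ x).ik w)
  have hb := block_of_sub (T := T) (fun x => (φ x).toAlgFrame) B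
    (fun x => (φ (T x)).k'.comp ((B x).comp (φ x).k)) (fun x w => by
      have h1 : B x ((φ x).k w) ∈ L (T x) := by
        rw [← hL]; exact Submodule.mem_map_of_mem (hk x w)
      have h2 := (φ (T x)).id (B x ((φ x).k w))
      rw [(hmem _ _).1 h1, map_zero, add_zero] at h2
      exact h2.symm)
  have h1 := h X T n hT A B φ _ _ hB hb (fun x m p s => by
    have h2 := hdom x m ((φ x).k p) (hk x p) ((φ x).i s)
    rw [(φ x).qd_range (hmem x), (φ _).qd_range (hmem _), hb.it_sub, hb.it_quot] at h2
    simpa [(φ x).ii] using h2) hAB ℓ hℓ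
  rwa [hW₁] at h1

end DominatedIndex

/-! ### Sums of ordered exponents -/

/-- The partial sums of the ordered list of the elements of a multiset. -/
noncomputable def sortedSum (s : Multiset ℝ) (j : ℕ) : ℝ := ((s.sort (· ≤ ·)).take j).sum

theorem sortedSum_range {d : ℕ} {u : ℕ → ℝ} (hu : ∀ j k, j ≤ k → k < d → u j ≤ u k) {j : ℕ}
    (hj : j ≤ d) : sortedSum ((Multiset.range d).map u) j = ∑ k ∈ Finset.range j, u k := by
  have h1 : ((Multiset.range d).map u).sort (· ≤ ·) = (List.range d).map u := by
    have h2 : ((Multiset.range d).map u) = (((List.range d).map u : List ℝ) : Multiset ℝ) := rfl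
    rw [h2, Multiset.coe_sort]
    refine List.mergeSort_of_pairwise ?_
    rw [List.pairwise_iff_getElem]
    intro a b ha hb hab
    rw [List.length_map, List.length_range] at hb
    simpa using hu a b hab.le hb
  rw [sortedSum, h1, ← List.map_take, List.take_range, min_eq_left hj]
  rw [Finset.sum_eq_multiset_sum, Finset.range_val]
  rfl

theorem exists_sorted_abs (s : Multiset ℝ) : ∃ r : ℕ → ℝ, s = (Multiset.range s.card).map r ∧
    ∀ j k, j ≤ k → k < s.card → |r j| ≤ |r k| := by
  let R : ℝ → ℝ → Prop := fun a b => |a| ≤ |b|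
  have : DecidableRel R := Classical.decRel R
  have : Std.Total R := ⟨fun a b => le_total |a| |b|⟩
  have : IsTrans ℝ R := ⟨fun a b c => le_trans⟩
  have : Std.Refl R := ⟨fun a => le_rfl⟩
  set l := s.toList.insertionSort R with hl
  have hls : (l : Multiset ℝ) = s := by
    conv_rhs => rw [← s.coe_toList]
    exact Multiset.coe_eq_coe.2 (List.perm_insertionSort R _)
  have hlen : l.length = s.card := by rw [← hls, Multiset.coe_card]
  have hp : l.Pairwise R := List.pairwise_insertionSort R _
  refine ⟨fun k => l.getD k 0, ?_, fun j k hjk hk => ?_⟩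
  · conv_lhs => rw [← hls]
    rw [← hlen]
    change (l : Multiset ℝ) = (((List.range l.length).map fun k => l.getD k 0 : List ℝ) : Multiset ℝ)
    congr 1
    refine List.ext_getElem (by simp) fun k h1 h2 => ?_
    simp [h1]
  · rw [← hlen] at hk
    beta_reduce
    rw [List.getD_eq_getElem _ _ hk, List.getD_eq_getElem _ _ (hjk.trans_lt hk)]
    rcases hjk.eq_or_lt with rfl | h
    · exact le_rfl
    · exact List.pairwise_iff_getElem.1 hp j k _ _ h

theorem monotone_path_trans {a b c : ℝ} {p : Path a b} {q : Path b c} (hp : Monotone p)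
    (hq : Monotone q) : Monotone (p.trans q) := by
  have h1 : ∀ s, p s ≤ b := fun s => by
    have := hp (show s ≤ 1 from s.2.2)
    rwa [p.target] at this
  have h2 : ∀ s, b ≤ q s := fun s => by
    have := hq (show 0 ≤ s from s.2.1)
    rwa [q.source] at this
  intro s t hst
  have hst' : (s : ℝ) ≤ t := hst
  rw [Path.trans_apply, Path.trans_apply]
  split_ifs with h3 h4 h4
  · exact hp (Subtype.mk_le_mk.2 (by linarith))
  · exact (h1 _).trans (h2 _)
  · exact absurd (hst'.trans h4) h3
  · exact hq (Subtype.mk_le_mk.2 (by linarith))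

/-! ### Small paths along which the Lyapunov graph does not decrease -/

section Reach

variable {X V W₁ W₂ : Type*} [NormedAddCommGroup V] [InnerProductSpace ℝ V]
  [FiniteDimensional ℝ V]
  [NormedAddCommGroup W₁] [InnerProductSpace ℝ W₁] [FiniteDimensional ℝ W₁]
  [NormedAddCommGroup W₂] [InnerProductSpace ℝ W₂] [FiniteDimensional ℝ W₂]
  {T : Equiv.Perm X} {n : ℕ}

/-- The moduli of the complex eigenvalues of the return map. -/
noncomputable def mods (T : Equiv.Perm X) (n : ℕ) (A : X → V →L[ℝ] V) (x : X) : Multiset ℝ :=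
  ((it T A n x).toLinearMap.charpoly.aroots ℂ).map norm

theorem HasSpec.mods_eq {A : X → V →L[ℝ] V} {s : Multiset ℝ} (h : HasSpec T n A s) (x : X) :
    mods T n A x = s.map fun r => |r| := by
  rw [mods, h x, aroots_def, Polynomial.map_multiset_prod, Multiset.map_map]
  have : (s.map (Polynomial.map (algebraMap ℝ ℂ) ∘ fun r => Polynomial.X - C r)) =
      (s.map fun r => (r : ℂ)).map fun z => Polynomial.X - C z := by
    simp [Multiset.map_map]
  rw [this, roots_multiset_prod_X_sub_C, Multiset.map_map]
  simp

theorem Block.mods_eq {φ : X → AlgFrame V W₁ W₂} {A : X → V →L[ℝ] V}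
    {P : X → W₁ →L[ℝ] W₁} {S : X → W₂ →L[ℝ] W₂} (h : Block T φ A P S) (hT : IsCyc T n) (x : X) :
    mods T n A x = mods T n P x + mods T n S x := by
  rw [mods, h.charpoly_eq hT, aroots_mul (mul_ne_zero (LinearMap.charpoly_monic _).ne_zero
    (LinearMap.charpoly_monic _).ne_zero), Multiset.map_add]
  rfl

/-- The Lyapunov graph. -/
noncomputable def gr (T : Equiv.Perm X) (n : ℕ) (A : X → V →L[ℝ] V) (x : X) (j : ℕ) : ℝ :=
  sortedSum ((mods T n A x).map fun r => Real.log r / n) j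

theorem HasSpec.gr_eq {A : X → V →L[ℝ] V} {d : ℕ} {r : ℕ → ℝ}
    (h : HasSpec T n A ((Multiset.range d).map r)) (hr0 : ∀ k < d, r k ≠ 0)
    (hr : ∀ j k, j ≤ k → k < d → |r j| ≤ |r k|) (x : X)
    {j : ℕ} (hj : j ≤ d) : gr T n A x j = ∑ k ∈ Finset.range j, Real.log |r k| / n := by
  rw [gr, h.mods_eq, Multiset.map_map, Multiset.map_map]
  refine sortedSum_range (u := fun k => Real.log |r k| / n) (fun j k hjk hk => ?_) hj
  have h1 := hr j k hjk hk
  have h2 := abs_pos.2 (hr0 j (hjk.trans_lt hk))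
  gcongr

/-- There is a small path from `A` to `B` along which the Lyapunov graph moves continuously and
does not decrease. -/
def Reach (T : Equiv.Perm X) (n d : ℕ) (ε : ℝ) (A B : X → V →L[ℝ] V) : Prop :=
  ∃ γ : Path A B, (∀ t x, ‖γ t x - A x‖ ≤ ε) ∧ ∀ x, ∀ j ≤ d,
    Continuous (fun t => gr T n (γ t) x j) ∧ Monotone fun t => gr T n (γ t) x j

theorem Reach.mono {A B : X → V →L[ℝ] V} {d : ℕ} {ε ε' : ℝ} (h : Reach T n d ε A B)
    (hε : ε ≤ ε') : Reach T n d ε' A B := by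
  obtain ⟨γ, h1, h2⟩ := h
  exact ⟨γ, fun t x => (h1 t x).trans hε, h2⟩

theorem Reach.norm_le {A B : X → V →L[ℝ] V} {d : ℕ} {ε : ℝ} (h : Reach T n d ε A B) (x : X) :
    ‖B x - A x‖ ≤ ε := by
  obtain ⟨γ, h1, h2⟩ := h
  have := h1 1 x
  rwa [γ.target] at this

theorem Reach.gr_le {A B : X → V →L[ℝ] V} {d : ℕ} {ε : ℝ} (h : Reach T n d ε A B) (x : X) {j : ℕ}
    (hj : j ≤ d) : gr T n A x j ≤ gr T n B x j := by
  obtain ⟨γ, h1, h2⟩ := h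
  have := (h2 x j hj).2 (show (0 : unitInterval) ≤ 1 from zero_le_one)
  simpa using this

theorem Reach.trans {A B D : X → V →L[ℝ] V} {d : ℕ} {ε δ : ℝ} (hδ : 0 ≤ δ)
    (h : Reach T n d ε A B) (h' : Reach T n d δ B D) : Reach T n d (ε + δ) A D := by
  have hBA := h.norm_le
  obtain ⟨γ, h1, h2⟩ := h
  obtain ⟨γ', h1', h2'⟩ := h'
  refine ⟨γ.trans γ', fun t x => ?_, fun x j hj => ?_⟩
  · rw [Path.trans_apply]
    split_ifs
    · exact (h1 _ _).trans (by linarith)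
    · have := norm_add_le (B x - A x) (γ' ⟨2 * t - 1, unitInterval.two_mul_sub_one_mem_iff.2
        ⟨(not_le.1 ‹_›).le, t.2.2⟩⟩ x - B x)
      rw [sub_add_sub_cancel'] at this
      exact this.trans (add_le_add (hBA x) (h1' _ _))
  · let p : Path (gr T n A x j) (gr T n B x j) :=
      ⟨⟨fun t => gr T n (γ t) x j, (h2 x j hj).1⟩, by simp, by simp⟩
    let q : Path (gr T n B x j) (gr T n D x j) :=
      ⟨⟨fun t => gr T n (γ' t) x j, (h2' x j hj).1⟩, by simp, by simp⟩
    have hpq : (fun t => gr T n (γ.trans γ' t) x j) = p.trans q := by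
      funext t
      rw [Path.trans_apply, Path.trans_apply]
      split_ifs <;> rfl
    rw [hpq]
    exact ⟨(p.trans q).continuous, monotone_path_trans (h2 x j hj).2 (h2' x j hj).2⟩

theorem JoinedIn.reach {A B : X → V →L[ℝ] V} {d : ℕ} {ε : ℝ}
    (h : JoinedIn {D | (∀ x, mods T n D x = mods T n A x) ∧ ∀ x, ‖D x - A x‖ ≤ ε} A B) :
    Reach T n d ε A B := by
  obtain ⟨γ, hγ⟩ := h
  have : ∀ x j t, gr T n (γ t) x j = gr T n A x j := fun x j t => by
    rw [gr, (hγ t).1 x]; rfl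
  refine ⟨γ, fun t => (hγ t).2, fun x j _ => ?_⟩
  simp only [this]
  exact ⟨continuous_const, monotone_const⟩

/-- Apply the bounds on the `n`-th iterate to an eigenvector. -/
theorem abs_log_le_of_isRoot {A : X → V →L[ℝ] V} {K : ℝ} (hK : 1 ≤ K) (hA : Bdd A K) (hn : 0 < n)
    {s : Multiset ℝ} (h : HasSpec T n A s) (x : X) {r : ℝ} (hr : r ∈ s) :
    |Real.log |r| / n| ≤ Real.log K := by
  obtain ⟨v, hv⟩ := ((Module.End.hasEigenvalue_iff_isRoot_charpoly _ _).2
    (h.isRoot x hr)).exists_hasEigenvector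
  have h1 : it T A n x v = r • v := hv.apply_eq_smul
  have hv0 : 0 < ‖v‖ := norm_pos_iff.2 hv.2
  have hr0 : 0 < |r| := abs_pos.2 (h.ne_zero hA.injective x hr)
  have h2 := hA.norm_it_le (T := T) (by linarith) n x v
  have h3 := hA.le_norm_it (T := T) (by linarith) n x v
  rw [h1, norm_smul, Real.norm_eq_abs] at h2 h3
  have h4 : |r| ≤ K ^ n := le_of_mul_le_mul_right h2 hv0
  have h5 : 1 ≤ K ^ n * |r| := by
    refine le_of_mul_le_mul_right ?_ hv0
    linarith
  have h6 := Real.log_le_log hr0 h4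
  have h7 := Real.log_le_log one_pos h5
  rw [Real.log_one, Real.log_mul (by positivity) hr0.ne', Real.log_pow] at h7
  rw [Real.log_pow] at h6
  have hn' : (0 : ℝ) < n := by exact_mod_cast hn
  rw [abs_le, le_div_iff₀ hn', div_le_iff₀ hn']
  constructor <;> linarith

end Reach

/-! ### Rescaling a real spectrum -/

section Scaling

/-- In a flag of invariant bundles the eigenvalues are the products of the diagonal rates. Each step
of the induction multiplies one rate by `exp (t * μ)` at every point, hence one eigenvalue by the
`n`-th power. The second entries of the pairs in `s` are the changes `μ` of the exponents. -/
theorem exists_scaling.{w} (N : ℕ) (V : Type) [NormedAddCommGroup V] [InnerProductSpace ℝ V]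
    [FiniteDimensional ℝ V] {X : Type w} {T : Equiv.Perm X} {n : ℕ} (hT : IsCyc T n)
    {A : X → V →L[ℝ] V} {K η : ℝ} (hK : 0 ≤ K) (hA : Bdd A K) {s : Multiset (ℝ × ℝ)}
    (hN : s.card = N)
    (hs : HasSpec T n A (s.map Prod.fst)) (hη : ∀ p ∈ s, |p.2| ≤ η) :
    ∃ f : unitInterval → X → V →L[ℝ] V, Continuous f ∧ f 0 = A ∧
      (∀ t, HasSpec T n (f t) (s.map fun p => p.1 * Real.exp (t * p.2) ^ n)) ∧
      ∀ t x, ‖f t x - A x‖ ≤ N * (K * (Real.exp η - 1)) := by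
  induction N generalizing V s with
  | zero =>
    rw [Multiset.card_eq_zero] at hN
    subst hN
    exact ⟨fun _ => A, continuous_const, rfl, fun t => hs, fun t x => by simp⟩
  | succ N ih =>
    rcases isEmpty_or_nonempty X with hX | ⟨⟨x₀⟩⟩
    · exact ⟨fun _ => A, continuous_const, rfl, fun t x => (hX.false x).elim,
        fun t x => (hX.false x).elim⟩
    obtain ⟨⟨r, μ⟩, hp⟩ := Multiset.card_pos_iff_exists_mem.1 (by omega : 0 < s.card)
    obtain ⟨s, rfl⟩ := Multiset.exists_cons_of_mem hp
    rw [Multiset.card_cons] at hN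
    rw [Multiset.map_cons] at hs
    have hV : Module.finrank ℝ V = N + 1 := by
      have h1 := congrArg natDegree (hs x₀)
      rw [LinearMap.charpoly_natDegree, natDegree_multiset_prod_X_sub_C_eq_card] at h1
      simpa [hN] using h1
    let W := EuclideanSpace ℝ (Fin N)
    obtain ⟨φ, c, S, hb, hc, hr⟩ := exists_line_frame (W₂ := W) hT hA.bijective x₀
      (hs.isRoot x₀ (Multiset.mem_cons_self _ _)) (by rw [hV]; simp [W])
    obtain ⟨g, hg, hg0, hgs, hgn⟩ := ih W (hb.bdd_quot hK hA) (by omega)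
      (hb.hasSpec_quot hc hT hs hr) fun p hp => hη p (Multiset.mem_cons_of_mem hp)
    set e : unitInterval → ℝ := fun t => Real.exp (t * μ) with he
    have hec : Continuous e := by fun_prop
    have hμ : |μ| ≤ η := hη _ (Multiset.mem_cons_self _ _)
    have hen : ∀ t, |e t - 1| ≤ Real.exp η - 1 := by
      intro t
      have h1 : |(t : ℝ) * μ| ≤ η := by
        rw [abs_mul, abs_of_nonneg t.2.1]
        calc (t : ℝ) * |μ| ≤ 1 * |μ| := by gcongr; exact t.2.2
          _ ≤ η := by linarith
      rw [abs_le] at h1 ⊢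
      have h2 : e t ≤ Real.exp η := Real.exp_le_exp.2 h1.2
      have h3 : Real.exp (-η) ≤ e t := Real.exp_le_exp.2 h1.1
      have h4 := Real.add_one_le_exp η
      have h5 : 1 - Real.exp (-η) ≤ Real.exp η - 1 := by
        have h6 : Real.exp η * Real.exp (-η) = 1 := by rw [← Real.exp_add]; simp
        nlinarith [sq_nonneg (Real.exp η - 1), Real.exp_pos (-η), Real.exp_pos η]
      constructor <;> linarith
    have hcn : ∀ x, |c x| ≤ K := fun x => by
      have := (hb.bdd_sub hK hA x).1
      rwa [norm_smul, ContinuousLinearMap.norm_id, mul_one, Real.norm_eq_abs] at this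
    have hb' := fun t => (hb.lift_quot (g t)).lift_sub (fun x => (c x * e t) •
      ContinuousLinearMap.id ℝ ℝ)
    refine ⟨fun t x => A x + (φ (T x)).i.comp ((g t x - S x).comp (φ x).i') +
      (φ (T x)).k.comp (((c x * e t) • ContinuousLinearMap.id ℝ ℝ -
        c x • ContinuousLinearMap.id ℝ ℝ).comp (φ x).k'), ?_, ?_, fun t => ?_, fun t x => ?_⟩
    · refine continuous_pi fun x => ?_
      have h1 : Continuous fun t => g t x := (continuous_apply x).comp hg
      have h2 : Continuous fun t => (c x * e t) • ContinuousLinearMap.id ℝ ℝ :=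
        (continuous_const.mul hec).smul continuous_const
      exact (continuous_const.add (continuous_const.clm_comp ((h1.sub continuous_const).clm_comp
        continuous_const))).add (continuous_const.clm_comp ((h2.sub continuous_const).clm_comp
        continuous_const))
    · funext x
      have : e 0 = 1 := by simp [he]
      simp [hg0, this]
    · rw [Multiset.map_cons]
      refine (hb' t).hasSpec_cons (fun x => mul_ne_zero (hc x) (Real.exp_ne_zero _)) hT (hgs t)
        fun x => ?_
      rw [sp_mul, hr, sp_const]
    · have e1 : (c x * e t) • ContinuousLinearMap.id ℝ ℝ - c x • ContinuousLinearMap.id ℝ ℝ =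
          (c x * (e t - 1)) • ContinuousLinearMap.id ℝ ℝ := by ext; simp; ring
      beta_reduce
      rw [e1, add_assoc, add_sub_cancel_left]
      have e2 := Frame.opNorm_sandwich_le (φ (T x)).opNorm_i (φ x).opNorm_i' (g t x - S x)
      have e3 := Frame.opNorm_sandwich_le (φ (T x)).opNorm_k (φ x).opNorm_k'
        ((c x * (e t - 1)) • ContinuousLinearMap.id ℝ ℝ)
      have e4 : ‖(c x * (e t - 1)) • ContinuousLinearMap.id ℝ ℝ‖ ≤ K * (Real.exp η - 1) := by
        rw [norm_smul, ContinuousLinearMap.norm_id, mul_one, Real.norm_eq_abs, abs_mul]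
        gcongr
        exacts [hcn x, hen t]
      have e5 := hgn t x
      push_cast
      calc _ ≤ N * (K * (Real.exp η - 1)) + K * (Real.exp η - 1) :=
            (norm_add_le _ _).trans (add_le_add (e2.trans e5) (e3.trans e4))
        _ = _ := by ring

end Scaling

/-! ### Rotating a pair of complex eigenvalues to the real axis -/

section Rotations

/-- The real and imaginary parts. -/
noncomputable def complexFrame : AlgFrame ℂ ℝ ℝ where
  k := Complex.ofRealCLM
  i := ContinuousLinearMap.toSpanSingleton ℝ Complex.I
  k' := Complex.reCLM
  i' := Complex.imCLM
  kk w := by simp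
  ii w := by simp
  ki w := by simp
  ik w := by simp
  id v := by
    simp only [ContinuousLinearMap.toSpanSingleton_apply, Complex.reCLM_apply, Complex.imCLM_apply,
      Complex.ofRealCLM_apply, Complex.real_smul]
    exact Complex.re_add_im v

/-- The rotation of angle `τ`. -/
noncomputable def rot (τ : ℝ) : ℂ →L[ℝ] ℂ := ContinuousLinearMap.mul ℝ ℂ (Complex.exp (Complex.I * τ))

theorem rot_apply (τ : ℝ) (z : ℂ) : rot τ z = Complex.exp (Complex.I * τ) * z := rfl

theorem rot_zero : rot 0 = ContinuousLinearMap.id ℝ ℂ := by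
  ext; simp [rot_apply]

theorem continuous_rot : Continuous rot := by
  unfold rot
  exact (ContinuousLinearMap.mul ℝ ℂ).continuous.comp (by fun_prop)

theorem norm_rot_sub_le (τ : ℝ) : ‖rot τ - ContinuousLinearMap.id ℝ ℂ‖ ≤ |τ| := by
  refine ContinuousLinearMap.opNorm_le_bound _ (abs_nonneg _) fun z => ?_
  have : (rot τ - ContinuousLinearMap.id ℝ ℂ) z = (Complex.exp (Complex.I * τ) - 1) * z := by
    rw [sub_apply, rot_apply, ContinuousLinearMap.id_apply]; ring
  rw [this, norm_mul]
  gcongr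
  exact Real.norm_exp_I_mul_ofReal_sub_one_le

/-- For a matrix with rows `a, b` and `c, d` one has `t = a + d` and `g = b - c`, and `t ^ 2 + g ^ 2
- 4 * D = (a - d) ^ 2 + (b + c) ^ 2`. -/
theorem exists_trace_rot (M : ℂ →L[ℝ] ℂ) : ∃ t g D : ℝ, 4 * D - t ^ 2 ≤ g ^ 2 ∧ ∀ τ,
    (M.comp (rot τ)).toLinearMap.charpoly = Polynomial.X ^ 2 -
      C (t * Real.cos τ + g * Real.sin τ) * Polynomial.X + C D := by
  set a := (M 1).re
  set c := (M 1).im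
  set b := (M Complex.I).re
  set d := (M Complex.I).im
  have hM : ∀ z, M z = z.re • M 1 + z.im • M Complex.I := fun z => by
    have : z = z.re • (1 : ℂ) + z.im • Complex.I := by
      simp [Complex.re_add_im]
    conv_lhs => rw [this]
    rw [map_add, map_smul, map_smul]
  refine ⟨a + d, b - c, a * d - b * c, by nlinarith [sq_nonneg (a - d), sq_nonneg (b + c)],
    fun τ => ?_⟩
  rw [charpoly_two complexFrame]
  have e1 : Complex.exp (Complex.I * τ) = ⟨Real.cos τ, Real.sin τ⟩ := by
    rw [mul_comm]
    apply Complex.ext <;> simp [Complex.exp_ofReal_mul_I_re, Complex.exp_ofReal_mul_I_im]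
  have e2 : rot τ 1 = ⟨Real.cos τ, Real.sin τ⟩ := by rw [rot_apply, e1, mul_one]
  have e3 : rot τ Complex.I = ⟨-Real.sin τ, Real.cos τ⟩ := by
    rw [rot_apply, e1]; apply Complex.ext <;> simp
  have f1 : (complexFrame.k 1 : ℂ) = 1 := by simp [complexFrame]
  have f2 : (complexFrame.i 1 : ℂ) = Complex.I := by simp [complexFrame]
  have f3 : ∀ z, complexFrame.k' z = z.re := fun z => rfl
  have f4 : ∀ z, complexFrame.i' z = z.im := fun z => rfl
  rw [f1, f2, f3, f3, f4, f4]
  simp only [ContinuousLinearMap.coe_coe, ContinuousLinearMap.comp_apply]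
  rw [e2, e3, hM ⟨Real.cos τ, Real.sin τ⟩, hM ⟨-Real.sin τ, Real.cos τ⟩]
  simp only [Complex.add_re, Complex.add_im, Complex.real_smul, Complex.re_ofReal_mul,
    Complex.im_ofReal_mul]
  have := Real.sin_sq_add_cos_sq τ
  congr 2
  · congr 2; ring
  · linear_combination (a * d - b * c) * this

/-- Write `t = R cos φ`, with `φ ≥ ψ`. Since `|g| ≥ R sin φ`, rotating in the direction that makes
the sine term negative keeps the trace below `R cos (φ + u)`. So the rotation advances the angle of
the eigenvalues at least by its own angle, unless the trace reaches `-R` before. -/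
theorem exists_kick {R t g ψ δ : ℝ} (hR : 0 < R) (ht : t ^ 2 < R ^ 2) (hg : R ^ 2 - t ^ 2 ≤ g ^ 2)
    (hψ : 0 ≤ ψ) (htψ : t ≤ R * Real.cos ψ) (hδ : 0 ≤ δ) (hψδ : ψ + δ ≤ Real.pi) :
    ∃ η : ℝ, |η| = 1 ∧ ∃ s, 0 ≤ s ∧ s ≤ δ ∧
      (∀ u, 0 ≤ u → u ≤ s → (t * Real.cos (η * u) + g * Real.sin (η * u)) ^ 2 ≤ R ^ 2) ∧
      (t * Real.cos (η * s) + g * Real.sin (η * s) = -R ∨ s = δ ∧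
        -R < t * Real.cos (η * δ) + g * Real.sin (η * δ) ∧
        t * Real.cos (η * δ) + g * Real.sin (η * δ) ≤ R * Real.cos (ψ + δ)) := by
  obtain ⟨ht1, ht2⟩ := abs_lt.1 (abs_lt_of_sq_lt_sq ht hR.le)
  obtain ⟨η, hη, hηg⟩ : ∃ η : ℝ, |η| = 1 ∧ η * g = -|g| := by
    rcases le_total 0 g with h | h
    · exact ⟨-1, by simp, by rw [abs_of_nonneg h]; ring⟩
    · exact ⟨1, by simp, by rw [abs_of_nonpos h]; ring⟩
  have hη2 : η = 1 ∨ η = -1 := (abs_eq zero_le_one).1 hη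
  refine ⟨η, hη, ?_⟩
  have htr : ∀ u, t * Real.cos (η * u) + g * Real.sin (η * u) =
      t * Real.cos u - |g| * Real.sin u := by
    intro u
    have e : g * Real.sin (η * u) = η * g * Real.sin u := by
      rcases hη2 with h | h <;> rw [h] <;> simp
    have e' : Real.cos (η * u) = Real.cos u := by
      rcases hη2 with h | h <;> rw [h] <;> simp
    rw [e, e', hηg]; ring
  simp only [htr]
  set F : ℝ → ℝ := fun u => t * Real.cos u - |g| * Real.sin u with hF
  have hFc : Continuous F := by fun_prop
  have hF0 : F 0 = t := by simp [hF]
  set φ := Real.arccos (t / R) with hφ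
  have h1 : -1 ≤ t / R := by rw [le_div_iff₀ hR]; linarith
  have h2 : t / R ≤ 1 := by rw [div_le_one hR]; linarith
  have hcos : R * Real.cos φ = t := by rw [Real.cos_arccos h1 h2]; field_simp
  have hφ0 : 0 ≤ φ := Real.arccos_nonneg _
  have hφπ : φ ≤ Real.pi := Real.arccos_le_pi _
  have hsin : R * Real.sin φ ≤ |g| := by
    have h3 : (R * Real.sin φ) ^ 2 ≤ g ^ 2 := by
      have := Real.sin_sq_add_cos_sq φ
      nlinarith
    exact (le_abs_self _).trans (sq_le_sq.1 h3)
  have hψφ : ψ ≤ φ := by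
    have : t / R ≤ Real.cos ψ := by rw [div_le_iff₀ hR]; linarith
    have h3 := Real.arccos_le_arccos this
    rwa [Real.arccos_cos hψ (by linarith)] at h3
  have hFle : ∀ u, 0 ≤ u → u ≤ Real.pi → F u ≤ R * Real.cos (φ + u) := by
    intro u hu0 huπ
    have h3 := Real.sin_nonneg_of_nonneg_of_le_pi hu0 huπ
    have h4 := mul_le_mul_of_nonneg_right hsin h3
    have h5 : R * Real.cos (φ + u) = R * Real.cos φ * Real.cos u - R * Real.sin φ * Real.sin u := by
      rw [Real.cos_add]; ring
    rw [h5, hcos]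
    simp only [hF]
    linarith
  have hFR : ∀ u, 0 ≤ u → u ≤ δ → -R ≤ F u → F u ^ 2 ≤ R ^ 2 := by
    intro u hu0 huδ h3
    have h4 := hFle u hu0 (by linarith)
    have h5 := Real.cos_le_one (φ + u)
    rw [sq_le_sq, abs_of_pos hR, abs_le]
    exact ⟨h3, h4.trans (by nlinarith)⟩
  -- Stop at the first time the trace is `-R`: until then the discriminant is not positive and the
  -- moduli do not change.
  by_cases hex : ∃ u, (0 ≤ u ∧ u ≤ δ) ∧ F u ≤ -R
  · have hcomp : IsCompact {u | (0 ≤ u ∧ u ≤ δ) ∧ F u ≤ -R} := by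
      have : {u | (0 ≤ u ∧ u ≤ δ) ∧ F u ≤ -R} = Set.Icc 0 δ ∩ {u | F u ≤ -R} := rfl
      rw [this]
      exact isCompact_Icc.inter_right (isClosed_le hFc continuous_const)
    obtain ⟨s, ⟨⟨hs0, hsδ⟩, hs⟩, hmin⟩ := hcomp.exists_isLeast hex
    have hlt : ∀ u, 0 ≤ u → u < s → -R < F u := fun u hu0 hus => by
      by_contra h3
      exact absurd (hmin ⟨⟨hu0, hus.le.trans hsδ⟩, not_lt.1 h3⟩) (not_le.2 hus)
    have hseq : F s = -R := by
      obtain ⟨u, ⟨hu0, hus⟩, hu⟩ := intermediate_value_Icc' hs0 hFc.continuousOn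
        (show -R ∈ Set.Icc (F s) (F 0) from ⟨hs, by rw [hF0]; linarith⟩)
      rcases hus.eq_or_lt with rfl | h
      · exact hu
      · exact absurd hu (hlt u hu0 h).ne'
    refine ⟨s, hs0, hsδ, fun u hu0 hus => hFR u hu0 (hus.trans hsδ) ?_, Or.inl hseq⟩
    rcases hus.eq_or_lt with rfl | h
    · exact hseq.ge
    · exact (hlt u hu0 h).le
  · push Not at hex
    refine ⟨δ, hδ, le_rfl, fun u hu0 huδ => hFR u hu0 huδ (hex u ⟨hu0, huδ⟩).le,
      Or.inr ⟨rfl, hex δ ⟨hδ, le_rfl⟩, ?_⟩⟩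
    have h3 : φ + δ ≤ Real.pi := by
      by_contra h3
      have h4 := hFle (Real.pi - φ) (by linarith) (by linarith)
      have h5 := hex (Real.pi - φ) ⟨by linarith, by linarith⟩
      rw [add_sub_cancel, Real.cos_pi] at h4
      linarith
    have h4 := Real.cos_le_cos_of_nonneg_of_le_pi (by linarith : 0 ≤ ψ + δ) h3
      (by linarith : ψ + δ ≤ φ + δ)
    exact (hFle δ hδ (by linarith)).trans (by gcongr)

variable {X : Type*} {T : Equiv.Perm X} {n : ℕ}

theorem it_update_comp (hT : IsCyc T n) [DecidableEq X] (A : X → ℂ →L[ℝ] ℂ) (x : X)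
    (R : ℂ →L[ℝ] ℂ) :
    it T (Function.update A x ((A x).comp R)) n x = (it T A n x).comp R := by
  obtain ⟨m, rfl⟩ := Nat.exists_eq_succ_of_ne_zero hT.pos.ne'
  rw [Nat.succ_eq_add_one, it_succ, it_succ, Function.update_self, it_congr (B := A) m (T x)]
  · rfl
  · intro j hj
    refine Function.update_of_ne (fun h => ?_) _ _
    rw [← Function.iterate_succ_apply] at h
    exact absurd (hT.inj x (j + 1) 0 (by omega) (by omega) h) (by omega)

theorem mods_of_disc {A : X → ℂ →L[ℝ] ℂ} {x : X} {t D : ℝ} (h : t ^ 2 ≤ 4 * D)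
    (hA : (it T A n x).toLinearMap.charpoly = Polynomial.X ^ 2 - C t * Polynomial.X + C D) :
    mods T n A x = {√D, √D} := by
  set s := √(D - t ^ 2 / 4) with hs
  have hs2 : s ^ 2 = D - t ^ 2 / 4 := Real.sq_sqrt (by linarith)
  have hz : ∀ y : ℝ, y ^ 2 = s ^ 2 → ‖(⟨t / 2, y⟩ : ℂ)‖ = √D := fun y hy => by
    rw [Complex.norm_def, Complex.normSq_mk]
    congr 1
    nlinarith
  have hp : (Polynomial.X ^ 2 - C t * Polynomial.X + C D : ℝ[X]).map (algebraMap ℝ ℂ) =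
      (({(⟨t / 2, s⟩ : ℂ), ⟨t / 2, -s⟩} : Multiset ℂ).map fun z => Polynomial.X - C z).prod := by
    have e1 : (⟨t / 2, s⟩ : ℂ) + ⟨t / 2, -s⟩ = (t : ℂ) := by
      apply Complex.ext <;> simp
    have e2 : (⟨t / 2, s⟩ : ℂ) * ⟨t / 2, -s⟩ = (D : ℂ) := by
      apply Complex.ext <;> simp
      · nlinarith
      · ring
    simp only [Multiset.insert_eq_cons, Multiset.map_cons, Multiset.map_singleton,
      Multiset.prod_cons, Multiset.prod_singleton, Polynomial.map_add, Polynomial.map_sub,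
      Polynomial.map_mul, Polynomial.map_pow, Polynomial.map_X, Polynomial.map_C,
      Complex.coe_algebraMap]
    rw [← e1, ← e2, C_add, C_mul]
    ring
  rw [mods, hA, aroots_def, hp, roots_multiset_prod_X_sub_C]
  simp [hz]

/-- Rotate by at most `π / N` at the first `N` points of the orbit of `x₀`, one after another. The
determinant is constant, and the moduli too as long as the discriminant is not positive. If no real
eigenvalue ever appeared, the trace would be at most `R cos (k * π / N)` after `k` rotations, which
is `-R` for `k = N`. -/
theorem exists_real_root_path (hT : IsCyc T n) {P : X → ℂ →L[ℝ] ℂ} {K δ : ℝ} {N : ℕ}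
    (hK : 1 ≤ K) (hP : Bdd P K) (hδ : δ ≤ 1 / (2 * K)) (hN0 : 0 < N) (hN : K * (Real.pi / N) ≤ δ)
    (hn : N ≤ n) (x₀ : X) (hno : ∀ r, ¬(it T P n x₀).toLinearMap.charpoly.IsRoot r) :
    ∃ B r, JoinedIn {B | (∀ x, mods T n B x = mods T n P x) ∧ ∀ x, ‖B x - P x‖ ≤ δ} P B ∧
      (it T B n x₀).toLinearMap.charpoly.IsRoot r := by
  classical
  have hK0 : 0 < K := by linarith
  have hδ0 : 0 ≤ δ := le_trans (by positivity) hN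
  obtain ⟨t₀, g₀, D, -, hD⟩ := exists_trace_rot (it T P n x₀)
  have hD0 := hD 0
  rw [rot_zero, ContinuousLinearMap.comp_id, Real.cos_zero, Real.sin_zero, mul_one, mul_zero,
    add_zero] at hD0
  have ht₀ : t₀ ^ 2 < 4 * D := by
    by_contra h
    push Not at h
    refine hno ((t₀ + √(t₀ ^ 2 - 4 * D)) / 2) ?_
    have := Real.sq_sqrt (by linarith : 0 ≤ t₀ ^ 2 - 4 * D)
    rw [hD0, IsRoot]
    simp
    nlinarith
  set R := 2 * √D with hR
  have hDpos : 0 < D := by nlinarith [sq_nonneg t₀]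
  have hR0 : 0 < R := by positivity
  have hR2 : R ^ 2 = 4 * D := by rw [hR, mul_pow, Real.sq_sqrt hDpos.le]; norm_num
  rw [← hR2] at ht₀
  set S := {B : X → ℂ →L[ℝ] ℂ | (∀ x, ∃ τ, τ ^ 2 ≤ R ^ 2 ∧ (it T B n x).toLinearMap.charpoly =
    Polynomial.X ^ 2 - C τ * Polynomial.X + C D) ∧ ∀ x, ‖B x - P x‖ ≤ δ} with hS
  have hSmods : ∀ B ∈ S, ∀ x, mods T n B x = {√D, √D} := fun B hB x => by
    obtain ⟨τ, hτ, h⟩ := hB.1 x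
    exact mods_of_disc (by rwa [hR2] at hτ) h
  have hbij : ∀ B : X → ℂ →L[ℝ] ℂ, (∀ x, ‖B x - P x‖ ≤ δ) → ∀ x, Function.Bijective (B x) :=
    fun B hB => (hP.perturb hK0 hδ hK hB).bijective
  have hPS : P ∈ S := ⟨fun x => ⟨t₀, ht₀.le, by rw [charpoly_ret_eq hT hP.bijective x x₀, hD0]⟩,
    fun x => by simpa using hδ0⟩
  suffices h : ∃ B r, JoinedIn S P B ∧ (it T B n x₀).toLinearMap.charpoly.IsRoot r by
    obtain ⟨B, r, h1, h2⟩ := h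
    exact ⟨B, r, h1.mono fun B hB => ⟨fun x => by rw [hSmods B hB, hSmods P hPS], hB.2⟩, h2⟩
  by_contra hcon
  push Not at hcon
  set z : ℕ → X := fun j => T^[j] x₀ with hz
  have claim : ∀ k ≤ N, ∃ B, JoinedIn S P B ∧ (∀ j, k ≤ j → j < n → B (z j) = P (z j)) ∧
      ∃ t, -R < t ∧ t ≤ R * Real.cos (k * (Real.pi / N)) ∧ (it T B n x₀).toLinearMap.charpoly =
        Polynomial.X ^ 2 - C t * Polynomial.X + C D := by
    intro k
    induction k with
    | zero =>
      intro _
      obtain ⟨h1, h2⟩ := abs_lt.1 (abs_lt_of_sq_lt_sq ht₀ hR0.le)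
      exact ⟨P, JoinedIn.refl hPS, fun _ _ _ => rfl, t₀, h1, by simpa using h2.le, hD0⟩
    | succ k ih =>
      intro hk
      obtain ⟨B, hB, hBP, t, ht1, ht2, htc⟩ := ih (by omega)
      have hBS := hB.target_mem
      have hBb := hbij B hBS.2
      have hNR : (0 : ℝ) < N := by exact_mod_cast hN0
      have hkN : (k + 1 : ℝ) ≤ N := by exact_mod_cast hk
      obtain ⟨t', g, D', hg, htr⟩ := exists_trace_rot (it T B n (z k))
      have h0 := htr 0
      rw [rot_zero, ContinuousLinearMap.comp_id, Real.cos_zero, Real.sin_zero, mul_one, mul_zero,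
        add_zero, charpoly_ret_eq hT hBb _ x₀, htc] at h0
      obtain rfl : D = D' := by
        have := congrArg (fun p => coeff p 0) h0
        simpa using this
      obtain rfl : t = t' := by
        have := congrArg (fun p => coeff p 1) h0
        simpa [coeff_X, coeff_C] using this
      have htR : t < R := by
        refine lt_of_le_of_ne (ht2.trans (mul_le_of_le_one_right hR0.le (Real.cos_le_one _))) ?_
        rintro rfl
        refine hcon B (R / 2) hB ?_
        rw [htc, IsRoot]
        simp
        nlinarith
      obtain ⟨η, hη, s, hs0, hsδ, hsu, hs⟩ := exists_kick (g := g) (δ := Real.pi / N) hR0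
        (sq_lt_sq.2 (by rw [abs_of_pos hR0, abs_lt]; exact ⟨ht1, htR⟩)) (by rwa [hR2])
        (by positivity) ht2 (by positivity) (by
          have : (k : ℝ) * (Real.pi / N) + Real.pi / N = (k + 1) / N * Real.pi := by ring
          rw [this]
          exact mul_le_of_le_one_left Real.pi_pos.le ((div_le_one hNR).2 hkN))
      set f : ℝ → X → ℂ →L[ℝ] ℂ := fun u =>
        Function.update B (z k) ((B (z k)).comp (rot (η * u))) with hf
      have hkn : k < n := by omega
      have hfd : ∀ u, 0 ≤ u → u ≤ s → ∀ x, ‖f u x - P x‖ ≤ δ := by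
        intro u hu0 hus x
        rcases eq_or_ne x (z k) with rfl | hx
        · simp only [hf, Function.update_self]
          have e : (B (z k)).comp (rot (η * u)) - P (z k) =
              (P (z k)).comp (rot (η * u) - ContinuousLinearMap.id ℝ ℂ) := by
            rw [hBP k le_rfl hkn, ContinuousLinearMap.comp_sub, ContinuousLinearMap.comp_id]
          rw [e]
          refine (ContinuousLinearMap.opNorm_comp_le _ _).trans (le_trans ?_ hN)
          gcongr
          · exact (hP _).1
          · refine (norm_rot_sub_le _).trans ?_
            rw [abs_mul, hη, one_mul, abs_of_nonneg hu0]
            exact hus.trans hsδ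
        · simp only [hf, Function.update_of_ne hx]
          exact hBS.2 x
      have hfc : ∀ u, 0 ≤ u → u ≤ s → ∀ x, (it T (f u) n x).toLinearMap.charpoly =
          Polynomial.X ^ 2 - C (t * Real.cos (η * u) + g * Real.sin (η * u)) * Polynomial.X +
            C D := by
        intro u hu0 hus x
        rw [charpoly_ret_eq hT (hbij _ (hfd u hu0 hus)) x (z k), it_update_comp hT, htr]
      have hfcont : Continuous f := by
        refine continuous_pi fun x => ?_
        rcases eq_or_ne x (z k) with rfl | hx
        · simp only [hf, Function.update_self]
          exact continuous_const.clm_comp (continuous_rot.comp (by fun_prop))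
        · simp only [hf, Function.update_of_ne hx]
          exact continuous_const
      have hf0 : f 0 = B := by
        simp only [hf, mul_zero, rot_zero, ContinuousLinearMap.comp_id, Function.update_eq_self]
      have hjoin : JoinedIn S P (f s) := by
        refine hB.trans ⟨⟨⟨fun u => f (u * s), hfcont.comp (by fun_prop)⟩, by simp [hf0],
          by simp⟩, fun u => ?_⟩
        have h1 : 0 ≤ (u : ℝ) * s := mul_nonneg u.2.1 hs0
        have h2 : (u : ℝ) * s ≤ s := mul_le_of_le_one_left hs0 u.2.2
        exact ⟨fun x => ⟨_, hsu _ h1 h2, hfc _ h1 h2 x⟩, hfd _ h1 h2⟩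
      rcases hs with hs | ⟨rfl, hs1, hs2⟩
      · refine absurd ?_ (hcon (f s) (-R / 2) hjoin)
        rw [hfc s hs0 le_rfl, hs, IsRoot]
        simp
        nlinarith
      · refine ⟨f _, hjoin, fun j hj hjn => ?_, _, hs1, ?_, hfc _ hs0 le_rfl x₀⟩
        · have : z j ≠ z k := fun h => by
            have := hT.inj x₀ j k hjn hkn h
            omega
          simp only [hf, Function.update_of_ne this]
          exact hBP j (by omega) hjn
        · refine hs2.trans (le_of_eq ?_)
          push_cast
          ring_nf
  obtain ⟨B, -, -, t, h1, h2, -⟩ := claim N le_rfl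
  have : (N : ℝ) * (Real.pi / N) = Real.pi := by
    have : (N : ℝ) ≠ 0 := by exact_mod_cast hN0.ne'
    field_simp
  rw [this, Real.cos_pi] at h2
  linarith

end Rotations

/-- Some irreducible factor of the characteristic polynomial kills a vector `v ≠ 0`. Without real
eigenvalues this factor has degree two, so `f (f v)` is a combination of `v` and `f v`. -/
theorem exists_invariant_plane {V : Type*} [NormedAddCommGroup V] [InnerProductSpace ℝ V]
    [FiniteDimensional ℝ V] (f : V →ₗ[ℝ] V) (hV : 0 < Module.finrank ℝ V)
    (hno : ∀ r, ¬f.charpoly.IsRoot r) :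
    ∃ W : Submodule ℝ V, Module.finrank ℝ W = 2 ∧ W.map f ≤ W := by
  have hno' : ∀ (r : ℝ) (v : V), v ≠ 0 → f v ≠ r • v := fun r v hv h =>
    hno r ((Module.End.hasEigenvalue_iff_isRoot_charpoly _ _).1
      (Module.End.hasEigenvalue_of_hasEigenvector ⟨Module.End.mem_eigenspace_iff.2 h, hv⟩))
  obtain ⟨q, v, hq, hv, hqv⟩ : ∃ (q : ℝ[X]) (v : V), Irreducible q ∧ v ≠ 0 ∧ aeval f q v = 0 := by
    have hnt : Nontrivial V := Module.nontrivial_of_finrank_pos hV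
    obtain ⟨v, hv⟩ := exists_ne (0 : V)
    have hp : aeval f f.charpoly v = 0 := by rw [LinearMap.aeval_self_charpoly]; rfl
    have hp0 := (LinearMap.charpoly_monic f).ne_zero
    generalize f.charpoly = p at hp hp0
    induction p using WfDvdMonoid.induction_on_irreducible generalizing v with
    | zero => exact absurd rfl hp0
    | unit u hu =>
      obtain ⟨c, hc, rfl⟩ := isUnit_iff.1 hu
      rw [aeval_C, Module.algebraMap_end_apply] at hp
      exact absurd hp (smul_ne_zero hc.ne_zero hv)
    | mul a q ha hq ih =>
      rw [mul_comm, map_mul, Module.End.mul_apply] at hp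
      by_cases h : aeval f q v = 0
      · exact ⟨q, v, hq, hv, h⟩
      · exact ih _ h hp ha
  have hdeg : q.natDegree ≤ 2 := by
    have := hq.degree_le_two
    exact natDegree_le_of_degree_le this
  have h0 : q.natDegree ≠ 0 := fun h => by
    rw [eq_C_of_natDegree_eq_zero h, aeval_C, Module.algebraMap_end_apply] at hqv
    rcases smul_eq_zero.1 hqv with h1 | h1
    · refine hq.ne_zero ?_
      rw [eq_C_of_natDegree_eq_zero h, h1, C_0]
    · exact hv h1
  have hsum : q.coeff 0 • v + q.coeff 1 • f v + q.coeff 2 • f (f v) = 0 := by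
    rw [← hqv, aeval_eq_sum_range' (by omega : q.natDegree < 3)]
    simp [Finset.sum_range_succ, pow_succ]
  have h2 : q.coeff 2 ≠ 0 := fun h => by
    rw [h, zero_smul, add_zero] at hsum
    have h1 : q.coeff 1 ≠ 0 := fun h1 => by
      have : q.natDegree = 0 := by
        by_contra h3
        have h4 : q.natDegree = 1 ∨ q.natDegree = 2 := by omega
        have h5 : q.leadingCoeff ≠ 0 := leadingCoeff_ne_zero.2 hq.ne_zero
        rw [leadingCoeff] at h5
        rcases h4 with h4 | h4 <;> rw [h4] at h5
        · exact h5 h1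
        · exact h5 h
      exact h0 this
    refine hno' (-(q.coeff 0 / q.coeff 1)) v hv ?_
    have h3 : q.coeff 1 • f v = -(q.coeff 0 • v) := by
      rw [eq_neg_iff_add_eq_zero, add_comm]; exact hsum
    have h4 := congrArg ((q.coeff 1)⁻¹ • ·) h3
    simp only [smul_smul, inv_mul_cancel₀ h1, one_smul, smul_neg] at h4
    rw [h4, neg_smul, div_eq_inv_mul]
  have hff : f (f v) = (-(q.coeff 0 / q.coeff 2)) • v + (-(q.coeff 1 / q.coeff 2)) • f v := by
    have h3 : q.coeff 2 • f (f v) = -(q.coeff 0 • v + q.coeff 1 • f v) := by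
      rw [eq_neg_iff_add_eq_zero, add_comm]; exact hsum
    have h4 := congrArg ((q.coeff 2)⁻¹ • ·) h3
    simp only [smul_smul, inv_mul_cancel₀ h2, one_smul, smul_neg, smul_add] at h4
    rw [h4, neg_smul, neg_smul, div_eq_inv_mul, div_eq_inv_mul]
    abel
  have hli : LinearIndependent ℝ ![v, f v] := by
    rw [LinearIndependent.pair_iff' hv]
    exact fun a h => hno' a v hv h.symm
  refine ⟨Submodule.span ℝ (Set.range ![v, f v]), by simpa using finrank_span_eq_card hli, ?_⟩
  have hv1 : v ∈ Submodule.span ℝ (Set.range ![v, f v]) := Submodule.subset_span ⟨0, rfl⟩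
  have hv2 : f v ∈ Submodule.span ℝ (Set.range ![v, f v]) := Submodule.subset_span ⟨1, rfl⟩
  rw [Submodule.map_span_le]
  rintro _ ⟨i, rfl⟩
  fin_cases i
  · exact hv2
  · change f (f v) ∈ _
    rw [hff]
    exact Submodule.add_mem _ (Submodule.smul_mem _ _ hv1) (Submodule.smul_mem _ _ hv2)

/-! ### Perturbation to a real spectrum with the same moduli -/

section RealSpectrum

theorem Frame.exists_mem_iff {V W₁ W₂ : Type*} [NormedAddCommGroup V] [InnerProductSpace ℝ V]
    [NormedAddCommGroup W₁] [InnerProductSpace ℝ W₁] [NormedAddCommGroup W₂]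
    [InnerProductSpace ℝ W₂] (φ : Frame V W₁ W₂) (v : V) :
    v ∈ LinearMap.range φ.k.toLinearMap ↔ φ.i' v = 0 := by
  constructor
  · rintro ⟨w, rfl⟩; exact φ.ik w
  · intro hv
    refine ⟨φ.k' v, ?_⟩
    have := φ.id v
    rwa [hv, map_zero, add_zero] at this

theorem Frame.block_of_map {X V W₁ W₂ : Type*} [NormedAddCommGroup V] [InnerProductSpace ℝ V]
    [FiniteDimensional ℝ V] [NormedAddCommGroup W₁] [InnerProductSpace ℝ W₁]
    [FiniteDimensional ℝ W₁] [NormedAddCommGroup W₂] [InnerProductSpace ℝ W₂]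
    [FiniteDimensional ℝ W₂] {T : Equiv.Perm X} {φ : X → Frame V W₁ W₂} {A : X → V →L[ℝ] V}
    {L : X → Submodule ℝ V} (hφ : ∀ x, LinearMap.range (φ x).k.toLinearMap = L x)
    (hL : ∀ x, (L x).map (A x).toLinearMap = L (T x)) :
    Block T (fun x => (φ x).toAlgFrame) A (fun x => (φ (T x)).k'.comp ((A x).comp (φ x).k))
      (fun x => (φ (T x)).i'.comp ((A x).comp (φ x).i)) := by
  refine block_of_sub (T := T) (fun x => (φ x).toAlgFrame) A _ fun x w => ?_
  have h1 : A x ((φ x).k w) ∈ LinearMap.range (φ (T x)).k.toLinearMap := by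
    rw [hφ, ← hL, ← hφ]
    exact Submodule.mem_map_of_mem (LinearMap.mem_range_self _ w)
  have h2 := (φ (T x)).id (A x ((φ x).k w))
  rw [((φ (T x)).exists_mem_iff _).1 h1, map_zero, add_zero] at h2
  exact h2.symm

theorem JoinedIn.mods_trans {X V : Type*} [NormedAddCommGroup V] [InnerProductSpace ℝ V]
    [FiniteDimensional ℝ V] {T : Equiv.Perm X} {n : ℕ} {A B D : X → V →L[ℝ] V} {ε δ : ℝ}
    (hδ : 0 ≤ δ)
    (h : JoinedIn {D | (∀ x, mods T n D x = mods T n A x) ∧ ∀ x, ‖D x - A x‖ ≤ ε} A B)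
    (h' : JoinedIn {D | (∀ x, mods T n D x = mods T n B x) ∧ ∀ x, ‖D x - B x‖ ≤ δ} B D) :
    JoinedIn {D | (∀ x, mods T n D x = mods T n A x) ∧ ∀ x, ‖D x - A x‖ ≤ ε + δ} A D := by
  have hB := h.target_mem
  refine JoinedIn.trans (y := B) (h.mono fun E hE => ?_)
    (h'.mono fun E hE => ⟨fun x => by rw [hE.1, hB.1], fun x => ?_⟩)
  · exact ⟨hE.1, fun x => (hE.2 x).trans (by linarith)⟩
  have := norm_add_le (B x - A x) (E x - B x)
  rw [sub_add_sub_cancel'] at this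
  exact this.trans (add_le_add (hB.2 x) (hE.2 x))

/-- Induction on the dimension. Once a return map has a real eigenvalue, pass to the quotient by its
line (`hreal`). If it has none, first rotate inside an invariant plane; the bound then doubles,
which explains the constants in the use of `hreal`. -/
theorem exists_real_spectrum.{w} (d : ℕ) (V : Type) [NormedAddCommGroup V]
    [InnerProductSpace ℝ V] [FiniteDimensional ℝ V] (hV : Module.finrank ℝ V = d) {K ε : ℝ}
    (hK : 1 ≤ K) (hε : 0 < ε) : ∃ N : ℕ, ∀ (X : Type w) (T : Equiv.Perm X) (n : ℕ), IsCyc T n →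
      N ≤ n → ∀ A : X → V →L[ℝ] V, Bdd A K → ∃ B s, HasSpec T n B s ∧
        JoinedIn {D | (∀ x, mods T n D x = mods T n A x) ∧ ∀ x, ‖D x - A x‖ ≤ ε} A B := by
  induction d generalizing V K ε with
  | zero =>
    refine ⟨0, fun X T n hT _ A hA => ⟨A, 0, fun x => ?_, JoinedIn.refl ⟨fun _ => rfl, fun x => ?_⟩⟩⟩
    · have h1 := LinearMap.charpoly_natDegree (it T A n x).toLinearMap
      rw [hV] at h1
      have h2 := (LinearMap.charpoly_monic (it T A n x).toLinearMap).natDegree_eq_zero.1 h1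
      rw [h2]; simp
    · rw [sub_self, norm_zero]; exact hε.le
  | succ d ih =>
    have hK0 : 0 < K := by linarith
    let W := EuclideanSpace ℝ (Fin d)
    have hW : Module.finrank ℝ W = d := by simp [W]
    have hreal : ∀ {K ε : ℝ}, 1 ≤ K → 0 < ε → ∃ N : ℕ, ∀ (X : Type w) (T : Equiv.Perm X) (n : ℕ),
        IsCyc T n → N ≤ n → ∀ A : X → V →L[ℝ] V, Bdd A K → ∀ x₀ r,
        (it T A n x₀).toLinearMap.charpoly.IsRoot r → ∃ B s, HasSpec T n B s ∧
        JoinedIn {D | (∀ x, mods T n D x = mods T n A x) ∧ ∀ x, ‖D x - A x‖ ≤ ε} A B := by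
      intro K ε hK hε
      obtain ⟨N, hN⟩ := ih W hW hK hε
      refine ⟨N, fun X T n hT hn A hA x₀ r hr => ?_⟩
      obtain ⟨φ, c, S, hb, hc, hcr⟩ := exists_line_frame (W₂ := W) hT hA.bijective x₀ hr
        (by rw [hW, hV])
      obtain ⟨S', s, hs, ⟨γ, hγ⟩⟩ := hN X T n hT hn S (hb.bdd_quot (by linarith) hA)
      refine ⟨_, r ::ₘ s, (hb.lift_quot S').hasSpec_cons hc hT hs hcr,
        ⟨⟨⟨fun t x => A x + (φ (T x)).i.comp ((γ t x - S x).comp (φ x).i'),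
          (continuous_affine_lift (T := T) (fun x => (φ x).i) (fun x => (φ x).i') A S).comp
            γ.continuous⟩, by ext; simp, by ext; simp⟩, fun t => ⟨fun x => ?_, fun x => ?_⟩⟩⟩
      · change mods T n (fun x => A x + (φ (T x)).i.comp ((γ t x - S x).comp (φ x).i')) x = _
        rw [(hb.lift_quot (γ t)).mods_eq hT, hb.mods_eq hT, (hγ t).1]
      · change ‖A x + (φ (T x)).i.comp ((γ t x - S x).comp (φ x).i') - A x‖ ≤ ε
        rw [add_sub_cancel_left]
        exact (Frame.opNorm_sandwich_le (φ (T x)).opNorm_i (φ x).opNorm_i' _).trans ((hγ t).2 x)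
    obtain ⟨N₁, hN₁⟩ := hreal (K := 2 * K) (ε := ε / 2) (by linarith) (by positivity)
    set δ := min (ε / 2) (1 / (2 * K)) with hδ
    have hδ0 : 0 < δ := lt_min (by positivity) (by positivity)
    obtain ⟨N₂, hN₂⟩ := exists_nat_gt (K * Real.pi / δ)
    have hN₂0 : (0 : ℝ) < N₂ := lt_of_le_of_lt (by positivity) hN₂
    refine ⟨max N₁ N₂, fun X T n hT hn A hA => ?_⟩
    have hn₁ : N₁ ≤ n := le_trans (le_max_left _ _) hn
    have hn₂ : N₂ ≤ n := le_trans (le_max_right _ _) hn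
    rcases isEmpty_or_nonempty X with hX | ⟨⟨x₀⟩⟩
    · exact ⟨A, 0, fun x => (hX.false x).elim, JoinedIn.refl ⟨fun _ => rfl,
        fun x => (hX.false x).elim⟩⟩
    suffices h : ∃ B r, JoinedIn {D | (∀ x, mods T n D x = mods T n A x) ∧
        ∀ x, ‖D x - A x‖ ≤ δ} A B ∧ (it T B n x₀).toLinearMap.charpoly.IsRoot r by
      obtain ⟨B, r, hB, hr⟩ := h
      have hB' := hA.perturb hK0 (min_le_right _ _) hK hB.target_mem.2
      obtain ⟨D, s, hs, hD⟩ := hN₁ X T n hT hn₁ B hB' x₀ r hr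
      refine ⟨D, s, hs, (hB.mods_trans (by positivity) hD).mono fun E hE =>
        ⟨hE.1, fun x => (hE.2 x).trans ?_⟩⟩
      have : δ ≤ ε / 2 := min_le_left _ _
      linarith
    by_cases hroot : ∃ r, (it T A n x₀).toLinearMap.charpoly.IsRoot r
    · obtain ⟨r, hr⟩ := hroot
      exact ⟨A, r, JoinedIn.refl ⟨fun _ => rfl, fun x => by simpa using hδ0.le⟩, hr⟩
    push Not at hroot
    obtain ⟨W₀, hW₀, hW₀i⟩ := exists_invariant_plane _ (by omega) hroot
    obtain ⟨L, hL0, hL, hLr⟩ := invariant_family hT hA.bijective x₀ W₀ hW₀i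
    rw [hW₀] at hLr
    have hle : 2 ≤ d + 1 := by
      rw [← hV, ← hW₀]; exact Submodule.finrank_le _
    let U := EuclideanSpace ℝ (Fin (d - 1))
    have hU : Module.finrank ℝ U = d - 1 := by simp [U]
    choose φ hφ using fun x => exists_frame (W₁ := ℂ) (W₂ := U) (L x)
      (by rw [hLr, Complex.finrank_real_complex]) (by rw [Complex.finrank_real_complex, hU]; omega)
    have hb := Frame.block_of_map (T := T) hφ hL
    set P : X → ℂ →L[ℝ] ℂ := fun x => (φ (T x)).k'.comp ((A x).comp (φ x).k)
    set S : X → U →L[ℝ] U := fun x => (φ (T x)).i'.comp ((A x).comp (φ x).i)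
    have hP := hb.bdd_sub hK0.le hA
    obtain ⟨P', r, ⟨γ, hγ⟩, hr⟩ := exists_real_root_path hT hK hP (min_le_right (ε / 2) _)
      (N := N₂) (by exact_mod_cast hN₂0) (by
        rw [div_lt_iff₀ hδ0] at hN₂
        rw [← mul_div_assoc, div_le_iff₀ hN₂0]
        linarith) hn₂ x₀ fun r hr => hroot r (by
          rw [hb.charpoly_eq hT, IsRoot, eval_mul, hr.eq_zero, zero_mul])
    refine ⟨_, r, ⟨⟨⟨fun t x => A x + (φ (T x)).k.comp ((γ t x - P x).comp (φ x).k'),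
          (continuous_affine_lift (T := T) (fun x => (φ x).k) (fun x => (φ x).k') A P).comp
            γ.continuous⟩, by ext; simp, rfl⟩, fun t => ⟨fun x => ?_, fun x => ?_⟩⟩, ?_⟩
    · change mods T n (fun x => A x + (φ (T x)).k.comp ((γ t x - P x).comp (φ x).k')) x = _
      rw [(hb.lift_sub (γ t)).mods_eq hT, hb.mods_eq hT, (hγ t).1]
    · change ‖A x + (φ (T x)).k.comp ((γ t x - P x).comp (φ x).k') - A x‖ ≤ δ
      rw [add_sub_cancel_left]
      exact (Frame.opNorm_sandwich_le (φ (T x)).opNorm_k (φ x).opNorm_k' _).trans ((hγ t).2 x)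
    · simp only [γ.target]
      rw [(hb.lift_sub P').charpoly_eq hT, IsRoot, eval_mul, hr.eq_zero, zero_mul]

end RealSpectrum

/-! ### Raising the graph at a single index -/

section Sweeps

/-- Split along `slow F`. The roots of the block on it avoid `F` and those of the quotient block lie
in `F`, so removing the members of `F` from the full list of roots leaves `S` for the first block.
-/
theorem finrank_slow {X V : Type*} [NormedAddCommGroup V] [InnerProductSpace ℝ V]
    [FiniteDimensional ℝ V] {T : Equiv.Perm X} {n : ℕ} {A : X → V →L[ℝ] V} {S F : Multiset ℝ}
    (hs : HasSpec T n A (S + F)) (h : ∀ r ∈ S, r ∉ F) (x : X) :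
    Module.finrank ℝ (slow T n A F x) = S.card := by
  classical
  set f := (it T A n x).toLinearMap with hf
  set q := (F.map fun r => Polynomial.X - C r).prod with hq
  set m := Module.finrank ℝ (slow T n A F x) with hm
  have hle : m ≤ Module.finrank ℝ V := Submodule.finrank_le _
  have hW₁ : Module.finrank ℝ (EuclideanSpace ℝ (Fin m)) = m := by simp
  have hW₂ : Module.finrank ℝ (EuclideanSpace ℝ (Fin (Module.finrank ℝ V - m))) =
    Module.finrank ℝ V - m := by simp
  obtain ⟨φ, hφ⟩ := exists_frame (W₁ := EuclideanSpace ℝ (Fin m))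
    (W₂ := EuclideanSpace ℝ (Fin (Module.finrank ℝ V - m))) (slow T n A F x) (by rw [hW₁])
    (by rw [hW₁, hW₂]; omega)
  have hmem : ∀ v, v ∈ slow T n A F x ↔ φ.i' v = 0 := fun v => by rw [← hφ, φ.exists_mem_iff]
  have hcomm : ∀ v, f (aeval f q v) = aeval f q (f v) := fun v =>
    aeval_intertwine (f := f) (g := f) (R := f) (fun _ => rfl) q v
  have hinv : ∀ v ∈ slow T n A F x, f v ∈ slow T n A F x := by
    rintro _ ⟨w, rfl⟩
    exact ⟨f w, (hcomm w).symm⟩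
  set P : EuclideanSpace ℝ (Fin m) →ₗ[ℝ] EuclideanSpace ℝ (Fin m) :=
    φ.k'.toLinearMap ∘ₗ f ∘ₗ φ.k.toLinearMap with hP
  set Q : EuclideanSpace ℝ (Fin (Module.finrank ℝ V - m)) →ₗ[ℝ] _ :=
    φ.i'.toLinearMap ∘ₗ f ∘ₗ φ.i.toLinearMap with hQ
  have hsub : ∀ w, f (φ.k w) = φ.k (P w) := fun w => by
    have h1 := φ.id (f (φ.k w))
    rw [(hmem _).1 (hinv _ ((hmem _).2 (φ.ik w))), map_zero, add_zero] at h1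
    exact h1.symm
  have hquot : ∀ v, φ.i' (f v) = Q (φ.i' v) := fun v => by
    conv_lhs => rw [← φ.id v]
    rw [map_add, map_add, hsub, φ.ik, zero_add]
    rfl
  have hchar := charpoly_block (k := φ.k.toLinearMap) (i := φ.i.toLinearMap)
    (k' := φ.k'.toLinearMap) (i' := φ.i'.toLinearMap) φ.kk φ.ii φ.ki φ.ik φ.id hsub hquot
  rw [hs x] at hchar
  have hP0 := (LinearMap.charpoly_monic P).ne_zero
  have hQ0 := (LinearMap.charpoly_monic Q).ne_zero
  have hroots := congrArg roots hchar
  rw [roots_multiset_prod_X_sub_C, roots_mul (mul_ne_zero hP0 hQ0)] at hroots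
  have hPr : ∀ r ∈ P.charpoly.roots, r ∉ F := by
    intro r hr hrF
    obtain ⟨w, hw⟩ := ((Module.End.hasEigenvalue_iff_isRoot_charpoly _ _).2
      (mem_roots'.1 hr).2).exists_hasEigenvector
    have h1 : P w = r • w := hw.apply_eq_smul
    have h2 : f (φ.k w) = r • φ.k w := by rw [hsub, h1, map_smul]
    have h3 : φ.k w ∈ slow T n A F x := (hmem _).2 (φ.ik w)
    have h4 := aeval_eq_zero_of_mem_slow hs h3
    rw [aeval_eigen h2] at h4
    rcases smul_eq_zero.1 h4 with h5 | h5
    · exact eval_prod_ne_zero (fun hrS => h r hrS hrF) h5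
    · refine hw.2 ?_
      rw [← φ.kk w, h5, map_zero]
  have hQr : ∀ r ∈ Q.charpoly.roots, r ∈ F := by
    intro r hr
    by_contra hrF
    obtain ⟨w, hw⟩ := ((Module.End.hasEigenvalue_iff_isRoot_charpoly _ _).2
      (mem_roots'.1 hr).2).exists_hasEigenvector
    have h1 : Q w = r • w := hw.apply_eq_smul
    have h2 := aeval_intertwine (f := f) (g := Q) (R := φ.i'.toLinearMap) hquot q (φ.i w)
    rw [ContinuousLinearMap.coe_coe, φ.ii, aeval_eigen h1, (hmem _).1 ⟨φ.i w, rfl⟩] at h2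
    rcases smul_eq_zero.1 h2.symm with h5 | h5
    · exact eval_prod_ne_zero hrF h5
    · exact hw.2 h5
  have h1 := congrArg (Multiset.filter (· ∉ F)) hroots
  rw [Multiset.filter_add, Multiset.filter_add, Multiset.filter_eq_self.2 h,
    Multiset.filter_eq_self.2 hPr, Multiset.filter_eq_nil.2 (fun r hr => not_not.2 hr),
    Multiset.filter_eq_nil.2 (fun r hr => not_not.2 (hQr r hr)), add_zero, add_zero] at h1
  have hsplit : P.charpoly.Splits := by
    have : (P.charpoly * Q.charpoly).Splits := by
      rw [← hchar]
      exact Splits.multisetProd fun p hp => by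
        obtain ⟨r, -, rfl⟩ := Multiset.mem_map.1 hp
        exact Splits.X_sub_C r
    exact ((splits_mul hP0 hQ0).1 this).1
  rw [h1, ← hsplit.natDegree_eq_card_roots, LinearMap.charpoly_natDegree, hW₁]

theorem range_eq_cons (r : ℕ → ℝ) (s t : ℕ) : (Multiset.range (s + 2 + t)).map r =
    r s ::ₘ r (s + 1) ::ₘ ((Multiset.range s).map r +
      (Multiset.range t).map fun k => r (s + 2 + k)) := by
  rw [Multiset.range_add, Multiset.map_add, Multiset.range_succ, Multiset.range_succ,
    Multiset.map_cons, Multiset.map_cons, Multiset.map_map, Multiset.cons_swap]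
  simp only [Multiset.cons_add]
  rfl

/-- The Lyapunov graph in terms of the ordered eigenvalues. -/
noncomputable def logSum (n : ℕ) (r : ℕ → ℝ) (j : ℕ) : ℝ := ∑ k ∈ Finset.range j, Real.log |r k| / n

theorem logSum_succ (n : ℕ) (r : ℕ → ℝ) (j : ℕ) :
    logSum n r (j + 1) = logSum n r j + Real.log |r j| / n := Finset.sum_range_succ _ _

theorem logSum_congr {n j : ℕ} {r r' : ℕ → ℝ} (h : ∀ k < j, r k = r' k) :
    logSum n r j = logSum n r' j :=
  Finset.sum_congr rfl fun k hk => by rw [h k (Finset.mem_range.1 hk)]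

/-- Replace the eigenvalues of index `s` and `s + 1`. -/
noncomputable def replace (r : ℕ → ℝ) (s : ℕ) (a b : ℝ) : ℕ → ℝ :=
  fun k => if k = s then a else if k = s + 1 then b else r k

theorem range_replace (r : ℕ → ℝ) (s t : ℕ) (a b : ℝ) :
    (Multiset.range (s + 2 + t)).map (replace r s a b) =
    a ::ₘ b ::ₘ ((Multiset.range s).map r + (Multiset.range t).map fun k => r (s + 2 + k)) := by
  rw [range_eq_cons]
  congr 1
  · simp [replace]
  congr 1
  · simp [replace]
  congr 1
  · refine Multiset.map_congr rfl fun k hk => ?_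
    have := Multiset.mem_range.1 hk
    simp [replace, this.ne, (this.trans (Nat.lt_succ_self s)).ne]
  · refine Multiset.map_congr rfl fun k hk => ?_
    simp only [replace]
    rw [if_neg (by omega), if_neg (by omega)]

theorem logSum_replace_succ (n : ℕ) (r : ℕ → ℝ) (s : ℕ) (a b : ℝ) :
    logSum n (replace r s a b) (s + 1) = logSum n r s + Real.log |a| / n := by
  rw [logSum_succ, logSum_congr (r' := r) fun k hk => by
    simp only [replace]; rw [if_neg (by omega), if_neg (by omega)]]
  simp [replace]

theorem logSum_replace {n : ℕ} {r : ℕ → ℝ} {s : ℕ} {a b : ℝ} (ha : a ≠ 0) (hb : b ≠ 0)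
    (hr : r s ≠ 0) (hr' : r (s + 1) ≠ 0) (h : a * b = r s * r (s + 1)) {j : ℕ} (hj : j ≠ s + 1) :
    logSum n (replace r s a b) j = logSum n r j := by
  rcases lt_or_gt_of_ne hj with hj | hj
  · exact logSum_congr fun k hk => by
      simp only [replace]; rw [if_neg (by omega), if_neg (by omega)]
  · obtain ⟨m, rfl⟩ := Nat.exists_eq_add_of_le (show s + 2 ≤ j by omega)
    clear hj
    induction m with
    | zero =>
      rw [add_zero, logSum_succ, logSum_replace_succ, logSum_succ, logSum_succ]
      have h1 : Real.log |a| + Real.log |b| = Real.log |r s| + Real.log |r (s + 1)| := by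
        rw [Real.log_abs, Real.log_abs, Real.log_abs, Real.log_abs, ← Real.log_mul ha hb, h,
          Real.log_mul hr hr']
      have h2 : replace r s a b (s + 1) = b := by simp [replace]
      rw [h2, add_assoc, add_assoc, ← add_div, ← add_div, h1]
    | succ m ih =>
      rw [← add_assoc, logSum_succ, logSum_succ, ih (by omega)]
      congr 3
      simp only [replace]
      rw [if_neg (by omega), if_neg (by omega)]

theorem abs_replace_le {r : ℕ → ℝ} {s d : ℕ} {a b : ℝ}
    (hr : ∀ j k, j ≤ k → k < d → |r j| ≤ |r k|) (hs : s + 1 < d) (h1 : |r s| ≤ |a|) (h2 : |a| ≤ |b|)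
    (h3 : |b| ≤ |r (s + 1)|) : ∀ j k, j ≤ k → k < d → |replace r s a b j| ≤ |replace r s a b k| := by
  have lower : ∀ j < s, |r j| ≤ |a| := fun j hj => (hr j s hj.le (by omega)).trans h1
  have upper : ∀ k, s + 1 ≤ k → k < d → |b| ≤ |r k| := fun k hk hkd => h3.trans (hr _ k hk hkd)
  intro j k hjk hk
  simp only [replace]
  split_ifs with e1 e2 e3 e4 e5 e6 e7 e8
  all_goals first
    | exact le_rfl
    | exact h2
    | omega
    | exact h2.trans (upper k (by omega) hk)
    | exact upper k (by omega) hk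
    | exact lower j (by omega)
    | exact (lower j (by omega)).trans h2
    | exact hr j k hjk hk

section

variable {X V : Type*} [NormedAddCommGroup V] [InnerProductSpace ℝ V]
  [FiniteDimensional ℝ V] {T : Equiv.Perm X} {n : ℕ}

theorem Mixes.exists_reach {A : X → V →L[ℝ] V} {ε τ : ℝ} {s t : ℕ} {r : ℕ → ℝ} (x₀ : X)
    (hε : 0 ≤ ε)
    (hA : ∀ x, Function.Injective (A x)) (hs : HasSpec T n A ((Multiset.range (s + 2 + t)).map r))
    (hr : ∀ j k, j ≤ k → k < s + 2 + t → |r j| ≤ |r k|)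
    (h : Mixes T n A ε (r s) (r (s + 1)) ((Multiset.range s).map r +
      (Multiset.range t).map fun k => r (s + 2 + k)))
    (hτ : logSum n r (s + 1) ≤ τ) : ∃ B r', Reach T n (s + 2 + t) (ε + ε) A B ∧
      HasSpec T n B ((Multiset.range (s + 2 + t)).map r') ∧
      (∀ j k, j ≤ k → k < s + 2 + t → |r' j| ≤ |r' k|) ∧ (∀ j ≠ s + 1, logSum n r' j = logSum n r j) ∧
      logSum n r' (s + 1) ≤ τ ∧ (logSum n r' (s + 1) = τ ∨ |r' s| = |r' (s + 1)|) := by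
  obtain ⟨A₁, hj, f, a, b, hf, hf0, hfn, hfs, hac, ham, hab, hab1, ha0, hb0, hprod⟩ := h
  have hr0 : ∀ k < s + 2 + t, r k ≠ 0 := fun k hk =>
    hs.ne_zero hA x₀ (Multiset.mem_map_of_mem r (Multiset.mem_range.2 hk))
  have hrs := hr0 s (by omega)
  have hrs' := hr0 (s + 1) (by omega)
  have hab0 : ∀ u, a u ≠ 0 ∧ b u ≠ 0 := fun u => by
    rw [← mul_ne_zero_iff, hprod]; exact mul_ne_zero hrs hrs'
  set R : unitInterval → ℕ → ℝ := fun u => replace r s (a u) (b u) with hR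
  have ha : ∀ u, |r s| ≤ |a u| := fun u => by
    have := ham (show 0 ≤ u from u.2.1)
    simpa [ha0] using this
  have hb : ∀ u, |b u| ≤ |r (s + 1)| := fun u => by
    have h1 : |a u| * |b u| = |r s| * |r (s + 1)| := by rw [← abs_mul, hprod, abs_mul]
    have h2 := abs_pos.2 hrs
    refine le_of_mul_le_mul_left ?_ h2
    rw [← h1]
    exact mul_le_mul_of_nonneg_right (ha u) (abs_nonneg _)
  have hRm : ∀ u, ∀ j k, j ≤ k → k < s + 2 + t → |R u j| ≤ |R u k| := fun u =>
    abs_replace_le hr (by omega) (ha u) (hab u) (hb u)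
  have hRs : ∀ u, HasSpec T n (f u) ((Multiset.range (s + 2 + t)).map (R u)) := fun u => by
    rw [range_replace]; exact hfs u
  have hR0 : ∀ u, ∀ k < s + 2 + t, R u k ≠ 0 := fun u k hk => by
    simp only [hR, replace]
    split_ifs
    exacts [(hab0 u).1, (hab0 u).2, hr0 k hk]
  have hgr : ∀ u x, ∀ j ≤ s + 2 + t, gr T n (f u) x j = logSum n (R u) j := fun u x j hj =>
    (hRs u).gr_eq (hR0 u) (hRm u) x hj
  have hLj : ∀ u, ∀ j ≠ s + 1, logSum n (R u) j = logSum n r j := fun u j hj =>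
    logSum_replace (hab0 u).1 (hab0 u).2 hrs hrs' (hprod u) hj
  have hLs : ∀ u, logSum n (R u) (s + 1) = logSum n r s + Real.log |a u| / n := fun u =>
    logSum_replace_succ n r s _ _
  have hLc : Continuous fun u => logSum n (R u) (s + 1) := by
    simp only [hLs]
    exact continuous_const.add ((hac.log fun u => (abs_pos.2 (hab0 u).1).ne').div_const _)
  have hLm : Monotone fun u => logSum n (R u) (s + 1) := fun u v huv => by
    have h1 := abs_pos.2 (hab0 u).1
    have h2 := ham huv
    simp only [hLs]
    gcongr
  have hL0 : logSum n (R 0) (s + 1) = logSum n r (s + 1) := by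
    rw [hLs, ha0, logSum_succ]
  -- By the intermediate value theorem the path of the mixing can be stopped when the graph at `s +
  -- 1` equals `τ`; if this never happens, it is followed to its end, where the two moduli agree.
  obtain ⟨u₀, hu₀, hu₀'⟩ : ∃ u₀, logSum n (R u₀) (s + 1) ≤ τ ∧
      (logSum n (R u₀) (s + 1) = τ ∨ |R u₀ s| = |R u₀ (s + 1)|) := by
    rcases le_total (logSum n (R 1) (s + 1)) τ with h1 | h1
    · exact ⟨1, h1, Or.inr (by simp [hR, replace, hab1])⟩
    · obtain ⟨u, hu⟩ := mem_range_of_exists_le_of_exists_ge hLc ⟨0, by rw [hL0]; exact hτ⟩ ⟨1, h1⟩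
      exact ⟨u, hu.le, Or.inl hu⟩
  refine ⟨f u₀, R u₀, Reach.trans hε (JoinedIn.reach (hj.mono fun B hB => ?_))
    (B := A₁) ⟨⟨⟨fun u => f (u * u₀), hf.comp (by fun_prop)⟩, by simp [hf0], by simp⟩,
      fun u => hfn _, fun x j hj => ?_⟩, hRs u₀, hRm u₀, hLj u₀, hu₀, hu₀'⟩
  · refine ⟨fun x => ?_, hB.2⟩
    rw [hB.1.mods_eq, hs.mods_eq, range_eq_cons]
  · have e : (fun u : unitInterval => gr T n (f (u * u₀)) x j) = fun u => logSum n (R (u * u₀)) j :=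
      funext fun u => hgr _ x j hj
    change Continuous (fun u : unitInterval => gr T n (f (u * u₀)) x j) ∧
      Monotone fun u : unitInterval => gr T n (f (u * u₀)) x j
    rw [e]
    have hmul : Monotone fun u : unitInterval => u * u₀ := fun u v huv =>
      mul_le_mul_of_nonneg_right (show (u : ℝ) ≤ v from huv) u₀.2.1
    by_cases hjs : j = s + 1
    · subst hjs
      exact ⟨hLc.comp (by fun_prop), hLm.comp hmul⟩
    · simp only [hLj _ j hjs]
      exact ⟨continuous_const, monotone_const⟩

end

end Sweeps

/-! ### Closing the gaps to the target graph -/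

section Targets

/-- `σ` is a convex graph above the graph of `A`, which agrees with it at the indices of the
splittings dominated at time `ℓ`. -/
structure Target {X V : Type*} [NormedAddCommGroup V] [InnerProductSpace ℝ V]
    [FiniteDimensional ℝ V] (T : Equiv.Perm X) (n d ℓ : ℕ) (A : X → V →L[ℝ] V) (σ : ℕ → ℝ) :
    Prop where
  zero : σ 0 = 0
  convex : ∀ j, j + 2 ≤ d → σ (j + 1) - σ j ≤ σ (j + 2) - σ (j + 1)
  le : ∀ x, ∀ j ≤ d, gr T n A x j ≤ σ j
  last : ∀ x, gr T n A x d = σ d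
  dom : ∀ i, 0 < i → i < d → DomIdx T A ℓ i → ∀ x, gr T n A x i = σ i

theorem Target.slope_mono {X V : Type*} [NormedAddCommGroup V] [InnerProductSpace ℝ V]
    [FiniteDimensional ℝ V] {T : Equiv.Perm X} {n d ℓ : ℕ} {A : X → V →L[ℝ] V} {σ : ℕ → ℝ}
    (h : Target T n d ℓ A σ) {j k : ℕ} (hjk : j ≤ k) (hk : k < d) :
    σ (j + 1) - σ j ≤ σ (k + 1) - σ k := by
  induction k, hjk using Nat.le_induction with
  | base => exact le_rfl
  | succ k hjk ih => exact (ih (by omega)).trans (h.convex k (by omega))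

theorem Target.le_max {X V : Type*} [NormedAddCommGroup V] [InnerProductSpace ℝ V]
    [FiniteDimensional ℝ V] {T : Equiv.Perm X} {n d ℓ : ℕ} {A : X → V →L[ℝ] V} {σ : ℕ → ℝ}
    (h : Target T n d ℓ A σ) {j : ℕ} (hj : j ≤ d) : σ j ≤ max 0 (σ d) := by
  rcases hj.eq_or_lt with rfl | hj
  · exact le_max_right _ _
  rcases le_total 0 (σ (j + 1) - σ j) with h1 | h1
  · refine le_trans ?_ (le_max_right _ _)
    have : ∀ k, j ≤ k → k ≤ d → σ j ≤ σ k := by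
      intro k hjk
      induction k, hjk using Nat.le_induction with
      | base => exact fun _ => le_rfl
      | succ k hjk ih =>
        intro hk
        have := h.slope_mono hjk (by omega : k < d)
        have := ih (by omega)
        linarith
    exact this d hj.le le_rfl
  · refine le_trans ?_ (le_max_left _ _)
    have : ∀ k, k ≤ j → σ k ≤ 0 := by
      intro k
      induction k with
      | zero => exact fun _ => h.zero.le
      | succ k ih =>
        intro hk
        have := h.slope_mono (by omega : k ≤ j) hj
        have := ih (by omega)
        linarith
    exact this j le_rfl

/-- If `ℓ` is large then, for every target, small perturbations make the gaps to the target at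
most `b`. -/
def Attain.{w} (V : Type) [NormedAddCommGroup V] [InnerProductSpace ℝ V] [FiniteDimensional ℝ V]
    (K : ℝ) (b : ℕ → ℝ) : Prop :=
  ∀ ε > 0, ∃ ℓ₀ : ℕ, ∀ ℓ ≥ ℓ₀, ∀ (X : Type w) (T : Equiv.Perm X) (n : ℕ) (_ : X), IsCyc T n →
    ℓ ≤ n → ∀ (A : X → V →L[ℝ] V) (σ : ℕ → ℝ), Bdd A K →
    Target T n (Module.finrank ℝ V) ℓ A σ → ∃ B r, Reach T n (Module.finrank ℝ V) ε A B ∧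
      HasSpec T n B ((Multiset.range (Module.finrank ℝ V)).map r) ∧
      (∀ j k, j ≤ k → k < Module.finrank ℝ V → |r j| ≤ |r k|) ∧
      ∀ j ≤ Module.finrank ℝ V, logSum n r j ≤ σ j ∧ σ j - logSum n r j ≤ b j

variable {V : Type} [NormedAddCommGroup V] [InnerProductSpace ℝ V] [FiniteDimensional ℝ V]

theorem HasSpec.card {X : Type*} {T : Equiv.Perm X} {n : ℕ} {A : X → V →L[ℝ] V} {s : Multiset ℝ}
    (h : HasSpec T n A s) (x : X) : s.card = Module.finrank ℝ V := by
  have h1 := congrArg natDegree (h x)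
  rw [LinearMap.charpoly_natDegree, natDegree_multiset_prod_X_sub_C_eq_card] at h1
  exact h1.symm

/-- The starting bound for the gaps. Exponents are at most `log (2 * K)` in absolute value, and by
convexity `σ` lies below the larger of its end values, which are `0` and the last value of the graph
of `A`. -/
theorem attain_base.{w} {K : ℝ} (hK : 1 ≤ K) :
    ∃ c, 0 ≤ c ∧ Attain.{w} V K fun _ => c := by
  set d := Module.finrank ℝ V
  have hK0 : 0 < K := by linarith
  have hlog : 0 ≤ Real.log (2 * K) := Real.log_nonneg (by linarith)
  refine ⟨2 * (d * Real.log (2 * K)), by positivity, fun ε hε => ?_⟩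
  have hδ0 : 0 < min ε (1 / (2 * K)) := lt_min hε (by positivity)
  obtain ⟨N, hN⟩ := exists_real_spectrum.{w} d V rfl hK hδ0
  refine ⟨N, fun ℓ hℓ X T n x₀ hT hn A σ hA hσ => ?_⟩
  obtain ⟨B, s, hs, hj⟩ := hN X T n hT (le_trans hℓ hn) A hA
  obtain ⟨r, hr, hrm⟩ := exists_sorted_abs s
  rw [hs.card x₀] at hr hrm
  subst hr
  have hB := hA.perturb hK0 (min_le_right _ _) hK hj.target_mem.2
  have hr0 : ∀ k < d, r k ≠ 0 := fun k hk =>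
    hs.ne_zero hB.injective x₀ (Multiset.mem_map_of_mem r (Multiset.mem_range.2 hk))
  have hgr : ∀ j ≤ d, logSum n r j = gr T n A x₀ j := fun j hj' => by
    rw [logSum, ← hs.gr_eq hr0 hrm x₀ hj', gr, hj.target_mem.1 x₀]
    rfl
  have hb : ∀ j ≤ d, |logSum n r j| ≤ d * Real.log (2 * K) := fun j hj' => by
    calc |logSum n r j| ≤ ∑ k ∈ Finset.range j, |Real.log |r k| / n| :=
          Finset.abs_sum_le_sum_abs _ _
      _ ≤ ∑ k ∈ Finset.range j, Real.log (2 * K) := Finset.sum_le_sum fun k hk =>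
          abs_log_le_of_isRoot (by linarith) hB hT.pos hs x₀ (Multiset.mem_map_of_mem r
            (Multiset.mem_range.2 ((Finset.mem_range.1 hk).trans_le hj')))
      _ = j * Real.log (2 * K) := by simp
      _ ≤ _ := by gcongr
  refine ⟨B, r, hj.reach.mono (min_le_left _ _), hs, hrm, fun j hj' => ⟨?_, ?_⟩⟩
  · rw [hgr j hj']; exact hσ.le x₀ j hj'
  · have h1 := abs_le.1 (hb j hj')
    have h2 := abs_le.1 (hb d le_rfl)
    have h3 := hσ.le_max hj'
    have h4 := hσ.last x₀
    rw [← hgr d le_rfl] at h4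
    have h5 : max 0 (σ d) ≤ d * Real.log (2 * K) := max_le (by positivity) (by linarith)
    linarith

/-- At the ends the gap is never positive: at `0` both graphs vanish, and at the last index the
graph starts at the target and does not decrease. -/
theorem Attain.weaken.{w} {K : ℝ} {b b' : ℕ → ℝ} (h : Attain.{w} V K b) (h0 : 0 ≤ b' 0)
    (hd : 0 ≤ b' (Module.finrank ℝ V)) (hb : ∀ j, 0 < j → j < Module.finrank ℝ V → b j ≤ b' j) :
    Attain.{w} V K b' := by
  intro ε hε
  obtain ⟨ℓ₀, h1⟩ := h (min ε (1 / (2 * (max K 1)))) (lt_min hε (by positivity))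
  refine ⟨ℓ₀, fun ℓ hℓ X T n x₀ hT hn A σ hA hσ => ?_⟩
  obtain ⟨B, r, hR, hs, hr, hj⟩ := h1 ℓ hℓ X T n x₀ hT hn A σ hA hσ
  refine ⟨B, r, hR.mono (min_le_left _ _), hs, hr, fun j hjd => ⟨(hj j hjd).1, ?_⟩⟩
  rcases Nat.eq_zero_or_pos j with rfl | hj0
  · simpa [logSum, hσ.zero] using h0
  rcases hjd.eq_or_lt with rfl | hjd'
  · have hB := (hA.mono (le_max_left K 1)).perturb (lt_of_lt_of_le one_pos (le_max_right K 1))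
      (min_le_right _ _) (le_max_right _ _) hR.norm_le
    have h2 := hR.gr_le x₀ le_rfl
    rw [hσ.last, hs.gr_eq (fun k hk => hs.ne_zero hB.injective x₀ (Multiset.mem_map_of_mem r
      (Multiset.mem_range.2 hk))) hr x₀ le_rfl] at h2
    have : σ (Module.finrank ℝ V) ≤ logSum n r (Module.finrank ℝ V) := h2
    linarith
  · exact (hj j hjd).2.trans (hb j hj0 hjd')

/-- Let `B` be the cocycle provided by `h`. If `B` is dominated at `s + 1`, then `A` has a splitting
of this index dominated at time `ℓ`, so its graph equals `σ` there and that of `B` is no lower.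
Otherwise mix. If the moduli become equal before the target is met, the graph is affine on `s, s +
1, s + 2`, and the convexity of `σ` bounds the gap by the mean of the two neighbouring gaps. -/
theorem Attain.step.{w} {K : ℝ} (hK : 1 ≤ K) {b b' : ℕ → ℝ} (h : Attain.{w} V K b) {s t : ℕ}
    (hst : s + 2 + t = Module.finrank ℝ V) (hb : ∀ j, j ≠ s + 1 → b j ≤ b' j)
    (hb0 : 0 ≤ b' (s + 1)) (hbs : (b s + b (s + 2)) / 2 ≤ b' (s + 1)) : Attain.{w} V K b' := by
  intro ε hε
  have hK0 : 0 < K := by linarith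
  -- The order of the choices matters: the size of the mixing fixes `C` and `θ`, these fix the range
  -- `ε₁` of robustness, and only then the size `δ ≤ ε₁` of all earlier perturbations is fixed.
  obtain ⟨C, θ, N, hC, hθ0, hθ1, hmix⟩ := unifMix.{w} (s + t) s t rfl V (by omega) (2 * K) (ε / 4)
    (by linarith) (by positivity)
  obtain ⟨ε₁, hε₁, ℓ₁, hrob⟩ := exists_domIdx.{w} (K := 2 * K) (by linarith) hC hθ0.le hθ1 V (s + 1)
    (by omega)
  set δ := min (ε / 2) (min ε₁ (1 / (2 * K))) with hδ
  have hδ0 : 0 < δ := lt_min (by positivity) (lt_min hε₁ (by positivity))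
  have hδε : δ ≤ ε / 2 := min_le_left _ _
  obtain ⟨ℓ₂, hℓ₂⟩ := h δ hδ0
  refine ⟨max (max ℓ₁ ℓ₂) N, fun ℓ hℓ X T n x₀ hT hn A σ hA hσ => ?_⟩
  have hℓ1 : ℓ₁ ≤ ℓ := ((le_max_left _ _).trans (le_max_left _ _)).trans hℓ
  have hℓ2 : ℓ₂ ≤ ℓ := ((le_max_right _ _).trans (le_max_left _ _)).trans hℓ
  have hNn : N ≤ n := ((le_max_right _ _).trans hℓ).trans hn
  obtain ⟨B, r, hR, hs, hr, hj⟩ := hℓ₂ ℓ hℓ2 X T n x₀ hT hn A σ hA hσ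
  rw [← hst] at hR hs hr hj hσ ⊢
  have hB := hA.perturb hK0 ((min_le_right _ _).trans (min_le_right _ _)) hK hR.norm_le
  have hr0 : ∀ k < s + 2 + t, r k ≠ 0 := fun k hk =>
    hs.ne_zero hB.injective x₀ (Multiset.mem_map_of_mem r (Multiset.mem_range.2 hk))
  have havg : ∀ r' : ℕ → ℝ, |r' s| = |r' (s + 1)| → logSum n r' s = logSum n r s →
      logSum n r' (s + 2) = logSum n r (s + 2) → σ (s + 1) - logSum n r' (s + 1) ≤ b' (s + 1) := by
    intro r' h1 h2 h3
    have h4 := logSum_succ n r' s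
    have h5 := logSum_succ n r' (s + 1)
    rw [← h1] at h5
    have h6 := hσ.convex s (by omega)
    have h7 := (hj s (by omega)).2
    have h8 := (hj (s + 2) (by omega)).2
    linarith
  have hsame : |r s| = |r (s + 1)| ∨ σ (s + 1) ≤ logSum n r (s + 1) → ∃ B r,
      Reach T n (s + 2 + t) ε A B ∧ HasSpec T n B ((Multiset.range (s + 2 + t)).map r) ∧
      (∀ j k, j ≤ k → k < s + 2 + t → |r j| ≤ |r k|) ∧
      ∀ j ≤ s + 2 + t, logSum n r j ≤ σ j ∧ σ j - logSum n r j ≤ b' j := by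
    intro h1
    refine ⟨B, r, hR.mono (by linarith), hs, hr, fun j hjd => ⟨(hj j hjd).1, ?_⟩⟩
    by_cases hjs : j = s + 1
    · subst hjs
      rcases h1 with h1 | h1
      · exact havg r h1 rfl rfl
      · linarith
    · exact (hj j hjd).2.trans (hb j hjs)
  rcases (hr s (s + 1) (by omega) (by omega)).eq_or_lt with heq | hlt
  · exact hsame (Or.inl heq)
  have hspec := hs
  rw [range_eq_cons] at hspec
  set S := (Multiset.range s).map r with hS
  set F := (Multiset.range t).map fun k => r (s + 2 + k) with hF
  have hSle : ∀ q ∈ S, |q| ≤ |r s| := fun q hq => by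
    obtain ⟨k, hk, rfl⟩ := Multiset.mem_map.1 hq
    exact hr k s (Multiset.mem_range.1 hk).le (by omega)
  have hFle : ∀ q ∈ F, |r (s + 1)| ≤ |q| := fun q hq => by
    obtain ⟨k, hk, rfl⟩ := Multiset.mem_map.1 hq
    have := Multiset.mem_range.1 hk
    exact hr _ _ (by omega) (by omega)
  by_cases hdom : Dom T B (slow T n B (r (s + 1) ::ₘ F)) C θ
  · refine hsame (Or.inr ?_)
    have hfin : ∀ x, Module.finrank ℝ (slow T n B (r (s + 1) ::ₘ F) x) = s + 1 := fun x => by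
      rw [finrank_slow (S := r s ::ₘ S) (by
        convert hspec using 1
        simp only [← Multiset.singleton_add]; abel) ?_ x]
      · simp [hS]
      · intro q hq hq'
        have h1 : |q| ≤ |r s| := by
          rcases Multiset.mem_cons.1 hq with rfl | h
          · exact le_rfl
          · exact hSle q h
        have h2 : |r (s + 1)| ≤ |q| := by
          rcases Multiset.mem_cons.1 hq' with rfl | h
          · exact le_rfl
          · exact hFle q h
        linarith
    have h1 := hrob X T n hT A B _ hB (slow_map hT hB.bijective _) hfin hdom (fun x => by
      rw [norm_sub_rev]
      exact (hR.norm_le x).trans ((min_le_right _ _).trans (min_le_left _ _))) ℓ hℓ1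
    have h2 := hσ.dom (s + 1) (by omega) (by omega) h1 x₀
    rw [← h2]
    exact (hR.gr_le x₀ (by omega)).trans (hs.gr_eq hr0 hr x₀ (by omega)).le
  · have hM := hmix X T n hT hNn B (r s) (r (s + 1)) S F (by simp [hS]) (by simp [hF]) hB hspec hlt
      hSle hFle hdom
    obtain ⟨B', r', hR', hs', hr', hL, hτ, hor⟩ := hM.exists_reach x₀ (by positivity) hB.injective
      hs hr (hj (s + 1) (by omega)).1
    refine ⟨B', r', (hR.trans (by positivity) hR').mono (by linarith), hs', hr', fun j hjd => ?_⟩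
    by_cases hjs : j = s + 1
    · subst hjs
      refine ⟨hτ, ?_⟩
      rcases hor with h1 | h1
      · rw [h1, sub_self]; exact hb0
      · exact havg r' h1 (hL s (by omega)) (hL (s + 2) (by omega))
    · rw [hL j hjs]
      exact ⟨(hj j hjd).1, (hj j hjd).2.trans (hb j hjs)⟩

/-- A sweep from left to right: when index `m + 1` is treated, the left gap is at most `(1 - 2^(-m))
* c` and the right one at most `c`, with mean `(1 - 2^(-(m + 1))) * c`. -/
theorem Attain.contract.{w} {K c : ℝ} (hK : 1 ≤ K) (hc : 0 ≤ c) (h : Attain.{w} V K fun _ => c) :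
    Attain.{w} V K fun _ => (1 - (1 / 2) ^ Module.finrank ℝ V) * c := by
  have hpow : ∀ m : ℕ, (1 / 2 : ℝ) ^ m ≤ 1 := fun m => pow_le_one₀ (by norm_num) (by norm_num)
  have hnn : ∀ m : ℕ, 0 ≤ (1 - (1 / 2 : ℝ) ^ m) * c := fun m =>
    mul_nonneg (by linarith [hpow m]) hc
  have key : ∀ m, m < Module.finrank ℝ V → Attain.{w} V K fun j =>
      if j ≤ m then (1 - (1 / 2) ^ j) * c else c := by
    intro m
    induction m with
    | zero =>
      intro _
      refine h.weaken (by simp) (by split_ifs; exacts [hnn _, hc]) fun j hj _ => ?_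
      rw [if_neg (by omega)]
    | succ m ih =>
      intro hm
      refine (ih (by omega)).step hK (s := m) (t := Module.finrank ℝ V - (m + 2)) (by omega)
        (fun j hj => ?_) ?_ ?_
      · split_ifs with h1 h2 h2
        exacts [le_rfl, by omega, by omega, le_rfl]
      · rw [if_pos le_rfl]; exact hnn _
      · rw [if_pos le_rfl, if_neg (by omega), if_pos le_rfl, pow_succ]
        linarith
  rcases Nat.eq_zero_or_pos (Module.finrank ℝ V) with h0 | h0
  · refine h.weaken (hnn _) (hnn _) fun j _ hj => by omega
  refine (key (Module.finrank ℝ V - 1) (by omega)).weaken (hnn _) (hnn _) fun j _ hj => ?_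
  rw [if_pos (by omega)]
  gcongr ?_ * c
  have : (1 / 2 : ℝ) ^ Module.finrank ℝ V ≤ (1 / 2) ^ j :=
    pow_le_pow_of_le_one (by norm_num) (by norm_num) hj.le
  linarith

theorem attain_const.{w} {K η : ℝ} (hK : 1 ≤ K) (hη : 0 < η) : Attain.{w} V K fun _ => η := by
  obtain ⟨c, hc, h⟩ := attain_base.{w} (V := V) hK
  set q := 1 - (1 / 2 : ℝ) ^ Module.finrank ℝ V with hq
  have hq0 : 0 ≤ q := by
    have : (1 / 2 : ℝ) ^ Module.finrank ℝ V ≤ 1 := pow_le_one₀ (by norm_num) (by norm_num)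
    linarith
  have hq1 : q < 1 := by
    have : 0 < (1 / 2 : ℝ) ^ Module.finrank ℝ V := by positivity
    linarith
  have key : ∀ m : ℕ, Attain.{w} V K fun _ => q ^ m * c := by
    intro m
    induction m with
    | zero => simpa using h
    | succ m ih =>
      have := ih.contract hK (by positivity)
      rwa [← hq, ← mul_assoc, ← pow_succ'] at this
  obtain ⟨m, hm⟩ : ∃ m : ℕ, q ^ m < η / (c + 1) := exists_pow_lt_of_lt_one (by positivity) hq1
  rw [lt_div_iff₀ (by positivity)] at hm
  refine (key m).weaken hη.le hη.le fun j _ _ => ?_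
  have : 0 ≤ q ^ m := by positivity
  linarith

theorem exists_reach_target.{w} {K ε : ℝ} (hK : 1 ≤ K) (hε : 0 < ε) : ∃ ℓ₀ : ℕ, ∀ ℓ ≥ ℓ₀,
    ∀ (X : Type w) (T : Equiv.Perm X) (n : ℕ) (_ : X), IsCyc T n → ℓ ≤ n →
    ∀ (A : X → V →L[ℝ] V) (σ : ℕ → ℝ), Bdd A K → Target T n (Module.finrank ℝ V) ℓ A σ →
      ∃ B, Reach T n (Module.finrank ℝ V) ε A B ∧
        ∀ x, ∀ j ≤ Module.finrank ℝ V, gr T n B x j = σ j := by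
  set d := Module.finrank ℝ V with hd
  have hK0 : 0 < K := by linarith
  obtain ⟨η, hη0, hη⟩ : ∃ η > 0, d * (2 * K * (Real.exp η - 1)) ≤ ε / 2 := by
    have h1 : Filter.Tendsto (fun η : ℝ => d * (2 * K * (Real.exp η - 1))) (nhdsWithin 0 (Set.Ioi 0))
        (nhds (d * (2 * K * (Real.exp 0 - 1)))) :=
      ((by fun_prop : Continuous fun η : ℝ => d * (2 * K * (Real.exp η - 1))).tendsto 0).mono_left
        nhdsWithin_le_nhds
    rw [Real.exp_zero, sub_self, mul_zero, mul_zero] at h1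
    obtain ⟨η, h2, h3⟩ := ((h1.eventually_le_const (show 0 < ε / 2 by positivity)).and
      self_mem_nhdsWithin).exists
    exact ⟨η, h3, h2⟩
  obtain ⟨ℓ₀, h⟩ := attain_const.{w} (V := V) hK hη0 (min (ε / 2) (1 / (2 * K)))
    (lt_min (by positivity) (by positivity))
  refine ⟨ℓ₀, fun ℓ hℓ X T n x₀ hT hn A σ hA hσ => ?_⟩
  obtain ⟨B, r, hR, hs, hr, hj⟩ := h ℓ hℓ X T n x₀ hT hn A σ hA hσ
  rw [← hd] at hR hs hr hj
  have hB := hA.perturb hK0 (min_le_right _ _) hK hR.norm_le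
  have hr0 : ∀ k < d, r k ≠ 0 := fun k hk =>
    hs.ne_zero hB.injective x₀ (Multiset.mem_map_of_mem r (Multiset.mem_range.2 hk))
  have hn0 : (n : ℝ) ≠ 0 := by exact_mod_cast hT.pos.ne'
  set μ : ℕ → ℝ := fun k => (σ (k + 1) - σ k) - Real.log |r k| / n with hμ
  -- `μ k` is the difference of two consecutive gaps, both of which lie in `[0, η]`.
  have hμη : ∀ k < d, |μ k| ≤ η := fun k hk => by
    have h1 := hj k hk.le
    have h2 := hj (k + 1) hk
    rw [logSum_succ] at h2
    rw [abs_le]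
    constructor <;> simp only [hμ] <;> linarith
  obtain ⟨f, hf, hf0, hfs, hfn⟩ := exists_scaling d V hT (by positivity) hB
    (s := (Multiset.range d).map fun k => (r k, μ k)) (η := η) (by simp)
    (by rw [Multiset.map_map]; exact hs) (fun p hp => by
      obtain ⟨k, hk, rfl⟩ := Multiset.mem_map.1 hp
      exact hμη k (Multiset.mem_range.1 hk))
  set R : unitInterval → ℕ → ℝ := fun t k => r k * Real.exp (t * μ k) ^ n with hRd
  have hfs' : ∀ t, HasSpec T n (f t) ((Multiset.range d).map (R t)) := fun t => by
    have := hfs t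
    rw [Multiset.map_map] at this
    exact this
  have hR0 : ∀ t, ∀ k < d, R t k ≠ 0 := fun t k hk =>
    mul_ne_zero (hr0 k hk) (pow_ne_zero _ (Real.exp_ne_zero _))
  have hlog : ∀ t : unitInterval, ∀ k < d, Real.log |R t k| / n =
      Real.log |r k| / n + t * μ k := fun t k hk => by
    simp only [hRd]
    rw [abs_mul, abs_of_pos (pow_pos (Real.exp_pos _) n),
      Real.log_mul (abs_pos.2 (hr0 k hk)).ne' (by positivity), Real.log_pow, Real.log_exp]
    field_simp
  -- The exponents at time `t` interpolate between those of `B` and the slopes of `σ`, both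
  -- nondecreasing, so the order is kept and the graph moves linearly.
  have hRm : ∀ t, ∀ j k, j ≤ k → k < d → |R t j| ≤ |R t k| := fun t j k hjk hk => by
    have hjd := hjk.trans_lt hk
    have p1 := abs_pos.2 (hR0 t j hjd)
    have p2 := abs_pos.2 (hR0 t k hk)
    refine (Real.log_le_log_iff p1 p2).1 ?_
    have hn' : (0 : ℝ) < n := by exact_mod_cast hT.pos
    refine (div_le_div_iff_of_pos_right hn').1 ?_
    rw [hlog t j hjd, hlog t k hk]
    have h1 := hσ.slope_mono hjk hk
    have h2 : Real.log |r j| / n ≤ Real.log |r k| / n := by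
      have := abs_pos.2 (hr0 j hjd)
      have := hr j k hjk hk
      gcongr
    have h3 := t.2.1
    have h4 := t.2.2
    simp only [hμ]
    nlinarith
  have hsum : ∀ t : unitInterval, ∀ x, ∀ j ≤ d, gr T n (f t) x j =
      logSum n r j + t * (σ j - logSum n r j) := fun t x j hjd => by
    rw [(hfs' t).gr_eq (hR0 t) (hRm t) x hjd, logSum, ← Finset.sum_congr rfl
      fun k hk => (hlog t k ((Finset.mem_range.1 hk).trans_le hjd)).symm, Finset.sum_add_distrib,
      ← Finset.mul_sum]
    congr 2
    rw [show (∑ k ∈ Finset.range j, μ k) = (∑ k ∈ Finset.range j, (σ (k + 1) - σ k)) -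
      logSum n r j from Finset.sum_sub_distrib _ _, Finset.sum_range_sub, hσ.zero, sub_zero]
    rfl
  refine ⟨f 1, (hR.trans (by positivity) (B := B) (δ := ε / 2) ⟨⟨⟨f, hf⟩, hf0, rfl⟩,
    fun t x => (hfn t x).trans hη, fun x j hjd => ?_⟩).mono (by
      have : min (ε / 2) (1 / (2 * K)) ≤ ε / 2 := min_le_left _ _
      linarith), fun x j hjd => ?_⟩
  · change Continuous (fun t => gr T n (f t) x j) ∧ Monotone fun t => gr T n (f t) x j
    have e : (fun t => gr T n (f t) x j) = fun t : unitInterval =>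
      logSum n r j + t * (σ j - logSum n r j) := funext fun t => hsum t x j hjd
    rw [e]
    refine ⟨by fun_prop, fun t u htu => ?_⟩
    have h1 := (hj j hjd).1
    have h2 : (t : ℝ) ≤ u := htu
    have : 0 ≤ σ j - logSum n r j := by linarith
    beta_reduce
    gcongr
  · rw [hsum 1 x j hjd]; simp

end Targets

/-! ### Minimum expansion and the domination ratio -/

section Expansion

variable {V W : Type v} [NormedAddCommGroup V] [InnerProductSpace ℝ V]
  [NormedAddCommGroup W] [InnerProductSpace ℝ W]

theorem minExpansion_mul_le (B : V →L[ℝ] W) (v : V) : minExpansion B * ‖v‖ ≤ ‖B v‖ := by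
  rcases eq_or_ne v 0 with rfl | hv
  · simp
  have hv' : 0 < ‖v‖ := norm_pos_iff.2 hv
  have h1 : ‖v‖⁻¹ • v ∈ Metric.sphere (0 : V) 1 := by
    simp [norm_smul, hv'.ne']
  have h2 : minExpansion B ≤ ‖B (‖v‖⁻¹ • v)‖ :=
    ciInf_le (f := fun w : Metric.sphere (0 : V) 1 => ‖B w‖)
      ⟨0, by rintro _ ⟨w, rfl⟩; exact norm_nonneg _⟩ ⟨_, h1⟩
  rw [map_smul, norm_smul, norm_inv, norm_norm] at h2
  calc minExpansion B * ‖v‖ ≤ ‖v‖⁻¹ * ‖B v‖ * ‖v‖ := by gcongr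
    _ = ‖B v‖ := by field_simp

theorem le_minExpansion [Nontrivial V] {B : V →L[ℝ] W} {c : ℝ}
    (h : ∀ v, ‖v‖ = 1 → c ≤ ‖B v‖) : c ≤ minExpansion B := by
  have : Nonempty (Metric.sphere (0 : V) 1) := (NormedSpace.sphere_nonempty.2 zero_le_one).to_subtype
  exact le_ciInf fun w => h w (by simp)

theorem minExpansion_nonneg (B : V →L[ℝ] W) : 0 ≤ minExpansion B :=
  Real.iInf_nonneg fun _ => norm_nonneg _

theorem minExpansion_pos [Nontrivial V] [FiniteDimensional ℝ V] {B : V →L[ℝ] W}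
    (hB : Function.Injective B) : 0 < minExpansion B := by
  obtain ⟨C, hC, h⟩ := B.toLinearMap.exists_antilipschitzWith (LinearMap.ker_eq_bot.2 hB)
  refine (show (0 : ℝ) < (C : ℝ)⁻¹ by positivity).trans_le (le_minExpansion fun v hv => ?_)
  have h1 := h.le_mul_norm_sub v 0
  rw [inv_le_iff_one_le_mul₀' (by positivity)]
  simpa [hv] using h1

theorem norm_mul_le_of_ratio_lt {B : V →L[ℝ] W} {F G : Submodule ℝ V} [FiniteDimensional ℝ V]
    (hB : Function.Injective B) (hG : G ≠ ⊥)
    (h : ‖B.comp F.subtypeL‖ / minExpansion (B.comp G.subtypeL) < 1 / 2) {v w : V} (hv : v ∈ F)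
    (hw : w ∈ G) : ‖B v‖ * ‖w‖ ≤ 1 / 2 * (‖v‖ * ‖B w‖) := by
  have : Nontrivial G := Submodule.nontrivial_iff_ne_bot.2 hG
  have h1 : 0 < minExpansion (B.comp G.subtypeL) :=
    minExpansion_pos (hB.comp Subtype.val_injective)
  rw [div_lt_iff₀ h1] at h
  have h2 := (B.comp F.subtypeL).le_opNorm ⟨v, hv⟩
  have h3 := minExpansion_mul_le (B.comp G.subtypeL) ⟨w, hw⟩
  simp only [ContinuousLinearMap.comp_apply, Submodule.subtypeL_apply, Submodule.coe_norm] at h2 h3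
  calc ‖B v‖ * ‖w‖ ≤ (‖B.comp F.subtypeL‖ * ‖v‖) * ‖w‖ := by gcongr
    _ ≤ (1 / 2 * minExpansion (B.comp G.subtypeL) * ‖v‖) * ‖w‖ := by gcongr
    _ = 1 / 2 * (‖v‖ * (minExpansion (B.comp G.subtypeL) * ‖w‖)) := by ring
    _ ≤ _ := by gcongr

/-- The constant `1 / 4` leaves room for the strict inequality with `1 / 2`. -/
theorem ratio_lt_of_norm_mul_le {B : V →L[ℝ] W} {F G : Submodule ℝ V} (hG : G ≠ ⊥)
    (h : ∀ v ∈ F, ∀ w ∈ G, ‖B v‖ * ‖w‖ ≤ 1 / 4 * (‖v‖ * ‖B w‖)) :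
    ‖B.comp F.subtypeL‖ / minExpansion (B.comp G.subtypeL) < 1 / 2 := by
  have : Nontrivial G := Submodule.nontrivial_iff_ne_bot.2 hG
  refine lt_of_le_of_lt (b := (1 / 4 : ℝ)) (div_le_of_le_mul₀ (minExpansion_nonneg _)
    (by norm_num) ?_) (by norm_num)
  have h1 : 4 * ‖B.comp F.subtypeL‖ ≤ minExpansion (B.comp G.subtypeL) := by
    refine le_minExpansion fun w hw => ?_
    have h2 : ‖B.comp F.subtypeL‖ ≤ 1 / 4 * ‖B w‖ := by
      refine ContinuousLinearMap.opNorm_le_bound _ (by positivity) fun v => ?_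
      have h3 := h v v.2 w w.2
      rw [← Submodule.coe_norm w, hw, mul_one] at h3
      exact h3.trans_eq (by rw [Submodule.coe_norm]; ring)
    change _ ≤ ‖B w‖
    linarith
  linarith

end Expansion

theorem sortedSum_convex {s : Multiset ℝ} {i : ℕ} (h : i + 2 ≤ s.card) :
    sortedSum s (i + 1) - sortedSum s i ≤ sortedSum s (i + 2) - sortedSum s (i + 1) := by
  have hl : (s.sort (· ≤ ·)).length = s.card := Multiset.length_sort _
  have h1 : i < (s.sort (· ≤ ·)).length := by omega
  have h2 : i + 1 < (s.sort (· ≤ ·)).length := by omega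
  simp only [sortedSum]
  rw [List.sum_take_succ _ (i + 1) h2, List.sum_take_succ _ i h1]
  have h3 : (s.sort (· ≤ ·))[i] ≤ (s.sort (· ≤ ·))[i + 1] :=
    List.pairwise_iff_getElem.1 (Multiset.pairwise_sort s (· ≤ ·)) i (i + 1) h1 h2 (Nat.lt_succ_self i)
  linarith

theorem isCyc_of_isCycleOn {X : Type*} [Finite X] [Nonempty X] {T : Equiv.Perm X}
    (hT : T.IsCycleOn Set.univ) : IsCyc T (Nat.card X) := by
  classical
  have := Fintype.ofFinite X
  have h : T.IsCycleOn (Finset.univ : Finset X) := by simpa using hT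
  have hc : (Finset.univ : Finset X).card = Nat.card X := by
    rw [Finset.card_univ, Nat.card_eq_fintype_card]
  refine ⟨Nat.card_pos, cyclic_iterate_card hT, fun x y => ?_, fun x i j hi hj hij => ?_⟩
  · obtain ⟨j, hj, h2⟩ := h.exists_pow_eq (Finset.mem_univ x) (Finset.mem_univ y)
    exact ⟨j, hc ▸ hj, by rwa [← Equiv.Perm.coe_pow]⟩
  · rw [← Equiv.Perm.coe_pow, ← Equiv.Perm.coe_pow, h.pow_apply_eq_pow_apply (Finset.mem_univ x),
      hc] at hij
    exact Nat.ModEq.eq_of_lt_of_lt hij hi hj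

/-! ### Passing to a trivial bundle -/

section Trivialization

variable {X : Type u} {T : Equiv.Perm X} {E : X → Type v} [∀ x, NormedAddCommGroup (E x)]
  [∀ x, InnerProductSpace ℝ (E x)] {V : Type*} [NormedAddCommGroup V] [InnerProductSpace ℝ V]

/-- The cocycle on the trivial bundle obtained from isometries of the fibers. -/
noncomputable def trivialize (φ : ∀ x, E x ≃ₗᵢ[ℝ] V) (A : LinCocycle T E) (x : X) : V →L[ℝ] V :=
  ((φ (T x)).toContinuousLinearEquiv.toContinuousLinearMap.comp (A.fiberMap x)).comp
    (φ x).symm.toContinuousLinearEquiv.toContinuousLinearMap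

theorem trivialize_apply (φ : ∀ x, E x ≃ₗᵢ[ℝ] V) (A : LinCocycle T E) (x : X) (v : E x) :
    trivialize φ A x (φ x v) = φ (T x) (A.fiberMap x v) := by
  simp [trivialize]

theorem it_trivialize (φ : ∀ x, E x ≃ₗᵢ[ℝ] V) (A : LinCocycle T E) (m : ℕ) (x : X) (v : E x) :
    it T (trivialize φ A) m x (φ x v) = φ (T^[m] x) (A.iter m x v) := by
  induction m generalizing x with
  | zero => rfl
  | succ m ih =>
    rw [it_succ, ContinuousLinearMap.comp_apply, trivialize_apply, ih]
    rfl

theorem isometry_transport (φ : ∀ x, E x ≃ₗᵢ[ℝ] V) {x y : X} (h : x = y) (v : E x) :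
    φ y (fiberTransport E h v) = φ x v := by
  subst h; rfl

theorem LinCocycle.iter_injective (A : LinCocycle T E) (m : ℕ) (x : X) :
    Function.Injective (A.iter m x) := by
  induction m generalizing x with
  | zero => exact Function.injective_id
  | succ m ih => exact (ih (T x)).comp (A x).injective

variable [∀ x, FiniteDimensional ℝ (E x)] [FiniteDimensional ℝ V]

theorem lyapunovGraph_eq_gr [Finite X] (hT : T.IsCycleOn Set.univ) (φ : ∀ x, E x ≃ₗᵢ[ℝ] V)
    (A : LinCocycle T E) {d : ℕ} (x : X) (i : Fin (d + 1)) :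
    A.lyapunovGraph hT d x i = gr T (Nat.card X) (trivialize φ A) x i := by
  have h : (A.returnMap hT x).toLinearMap.charpoly =
      (it T (trivialize φ A) (Nat.card X) x).toLinearMap.charpoly := by
    refine charpoly_eq_of_conj (φ x).toLinearEquiv.toLinearMap (φ x).bijective ?_
    ext v
    change φ x (A.returnMap hT x v) = it T (trivialize φ A) (Nat.card X) x (φ x v)
    rw [it_trivialize]
    exact isometry_transport φ _ _
  rw [LinCocycle.lyapunovGraph, LinCocycle.lyapunovExponents, h, gr, mods, Multiset.map_map]
  rfl

theorem isConvexGraph_lyapunovGraph [Finite X] (hT : T.IsCycleOn Set.univ) (A : LinCocycle T E)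
    (x : X) {d : ℕ} (hd : Module.finrank ℝ (E x) = d) : IsConvexGraph (A.lyapunovGraph hT d x) := by
  have hc : (A.lyapunovExponents hT x).card = d := by
    rw [LinCocycle.lyapunovExponents, Multiset.card_map, IsAlgClosed.card_aroots_eq_natDegree,
      LinearMap.charpoly_natDegree, hd]
  refine ⟨by simp [LinCocycle.lyapunovGraph], fun i hi => ?_⟩
  exact sortedSum_convex (s := A.lyapunovExponents hT x) (by omega)

theorem bdd_trivialize (φ : ∀ x, E x ≃ₗᵢ[ℝ] V) {A : LinCocycle T E} {K : ℝ} (hK : 0 < K)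
    (hA : A.BoundedBy K) : Bdd (trivialize φ A) K := by
  intro x
  constructor
  · refine ContinuousLinearMap.opNorm_le_bound _ hK.le fun v => ?_
    obtain ⟨v, rfl⟩ := (φ x).surjective v
    rw [trivialize_apply, LinearIsometryEquiv.norm_map, LinearIsometryEquiv.norm_map]
    exact (A.fiberMap x).le_of_opNorm_le (hA x).2 v
  · intro v
    obtain ⟨v, rfl⟩ := (φ x).surjective v
    rw [trivialize_apply, LinearIsometryEquiv.norm_map, LinearIsometryEquiv.norm_map]
    have h1 := minExpansion_mul_le (A.fiberMap x) v
    have h2 : K⁻¹ * ‖v‖ ≤ ‖A.fiberMap x v‖ :=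
      (mul_le_mul_of_nonneg_right (hA x).1 (norm_nonneg v)).trans h1
    rwa [inv_mul_le_iff₀ hK] at h2

/-- The cocycle on `E` given by a cocycle of bijections on the trivial bundle. -/
noncomputable def untrivialize (φ : ∀ x, E x ≃ₗᵢ[ℝ] V) (B : X → V →L[ℝ] V)
    (hB : ∀ x, Function.Bijective (B x)) : LinCocycle T E := fun x =>
  ((φ x).toLinearEquiv.trans ((LinearEquiv.ofBijective (B x).toLinearMap (hB x)).trans
    (φ (T x)).symm.toLinearEquiv)).toContinuousLinearEquiv

theorem untrivialize_fiberMap (φ : ∀ x, E x ≃ₗᵢ[ℝ] V) (B : X → V →L[ℝ] V)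
    (hB : ∀ x, Function.Bijective (B x)) (x : X) :
    (untrivialize (T := T) φ B hB).fiberMap x =
      ((φ (T x)).symm.toContinuousLinearEquiv.toContinuousLinearMap.comp (B x)).comp
        (φ x).toContinuousLinearEquiv.toContinuousLinearMap := by
  ext v; rfl

theorem trivialize_untrivialize (φ : ∀ x, E x ≃ₗᵢ[ℝ] V) (B : X → V →L[ℝ] V)
    (hB : ∀ x, Function.Bijective (B x)) : trivialize φ (untrivialize (T := T) φ B hB) = B := by
  funext x
  ext v
  simp [trivialize, untrivialize_fiberMap]

theorem untrivialize_trivialize (φ : ∀ x, E x ≃ₗᵢ[ℝ] V) (A : LinCocycle T E) {B : X → V →L[ℝ] V}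
    (hB : ∀ x, Function.Bijective (B x)) (h : B = trivialize φ A) :
    untrivialize φ B hB = A := by
  subst h
  funext x
  ext v
  change (φ (T x)).symm (trivialize φ A x (φ x v)) = A.fiberMap x v
  rw [trivialize_apply, LinearIsometryEquiv.symm_apply_apply]

end Trivialization

/-! ### Indices of the finest dominated splitting -/

namespace LinCocycle

variable {X : Type u} {T : Equiv.Perm X} {E : X → Type v} [∀ x, NormedAddCommGroup (E x)]
  [∀ x, InnerProductSpace ℝ (E x)] [∀ x, FiniteDimensional ℝ (E x)]

theorem isDominatedSplitting_pair {A : LinCocycle T E} {ℓ i d : ℕ} {L H : ∀ x, Submodule ℝ (E x)}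
    (hd : ∀ x, Module.finrank ℝ (E x) = d) (hi0 : 0 < i) (hi : i < d)
    (hL : ∀ x, (L x).map (A.fiberMap x).toLinearMap = L (T x))
    (hH : ∀ x, (H x).map (A.fiberMap x).toLinearMap = H (T x))
    (hLH : ∀ x, IsCompl (L x) (H x)) (hLi : ∀ x, Module.finrank ℝ (L x) = i)
    (h : ∀ x, ∀ v ∈ L x, ∀ w ∈ H x,
      ‖A.iter ℓ x v‖ * ‖w‖ ≤ 1 / 4 * (‖v‖ * ‖A.iter ℓ x w‖)) :
    A.IsDominatedSplitting ℓ (m := 2) ![L, H] := by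
  have hHi : ∀ x, Module.finrank ℝ (H x) = d - i := fun x => by
    have := Submodule.finrank_add_eq_of_isCompl (hLH x)
    rw [hLi, hd] at this
    omega
  have hL0 : ∀ x, L x ≠ ⊥ := fun x h0 => by
    have := hLi x
    rw [h0, finrank_bot] at this
    omega
  have hH0 : ∀ x, H x ≠ ⊥ := fun x h0 => by
    have := hHi x
    rw [h0, finrank_bot] at this
    omega
  refine ⟨?_, ?_, fun x => ?_, ?_⟩
  · intro j
    fin_cases j
    · exact ⟨⟨i, hLi⟩, hL⟩
    · exact ⟨⟨d - i, hHi⟩, hH⟩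
  · intro j
    fin_cases j
    · exact hL0
    · exact hH0
  · refine (DirectSum.isInternal_submodule_iff_isCompl (i := (0 : Fin 2)) (j := 1) _ (by simp)
      (by ext j; fin_cases j <;> simp)).2 (hLH x)
  · intro j hj
    obtain rfl : j = 0 := by ext; simp; omega
    have e1 : (fun x => ⨆ k ≤ (0 : Fin 2), (![L, H] : Fin 2 → ∀ x, Submodule ℝ (E x)) k x) = L := by
      funext x
      simp
    have e2 : (fun x => ⨆ k > (0 : Fin 2), (![L, H] : Fin 2 → ∀ x, Submodule ℝ (E x)) k x) = H := by
      funext x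
      refine le_antisymm (iSup₂_le fun k hk => ?_) (le_iSup₂_of_le (1 : Fin 2) (by simp) le_rfl)
      fin_cases k
      · simp at hk
      · exact le_rfl
    rw [e1, e2]
    exact ⟨⟨⟨i, hLi⟩, hL⟩, ⟨⟨d - i, hHi⟩, hH⟩, hL0, hH0, fun x => ratio_lt_of_norm_mul_le (hH0 x) (h x)⟩

/-- `L` and `H` are sums of bundles of the finest splitting. The bundles in `L` form an initial
segment, because a bundle of `L` above a bundle of `H` would be dominated by it and dominate it at
the same time. The dimension of `L` is then an index. -/
theorem IsFinestDominatedSplitting.mem_splittingIndices [Nonempty X] {A : LinCocycle T E}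
    {ℓ i d m : ℕ} {F : Fin m → ∀ x, Submodule ℝ (E x)} (hF : A.IsFinestDominatedSplitting ℓ F)
    {L H : ∀ x, Submodule ℝ (E x)}
    (hd : ∀ x, Module.finrank ℝ (E x) = d) (hi0 : 0 < i) (hi : i < d)
    (hL : ∀ x, (L x).map (A.fiberMap x).toLinearMap = L (T x))
    (hH : ∀ x, (H x).map (A.fiberMap x).toLinearMap = H (T x))
    (hLH : ∀ x, IsCompl (L x) (H x)) (hLi : ∀ x, Module.finrank ℝ (L x) = i)
    (h : ∀ x, ∀ v ∈ L x, ∀ w ∈ H x,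
      ‖A.iter ℓ x v‖ * ‖w‖ ≤ 1 / 4 * (‖v‖ * ‖A.iter ℓ x w‖)) : i ∈ splittingIndices F := by
  obtain ⟨hF1, hF2⟩ := hF
  have hG := hF2 2 _ (isDominatedSplitting_pair hd hi0 hi hL hH hLH hLi h)
  obtain ⟨S, hS⟩ := hG 0
  obtain ⟨S', hS'⟩ := hG 1
  change ∀ x, L x = _ at hS
  change ∀ x, H x = _ at hS'
  inhabit X
  let x : X := default
  have hle : ∀ s ∈ S, F s x ≤ L x := fun s hs => hS x ▸ le_iSup₂_of_le s hs le_rfl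
  have hle' : ∀ s ∈ S', F s x ≤ H x := fun s hs => hS' x ▸ le_iSup₂_of_le s hs le_rfl
  have hind := (hF1.isInternal x).submodule_iSupIndep
  -- A bundle belonging to neither sum would be independent of `L ⊔ H`, which is everything.
  have hcov : ∀ s ∉ S, s ∈ S' := by
    intro s hs
    by_contra hs'
    refine hF1.ne_bot s x ?_
    have h1 : L x ⊔ H x ≤ ⨆ t, ⨆ (_ : t ≠ s), F t x := by
      rw [hS, hS']
      exact sup_le (iSup₂_le fun t ht => le_iSup₂_of_le t (fun e => hs (e ▸ ht)) le_rfl)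
        (iSup₂_le fun t ht => le_iSup₂_of_le t (fun e => hs' (e ▸ ht)) le_rfl)
    rw [(hLH x).sup_eq_top] at h1
    have h2 := hind s
    rw [top_le_iff.1 h1] at h2
    exact disjoint_top.1 h2
  -- Test both dominations on nonzero vectors of the two bundles; the constants `1 / 4` and `1 / 2`
  -- multiply to less than `1`.
  have hdown : ∀ s ∈ S, ∀ t < s, t ∈ S := by
    intro s hs t hts
    by_contra ht
    obtain ⟨v, hv, hv0⟩ := Submodule.exists_mem_ne_zero_of_ne_bot (hF1.ne_bot s x)
    obtain ⟨w, hw, hw0⟩ := Submodule.exists_mem_ne_zero_of_ne_bot (hF1.ne_bot t x)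
    have h1 := h x v (hle s hs hv) w (hle' t (hcov t ht) hw)
    obtain ⟨-, -, -, h3, h4⟩ := hF1.dominated t (by have := s.2; have : (t : ℕ) < s := hts; omega)
    have hinj := A.iter_injective ℓ x
    have h5 := norm_mul_le_of_ratio_lt hinj (h3 x) (h4 x)
      ((le_iSup₂_of_le (f := fun i (_ : i ≤ t) => F i x) t le_rfl le_rfl) hw)
      ((le_iSup₂_of_le (f := fun i (_ : i > t) => F i x) s hts le_rfl) hv)
    have h6 : 0 < ‖A.iter ℓ x v‖ := norm_pos_iff.2 fun e => hv0 (hinj (e.trans (map_zero _).symm))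
    have h7 : 0 < ‖w‖ := norm_pos_iff.2 hw0
    have h8 := mul_pos h6 h7
    nlinarith
  have hne : S.Nonempty := by
    rw [Set.nonempty_iff_ne_empty]
    rintro rfl
    have h1 : L x = ⊥ := by rw [hS]; simp
    have := hLi x
    rw [h1, finrank_bot] at this
    omega
  obtain ⟨j, hj, hjmax⟩ := Set.exists_max_image S id S.toFinite hne
  have hSj : ∀ y, L y = ⨆ k ≤ j, F k y := fun y => by
    rw [hS]
    refine le_antisymm (iSup₂_le fun k hk => le_iSup₂_of_le k (hjmax k hk) le_rfl)
      (iSup₂_le fun k hk => le_iSup₂_of_le k ?_ le_rfl)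
    rcases hk.eq_or_lt with rfl | hk
    · exact hj
    · exact hdown j hj k hk
  refine ⟨j, ?_, fun y => by rw [← hSj, hLi]⟩
  by_contra hjm
  have h1 : L x = ⊤ := by
    rw [hSj, ← top_le_iff, ← (hF1.isInternal x).submodule_iSup_eq_top]
    refine iSup_le fun k => le_iSup₂_of_le k ?_ le_rfl
    have := k.2
    have : (k : ℕ) ≤ j := by omega
    exact this
  have := hLi x
  rw [h1, finrank_top, hd] at this
  omega

end LinCocycle

/-- The condition `dom` only looks at pairs of bundles in the trivialised cocycle. Pulled back by
the isometries, such a pair gives an index of the finest splitting, where the graphs agree by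
hypothesis. -/
theorem target_trivialize {X : Type u} [Finite X] [Nonempty X] {T : Equiv.Perm X}
    (hT : T.IsCycleOn Set.univ)
    {E : X → Type v} [∀ x, NormedAddCommGroup (E x)] [∀ x, InnerProductSpace ℝ (E x)]
    [∀ x, FiniteDimensional ℝ (E x)] {V : Type*} [NormedAddCommGroup V] [InnerProductSpace ℝ V]
    [FiniteDimensional ℝ V] (φ : ∀ x, E x ≃ₗᵢ[ℝ] V) {A : LinCocycle T E} {d ℓ m : ℕ}
    (hd : ∀ x, Module.finrank ℝ (E x) = d) {F : Fin m → ∀ x, Submodule ℝ (E x)}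
    (hF : A.IsFinestDominatedSplitting ℓ F) {x₀ : X} {σ : Fin (d + 1) → ℝ} (hσ : IsConvexGraph σ)
    (hle : A.lyapunovGraph hT d x₀ ≤ σ)
    (hind : ∀ i : Fin (d + 1), (i : ℕ) ∈ splittingIndices F → σ i = A.lyapunovGraph hT d x₀ i)
    (hlast : σ (Fin.last d) = A.lyapunovGraph hT d x₀ (Fin.last d)) :
    Target T (Nat.card X) d ℓ (trivialize φ A) (fun j => if h : j < d + 1 then σ ⟨j, h⟩ else 0) := by
  have hgr : ∀ x (i : Fin (d + 1)), gr T (Nat.card X) (trivialize φ A) x i =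
      A.lyapunovGraph hT d x₀ i := fun x i => by
    rw [← lyapunovGraph_eq_gr hT φ A x i, A.lyapunovGraph_eq hT d x x₀]
  refine ⟨by simpa using hσ.1, fun j hj => ?_, fun x j hj => ?_, fun x => ?_, ?_⟩
  · simp only [show j < d + 1 by omega, show j + 1 < d + 1 by omega, show j + 2 < d + 1 by omega,
      dif_pos]
    exact hσ.2 j (by omega)
  · simp only [show j < d + 1 by omega, dif_pos]
    exact (hgr x ⟨j, by omega⟩).trans_le (hle _)
  · simp only [show d < d + 1 by omega, dif_pos]
    exact (hgr x (Fin.last d)).trans hlast.symm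
  · rintro i hi0 hi ⟨L, H, hL, hH, hLH, hLi, h⟩ x
    simp only [show i < d + 1 by omega, dif_pos]
    refine (hgr x ⟨i, by omega⟩).trans (hind ⟨i, by omega⟩ ?_).symm
    have hinv : ∀ L : X → Submodule ℝ V, (∀ x, (L x).map (trivialize φ A x).toLinearMap = L (T x)) →
        ∀ x, ((L x).comap (φ x).toLinearEquiv.toLinearMap).map (A.fiberMap x).toLinearMap =
          (L (T x)).comap (φ (T x)).toLinearEquiv.toLinearMap := by
      intro L hL x
      ext w
      rw [Submodule.mem_comap, ← hL x]
      constructor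
      · rintro ⟨v, hv, rfl⟩
        exact ⟨φ x v, hv, trivialize_apply φ A x v⟩
      · rintro ⟨v, hv, e⟩
        obtain ⟨v, rfl⟩ := (φ x).surjective v
        exact ⟨v, hv, (φ (T x)).injective ((trivialize_apply φ A x v).symm.trans e)⟩
    refine hF.mem_splittingIndices hd hi0 hi (hinv L hL) (hinv H hH) (fun x => ?_) (fun x => ?_)
      (fun x v hv w hw => ?_)
    · exact (Submodule.orderIsoMapComap (φ x).toLinearEquiv).symm.isCompl (hLH x)
    · refine Eq.trans ?_ (hLi x)
      rw [Submodule.comap_equiv_eq_map_symm]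
      exact LinearEquiv.finrank_map_eq _ _
    · have h1 := h x (φ x v) hv (φ x w) hw
      simpa only [it_trivialize, LinearIsometryEquiv.norm_map] using h1

/-! ### The theorem -/

theorem theoremt (d : ℕ) (hd : 2 ≤ d) (K : ℝ) (hK : 1 < K) (ε : ℝ) (hε : 0 < ε) :
    ∃ ℓ ∈ Set.range (fun k : ℕ => 2 ^ k),
      ∀ (X : Type u) [Finite X] (T : Equiv.Perm X) (hT : T.IsCycleOn Set.univ)
        (E : X → Type v) [∀ x, NormedAddCommGroup (E x)] [∀ x, InnerProductSpace ℝ (E x)]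
        [∀ x, FiniteDimensional ℝ (E x)] (A : LinCocycle T E),
        (∀ x, Module.finrank ℝ (E x) = d) → A.BoundedBy K → ℓ ≤ Nat.card X →
        ∀ (m : ℕ) (F : Fin m → ∀ x, Submodule ℝ (E x)), A.IsFinestDominatedSplitting ℓ F →
        ∀ (x₀ : X) (σ : Fin (d + 1) → ℝ), IsConvexGraph σ →
          A.lyapunovGraph hT d x₀ ≤ σ →
          (∀ i : Fin (d + 1), (i : ℕ) ∈ splittingIndices F → σ i = A.lyapunovGraph hT d x₀ i) →
          σ (Fin.last d) = A.lyapunovGraph hT d x₀ (Fin.last d) →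
          ∃ B : unitInterval → LinCocycle T E,
            LinCocycle.IsPath B ∧ B 0 = A ∧ LinCocycle.IsShort ε B ∧
            IsNondecreasingGraphPath (fun t => (B t).lyapunovGraph hT d x₀) ∧
            (B 1).lyapunovGraph hT d x₀ = σ := by
  have hK0 : 0 < K := by linarith
  -- `ε / 2` makes the final estimate strict, and `1 / (2 * K)` keeps the whole path invertible.
  set δ := min (ε / 2) (1 / (2 * K)) with hδ
  have hδ0 : 0 < δ := by positivity
  obtain ⟨ℓ₀, h⟩ := exists_reach_target.{u} (V := EuclideanSpace ℝ (Fin d)) hK.le hδ0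
  -- Every `ℓ ≥ ℓ₀` would do, and `2 ^ ℓ₀` is a power of two with this property.
  refine ⟨2 ^ ℓ₀, ⟨ℓ₀, rfl⟩, ?_⟩
  intro X _ T hT E _ _ _ A hE hA hℓ m F hF x₀ σ hσ hle hind hlast
  have : Nonempty X := ⟨x₀⟩
  have hfr : Module.finrank ℝ (EuclideanSpace ℝ (Fin d)) = d := by simp
  have φ : ∀ x, E x ≃ₗᵢ[ℝ] EuclideanSpace ℝ (Fin d) := fun x =>
    ((stdOrthonormalBasis ℝ (E x)).reindex (finCongr (hE x))).repr
  have hbdd := bdd_trivialize φ hK0 hA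
  rw [hfr] at h
  obtain ⟨B, ⟨γ, hγ, hgr⟩, hB⟩ := h _ Nat.lt_two_pow_self.le X T _ x₀ (isCyc_of_isCycleOn hT) hℓ _ _
    hbdd (target_trivialize hT φ hE hF hσ hle hind hlast)
  have hbij : ∀ t x, Function.Bijective (γ t x) := fun t =>
    (hbdd.perturb hK0 (min_le_right _ _) hK.le (hγ t)).bijective
  have hgraph : ∀ t (i : Fin (d + 1)), (untrivialize φ (γ t) (hbij t)).lyapunovGraph hT d x₀ i =
      gr T (Nat.card X) (γ t) x₀ i := fun t i => by
    rw [lyapunovGraph_eq_gr hT φ, trivialize_untrivialize]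
  have h0 : untrivialize φ (γ 0) (hbij 0) = A := untrivialize_trivialize φ A _ γ.source
  refine ⟨fun t => untrivialize φ (γ t) (hbij t), fun x => ?_, h0, fun t x => ?_, ⟨fun t => ?_, ?_, ?_⟩,
    ?_⟩
  · simp only [untrivialize_fiberMap]
    have h1 : Continuous fun t => γ t x := (continuous_apply x).comp γ.continuous
    exact (continuous_const.clm_comp h1).clm_comp continuous_const
  · beta_reduce
    rw [h0]
    refine (lt_of_le_of_lt (b := δ) ?_ ((min_le_left _ _).trans_lt (half_lt_self hε)))
    refine ContinuousLinearMap.opNorm_le_bound _ hδ0.le fun v => ?_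
    have h1 := (γ t x - trivialize φ A x).le_of_opNorm_le (hγ t x) (φ x v)
    rw [sub_apply, trivialize_apply, LinearIsometryEquiv.norm_map] at h1
    refine le_trans (le_of_eq ?_) h1
    rw [sub_apply, ← LinearIsometryEquiv.norm_map (φ (T x)), map_sub,
      untrivialize_fiberMap]
    simp
  · exact isConvexGraph_lyapunovGraph hT _ x₀ (hE x₀)
  · refine continuous_pi fun i => ?_
    simp only [hgraph]
    exact (hgr x₀ i (Nat.le_of_lt_succ i.2)).1
  · intro s t hst i
    simp only [hgraph]
    exact (hgr x₀ i (Nat.le_of_lt_succ i.2)).2 hst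
  · funext i
    rw [hgraph, γ.target, hB x₀ i (Nat.le_of_lt_succ i.2), dif_pos i.2]
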